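/- Let $N\ge 1$, let $\Omega\subset\mathbb R^N$ be a bounded open set, $0<T<\infty$ and $\Omega_T=\Omega\times(0,T)$. Let $b:\mathbb R\to\mathbb R$ be continuous and strictly increasing with $b(0)=0$. For $a_1\in\mathbb R$, we say that a function $b$ satisfies condition (B) with exponent $a_1$ if * (B1) $a_1>0$ and there is $C>0$ with $b(s)\ge C s^{a_1}$ for all large $s$; * (B2) there is $a_2<1$ such that, for all small $s>0$, $b$ is differentiable at $s$ and $|b'(s)|\le s^{-a_2}$; * (B3) there are $a_3\in(\frac{N-1}{N},1)$ and $\varepsilon>0$ such that either $b\in C^1([0,\infty))$ and $|b'(s)|\,b(s)^{2a_3-1}\le s^{\frac{N+2a_1}{N}-\varepsilon}$ for all large $s$, or, for all large $s$, $b$ is differentiable at $s$ and $|b'(s)|\le b(s)^{2-2a_3-\varepsilon}$. Assume that $b$ satisfies (B) with exponent $a_1$. Let $\mu$ be a signed Radon measure of finite total variation on $\Omega_T$ and let $b(v_0)\in L^1(\Omega)$. Let $h_n\in L^\infty(\Omega_T)$ with $h_n\rightharpoonup\mu$ weakly-* as measures, i.e. $\iint_{\Omega_T}h_n\varphi\to\int_{\Omega_T}\varphi\,d\mu$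 for all $\varphi\in C_0(\Omega_T)$, and let $g_n\in L^\infty(\Omega)$ with $g_n\to b(v_0)$ in $L^1(\Omega)$. For every $n$ let $v_n$ be a weak solution of $$b(v_n)_t-\Delta v_n=h_n\ \text{ in }\Omega_T,\qquad v_n=0\ \text{ on }\partial\Omega\times(0,T),\qquad b(v_n(\cdot,0))=g_n\ \text{ in }\Omega,$$ that is: $v_n\in L^2(0,T;W^{1,2}_0(\Omega))\cap L^\infty(\Omega_T)$; $b(v_n)\in C([0,T);L^q(\Omega))$ for all $1\le q<\infty$, with value $g_n$ at $t=0$; $b(v_n)_t\in L^2(0,T;W^{-1,2}(\Omega))$; and $$\int_0^T\langle b(v_n)_t,\phi\rangle\,dt+\iint_{\Omega_T}\nabla v_n\cdot\nabla\phi=\iint_{\Omega_T}h_n\phi\qquad\text{for all }\phi\in L^2(0,T;W^{1,2}_0(\Omega)).$$ Then: 1. For each $0<\beta<\frac12$, the sequence $\{(|v_n|+1)^\beta-1\}_n$ is bounded in $L^2(0,T;W^{1,2}_0(\Omega))$. 2. The sequence $\{b(v_n)\}_n$ is bounded in $L^\infty(0,T;L^1(\Omega))$. 3. For every $\alpha>0$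 there is a constant $C$ (depending on $\alpha$, not on $n$) with $\displaystyle\iint_{\Omega_T}\frac{|\nabla v_n|^2}{(1+|v_n|)^{\alpha+1}}\le C$ for all $n$. Suppose moreover that either $v_n\ge 0$ a.e. in $\Omega_T$ for all $n$, or the function $s\mapsto -b(-s)$ also satisfies (B), with the same exponent $a_1$. Then: 4. The sequence $\{b(v_n)_t\}_n$ is bounded in $L^1(\Omega_T)+L^\sigma(0,T;W^{-1,\sigma}(\Omega))$ for some $1<\sigma<\infty$. 5. The sequence $\{|\nabla v_n|\}_n$ is bounded in the Marcinkiewicz space $M^{q}(\Omega_T)$ with $q=\frac{N+2a_1}{N+a_1}$, and $\{v_n\}_n$ is bounded in $M^{r}(\Omega_T)$ with $r=\frac{N+2a_1}{N}$. Here $\{f_n\}_n$ is bounded in $M^{q}(\Omega_T)$ if there is $C$ such that $|\{z\in\Omega_T:|f_n(z)|>k\}|\le C k^{-q}$ for all $k>0$ and all $n$. 6. There are a measurable function $v:\Omega_T\to\mathbb R$ and a subsequence (not relabelled) such that $v_n\to v$ a.e. in $\Omega_T$, $b(v)\in L^1(\Omega_T)$ and $b(v_n)\to b(v)$ strongly in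 $L^1(\Omega_T)$. -/

import Mathlib

open MeasureTheory Filter Topology Set TopologicalSpace
open scoped ENNReal ContDiff Distributions

noncomputable section

namespace EllipticParabolic

/-- The space `ℝ^N` with the Euclidean norm. -/
abbrev Space (N : ℕ) := EuclideanSpace ℝ (Fin N)

/-- The cylinder `Ω_T = Ω × (0, T)`; its points are written `z = (x, t)`. -/
def cyl {N : ℕ} (Ω : Opens (Space N)) (T : ℝ) : Opens (Space N × ℝ) :=
  ⟨(Ω : Set (Space N)) ×ˢ Ioo 0 T, Ω.isOpen.prod isOpen_Ioo⟩

/-- Lebesgue measure on the cylinder `Ω_T`. -/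
def cylMeasure {N : ℕ} (Ω : Opens (Space N)) (T : ℝ) : Measure (Space N × ℝ) :=
  volume.restrict (cyl Ω T : Set (Space N × ℝ))

/-- The classical spatial gradient `∇ₓ φ (x, t)`. -/
def spaceGrad {N : ℕ} (φ : Space N × ℝ → ℝ) (z : Space N × ℝ) : Space N :=
  gradient (fun y => φ (y, z.2)) z.1

/-- The classical time derivative `∂ₜ φ (x, t)`. -/
def timeDeriv {N : ℕ} (φ : Space N × ℝ → ℝ) (z : Space N × ℝ) : ℝ :=
  deriv (fun s => φ (z.1, s)) z.2

theorem continuous_spaceGrad {N : ℕ} {φ : Space N × ℝ → ℝ} (hφ : ContDiff ℝ 1 φ) :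
    Continuous (spaceGrad φ) := by
  have h : spaceGrad φ = fun z => (InnerProductSpace.toDual ℝ (Space N)).symm
      ((fderiv ℝ φ z).comp (ContinuousLinearMap.inl ℝ (Space N) ℝ)) := by
    funext z
    have h1 : HasFDerivAt φ (fderiv ℝ φ (z.1, z.2)) (z.1, z.2) :=
      (hφ.differentiable one_ne_zero (z.1, z.2)).hasFDerivAt
    have h2 : HasFDerivAt (fun y => φ (y, z.2))
        ((fderiv ℝ φ z).comp (ContinuousLinearMap.inl ℝ (Space N) ℝ)) z.1 :=
      HasFDerivAt.comp (f := fun y => (y, z.2)) z.1 h1 (hasFDerivAt_prodMk_left z.1 z.2)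
    simp only [spaceGrad, gradient]
    rw [h2.fderiv]
  rw [h]
  have h3 : Continuous (fderiv ℝ φ) := hφ.continuous_fderiv one_ne_zero
  exact (LinearIsometryEquiv.continuous _).comp (h3.clm_comp continuous_const)

theorem hasCompactSupport_spaceGrad {N : ℕ} {φ : Space N × ℝ → ℝ} (hφ : HasCompactSupport φ) :
    HasCompactSupport (spaceGrad φ) := by
  refine HasCompactSupport.intro hφ.isCompact ?_
  intro z hz
  have h0 : φ =ᶠ[𝓝 (z.1, z.2)] 0 := notMem_tsupport_iff_eventuallyEq.mp hz
  have h1 : Tendsto (fun y : Space N => (y, z.2)) (𝓝 z.1) (𝓝 (z.1, z.2)) :=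
    (Continuous.prodMk_left z.2).tendsto z.1
  have h2 : (fun y => φ (y, z.2)) =ᶠ[𝓝 z.1] fun _ => 0 := h1.eventually h0
  simp [spaceGrad, gradient, h2.fderiv_eq]

theorem memLp_testFunction {N : ℕ} {Ω : Opens (Space N)} {T : ℝ} (p : ℝ≥0∞)
    (φ : 𝓓(cyl Ω T, ℝ)) : MemLp φ p (cylMeasure Ω T) :=
  (φ.continuous.memLp_of_hasCompactSupport φ.hasCompactSupport).restrict _

theorem memLp_spaceGrad {N : ℕ} {Ω : Opens (Space N)} {T : ℝ} (p : ℝ≥0∞)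
    (φ : 𝓓(cyl Ω T, ℝ)) : MemLp (spaceGrad φ) p (cylMeasure Ω T) :=
  ((continuous_spaceGrad (φ.contDiff.of_le (by norm_cast))).memLp_of_hasCompactSupport
    (hasCompactSupport_spaceGrad φ.hasCompactSupport)).restrict _

/-- A test function on `Ω_T` together with its spatial gradient, as a pair of `L^p` functions. -/
def testPair {N : ℕ} {Ω : Opens (Space N)} {T : ℝ} (p : ℝ≥0∞) (φ : 𝓓(cyl Ω T, ℝ)) :
    Lp ℝ p (cylMeasure Ω T) × Lp (Space N) p (cylMeasure Ω T) :=
  ((memLp_testFunction p φ).toLp φ, (memLp_spaceGrad p φ).toLp (spaceGrad φ))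

/-- The Banach space `L^p(0, T; W₀^{1,p}(Ω))`, `1 ≤ p < ∞`: the closure of `C_c^∞(Ω_T)` in the norm
of `u` and `∇u` in `L^p(Ω_T)`. An element is the pair `(u, ∇u)` of a function and its weak spatial
gradient, and the norm is `max (‖u‖_{L^p}) (‖∇u‖_{L^p})`. -/
def LpW0 {N : ℕ} (p : ℝ≥0∞) [Fact (1 ≤ p)] (Ω : Opens (Space N)) (T : ℝ) :
    Submodule ℝ (Lp ℝ p (cylMeasure Ω T) × Lp (Space N) p (cylMeasure Ω T)) :=
  (Submodule.span ℝ (range (testPair p))).topologicalClosure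

/-- A test function on `Ω_T` as an element of `L^p(0, T; W₀^{1,p}(Ω))`. -/
def testElt {N : ℕ} (p : ℝ≥0∞) [Fact (1 ≤ p)] {Ω : Opens (Space N)} {T : ℝ}
    (φ : 𝓓(cyl Ω T, ℝ)) : LpW0 p Ω T :=
  ⟨testPair p φ, Submodule.le_topologicalClosure _ (Submodule.subset_span ⟨φ, rfl⟩)⟩

/-- For `1 < p < ∞` and `1/p + 1/q = 1` this is the space `L^q(0, T; W^{-1,q}(Ω))`, realised as the
dual of `L^p(0, T; W₀^{1,p}(Ω))`. -/
abbrev DualLpW0 {N : ℕ} (p : ℝ≥0∞) [Fact (1 ≤ p)] (Ω : Opens (Space N)) (T : ℝ) :=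
  LpW0 p Ω T →L[ℝ] ℝ

/-- The distributional time derivative of `w`, evaluated at a test function:
`⟨wₜ, φ⟩ = - ∬ w φₜ`. -/
def distTimeDeriv {N : ℕ} {Ω : Opens (Space N)} {T : ℝ} (w : Space N × ℝ → ℝ)
    (φ : 𝓓(cyl Ω T, ℝ)) : ℝ :=
  - ∫ z, w z * timeDeriv φ z ∂(cylMeasure Ω T)

/-- `v`, with weak spatial gradient `Dv`, is the weak solution of `b(v)ₜ - Δv = h` in `Ω_T`, `v = 0`
on `∂Ω × (0, T)`, `b(v(·, 0)) = g` in `Ω`. -/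
structure IsWeakSolution {N : ℕ} (Ω : Opens (Space N)) (T : ℝ) (b : ℝ → ℝ)
    (h : Space N × ℝ → ℝ) (g : Space N → ℝ)
    (v : Space N × ℝ → ℝ) (Dv : Space N × ℝ → Space N) : Prop where
  /-- `v ∈ L²(0, T; W₀^{1,2}(Ω))`, with spatial gradient `Dv` -/
  mem_energy : ∃ V : LpW0 2 Ω T,
    (V.1.1 : Space N × ℝ → ℝ) =ᵐ[cylMeasure Ω T] v ∧
    (V.1.2 : Space N × ℝ → Space N) =ᵐ[cylMeasure Ω T] Dv
  /-- `v ∈ L^∞(0, T; L^∞(Ω))` -/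
  bounded : ∃ M : ℝ, ∀ᵐ z ∂(cylMeasure Ω T), |v z| ≤ M
  /-- `b(v) ∈ C([0, T); L^q(Ω))` for all `q < ∞`, with value `g` at `t = 0` -/
  continuous_in_time : ∀ (q : ℝ≥0∞) [Fact (1 ≤ q)], q ≠ ⊤ →
    ∃ B : ℝ → Lp ℝ q (volume.restrict (Ω : Set (Space N))),
      ContinuousOn B (Ico 0 T) ∧
      (∀ᵐ t ∂(volume.restrict (Ioo 0 T)),
        (B t : Space N → ℝ) =ᵐ[volume.restrict (Ω : Set (Space N))] fun x => b (v (x, t))) ∧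
      (B 0 : Space N → ℝ) =ᵐ[volume.restrict (Ω : Set (Space N))] g
  /-- `b(v)ₜ ∈ L²(0, T; W^{-1,2}(Ω))`, and the equation holds against every
  `φ ∈ L²(0, T; W₀^{1,2}(Ω))` -/
  equation : ∃ ξ : DualLpW0 2 Ω T,
    (∀ φ : 𝓓(cyl Ω T, ℝ), ξ (testElt 2 φ) = distTimeDeriv (fun z => b (v z)) φ) ∧
    ∀ Φ : LpW0 2 Ω T,
      ξ Φ + ∫ z, inner ℝ (Dv z) (Φ.1.2 z) ∂(cylMeasure Ω T)
        = ∫ z, h z * Φ.1.1 z ∂(cylMeasure Ω T)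

/-- The structural conditions on `b` in dimension `N`, with growth exponent `a₁` at infinity. They
only concern the values of `b` on `[0, ∞)`. -/
structure ConditionB (N : ℕ) (b : ℝ → ℝ) (a₁ : ℝ) : Prop where
  /-- `b(s) ≥ C s^{a₁}` for `s` large, where `a₁ > 0` -/
  growth : 0 < a₁ ∧ ∃ C : ℝ, 0 < C ∧ ∀ᶠ s in atTop, C * s ^ a₁ ≤ b s
  /-- `|b'(s)| ≤ s^{-a₂}` for `s > 0` small, where `a₂ < 1` -/
  near_zero : ∃ a₂ : ℝ, a₂ < 1 ∧
    ∀ᶠ s in 𝓝[>] (0 : ℝ), DifferentiableAt ℝ b s ∧ |deriv b s| ≤ 1 / s ^ a₂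
  /-- the growth restriction on `b'`, with `a₃ ∈ ((N-1)/N, 1)` and some `ε > 0` -/
  near_infinity : ∃ a₃ : ℝ, ((N : ℝ) - 1) / N < a₃ ∧ a₃ < 1 ∧ ∃ ε : ℝ, 0 < ε ∧
    ((ContDiffOn ℝ 1 b (Ici 0) ∧
        ∀ᶠ s in atTop, |deriv b s| * b s ^ (2 * a₃ - 1) ≤ s ^ (((N : ℝ) + 2 * a₁) / N - ε)) ∨
      ∀ᶠ s in atTop, DifferentiableAt ℝ b s ∧ |deriv b s| ≤ b s ^ (2 - 2 * a₃ - ε))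

/-- Weak-* convergence `h_n → μ` of bounded Radon measures on `Ω_T`, that is against all functions
in `C₀(Ω_T)`, the continuous functions that vanish at the boundary of (the bounded set) `Ω_T`. -/
def WeakStarConv {N : ℕ} (Ω : Opens (Space N)) (T : ℝ) (h : ℕ → Space N × ℝ → ℝ)
    (μ : SignedMeasure (Space N × ℝ)) : Prop :=
  ∀ φ : Space N × ℝ → ℝ, Continuous φ → (∀ z, z ∉ cyl Ω T → φ z = 0) →
    Tendsto (fun n => ∫ z, h n z * φ z ∂(cylMeasure Ω T)) atTop (𝓝 (∫ᵛ z, φ z ∂•μ))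

/-- The sequence `f_n` is bounded in the Marcinkiewicz (weak `L^q`) space `M^q(Ω_T)`:
`|{z ∈ Ω_T : |f_n(z)| > k}| ≤ C k^{-q}` for all `k > 0` and all `n`. -/
def BoundedInMarcinkiewicz {N : ℕ} (Ω : Opens (Space N)) (T : ℝ) (q : ℝ)
    (f : ℕ → Space N × ℝ → ℝ) : Prop :=
  ∃ C : ℝ, ∀ n : ℕ, ∀ k : ℝ, 0 < k →
    cylMeasure Ω T {z | k < |f n z|} ≤ ENNReal.ofReal (C / k ^ q)

/-- The sequence of distributional time derivatives `(w_n)ₜ` is bounded in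
`L¹(Ω_T) + L^σ(0, T; W^{-1,σ}(Ω))` for some `1 < σ < ∞`. -/
def TimeDerivBounded {N : ℕ} (Ω : Opens (Space N)) (T : ℝ) (w : ℕ → Space N × ℝ → ℝ) : Prop :=
  ∃ (σ σ' : ℝ≥0∞) (_ : Fact (1 ≤ σ')), 1 < σ ∧ σ < ⊤ ∧ ENNReal.HolderConjugate σ σ' ∧
    ∃ C : ℝ, ∀ n : ℕ, ∃ (f : Lp ℝ 1 (cylMeasure Ω T)) (Λ : DualLpW0 σ' Ω T),
      ‖f‖ ≤ C ∧ ‖Λ‖ ≤ C ∧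
      ∀ φ : 𝓓(cyl Ω T, ℝ),
        distTimeDeriv (w n) φ = ∫ z, f z * φ z ∂(cylMeasure Ω T) + Λ (testElt σ' φ)

end EllipticParabolic

end

/-! Every bound comes from testing the equation with `ψ(v)`, where `ψ` is nondecreasing, Lipschitz,
vanishes at `0` and satisfies `|ψ| ≤ 1`. With `B(s) = ∫₀ˢ ψ db` (`prim`) this bounds both `∬
ψ'(v)|∇v|²` and `∫ B(v(t))`, for almost every `t`, by `‖h‖₁ + ‖g‖₁ + 1` (`Sol.energy`,
`Sol.mass_le`). The right side is uniform in `n`, because a weak-* convergent sequence is bounded in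
`L¹` by Banach–Steinhaus (`WeakStarConv.exists_bound`). Since `b` need not be differentiable, the
chain rule `B(v)ₜ = ψ(v) b(v)ₜ` is read off from the convexity inequality `(b(s) - b(r)) ψ(r) ≤ B(s)
- B(r)`: it says that a certain function of the time shift has a minimum at shift zero
(`Sol.time_chain`).

Particular choices of `ψ` do the rest. The odd extension of `1 - (1+s)^(-α)` gives the weighted
gradient bound, and with it the bound for `(|v|+1)^β - 1`, whose gradient has exactly that weight
for `α = 1 - 2β`. The choice `s/(1+|s|)` gives the bound on `b(v)` in `L^∞(L¹)`, and `s/(k+|s|)`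
gives `∬_{|v|<k} |∇v|² ≤ 4kK`.

Marcinkiewicz bounds: the growth of `b` and the mass bound yield `|{v(t) > k}| ≤ C k^(-a₁)` on time
slices. Sobolev's inequality on a slice, applied to the part of `v` between `k/2` and `k`, bounds
`|{v(t) > k}|` by `C k⁻² ∫_{|v|<k} |∇v|² · |{v(t) > k/3}|^(2/N)` (`exists_ae_level_le`). Integration
in time gives the decay `k^(-(N+2a₁)/N)` (`exists_level_le`), and splitting according to the size of
`v` gives the gradient bound (`Sol.grad_level_le`). Its exponent exceeds `1`, so the equation itself
decomposes `b(v)ₜ` as required (`timeDerivBounded_of_sol`). Negative values of `v` are handled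
through the symmetry `Sol.neg`.

Almost everywhere convergence: `arctan v` is bounded with gradient bounded in `L²`, but `b(v)ₜ` is
too irregular to be paired with it. Its renormalisation `Z = ∫ db/(1+|r|)` (`renorm`) is better:
`Z(v)ₜ` is bounded in `L¹ + L²(W^{-1,2})`, because the flux `∇v/(1+|v|)` is in `L²` and the defect
`|∇v|²/(1+|v|)²` is in `L¹` (`Sol.abs_integral_renorm_le`). Hence time differences satisfy `∬ χ ΔZ
Δarctan ≤ C|s|`, and strict monotonicity of `Z` converts this into a modulus of continuity of
`arctan v` in time (`exists_modulus_arctan`). A Kolmogorov–Riesz argument with ball means gives a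
convergent subsequence of `arctan v_n`; the level set bound prevents the limit from reaching `±π/2`,
so that `v_n` itself converges to a finite limit (`exists_subseq_tendsto`).

Convergence of `b(v_n)` in `L¹`: the condition on `b'` at infinity bounds the gradient of `b(v)^a₃`
in `L¹`. The embedding of `W^{1,1}` on slices, interpolated with the mass bound, gives `|{b(v) > L}|
≤ C L^(-(1+d))` with `d = a₃ - (N-1)/N > 0` (`exists_level_b_le`). So `b(v_n)` is bounded in some
`L^p` with `p > 1`, and Vitali's theorem concludes (`tendsto_one_of_bounded`). -/

namespace EllipticParabolic

variable {N : ℕ}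

/-! ### Elementary calculus of the spatial gradient and the time derivative -/

theorem inner_spaceGrad {φ : Space N × ℝ → ℝ} {z : Space N × ℝ} (hφ : DifferentiableAt ℝ φ z)
    (y : Space N) : inner ℝ (spaceGrad φ z) y = fderiv ℝ φ z (y, 0) := by
  have h1 : HasFDerivAt φ (fderiv ℝ φ z) (z.1, z.2) := hφ.hasFDerivAt
  have h2 : HasFDerivAt (fun y => φ (y, z.2))
      ((fderiv ℝ φ z).comp (ContinuousLinearMap.inl ℝ (Space N) ℝ)) z.1 :=
    HasFDerivAt.comp (f := fun y => (y, z.2)) z.1 h1 (hasFDerivAt_prodMk_left z.1 z.2)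
  simp only [spaceGrad, gradient]
  rw [h2.fderiv, InnerProductSpace.toDual_symm_apply]
  simp

theorem timeDeriv_eq_fderiv {φ : Space N × ℝ → ℝ} {z : Space N × ℝ}
    (hφ : DifferentiableAt ℝ φ z) : timeDeriv φ z = fderiv ℝ φ z (0, 1) := by
  have h1 : HasFDerivAt φ (fderiv ℝ φ z) (z.1, z.2) := hφ.hasFDerivAt
  have h2 : HasFDerivAt (fun s => φ (z.1, s))
      ((fderiv ℝ φ z).comp (ContinuousLinearMap.inr ℝ (Space N) ℝ)) z.2 :=
    HasFDerivAt.comp (f := fun s => (z.1, s)) z.2 h1 (hasFDerivAt_prodMk_right z.1 z.2)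
  simp only [timeDeriv]
  rw [h2.hasDerivAt.deriv]
  simp

theorem spaceGrad_sub {φ ψ : Space N × ℝ → ℝ} (hφ : Differentiable ℝ φ)
    (hψ : Differentiable ℝ ψ) (z : Space N × ℝ) :
    spaceGrad (fun z => φ z - ψ z) z = spaceGrad φ z - spaceGrad ψ z := by
  refine ext_inner_right ℝ fun y => ?_
  rw [inner_sub_left, inner_spaceGrad ((hφ z).fun_sub (hψ z)), inner_spaceGrad (hφ z),
    inner_spaceGrad (hψ z), fderiv_fun_sub (hφ z) (hψ z)]
  rfl

theorem spaceGrad_add {φ ψ : Space N × ℝ → ℝ} (hφ : Differentiable ℝ φ)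
    (hψ : Differentiable ℝ ψ) (z : Space N × ℝ) :
    spaceGrad (fun z => φ z + ψ z) z = spaceGrad φ z + spaceGrad ψ z := by
  refine ext_inner_right ℝ fun y => ?_
  rw [inner_add_left, inner_spaceGrad ((hφ z).fun_add (hψ z)), inner_spaceGrad (hφ z),
    inner_spaceGrad (hψ z), fderiv_fun_add (hφ z) (hψ z)]
  rfl

theorem spaceGrad_mul {φ ψ : Space N × ℝ → ℝ} (hφ : Differentiable ℝ φ)
    (hψ : Differentiable ℝ ψ) (z : Space N × ℝ) :
    spaceGrad (fun z => φ z * ψ z) z = φ z • spaceGrad ψ z + ψ z • spaceGrad φ z := by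
  refine ext_inner_right ℝ fun y => ?_
  rw [inner_add_left, inner_smul_left, inner_smul_left,
    inner_spaceGrad ((hφ z).fun_mul (hψ z)), inner_spaceGrad (hφ z),
    inner_spaceGrad (hψ z), fderiv_fun_mul (hφ z) (hψ z)]
  simp

theorem spaceGrad_const_mul (c : ℝ) {φ : Space N × ℝ → ℝ} (hφ : Differentiable ℝ φ)
    (z : Space N × ℝ) : spaceGrad (fun z => c * φ z) z = c • spaceGrad φ z := by
  refine ext_inner_right ℝ fun y => ?_
  rw [inner_smul_left, inner_spaceGrad ((hφ z).const_mul c), inner_spaceGrad (hφ z),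
    fderiv_const_mul (hφ z)]
  simp

theorem spaceGrad_comp {χ : ℝ → ℝ} {φ : Space N × ℝ → ℝ} (hχ : Differentiable ℝ χ)
    (hφ : Differentiable ℝ φ) (z : Space N × ℝ) :
    spaceGrad (fun z => χ (φ z)) z = deriv χ (φ z) • spaceGrad φ z := by
  refine ext_inner_right ℝ fun y => ?_
  have h : HasFDerivAt (fun z => χ (φ z)) (deriv χ (φ z) • fderiv ℝ φ z) z :=
    (hχ (φ z)).hasDerivAt.comp_hasFDerivAt z (hφ z).hasFDerivAt
  rw [inner_smul_left, inner_spaceGrad h.differentiableAt, inner_spaceGrad (hφ z), h.fderiv]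
  simp

theorem spaceGrad_time {η : ℝ → ℝ} (z : Space N × ℝ) :
    spaceGrad (fun z : Space N × ℝ => η z.2) z = 0 := by
  simp [spaceGrad, gradient]

theorem timeDeriv_time {η : ℝ → ℝ} (z : Space N × ℝ) :
    timeDeriv (fun z : Space N × ℝ => η z.2) z = deriv η z.2 := rfl

/-- `φ` is a smooth function with compact support in `U`. -/
structure IsTest (U : Set (Space N × ℝ)) (φ : Space N × ℝ → ℝ) : Prop where
  smooth : ContDiff ℝ ∞ φ
  compact : HasCompactSupport φ
  supp : tsupport φ ⊆ U

namespace IsTest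

variable {U V : Set (Space N × ℝ)} {φ ψ : Space N × ℝ → ℝ}

theorem differentiable (hφ : IsTest U φ) : Differentiable ℝ φ :=
  hφ.smooth.differentiable (by simp)

theorem continuous (hφ : IsTest U φ) : Continuous φ := hφ.smooth.continuous

theorem eq_zero (hφ : IsTest U φ) {z : Space N × ℝ} (hz : z ∉ U) : φ z = 0 :=
  image_eq_zero_of_notMem_tsupport fun h => hz (hφ.supp h)

theorem spaceGrad_eq_zero (φ : Space N × ℝ → ℝ) {z : Space N × ℝ} (hz : z ∉ tsupport φ) :
    spaceGrad φ z = 0 := by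
  have h0 : φ =ᶠ[𝓝 (z.1, z.2)] 0 := notMem_tsupport_iff_eventuallyEq.mp hz
  have h1 : Tendsto (fun y : Space N => (y, z.2)) (𝓝 z.1) (𝓝 (z.1, z.2)) :=
    (Continuous.prodMk_left z.2).tendsto z.1
  have h2 : (fun y => φ (y, z.2)) =ᶠ[𝓝 z.1] fun _ => 0 := h1.eventually h0
  simp [spaceGrad, gradient, h2.fderiv_eq]

theorem grad_eq_zero (hφ : IsTest U φ) {z : Space N × ℝ} (hz : z ∉ U) : spaceGrad φ z = 0 :=
  spaceGrad_eq_zero φ fun h => hz (hφ.supp h)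

theorem continuous_grad (hφ : IsTest U φ) : Continuous (spaceGrad φ) :=
  continuous_spaceGrad (hφ.smooth.of_le (by norm_cast))

theorem compact_grad (hφ : IsTest U φ) : HasCompactSupport (spaceGrad φ) :=
  hasCompactSupport_spaceGrad hφ.compact

theorem memLp (hφ : IsTest U φ) (p : ℝ≥0∞) : MemLp φ p volume :=
  hφ.continuous.memLp_of_hasCompactSupport hφ.compact

theorem memLp_grad (hφ : IsTest U φ) (p : ℝ≥0∞) : MemLp (spaceGrad φ) p volume :=
  hφ.continuous_grad.memLp_of_hasCompactSupport hφ.compact_grad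

theorem sub (hφ : IsTest U φ) (hψ : IsTest U ψ) : IsTest U (fun z => φ z - ψ z) :=
  ⟨hφ.smooth.sub hψ.smooth, hφ.compact.sub hψ.compact,
    (tsupport_sub φ ψ).trans (union_subset hφ.supp hψ.supp)⟩

theorem add (hφ : IsTest U φ) (hψ : IsTest U ψ) : IsTest U (fun z => φ z + ψ z) :=
  ⟨hφ.smooth.add hψ.smooth, hφ.compact.add hψ.compact,
    (tsupport_add φ ψ).trans (union_subset hφ.supp hψ.supp)⟩

theorem of_support (hφ : IsTest U φ) (hψ : ContDiff ℝ ∞ ψ) (h : ∀ z, φ z = 0 → ψ z = 0) :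
    IsTest U ψ := by
  have hs : Function.support ψ ⊆ Function.support φ := fun z hz h0 => hz (h z h0)
  exact ⟨hψ, hφ.compact.mono hs, (closure_mono hs).trans hφ.supp⟩

theorem const_mul (hφ : IsTest U φ) (c : ℝ) : IsTest U (fun z => c * φ z) :=
  hφ.of_support (contDiff_const.mul hφ.smooth) fun z h => by simp [h]

theorem comp (hφ : IsTest U φ) {χ : ℝ → ℝ} (hχ : ContDiff ℝ ∞ χ) (h0 : χ 0 = 0) :
    IsTest U (fun z => χ (φ z)) :=
  hφ.of_support (hχ.comp hφ.smooth) fun z h => by simp [h, h0]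

theorem mul (hφ : IsTest U φ) (hψ : ContDiff ℝ ∞ ψ) (hV : tsupport ψ ∩ U ⊆ V) :
    IsTest V (fun z => ψ z * φ z) := by
  have h := hφ.of_support (hψ.mul hφ.smooth) fun z h => by simp [h]
  refine ⟨h.smooth, h.compact, fun z hz => hV ⟨?_, h.supp hz⟩⟩
  exact tsupport_mul_subset_left hz

end IsTest

/-! ### Dominated convergence in `L²` -/

theorem tendsto_eLpNorm_two_of_dominated {α F : Type*} [MeasurableSpace α] {μ : Measure α}
    [NormedAddCommGroup F] {f : ℕ → α → F} {g : α → ℝ} (hf : ∀ k, AEStronglyMeasurable (f k) μ)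
    (hg : MemLp g 2 μ) (hfg : ∀ k, ∀ᵐ a ∂μ, ‖f k a‖ ≤ g a)
    (hlim : ∀ᵐ a ∂μ, Tendsto (fun k => f k a) atTop (𝓝 0)) :
    Tendsto (fun k => eLpNorm (f k) 2 μ) atTop (𝓝 0) := by
  have key : Tendsto (fun k => ∫⁻ a, ‖f k a‖ₑ ^ (2 : ℝ) ∂μ) atTop (𝓝 0) := by
    have h0 : (∫⁻ _ : α, (0 : ℝ≥0∞) ∂μ) = 0 := by simp
    rw [← h0]
    refine tendsto_lintegral_of_dominated_convergence' (fun a => ‖g a‖ₑ ^ (2 : ℝ))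
      (fun k => (hf k).enorm.pow_const _) (fun k => ?_) ?_ ?_
    · filter_upwards [hfg k] with a ha
      gcongr
      rw [← ofReal_norm, ← ofReal_norm]
      exact ENNReal.ofReal_le_ofReal (ha.trans (le_abs_self _))
    · have := hg.2
      rw [eLpNorm_eq_lintegral_rpow_enorm_toReal (by norm_num) (by norm_num)] at this
      simp only [ENNReal.toReal_ofNat] at this
      intro h
      rw [h] at this
      simp at this
    · filter_upwards [hlim] with a ha
      have h1 : Tendsto (fun k => ‖f k a‖ₑ) atTop (𝓝 0) := by
        simpa using ha.enorm
      have h2 := h1.ennrpow_const 2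
      simpa using h2
  have h3 := key.ennrpow_const (1 / 2)
  simp only [eLpNorm_eq_lintegral_rpow_enorm_toReal (p := 2) (by norm_num) (by norm_num),
    ENNReal.toReal_ofNat]
  simpa using h3

/-! ### The parabolic energy space, with functions extended by zero -/

/-- `(u, Du)` is an `L²` limit of pairs `(φ, ∇ₓφ)` with `φ` a test function on `U`. -/
structure W0 (U : Set (Space N × ℝ)) (u : Space N × ℝ → ℝ) (Du : Space N × ℝ → Space N) :
    Prop where
  meas : AEStronglyMeasurable u volume
  meas_grad : AEStronglyMeasurable Du volume
  approx : ∀ ε : ℝ≥0∞, 0 < ε → ∃ φ, IsTest U φ ∧ eLpNorm (φ - u) 2 volume ≤ ε ∧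
    eLpNorm (spaceGrad φ - Du) 2 volume ≤ ε

theorem exists_subseq_tendsto_ae {α F : Type*} [MeasurableSpace α] {μ : Measure α}
    [NormedAddCommGroup F] {p : ℝ≥0∞} (hp : p ≠ 0) {f : ℕ → α → F} {g : α → F}
    (hf : ∀ k, AEStronglyMeasurable (f k) μ) (hg : AEStronglyMeasurable g μ)
    (h : Tendsto (fun k => eLpNorm (f k - g) p μ) atTop (𝓝 0)) :
    ∃ s : ℕ → ℕ, StrictMono s ∧ ∀ᵐ a ∂μ, Tendsto (fun k => f (s k) a) atTop (𝓝 (g a)) :=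
  (tendstoInMeasure_of_tendsto_eLpNorm hp hf hg h).exists_seq_tendsto_ae

namespace W0

variable {U V : Set (Space N × ℝ)} {u w : Space N × ℝ → ℝ} {Du Dw : Space N × ℝ → Space N}

theorem exists_seq (h : W0 U u Du) : ∃ φ : ℕ → Space N × ℝ → ℝ, (∀ k, IsTest U (φ k)) ∧
    Tendsto (fun k => eLpNorm (φ k - u) 2 volume) atTop (𝓝 0) ∧
    Tendsto (fun k => eLpNorm (spaceGrad (φ k) - Du) 2 volume) atTop (𝓝 0) ∧
    (∀ᵐ z, Tendsto (fun k => φ k z) atTop (𝓝 (u z))) ∧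
    (∀ᵐ z, Tendsto (fun k => spaceGrad (φ k) z) atTop (𝓝 (Du z))) := by
  have hε : ∀ k : ℕ, (0 : ℝ≥0∞) < ((k : ℝ≥0∞) + 1)⁻¹ := fun k => by
    simp [ENNReal.inv_pos]
  choose φ h1 h2 h3 using fun k : ℕ => h.approx _ (hε k)
  have hlim : Tendsto (fun k : ℕ => ((k : ℝ≥0∞) + 1)⁻¹) atTop (𝓝 0) := by
    have := ENNReal.tendsto_inv_nat_nhds_zero.comp (tendsto_add_atTop_nat 1)
    simpa [Function.comp_def] using this
  have h2' := tendsto_of_tendsto_of_tendsto_of_le_of_le tendsto_const_nhds hlim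
    (fun k => zero_le) h2
  have h3' := tendsto_of_tendsto_of_tendsto_of_le_of_le tendsto_const_nhds hlim
    (fun k => zero_le) h3
  obtain ⟨s, hs, hs'⟩ := exists_subseq_tendsto_ae (by norm_num)
    (fun k => ((h1 k).memLp 2).1) h.meas h2'
  obtain ⟨r, hr, hr'⟩ := exists_subseq_tendsto_ae (f := fun k => spaceGrad (φ (s k)))
    (by norm_num) (fun k => ((h1 _).memLp_grad 2).1) h.meas_grad (h3'.comp hs.tendsto_atTop)
  refine ⟨fun k => φ (s (r k)), fun k => h1 _,
    h2'.comp (hs.tendsto_atTop.comp hr.tendsto_atTop),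
    h3'.comp (hs.tendsto_atTop.comp hr.tendsto_atTop), ?_, hr'⟩
  filter_upwards [hs'] with z hz
  exact hz.comp hr.tendsto_atTop

theorem of_seq {φ : ℕ → Space N × ℝ → ℝ} (hu : AEStronglyMeasurable u volume)
    (hDu : AEStronglyMeasurable Du volume) (hφ : ∀ k, IsTest U (φ k))
    (h1 : Tendsto (fun k => eLpNorm (φ k - u) 2 volume) atTop (𝓝 0))
    (h2 : Tendsto (fun k => eLpNorm (spaceGrad (φ k) - Du) 2 volume) atTop (𝓝 0)) :
    W0 U u Du := by
  refine ⟨hu, hDu, fun ε hε => ?_⟩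
  obtain ⟨k, h1k, h2k⟩ := ((h1.eventually (ge_mem_nhds hε)).and
    (h2.eventually (ge_mem_nhds hε))).exists
  exact ⟨φ k, hφ k, h1k, h2k⟩

theorem of_test {φ : Space N × ℝ → ℝ} (hφ : IsTest U φ) : W0 U φ (spaceGrad φ) :=
  ⟨(hφ.memLp 2).1, (hφ.memLp_grad 2).1, fun ε _ => ⟨φ, hφ, by simp, by simp⟩⟩

/-- Closedness of the energy space: it lets the chain rule pass from smooth to Lipschitz
nonlinearities. -/
theorem of_tendsto {f : ℕ → Space N × ℝ → ℝ} {Df : ℕ → Space N × ℝ → Space N}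
    (hu : AEStronglyMeasurable u volume)
    (hDu : AEStronglyMeasurable Du volume) (hf : ∀ k, W0 U (f k) (Df k))
    (h1 : Tendsto (fun k => eLpNorm (f k - u) 2 volume) atTop (𝓝 0))
    (h2 : Tendsto (fun k => eLpNorm (Df k - Du) 2 volume) atTop (𝓝 0)) :
    W0 U u Du := by
  refine ⟨hu, hDu, fun ε hε => ?_⟩
  have hε2 : 0 < ε / 2 := ENNReal.half_pos hε.ne'
  obtain ⟨k, h1k, h2k⟩ := ((h1.eventually (ge_mem_nhds hε2)).and
    (h2.eventually (ge_mem_nhds hε2))).exists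
  obtain ⟨φ, hφ, h3, h4⟩ := (hf k).approx _ hε2
  refine ⟨φ, hφ, ?_, ?_⟩
  · calc eLpNorm (φ - u) 2 volume = eLpNorm ((φ - f k) + (f k - u)) 2 volume := by
          congr 1; abel
      _ ≤ _ := eLpNorm_add_le (((hφ.memLp 2).1).sub (hf k).meas) ((hf k).meas.sub hu)
          (by norm_num)
      _ ≤ ε / 2 + ε / 2 := add_le_add h3 h1k
      _ = ε := ENNReal.add_halves ε
  · calc eLpNorm (spaceGrad φ - Du) 2 volume
          = eLpNorm ((spaceGrad φ - Df k) + (Df k - Du)) 2 volume := by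
          congr 1; abel
      _ ≤ _ := eLpNorm_add_le (((hφ.memLp_grad 2).1).sub (hf k).meas_grad)
          ((hf k).meas_grad.sub hDu) (by norm_num)
      _ ≤ ε / 2 + ε / 2 := add_le_add h4 h2k
      _ = ε := ENNReal.add_halves ε

theorem memLp (h : W0 U u Du) : MemLp u 2 volume := by
  obtain ⟨φ, hφ, h1, -⟩ := h.approx 1 one_pos
  have : MemLp (φ - u) 2 volume :=
    ⟨((hφ.memLp 2).1).sub h.meas, h1.trans_lt ENNReal.one_lt_top⟩
  simpa using (hφ.memLp 2).sub this

theorem memLp_grad (h : W0 U u Du) : MemLp Du 2 volume := by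
  obtain ⟨φ, hφ, -, h1⟩ := h.approx 1 one_pos
  have : MemLp (spaceGrad φ - Du) 2 volume :=
    ⟨((hφ.memLp_grad 2).1).sub h.meas_grad, h1.trans_lt ENNReal.one_lt_top⟩
  simpa using (hφ.memLp_grad 2).sub this

theorem congr (h : W0 U u Du) (hu : u =ᵐ[volume] w) (hDu : Du =ᵐ[volume] Dw) : W0 U w Dw := by
  refine ⟨h.meas.congr hu, h.meas_grad.congr hDu, fun ε hε => ?_⟩
  obtain ⟨φ, hφ, h1, h2⟩ := h.approx ε hε
  refine ⟨φ, hφ, ?_, ?_⟩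
  · rwa [← eLpNorm_congr_ae (EventuallyEq.rfl.sub hu)]
  · rwa [← eLpNorm_congr_ae (EventuallyEq.rfl.sub hDu)]

theorem sub (h : W0 U u Du) (h' : W0 U w Dw) :
    W0 U (fun z => u z - w z) (fun z => Du z - Dw z) := by
  refine ⟨h.meas.sub h'.meas, h.meas_grad.sub h'.meas_grad, fun ε hε => ?_⟩
  have hε2 : 0 < ε / 2 := ENNReal.half_pos hε.ne'
  obtain ⟨φ, hφ, h1, h2⟩ := h.approx _ hε2
  obtain ⟨ψ, hψ, h3, h4⟩ := h'.approx _ hε2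
  refine ⟨_, hφ.sub hψ, ?_, ?_⟩
  · calc _ = eLpNorm ((φ - u) - (ψ - w)) 2 volume := by
          congr 1; ext z; simp only [Pi.sub_apply]; ring
      _ ≤ _ := eLpNorm_sub_le (((hφ.memLp 2).1).sub h.meas) (((hψ.memLp 2).1).sub h'.meas)
          (by norm_num)
      _ ≤ ε / 2 + ε / 2 := add_le_add h1 h3
      _ = ε := ENNReal.add_halves ε
  · calc _ = eLpNorm ((spaceGrad φ - Du) - (spaceGrad ψ - Dw)) 2 volume := by
          congr 1; ext1 z
          simp only [Pi.sub_apply, spaceGrad_sub hφ.differentiable hψ.differentiable]; abel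
      _ ≤ _ := eLpNorm_sub_le (((hφ.memLp_grad 2).1).sub h.meas_grad)
          (((hψ.memLp_grad 2).1).sub h'.meas_grad) (by norm_num)
      _ ≤ ε / 2 + ε / 2 := add_le_add h2 h4
      _ = ε := ENNReal.add_halves ε

theorem zero : W0 U (fun _ => 0) (fun _ => 0) := by
  have h : IsTest U (fun _ : Space N × ℝ => (0 : ℝ)) :=
    ⟨contDiff_const, HasCompactSupport.zero, by
      simp [tsupport, Function.support]⟩
  have := of_test h
  refine this.congr EventuallyEq.rfl (Eventually.of_forall fun z => ?_)
  simp [spaceGrad, gradient]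

theorem neg (h : W0 U u Du) : W0 U (fun z => -u z) (fun z => -Du z) := by
  simpa using zero.sub h

end W0

end EllipticParabolic

/-! ### Lipschitz functions with one-sided derivatives -/

namespace EllipticParabolic

variable {N : ℕ}

/-- `ψ` is continuous with right derivative `ψ'` everywhere, and `|ψ'| ≤ L`. -/
structure LipRight (ψ ψ' : ℝ → ℝ) (L : ℝ) : Prop where
  cont : Continuous ψ
  deriv : ∀ s, HasDerivWithinAt ψ (ψ' s) (Ioi s) s
  bound : ∀ s, |ψ' s| ≤ L

namespace LipRight

variable {ψ ψ' : ℝ → ℝ} {L : ℝ}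

theorem nonneg (h : LipRight ψ ψ' L) : 0 ≤ L := (abs_nonneg _).trans (h.bound 0)

theorem lip (h : LipRight ψ ψ' L) (r s : ℝ) : |ψ s - ψ r| ≤ L * |s - r| := by
  wlog hrs : r ≤ s generalizing r s
  · rw [abs_sub_comm, abs_sub_comm s]
    exact this s r (le_of_not_ge hrs)
  have := norm_image_sub_le_of_norm_deriv_right_le_segment (f := ψ) (f' := ψ') (a := r) (b := s)
    (C := L) h.cont.continuousOn (fun x _ => (hasDerivWithinAt_Ioi_iff_Ici.mp (h.deriv x)))
    (fun x _ => h.bound x) s ⟨hrs, le_rfl⟩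
  rwa [Real.norm_eq_abs, ← abs_of_nonneg (sub_nonneg.mpr hrs)] at this

/-- A right derivative at every point is a limit of one fixed sequence of continuous difference
quotients. Hence `ψ'` is Borel, kinks need no exceptional null sets, and smooth approximation
becomes possible. -/
theorem tendsto_slope (h : LipRight ψ ψ' L) (s : ℝ) :
    Tendsto (fun j : ℕ => (ψ (s + 1 / ((j : ℝ) + 1)) - ψ s) * ((j : ℝ) + 1)) atTop
      (𝓝 (ψ' s)) := by
  have h1 := (hasDerivWithinAt_iff_tendsto_slope' (by simp)).mp (h.deriv s)
  have h2 : Tendsto (fun j : ℕ => s + 1 / ((j : ℝ) + 1)) atTop (𝓝[>] s) := by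
    refine tendsto_nhdsWithin_iff.mpr ⟨?_, Eventually.of_forall fun j => ?_⟩
    · simpa using tendsto_one_div_add_atTop_nhds_zero_nat.const_add s
    · have : (0 : ℝ) < 1 / ((j : ℝ) + 1) := by positivity
      simpa using this
  refine (h1.comp h2).congr fun j => ?_
  have : ((j : ℝ) + 1) ≠ 0 := by positivity
  simp only [Function.comp, slope_def_field]
  field_simp
  ring

theorem measurable_deriv (h : LipRight ψ ψ' L) : Measurable ψ' := by
  refine measurable_of_tendsto_metrizable (f := fun (j : ℕ) s =>
    (ψ (s + 1 / ((j : ℝ) + 1)) - ψ s) * ((j : ℝ) + 1)) (fun j => ?_)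
    (tendsto_pi_nhds.mpr fun s => h.tendsto_slope s)
  have := h.cont
  exact Continuous.measurable (by fun_prop)

theorem intervalIntegrable (h : LipRight ψ ψ' L) (r s : ℝ) :
    IntervalIntegrable ψ' volume r s :=
  (intervalIntegrable_const (c := L)).mono_fun h.measurable_deriv.aestronglyMeasurable
    (Eventually.of_forall fun x => by
      simpa [Real.norm_eq_abs] using (h.bound x).trans (le_abs_self L))

theorem integral (h : LipRight ψ ψ' L) (r s : ℝ) : ∫ x in r..s, ψ' x = ψ s - ψ r :=
  intervalIntegral.integral_eq_sub_of_hasDeriv_right h.cont.continuousOn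
    (fun x _ => h.deriv x) (h.intervalIntegrable r s)

theorem deriv_nonneg (h : LipRight ψ ψ' L) (hm : Monotone ψ) (s : ℝ) : 0 ≤ ψ' s :=
  ge_of_tendsto' (h.tendsto_slope s) fun j =>
    mul_nonneg (sub_nonneg.mpr (hm (by simp; positivity))) (by positivity)

theorem of_hasDerivAt (h : ∀ s, HasDerivAt ψ (ψ' s) s) (hb : ∀ s, |ψ' s| ≤ L) :
    LipRight ψ ψ' L :=
  ⟨continuous_iff_continuousAt.mpr fun s => (h s).continuousAt,
    fun s => (h s).hasDerivWithinAt, hb⟩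

/-- A Lipschitz function with a right derivative is a limit of smooth functions whose
derivatives converge pointwise. -/
theorem exists_smooth_approx (h : LipRight ψ ψ' L) (h0 : ψ 0 = 0) :
    ∃ χ : ℕ → ℝ → ℝ, (∀ j, ContDiff ℝ ∞ (χ j)) ∧ (∀ j, χ j 0 = 0) ∧
      (∀ j s, |_root_.deriv (χ j) s| ≤ L + 1) ∧
      (∀ s, Tendsto (fun j => χ j s) atTop (𝓝 (ψ s))) ∧
      (∀ s, Tendsto (fun j => _root_.deriv (χ j) s) atTop (𝓝 (ψ' s))) := by
  have hcont := h.cont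
  have hpos : ∀ j : ℕ, (0 : ℝ) < 1 / ((j : ℝ) + 1) := fun j => by positivity
  -- The right difference quotient of step `1/(j+1)` is continuous, bounded by `L` and tends to `ψ'`
  -- everywhere. A smooth `g` uniformly within `1/(j+1)` of it has the same limit, and its primitive
  -- is the approximant; the uniform error accounts for the bound `L + 1`.
  have hex : ∀ j : ℕ, ∃ g : ℝ → ℝ, ContDiff ℝ ∞ g ∧
      ∀ s, |g s - (ψ (s + 1 / ((j : ℝ) + 1)) - ψ s) * ((j : ℝ) + 1)| < 1 / ((j : ℝ) + 1) := by
    intro j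
    obtain ⟨g, hg, hg', -⟩ := Continuous.exists_contDiff_approx (n := ⊤)
      (f := fun s => (ψ (s + 1 / ((j : ℝ) + 1)) - ψ s) * ((j : ℝ) + 1))
      (ε := fun _ => 1 / ((j : ℝ) + 1)) (by fun_prop) continuous_const (fun _ => hpos j)
    exact ⟨g, hg, fun s => by simpa [Real.dist_eq] using hg' s⟩
  choose g hg hg' using hex
  have hd : ∀ j s, HasDerivAt (fun s => ∫ x in (0 : ℝ)..s, g j x) (g j s) s := fun j s =>
    intervalIntegral.integral_hasDerivAt_right ((hg j).continuous.intervalIntegrable _ _)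
      ((hg j).continuous.stronglyMeasurableAtFilter _ _) (hg j).continuous.continuousAt
  have hderiv : ∀ j, _root_.deriv (fun s => ∫ x in (0 : ℝ)..s, g j x) = g j := fun j =>
    funext fun s => (hd j s).deriv
  have hb : ∀ j s, |g j s| ≤ L + 1 := by
    intro j s
    have h1 := hg' j s
    have h2 := h.lip s (s + 1 / ((j : ℝ) + 1))
    have h3 : |(ψ (s + 1 / ((j : ℝ) + 1)) - ψ s) * ((j : ℝ) + 1)| ≤ L := by
      rw [abs_mul, abs_of_pos (show (0 : ℝ) < (j : ℝ) + 1 by positivity)]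
      rw [add_sub_cancel_left, abs_of_pos (hpos j)] at h2
      calc _ ≤ L * (1 / ((j : ℝ) + 1)) * ((j : ℝ) + 1) := by gcongr
        _ = L := by field_simp
    have h4 : 1 / ((j : ℝ) + 1) ≤ 1 := by
      rw [div_le_one (by positivity)]; simp
    have h5 := abs_sub_abs_le_abs_sub (g j s) ((ψ (s + 1 / ((j : ℝ) + 1)) - ψ s) * ((j : ℝ) + 1))
    linarith
  have hlim : ∀ s, Tendsto (fun j => g j s) atTop (𝓝 (ψ' s)) := by
    intro s
    have h1 : Tendsto (fun j => g j s - (ψ (s + 1 / ((j : ℝ) + 1)) - ψ s) * ((j : ℝ) + 1)) atTop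
        (𝓝 0) :=
      squeeze_zero_norm (fun j => (hg' j s).le) tendsto_one_div_add_atTop_nhds_zero_nat
    simpa using h1.add (h.tendsto_slope s)
  refine ⟨fun j s => ∫ x in (0 : ℝ)..s, g j x, fun j => ?_, fun j => by simp, fun j s => ?_,
    fun s => ?_, fun s => ?_⟩
  · refine contDiff_infty_iff_deriv.mpr ⟨fun s => (hd j s).differentiableAt, ?_⟩
    rw [hderiv]; exact hg j
  · rw [hderiv]; exact hb j s
  · have h1 := h.integral 0 s
    rw [h0, sub_zero] at h1
    rw [← h1]
    refine intervalIntegral.tendsto_integral_filter_of_dominated_convergence (fun _ => L + 1)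
      (Eventually.of_forall fun j => (hg j).continuous.aestronglyMeasurable)
      (Eventually.of_forall fun j => Eventually.of_forall fun x _ => hb j x)
      intervalIntegrable_const (Eventually.of_forall fun x _ => hlim x)
  · simp_rw [hderiv]; exact hlim s

end LipRight

/-! ### Chain rule and products in the energy space -/

namespace W0

variable {U V : Set (Space N × ℝ)} {u w : Space N × ℝ → ℝ} {Du Dw : Space N × ℝ → Space N}

/-- The approximants are `χ` of test functions. Recording that they take values in the range of `χ`
matters for bounded `χ` such as `arctan`: it provides test functions with a uniform sup bound, which
convergence in `L²` alone does not give. -/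
theorem exists_seq_comp (h : W0 U u Du) {χ : ℝ → ℝ} (hχ : ContDiff ℝ ∞ χ) (h0 : χ 0 = 0) {L : ℝ}
    (hL : ∀ s, |deriv χ s| ≤ L) :
    ∃ φ : ℕ → Space N × ℝ → ℝ, (∀ k, IsTest U (φ k)) ∧ (∀ k z, ∃ s, φ k z = χ s) ∧
    Tendsto (fun k => eLpNorm (φ k - fun z => χ (u z)) 2 volume) atTop (𝓝 0) ∧
    Tendsto (fun k => eLpNorm (spaceGrad (φ k) - fun z => deriv χ (u z) • Du z) 2 volume)
      atTop (𝓝 0) := by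
  obtain ⟨φ, hφ, h1, h2, h3, -⟩ := h.exists_seq
  have hd : Differentiable ℝ χ := hχ.differentiable (by simp)
  have hd' : Continuous (deriv χ) := hχ.continuous_deriv (by simp)
  have hL0 : 0 ≤ L := (abs_nonneg _).trans (hL 0)
  have hlip : ∀ r s, |χ s - χ r| ≤ L * |s - r| := fun r s =>
    (LipRight.of_hasDerivAt (fun s => (hd s).hasDerivAt) hL).lip r s
  refine ⟨fun k z => χ (φ k z), fun k => (hφ k).comp hχ h0, fun k z => ⟨_, rfl⟩, ?_, ?_⟩
  · have hle : ∀ k, eLpNorm ((fun z => χ (φ k z)) - fun z => χ (u z)) 2 volume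
        ≤ ENNReal.ofReal L * eLpNorm (φ k - u) 2 volume := fun k =>
      eLpNorm_le_mul_eLpNorm_of_ae_le_mul (Eventually.of_forall fun z => hlip _ _) 2
    have hlim := ENNReal.Tendsto.const_mul (a := ENNReal.ofReal L) h1 (Or.inr (by simp))
    rw [mul_zero] at hlim
    exact tendsto_of_tendsto_of_tendsto_of_le_of_le tendsto_const_nhds hlim
      (fun _ => zero_le) hle
  · have hm1 : ∀ k, AEStronglyMeasurable (fun z => deriv χ (φ k z)) volume := fun k =>
      (hd'.comp (hφ k).continuous).aestronglyMeasurable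
    have hm2 : AEStronglyMeasurable (fun z => deriv χ (u z)) volume :=
      hd'.comp_aestronglyMeasurable h.meas
    -- The gradient error splits as `χ'(φₖ)(∇φₖ - Du) + (χ'(φₖ) - χ'(u)) Du`. The first part is
    -- small because `χ'` is bounded, the second by dominated convergence along the a.e. convergent
    -- sequence.
    have hA : Tendsto (fun k => eLpNorm (fun z => deriv χ (φ k z) • (spaceGrad (φ k) z - Du z)) 2
        volume) atTop (𝓝 0) := by
      have hle : ∀ k, eLpNorm (fun z => deriv χ (φ k z) • (spaceGrad (φ k) z - Du z)) 2 volume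
          ≤ ENNReal.ofReal L * eLpNorm (spaceGrad (φ k) - Du) 2 volume := fun k =>
        eLpNorm_le_mul_eLpNorm_of_ae_le_mul (Eventually.of_forall fun z => by
          rw [norm_smul]; exact mul_le_mul_of_nonneg_right (hL _) (norm_nonneg _)) 2
      have hlim := ENNReal.Tendsto.const_mul (a := ENNReal.ofReal L) h2 (Or.inr (by simp))
      rw [mul_zero] at hlim
      exact tendsto_of_tendsto_of_tendsto_of_le_of_le tendsto_const_nhds hlim
        (fun _ => zero_le) hle
    have hB : Tendsto (fun k => eLpNorm (fun z => (deriv χ (φ k z) - deriv χ (u z)) • Du z) 2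
        volume) atTop (𝓝 0) := by
      refine tendsto_eLpNorm_two_of_dominated (g := fun z => 2 * L * ‖Du z‖)
        (fun k => ((hm1 k).sub hm2).smul h.meas_grad) (h.memLp_grad.norm.const_mul _)
        (fun k => Eventually.of_forall fun z => ?_) ?_
      · rw [norm_smul]
        refine mul_le_mul_of_nonneg_right ?_ (norm_nonneg _)
        refine (norm_sub_le _ _).trans ?_
        have := hL (φ k z)
        have := hL (u z)
        simp only [Real.norm_eq_abs]
        linarith
      · filter_upwards [h3] with z hz
        have h5 : Tendsto (fun k => deriv χ (φ k z)) atTop (𝓝 (deriv χ (u z))) :=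
          (hd'.tendsto _).comp hz
        have h6 := (h5.sub_const (deriv χ (u z))).smul_const (Du z)
        simpa using h6
    have hlim := hA.add hB
    rw [add_zero] at hlim
    refine tendsto_of_tendsto_of_tendsto_of_le_of_le tendsto_const_nhds hlim
      (fun _ => zero_le) fun k => ?_
    refine le_trans (le_of_eq ?_) (eLpNorm_add_le ((hm1 k).smul
      (((hφ k).memLp_grad 2).1.sub h.meas_grad)) (((hm1 k).sub hm2).smul h.meas_grad)
      (by norm_num))
    congr 1
    ext1 z
    simp only [Pi.sub_apply, Pi.add_apply,
      spaceGrad_comp hd (hφ k).differentiable, smul_sub, sub_smul]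
    abel

theorem comp_smooth (h : W0 U u Du) {χ : ℝ → ℝ} (hχ : ContDiff ℝ ∞ χ) (h0 : χ 0 = 0) {L : ℝ}
    (hL : ∀ s, |deriv χ s| ≤ L) : W0 U (fun z => χ (u z)) (fun z => deriv χ (u z) • Du z) := by
  obtain ⟨φ, hφ, -, h1, h2⟩ := h.exists_seq_comp hχ h0 hL
  exact of_seq (hχ.continuous.comp_aestronglyMeasurable h.meas)
    (((hχ.continuous_deriv (by simp)).comp_aestronglyMeasurable h.meas).smul h.meas_grad) hφ h1 h2

/-- The chain rule for Lipschitz functions with a right derivative everywhere. -/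
theorem comp (h : W0 U u Du) {ψ ψ' : ℝ → ℝ} {L : ℝ} (hψ : LipRight ψ ψ' L) (h0 : ψ 0 = 0) :
    W0 U (fun z => ψ (u z)) (fun z => ψ' (u z) • Du z) := by
  obtain ⟨χ, h1, h2, h3, h4, h5⟩ := hψ.exists_smooth_approx h0
  have hL := hψ.nonneg
  have hm1 : AEStronglyMeasurable (fun z => ψ (u z)) volume :=
    hψ.cont.comp_aestronglyMeasurable h.meas
  have hm2 : AEStronglyMeasurable (fun z => ψ' (u z)) volume :=
    (hψ.measurable_deriv.comp_aemeasurable h.meas.aemeasurable).aestronglyMeasurable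
  have hlip : ∀ j s, |χ j s| ≤ (L + 1) * |s| := fun j s => by
    have := (LipRight.of_hasDerivAt (fun s => (((h1 j).differentiable (by simp)) s).hasDerivAt)
      (h3 j)).lip 0 s
    simpa [h2] using this
  have hlip' : ∀ s, |ψ s| ≤ L * |s| := fun s => by simpa [h0] using hψ.lip 0 s
  refine of_tendsto (f := fun j z => χ j (u z)) (Df := fun j z => deriv (χ j) (u z) • Du z)
    hm1 (hm2.smul h.meas_grad) (fun j => h.comp_smooth (h1 j) (h2 j) (h3 j)) ?_ ?_
  · refine tendsto_eLpNorm_two_of_dominated (g := fun z => (2 * L + 1) * ‖u z‖)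
      (fun j => ((h1 j).continuous.comp_aestronglyMeasurable h.meas).sub hm1)
      (h.memLp.norm.const_mul _) (fun j => Eventually.of_forall fun z => ?_)
      (Eventually.of_forall fun z => ?_)
    · refine (norm_sub_le _ _).trans ?_
      have := hlip j (u z)
      have := hlip' (u z)
      simp only [Real.norm_eq_abs]
      linarith
    · simpa using (h4 (u z)).sub_const (ψ (u z))
  · refine tendsto_eLpNorm_two_of_dominated (g := fun z => (2 * L + 1) * ‖Du z‖)
      (fun j => ((((h1 j).continuous_deriv (by simp)).comp_aestronglyMeasurable h.meas).smul
        h.meas_grad).sub (hm2.smul h.meas_grad))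
      (h.memLp_grad.norm.const_mul _) (fun j => Eventually.of_forall fun z => ?_)
      (Eventually.of_forall fun z => ?_)
    · simp only [Pi.sub_apply]
      rw [← sub_smul, norm_smul]
      refine mul_le_mul_of_nonneg_right ?_ (norm_nonneg _)
      refine (norm_sub_le _ _).trans ?_
      have := h3 j (u z)
      have := hψ.bound (u z)
      simp only [Real.norm_eq_abs]
      linarith
    · simpa using ((h5 (u z)).smul_const (Du z)).sub_const (ψ' (u z) • Du z)

/-- Multiplication by a smooth function with bounded value and spatial gradient. -/
theorem exists_seq_mul {φ : ℕ → Space N × ℝ → ℝ} (hu : AEStronglyMeasurable u volume)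
    (hDu : AEStronglyMeasurable Du volume) (hφ : ∀ k, IsTest U (φ k))
    (h1 : Tendsto (fun k => eLpNorm (φ k - u) 2 volume) atTop (𝓝 0))
    (h2 : Tendsto (fun k => eLpNorm (spaceGrad (φ k) - Du) 2 volume) atTop (𝓝 0))
    {η : Space N × ℝ → ℝ} (hη : ContDiff ℝ ∞ η) {C : ℝ}
    (hC : ∀ z, |η z| ≤ C) (hC' : ∀ z, ‖spaceGrad η z‖ ≤ C) (hV : tsupport η ∩ U ⊆ V) :
    (∀ k, IsTest V (fun z => η z * φ k z)) ∧
    Tendsto (fun k => eLpNorm ((fun z => η z * φ k z) - fun z => η z * u z) 2 volume) atTop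
      (𝓝 0) ∧
    Tendsto (fun k => eLpNorm (spaceGrad (fun z => η z * φ k z) -
      fun z => η z • Du z + u z • spaceGrad η z) 2 volume) atTop (𝓝 0) := by
  have hηd : Differentiable ℝ η := hη.differentiable (by simp)
  have hηc : Continuous (spaceGrad η) := continuous_spaceGrad (hη.of_le (by norm_cast))
  have hlim1 := ENNReal.Tendsto.const_mul (a := ENNReal.ofReal C) h1 (Or.inr (by simp))
  have hlim2 := ENNReal.Tendsto.const_mul (a := ENNReal.ofReal C) h2 (Or.inr (by simp))
  rw [mul_zero] at hlim1 hlim2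
  refine ⟨fun k => (hφ k).mul hη hV, ?_, ?_⟩
  · refine tendsto_of_tendsto_of_tendsto_of_le_of_le tendsto_const_nhds hlim1
      (fun _ => zero_le) fun k => ?_
    refine eLpNorm_le_mul_eLpNorm_of_ae_le_mul (Eventually.of_forall fun z => ?_) 2
    simp only [Pi.sub_apply]
    rw [← mul_sub, norm_mul]
    exact mul_le_mul_of_nonneg_right (hC z) (norm_nonneg _)
  · have hlim := hlim2.add hlim1
    rw [add_zero] at hlim
    refine tendsto_of_tendsto_of_tendsto_of_le_of_le tendsto_const_nhds hlim
      (fun _ => zero_le) fun k => ?_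
    have heq : (spaceGrad (fun z => η z * φ k z) - fun z => η z • Du z + u z • spaceGrad η z)
        = (fun z => η z • (spaceGrad (φ k) z - Du z)) + fun z => (φ k z - u z) • spaceGrad η z := by
      ext1 z
      simp only [Pi.sub_apply, Pi.add_apply, spaceGrad_mul hηd (hφ k).differentiable, smul_sub,
        sub_smul]
      abel
    rw [heq]
    refine (eLpNorm_add_le (hη.continuous.aestronglyMeasurable.smul
      (((hφ k).memLp_grad 2).1.sub hDu)) ((((hφ k).memLp 2).1.sub hu).smul
      hηc.aestronglyMeasurable) (by norm_num)).trans ?_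
    refine add_le_add ?_ ?_
    · refine eLpNorm_le_mul_eLpNorm_of_ae_le_mul (Eventually.of_forall fun z => ?_) 2
      rw [Pi.smul_apply', norm_smul]
      exact mul_le_mul_of_nonneg_right (hC z) (norm_nonneg _)
    · refine eLpNorm_le_mul_eLpNorm_of_ae_le_mul (Eventually.of_forall fun z => ?_) 2
      rw [Pi.smul_apply', norm_smul, mul_comm]
      exact mul_le_mul_of_nonneg_right (hC' z) (norm_nonneg _)

theorem mul (h : W0 U u Du) {η : Space N × ℝ → ℝ} (hη : ContDiff ℝ ∞ η) {C : ℝ}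
    (hC : ∀ z, |η z| ≤ C) (hC' : ∀ z, ‖spaceGrad η z‖ ≤ C) (hV : tsupport η ∩ U ⊆ V) :
    W0 V (fun z => η z * u z) (fun z => η z • Du z + u z • spaceGrad η z) := by
  obtain ⟨φ, hφ, h1, h2, -⟩ := h.exists_seq
  obtain ⟨h3, h4, h5⟩ := exists_seq_mul h.meas h.meas_grad hφ h1 h2 hη hC hC' hV
  have hηc : Continuous (spaceGrad η) := continuous_spaceGrad (hη.of_le (by norm_cast))
  exact of_seq (hη.continuous.aestronglyMeasurable.mul h.meas)
    ((hη.continuous.aestronglyMeasurable.smul h.meas_grad).add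
      (h.meas.smul hηc.aestronglyMeasurable)) h3 h4 h5

end W0

end EllipticParabolic

namespace EllipticParabolic

variable {N : ℕ}

/-! ### Translations and `L²` pairings -/

instance instIsAddHaarMeasureSpaceTime : (volume : Measure (Space N × ℝ)).IsAddHaarMeasure :=
  Measure.prod.instIsAddHaarMeasure volume volume

theorem shift_zero (z : Space N × ℝ) : z + ((0 : Space N), (0 : ℝ)) = z := add_zero z

theorem measurePreserving_shift (a : Space N × ℝ) :
    MeasurePreserving (fun z : Space N × ℝ => z + a) volume volume :=
  measurePreserving_add_right volume a

theorem integral_shift {F : Type*} [NormedAddCommGroup F] [NormedSpace ℝ F]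
    (f : Space N × ℝ → F) (a : Space N × ℝ) : ∫ z, f (z + a) = ∫ z, f z :=
  integral_add_right_eq_self f a

theorem spaceGrad_shift (φ : Space N × ℝ → ℝ) (a z : Space N × ℝ) :
    spaceGrad (fun z => φ (z + a)) z = spaceGrad φ (z + a) := by
  simp only [spaceGrad, gradient]
  congr 1
  exact fderiv_comp_add_right (f := fun y => φ (y, (z + a).2)) a.1

theorem timeDeriv_shift (φ : Space N × ℝ → ℝ) (a z : Space N × ℝ) :
    timeDeriv (fun z => φ (z + a)) z = timeDeriv φ (z + a) := by
  simp only [timeDeriv]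
  exact deriv_comp_add_const (f := fun s => φ ((z + a).1, s)) a.2 z.2

theorem IsTest.shift {U V : Set (Space N × ℝ)} {φ : Space N × ℝ → ℝ} (hφ : IsTest U φ)
    (a : Space N × ℝ) (h : ∀ z, z + a ∈ U → z ∈ V) : IsTest V (fun z => φ (z + a)) := by
  refine ⟨hφ.smooth.comp (contDiff_id.add contDiff_const),
    hφ.compact.comp_homeomorph (Homeomorph.addRight a), ?_⟩
  have : tsupport (fun z => φ (z + a)) = (fun z => z + a) ⁻¹' tsupport φ :=
    tsupport_comp_eq_preimage φ (Homeomorph.addRight a)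
  rw [this]
  exact fun z hz => h z (hφ.supp hz)

theorem memLp_shift {F : Type*} [NormedAddCommGroup F] {f : Space N × ℝ → F} {p : ℝ≥0∞}
    (hf : MemLp f p volume) (a : Space N × ℝ) : MemLp (fun z => f (z + a)) p volume :=
  hf.comp_measurePreserving (measurePreserving_shift a)

/-- Translations are continuous in `L²`. -/
theorem exists_shift_close {F : Type*} [NormedAddCommGroup F] {f : Space N × ℝ → F}
    (hf : MemLp f 2 volume) {ε : ℝ} (hε : 0 < ε) : ∃ δ > 0, ∀ s : ℝ, |s| < δ →
      (eLpNorm (fun z => f (z + (0, s)) - f z) 2 volume).toReal ≤ ε := by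
  let g : ℝ → C(Space N × ℝ, Space N × ℝ) := fun s => ⟨fun z => z + (0, s), by fun_prop⟩
  have hg : Continuous g :=
    ContinuousMap.continuous_of_continuous_uncurry _ (by simp only [Function.uncurry_def, g, ContinuousMap.coe_mk]; fun_prop)
  have hgm : ∀ s, MeasurePreserving (g s) volume volume := fun s => measurePreserving_shift _
  have h := Filter.Tendsto.compMeasurePreservingLp
    (tendsto_const_nhds (x := hf.toLp f) (f := 𝓝 (0 : ℝ))) (hg.tendsto 0) hgm (hgm 0) (by norm_num)
  obtain ⟨δ, hδ, hδ'⟩ := Metric.tendsto_nhds_nhds.mp h ε hε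
  refine ⟨δ, hδ, fun s hs => ?_⟩
  have h1 := hδ' (x := s) (by simpa using hs)
  rw [dist_eq_norm, Lp.norm_def] at h1
  refine le_trans (le_of_eq ?_) h1.le
  congr 1
  refine eLpNorm_congr_ae ?_
  have e1 := Lp.coeFn_sub (Lp.compMeasurePreserving (g s) (hgm s) (hf.toLp f))
    (Lp.compMeasurePreserving (g 0) (hgm 0) (hf.toLp f))
  have e2 := Lp.coeFn_compMeasurePreserving (hf.toLp f) (hgm s)
  have e3 := Lp.coeFn_compMeasurePreserving (hf.toLp f) (hgm 0)
  have e4 := hf.coeFn_toLp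
  have e5 := (hgm s).quasiMeasurePreserving.ae e4
  have e6 := (hgm 0).quasiMeasurePreserving.ae e4
  filter_upwards [e1, e2, e3, e5, e6] with z h1 h2 h3 h5 h6
  rw [h1, Pi.sub_apply, h2, h3]
  simp only [Function.comp]
  rw [h5, h6]
  simp [g, shift_zero]

theorem abs_integral_inner_le {α F : Type*} [MeasurableSpace α] {μ : Measure α}
    [NormedAddCommGroup F] [InnerProductSpace ℝ F] {f g : α → F} (hf : MemLp f 2 μ)
    (hg : MemLp g 2 μ) :
    |∫ z, inner ℝ (f z) (g z) ∂μ| ≤ (eLpNorm f 2 μ).toReal * (eLpNorm g 2 μ).toReal := by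
  have h1 := abs_real_inner_le_norm (hf.toLp f) (hg.toLp g)
  rw [Lp.norm_toLp, Lp.norm_toLp, L2.inner_def] at h1
  refine le_trans (le_of_eq ?_) h1
  congr 1
  refine integral_congr_ae ?_
  filter_upwards [hf.coeFn_toLp, hg.coeFn_toLp] with z h1 h2
  rw [h1, h2]

theorem integrable_inner {α F : Type*} [MeasurableSpace α] {μ : Measure α}
    [NormedAddCommGroup F] [InnerProductSpace ℝ F] {f g : α → F} (hf : MemLp f 2 μ)
    (hg : MemLp g 2 μ) : Integrable (fun z => inner ℝ (f z) (g z)) μ := by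
  refine (L2.integrable_inner (𝕜 := ℝ) (hf.toLp f) (hg.toLp g)).congr ?_
  filter_upwards [hf.coeFn_toLp, hg.coeFn_toLp] with z h1 h2
  rw [h1, h2]

theorem tendsto_integral_inner {α F : Type*} [MeasurableSpace α] {μ : Measure α}
    [NormedAddCommGroup F] [InnerProductSpace ℝ F] {f : α → F} {g : ℕ → α → F} {g₀ : α → F}
    (hf : MemLp f 2 μ) (hg : ∀ k, MemLp (g k) 2 μ) (hg₀ : MemLp g₀ 2 μ)
    (h : Tendsto (fun k => eLpNorm (g k - g₀) 2 μ) atTop (𝓝 0)) :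
    Tendsto (fun k => ∫ z, inner ℝ (f z) (g k z) ∂μ) atTop (𝓝 (∫ z, inner ℝ (f z) (g₀ z) ∂μ)) := by
  rw [tendsto_iff_norm_sub_tendsto_zero]
  have h1 : Tendsto (fun k => (eLpNorm f 2 μ).toReal * (eLpNorm (g k - g₀) 2 μ).toReal) atTop
      (𝓝 0) := by
    simpa using ((ENNReal.tendsto_toReal ENNReal.zero_ne_top).comp h).const_mul
      (eLpNorm f 2 μ).toReal
  refine squeeze_zero (fun _ => norm_nonneg _) (fun k => ?_) h1
  rw [← integral_sub (integrable_inner hf (hg k)) (integrable_inner hf hg₀)]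
  refine le_trans (le_of_eq ?_) (abs_integral_inner_le hf ((hg k).sub hg₀))
  rw [Real.norm_eq_abs]
  congr 2
  ext z
  simp [inner_sub_right]

theorem real_inner_eq (x y : ℝ) : inner ℝ x y = x * y := by
  simp [mul_comm]

theorem continuous_timeDeriv {φ : Space N × ℝ → ℝ} (hφ : ContDiff ℝ 1 φ) :
    Continuous (timeDeriv φ) := by
  have h : timeDeriv φ = fun z => fderiv ℝ φ z (0, 1) := by
    funext z
    exact timeDeriv_eq_fderiv (hφ.differentiable one_ne_zero z)
  rw [h]
  exact (hφ.continuous_fderiv one_ne_zero).clm_apply continuous_const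

theorem hasDerivAt_time {φ : Space N × ℝ → ℝ} (hφ : Differentiable ℝ φ) (z : Space N × ℝ)
    (s : ℝ) : HasDerivAt (fun s : ℝ => φ (z + (0, s))) (timeDeriv φ (z + (0, s))) s := by
  have h1 : DifferentiableAt ℝ (fun r : ℝ => φ ((z + (0, s)).1, r)) (z.2 + s) := by fun_prop
  have h2 := (h1.hasDerivAt).comp_const_add z.2 s
  have h3 : (fun s : ℝ => φ (z + (0, s))) = fun x => φ ((z + (0, s)).1, z.2 + x) := by
    ext x; simp [Prod.add_def]
  rw [h3]
  exact h2

theorem bounded_timeDeriv {φ : Space N × ℝ → ℝ} (hφ : ContDiff ℝ 1 φ)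
    (hc : HasCompactSupport φ) : ∃ C, ∀ z, |timeDeriv φ z| ≤ C := by
  have h : timeDeriv φ = fun z => fderiv ℝ φ z (0, 1) := by
    funext z
    exact timeDeriv_eq_fderiv (hφ.differentiable one_ne_zero z)
  have hs : HasCompactSupport (timeDeriv φ) := by
    rw [h]
    exact (hc.fderiv (𝕜 := ℝ)).comp_left (g := fun L : Space N × ℝ →L[ℝ] ℝ => L (0, 1)) (by simp)
  obtain ⟨C, hC⟩ := hs.exists_bound_of_continuous (continuous_timeDeriv hφ)
  exact ⟨C, hC⟩

/-- Differentiation of an integral against a translated function. -/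
theorem hasDerivAt_integral_shift {w φ : Space N × ℝ → ℝ} (hw : Integrable w volume)
    (hφ : ContDiff ℝ 1 φ) {C : ℝ} (hC : ∀ z, |φ z| ≤ C) (hC' : ∀ z, |timeDeriv φ z| ≤ C) (s : ℝ) :
    HasDerivAt (fun s : ℝ => ∫ z, w z * φ (z + (0, s)))
      (∫ z, w z * timeDeriv φ (z + (0, s))) s := by
  have hc : Continuous φ := hφ.continuous
  have hc' := continuous_timeDeriv hφ
  refine (hasDerivAt_integral_of_dominated_loc_of_deriv_le (s := univ) univ_mem
    (bound := fun z => |w z| * C)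
    (F' := fun s z => w z * timeDeriv φ (z + (0, s)))
    (Eventually.of_forall fun r => hw.1.mul (Continuous.aestronglyMeasurable (by fun_prop))) ?_
    (hw.1.mul (Continuous.aestronglyMeasurable (by fun_prop))) ?_ (hw.abs.mul_const C) ?_).2
  · exact hw.mul_bdd (c := C) (Continuous.aestronglyMeasurable (by fun_prop))
      (Eventually.of_forall fun z => hC _)
  · refine Eventually.of_forall fun z r _ => ?_
    rw [norm_mul]
    exact mul_le_mul_of_nonneg_left (hC' _) (norm_nonneg _)
  · exact Eventually.of_forall fun z r _ =>
      (hasDerivAt_time (hφ.differentiable one_ne_zero) z r).const_mul (w z)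

/-- Mean value theorem for `r ↦ ∫ w φ(· + r)`. A time difference becomes one time derivative of the
test function at an intermediate shift, and there the equation applies. -/
theorem exists_shift_eq {U : Set (Space N × ℝ)} {w φ : Space N × ℝ → ℝ}
    (hw : Integrable w volume) (hφ : IsTest U φ) (s : ℝ) :
    ∃ ξ : ℝ, |ξ| ≤ |s| ∧
      ∫ z, w z * (φ z - φ (z + (0, s))) = - s * ∫ z, w z * timeDeriv φ (z + (0, ξ)) := by
  have h1 : ContDiff ℝ 1 φ := hφ.smooth.of_le (by norm_cast)
  obtain ⟨C₁, hC₁⟩ := hφ.compact.exists_bound_of_continuous hφ.continuous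
  obtain ⟨C₂, hC₂⟩ := bounded_timeDeriv h1 hφ.compact
  have hd := hasDerivAt_integral_shift hw h1 (C := max C₁ C₂)
    (fun z => (hC₁ z).trans (le_max_left _ _)) (fun z => (hC₂ z).trans (le_max_right _ _))
  have hi : ∀ r : ℝ, Integrable (fun z => w z * φ (z + (0, r))) volume := fun r =>
    hw.mul_bdd (c := C₁) (Continuous.aestronglyMeasurable (by have := hφ.continuous; fun_prop))
      (Eventually.of_forall fun z => hC₁ _)
  have heq : ∫ z, w z * (φ z - φ (z + (0, s)))
      = (∫ z, w z * φ (z + (0, 0))) - ∫ z, w z * φ (z + (0, s)) := by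
    rw [← integral_sub (hi 0) (hi s)]
    congr 1; ext z
    simp [mul_sub, shift_zero]
  rw [heq]
  have hcont : Continuous (fun s : ℝ => ∫ z, w z * φ (z + (0, s))) :=
    continuous_iff_continuousAt.mpr fun r => (hd r).continuousAt
  rcases lt_trichotomy s 0 with hs | hs | hs
  · obtain ⟨ξ, hξ, h⟩ := exists_hasDerivAt_eq_slope _ _ hs hcont.continuousOn
      (fun x _ => hd x)
    refine ⟨ξ, ?_, ?_⟩
    · rw [abs_of_neg hs, abs_of_neg hξ.2]; linarith [hξ.1]
    · rw [h]; field_simp; ring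
  · subst hs
    exact ⟨0, le_rfl, by simp⟩
  · obtain ⟨ξ, hξ, h⟩ := exists_hasDerivAt_eq_slope _ _ hs hcont.continuousOn
      (fun x _ => hd x)
    refine ⟨ξ, ?_, ?_⟩
    · rw [abs_of_pos hs, abs_of_pos hξ.1]; exact hξ.2.le
    · rw [h]; field_simp; ring

/-! ### Solutions extended by zero -/

/-- A bounded weak solution, with all functions extended by zero outside the cylinder; `m₀` is the
`L¹` norm of the initial datum. -/
structure Sol (Ω : Opens (Space N)) (T : ℝ) (b : ℝ → ℝ) (h : Space N × ℝ → ℝ) (m₀ : ℝ)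
    (v : Space N × ℝ → ℝ) (Dv : Space N × ℝ → Space N) : Prop where
  cont : Continuous b
  mono : StrictMono b
  zero : b 0 = 0
  pos : 0 < T
  bdd : Bornology.IsBounded (Ω : Set (Space N))
  meas : Measurable v
  zero_off : ∀ z, z ∉ cyl Ω T → v z = 0
  bounded : ∃ M : ℝ, ∀ z, |v z| ≤ M
  source : MemLp h 2 volume
  source_one : Integrable h volume
  mem : W0 (cyl Ω T) v Dv
  eqn : ∀ φ, IsTest (cyl Ω T) φ →
    -∫ z, b (v z) * timeDeriv φ z = (∫ z, h z * φ z) - ∫ z, inner ℝ (Dv z) (spaceGrad φ z)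
  mass : ∃ c : ℝ → ℝ, ContinuousOn c (Ico 0 T) ∧
    (∀ᵐ t, t ∈ Ioo 0 T → ∫ x, |b (v (x, t))| = c t) ∧ c 0 = m₀

theorem isBounded_cyl {Ω : Opens (Space N)} (hΩ : Bornology.IsBounded (Ω : Set (Space N)))
    (T : ℝ) : Bornology.IsBounded (cyl Ω T : Set (Space N × ℝ)) :=
  hΩ.prod (Metric.isBounded_Ioo 0 T)

theorem measurableSet_cyl (Ω : Opens (Space N)) (T : ℝ) :
    MeasurableSet (cyl Ω T : Set (Space N × ℝ)) :=
  (cyl Ω T).isOpen.measurableSet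

theorem mem_cyl {Ω : Opens (Space N)} {T : ℝ} {z : Space N × ℝ} :
    z ∈ cyl Ω T ↔ z.1 ∈ Ω ∧ 0 < z.2 ∧ z.2 < T := Iff.rfl

/-- A bounded measurable function vanishing outside a set of finite measure is in every `L^p`. -/
theorem memLp_of_bounded_off {α F : Type*} [MeasurableSpace α] {μ : Measure α}
    [NormedAddCommGroup F] {f : α → F} (hf : AEStronglyMeasurable f μ) {S : Set α}
    (hS : MeasurableSet S) (hS' : μ S < ⊤) {C : ℝ} (hC : ∀ z, ‖f z‖ ≤ C)
    (h0 : ∀ z, z ∉ S → f z = 0) (p : ℝ≥0∞) : MemLp f p μ := by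
  have h1 : f = S.indicator f := by
    ext z
    by_cases hz : z ∈ S
    · simp [hz]
    · simp [hz, h0 z hz]
  rw [h1, memLp_indicator_iff_restrict hS]
  have : IsFiniteMeasure (μ.restrict S) := ⟨by simpa using hS'⟩
  exact MemLp.of_bound hf.restrict C (Eventually.of_forall hC)

namespace Sol

variable {Ω : Opens (Space N)} {T : ℝ} {b : ℝ → ℝ} {h : Space N × ℝ → ℝ} {m₀ : ℝ}
  {v : Space N × ℝ → ℝ} {Dv : Space N × ℝ → Space N}

theorem fin (hs : Sol Ω T b h m₀ v Dv) : volume (cyl Ω T : Set (Space N × ℝ)) < ⊤ :=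
  (isBounded_cyl hs.bdd T).measure_lt_top

theorem memLp_comp (hs : Sol Ω T b h m₀ v Dv) {F : ℝ → ℝ} (hF : Continuous F) (h0 : F 0 = 0)
    (p : ℝ≥0∞) : MemLp (fun z => F (v z)) p volume := by
  obtain ⟨M, hM⟩ := hs.bounded
  obtain ⟨C, hC⟩ := (isCompact_Icc (a := -M) (b := M)).exists_bound_of_continuousOn hF.continuousOn
  exact memLp_of_bounded_off (hF.measurable.comp hs.meas).aestronglyMeasurable
    (measurableSet_cyl Ω T) hs.fin (fun z => hC _ (abs_le.mp (hM z)))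
    (fun z hz => by rw [Function.comp_apply, hs.zero_off z hz, h0]) p

/-- The equation, differentiated along time translations of an element of the energy space that
vanishes near the initial and the final time. -/
theorem hasDerivAt_shift (hs : Sol Ω T b h m₀ v Dv) {a c : ℝ} (ha : 0 < a) (hc : c < T)
    {f : Space N × ℝ → ℝ} {Df : Space N × ℝ → Space N}
    (hf : W0 ((Ω : Set (Space N)) ×ˢ Ioo a c) f Df) :
    HasDerivAt (fun s : ℝ => ∫ z, b (v z) * f (z + (0, s)))
      (-((∫ z, h z * f z) - ∫ z, inner ℝ (Dv z) (Df z))) 0 := by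
  obtain ⟨φ, hφ, h1, h2, -⟩ := hf.exists_seq
  have hw : MemLp (fun z => b (v z)) 2 volume := hs.memLp_comp hs.cont hs.zero 2
  have hw1 : Integrable (fun z => b (v z)) volume :=
    memLp_one_iff_integrable.mp (hs.memLp_comp hs.cont hs.zero 1)
  set R := (∫ z, h z * f z) - ∫ z, inner ℝ (Dv z) (Df z) with hR
  have hlimR : Tendsto (fun k => (∫ z, h z * φ k z) - ∫ z, inner ℝ (Dv z) (spaceGrad (φ k) z))
      atTop (𝓝 R) := by
    refine Tendsto.sub ?_ (tendsto_integral_inner hs.mem.memLp_grad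
      (fun k => (hφ k).memLp_grad 2) hf.memLp_grad h2)
    simpa only [real_inner_eq] using tendsto_integral_inner hs.source
      (fun k => (hφ k).memLp 2) hf.memLp h1
  have hlimw : ∀ s : ℝ, Tendsto (fun k => ∫ z, b (v z) * φ k (z + (0, s))) atTop
      (𝓝 (∫ z, b (v z) * f (z + (0, s)))) := by
    intro s
    have := tendsto_integral_inner hw (fun k => memLp_shift ((hφ k).memLp 2) (0, s))
      (memLp_shift hf.memLp (0, s)) (by
        refine h1.congr fun k => ?_
        exact (eLpNorm_comp_measurePreserving (((hφ k).memLp 2).sub hf.memLp).1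
          (measurePreserving_shift (0, s))).symm)
    simpa only [real_inner_eq] using this
  have hn1 : Tendsto (fun k => (eLpNorm (φ k) 2 volume).toReal) atTop
      (𝓝 (eLpNorm f 2 volume).toReal) := by
    have := (Lp.tendsto_Lp_iff_tendsto_eLpNorm'' φ (fun k => (hφ k).memLp 2) f hf.memLp).mpr h1
    simpa [Lp.norm_toLp] using this.norm
  have hn2 : Tendsto (fun k => (eLpNorm (spaceGrad (φ k)) 2 volume).toReal) atTop
      (𝓝 (eLpNorm Df 2 volume).toReal) := by
    have := (Lp.tendsto_Lp_iff_tendsto_eLpNorm'' (fun k => spaceGrad (φ k))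
      (fun k => (hφ k).memLp_grad 2) Df hf.memLp_grad).mpr h2
    simpa [Lp.norm_toLp] using this.norm
  set K := (eLpNorm f 2 volume).toReal + (eLpNorm Df 2 volume).toReal with hK
  have hK0 : 0 ≤ K := by positivity
  rw [hasDerivAt_iff_isLittleO, Asymptotics.isLittleO_iff]
  intro ε hε
  obtain ⟨δ₁, hδ₁, hδ₁'⟩ := exists_shift_close hs.source (ε := ε / (K + 1)) (by positivity)
  obtain ⟨δ₂, hδ₂, hδ₂'⟩ := exists_shift_close hs.mem.memLp_grad (ε := ε / (K + 1)) (by positivity)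
  -- The bounds `a` and `T - c` keep the shifted supports inside the cylinder; `δ₁` and `δ₂` come
  -- from continuity of translations in `L²`.
  have hδ : 0 < min (min δ₁ δ₂) (min a (T - c)) := by
    refine lt_min (lt_min hδ₁ hδ₂) (lt_min ha (by linarith))
  filter_upwards [Metric.ball_mem_nhds (0 : ℝ) hδ] with s hs'
  rw [mem_ball_zero_iff, Real.norm_eq_abs, lt_min_iff, lt_min_iff, lt_min_iff] at hs'
  obtain ⟨⟨hs1, hs2⟩, hs3, hs4⟩ := hs'
  -- For a test function, the mean value theorem and the equation tested with `φₖ(· + ξ)` express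
  -- the increment through `h` and `Dv` shifted by `-ξ`. The shift then falls on fixed `L²`
  -- functions, so the error is `ε|s|` times norms of `φₖ` that converge, and `k → ∞` is allowed for
  -- fixed `s`.
  have key : ∀ k, |((∫ z, b (v z) * φ k (z + (0, s))) - ∫ z, b (v z) * φ k (z + (0, 0))) +
      s * ((∫ z, h z * φ k z) - ∫ z, inner ℝ (Dv z) (spaceGrad (φ k) z))| ≤
      |s| * (ε / (K + 1) * ((eLpNorm (φ k) 2 volume).toReal +
        (eLpNorm (spaceGrad (φ k)) 2 volume).toReal)) := by
    intro k
    obtain ⟨ξ, hξ, hE⟩ := exists_shift_eq hw1 (hφ k) s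
    have hi : ∀ r : ℝ, Integrable (fun z => b (v z) * φ k (z + (0, r))) volume := fun r => by
      simpa only [real_inner_eq] using
        integrable_inner hw (memLp_shift ((hφ k).memLp 2) (0, r))
    have hE' : (∫ z, b (v z) * φ k (z + (0, s))) - ∫ z, b (v z) * φ k (z + (0, 0))
        = s * ∫ z, b (v z) * timeDeriv (φ k) (z + (0, ξ)) := by
      have : ∫ z, b (v z) * (φ k z - φ k (z + (0, s)))
          = (∫ z, b (v z) * φ k (z + (0, 0))) - ∫ z, b (v z) * φ k (z + (0, s)) := by
        rw [← integral_sub (hi 0) (hi s)]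
        congr 1; ext z
        simp [mul_sub, shift_zero]
      linarith
    have htest : IsTest (cyl Ω T) (fun z => φ k (z + (0, ξ))) := by
      refine (hφ k).shift _ fun z hz => ?_
      have h1 := abs_le.mp hξ
      obtain ⟨hz1, hz2, hz3⟩ := hz
      simp only [Prod.fst_add, add_zero, Prod.snd_add] at hz1 hz2 hz3
      refine mem_cyl.mpr ⟨hz1, ?_, ?_⟩ <;> linarith
    have hq := hs.eqn _ htest
    simp only [timeDeriv_shift, spaceGrad_shift] at hq
    have e1 : ∫ z, h z * φ k (z + (0, ξ)) = ∫ z, h (z + (0, -ξ)) * φ k z := by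
      rw [← integral_shift _ ((0, -ξ) : Space N × ℝ)]
      congr 1; ext z; simp [add_assoc, shift_zero]
    have e2 : ∫ z, inner ℝ (Dv z) (spaceGrad (φ k) (z + (0, ξ)))
        = ∫ z, inner ℝ (Dv (z + (0, -ξ))) (spaceGrad (φ k) z) := by
      rw [← integral_shift _ ((0, -ξ) : Space N × ℝ)]
      congr 1; ext z; simp [add_assoc, shift_zero]
    rw [e1, e2] at hq
    have d1 := abs_integral_inner_le ((memLp_shift hs.source (0, -ξ)).sub hs.source)
      ((hφ k).memLp 2)
    have d2 := abs_integral_inner_le ((memLp_shift hs.mem.memLp_grad (0, -ξ)).sub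
      hs.mem.memLp_grad) ((hφ k).memLp_grad 2)
    have d1' : (∫ z, inner ℝ (h (z + (0, -ξ)) - h z) (φ k z))
        = (∫ z, h (z + (0, -ξ)) * φ k z) - ∫ z, h z * φ k z := by
      rw [← integral_sub]
      · congr 1; ext z; simp [mul_sub, mul_comm]
      · simpa only [real_inner_eq] using
          integrable_inner (memLp_shift hs.source (0, -ξ)) ((hφ k).memLp 2)
      · simpa only [real_inner_eq] using integrable_inner hs.source ((hφ k).memLp 2)
    have d2' : (∫ z, inner ℝ (Dv (z + (0, -ξ)) - Dv z) (spaceGrad (φ k) z))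
        = (∫ z, inner ℝ (Dv (z + (0, -ξ))) (spaceGrad (φ k) z)) -
          ∫ z, inner ℝ (Dv z) (spaceGrad (φ k) z) := by
      rw [← integral_sub (integrable_inner (memLp_shift hs.mem.memLp_grad (0, -ξ))
        ((hφ k).memLp_grad 2)) (integrable_inner hs.mem.memLp_grad ((hφ k).memLp_grad 2))]
      congr 1; ext z; simp [inner_sub_left]
    simp only [Pi.sub_apply] at d1 d2
    rw [d1'] at d1
    rw [d2'] at d2
    have c1 := hδ₁' (-ξ) (by rw [abs_neg]; linarith)
    have c2 := hδ₂' (-ξ) (by rw [abs_neg]; linarith)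
    rw [hE', show ∀ x y : ℝ, s * x + s * y = s * (x + y) from fun x y => by ring, abs_mul]
    refine mul_le_mul_of_nonneg_left ?_ (abs_nonneg _)
    rw [mul_add]
    have d1'' := d1.trans (mul_le_mul_of_nonneg_right c1 ENNReal.toReal_nonneg)
    have d2'' := d2.trans (mul_le_mul_of_nonneg_right c2 ENNReal.toReal_nonneg)
    rw [abs_le] at d1'' d2'' ⊢
    constructor <;> linarith [d1''.1, d1''.2, d2''.1, d2''.2]
  have hlim := le_of_tendsto_of_tendsto
    ((((hlimw s).sub (hlimw 0)).add (hlimR.const_mul s)).abs)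
    (((hn1.add hn2).const_mul (ε / (K + 1))).const_mul |s|) (Eventually.of_forall key)
  simp only [sub_zero, smul_eq_mul, Real.norm_eq_abs, mul_neg, sub_neg_eq_add]
  refine hlim.trans ?_
  rw [mul_comm]
  refine mul_le_mul_of_nonneg_right ?_ (abs_nonneg _)
  rw [div_mul_eq_mul_div, div_le_iff₀ (by positivity)]
  rw [← hK]
  nlinarith

/-- The chain rule in time: `B` is a primitive of `ψ` with respect to `b`. -/
theorem time_chain (hs : Sol Ω T b h m₀ v Dv) {ψ B : ℝ → ℝ} (hBc : Continuous B) (hB0 : B 0 = 0)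
    (hB : ∀ r s, (b s - b r) * ψ r ≤ B s - B r)
    {φ : Space N × ℝ → ℝ} (hφ : ContDiff ℝ 1 φ) (hφ0 : ∀ z, 0 ≤ φ z) {C : ℝ}
    (hC : ∀ z, |φ z| ≤ C) (hC' : ∀ z, |timeDeriv φ z| ≤ C) {a c : ℝ} (ha : 0 < a) (hc : c < T)
    {Df : Space N × ℝ → Space N}
    (hf : W0 ((Ω : Set (Space N)) ×ˢ Ioo a c) (fun z => φ z * ψ (v z)) Df) :
    -∫ z, B (v z) * timeDeriv φ z =
      (∫ z, h z * (φ z * ψ (v z))) - ∫ z, inner ℝ (Dv z) (Df z) := by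
  have hBv : Integrable (fun z => B (v z)) volume :=
    memLp_one_iff_integrable.mp (hs.memLp_comp hBc hB0 1)
  have hw : MemLp (fun z => b (v z)) 2 volume := hs.memLp_comp hs.cont hs.zero 2
  have hD := hs.hasDerivAt_shift ha hc hf
  have hE := hasDerivAt_integral_shift hBv hφ hC hC' 0
  -- After a translation the integrand is `φ(z)` times `B(v(z-s)) - b(v(z-s)) ψ(v(z))`. By `hB` this
  -- is smallest at `s = 0`, and `φ ≥ 0` preserves the inequality. Both integrals are differentiable
  -- at `0`, so their derivatives agree there, and this is the chain rule.
  have hmin : IsLocalMin (fun s : ℝ => (∫ z, B (v z) * φ (z + (0, s))) -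
      ∫ z, b (v z) * (φ (z + (0, s)) * ψ (v (z + (0, s))))) 0 := by
    refine Eventually.of_forall fun s => ?_
    have hi1 : ∀ r : ℝ, Integrable (fun z => B (v z) * φ (z + (0, r))) volume := fun r =>
      hBv.mul_bdd (c := C) (Continuous.aestronglyMeasurable (by have := hφ.continuous; fun_prop))
        (Eventually.of_forall fun z => hC _)
    have hi2 : ∀ r : ℝ, Integrable (fun z => b (v z) * (φ (z + (0, r)) * ψ (v (z + (0, r)))))
        volume := fun r => by
      simpa only [real_inner_eq] using integrable_inner hw (memLp_shift hf.memLp (0, r))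
    beta_reduce
    rw [← integral_sub (hi1 0) (hi2 0), ← integral_sub (hi1 s) (hi2 s)]
    have e : ∫ z, (B (v z) * φ (z + (0, s)) - b (v z) * (φ (z + (0, s)) * ψ (v (z + (0, s)))))
        = ∫ z, (B (v (z + (0, -s))) * φ z - b (v (z + (0, -s))) * (φ z * ψ (v z))) := by
      rw [← integral_shift _ ((0, -s) : Space N × ℝ)]
      congr 1; ext z; simp [add_assoc, shift_zero]
    rw [e]
    refine integral_mono ((hi1 0).sub (hi2 0)) ?_ fun z => ?_
    · have := ((hi1 s).sub (hi2 s)).comp_add_right ((0, -s) : Space N × ℝ)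
      simpa [add_assoc, shift_zero] using this
    · have h1 := mul_le_mul_of_nonneg_right (hB (v z) (v (z + (0, -s)))) (hφ0 z)
      simp only [shift_zero]
      linarith
  have h0 := hmin.hasDerivAt_eq_zero (hE.sub hD)
  simp only [shift_zero] at h0
  linarith

end Sol

end EllipticParabolic

namespace EllipticParabolic

variable {N : ℕ}

/-! ### Primitives with respect to `b` -/

/-- The primitive `∫₀ˢ ψ db`, for a function `ψ` with right derivative `ψ'`. -/
noncomputable def prim (b ψ ψ' : ℝ → ℝ) (s : ℝ) : ℝ := ψ s * b s - ∫ x in (0 : ℝ)..s, b x * ψ' x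

section prim

variable {b ψ ψ' : ℝ → ℝ} {L : ℝ}

theorem intervalIntegrable_prim (hb : Continuous b) (hψ : LipRight ψ ψ' L) (r s : ℝ) :
    IntervalIntegrable (fun x => b x * ψ' x) volume r s :=
  (hψ.intervalIntegrable r s).continuousOn_mul hb.continuousOn

theorem continuous_prim (hb : Continuous b) (hψ : LipRight ψ ψ' L) : Continuous (prim b ψ ψ') :=
  (hψ.cont.mul hb).sub
    (intervalIntegral.continuous_primitive (fun r s => intervalIntegrable_prim hb hψ r s) 0)

theorem prim_zero (hb0 : b 0 = 0) : prim b ψ ψ' 0 = 0 := by simp [prim, hb0]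

/-- After integration by parts the difference of the two sides is `∫ᵣˢ (b(s) - b(x)) ψ'(x) dx`,
which is nonnegative for either order of `r` and `s`. No derivative of `b` occurs. This is the
convexity inequality required by `Sol.time_chain`. -/
theorem prim_sub_ge (hb : Continuous b) (hbm : Monotone b) (hψ : LipRight ψ ψ' L)
    (hm : Monotone ψ) (r s : ℝ) : (b s - b r) * ψ r ≤ prim b ψ ψ' s - prim b ψ ψ' r := by
  have hi := intervalIntegrable_prim hb hψ
  have h1 : (∫ x in (0 : ℝ)..s, b x * ψ' x) - ∫ x in (0 : ℝ)..r, b x * ψ' x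
      = ∫ x in r..s, b x * ψ' x :=
    intervalIntegral.integral_interval_sub_left (hi 0 s) (hi 0 r)
  have h2 : ∫ x in r..s, (b s - b x) * ψ' x = b s * (ψ s - ψ r) - ∫ x in r..s, b x * ψ' x := by
    rw [← hψ.integral r s, ← intervalIntegral.integral_const_mul, ← intervalIntegral.integral_sub
      ((hψ.intervalIntegrable r s).const_mul _) (hi r s)]
    congr 1; ext x; ring
  have h3 : 0 ≤ ∫ x in r..s, (b s - b x) * ψ' x := by
    rcases le_total r s with hrs | hrs
    · exact intervalIntegral.integral_nonneg hrs fun x hx =>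
        mul_nonneg (sub_nonneg.mpr (hbm hx.2)) (hψ.deriv_nonneg hm x)
    · rw [intervalIntegral.integral_symm, ← intervalIntegral.integral_neg]
      exact intervalIntegral.integral_nonneg hrs fun x hx => by
        have := mul_nonneg (sub_nonneg.mpr (hbm hx.1)) (hψ.deriv_nonneg hm x)
        linarith
  simp only [prim]
  linarith

theorem prim_nonneg (hb : Continuous b) (hbm : Monotone b) (hb0 : b 0 = 0)
    (hψ : LipRight ψ ψ' L) (hm : Monotone ψ) (h0 : ψ 0 = 0) (s : ℝ) : 0 ≤ prim b ψ ψ' s := by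
  have := prim_sub_ge hb hbm hψ hm 0 s
  rwa [h0, prim_zero hb0, mul_zero, sub_zero] at this

theorem prim_le (hb : Continuous b) (hbm : Monotone b) (hb0 : b 0 = 0)
    (hψ : LipRight ψ ψ' L) (hm : Monotone ψ) (h1 : ∀ s, |ψ s| ≤ 1) (s : ℝ) :
    prim b ψ ψ' s ≤ |b s| := by
  have h := prim_sub_ge hb hbm hψ hm s 0
  rw [hb0, prim_zero hb0] at h
  have h2 : b s * ψ s ≤ |b s| := by
    calc b s * ψ s ≤ |b s * ψ s| := le_abs_self _
      _ = |b s| * |ψ s| := abs_mul _ _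
      _ ≤ |b s| * 1 := by gcongr; exact h1 s
      _ = |b s| := mul_one _
  linarith

end prim

/-! ### Bumps in time -/

/-- A continuous probability density on `[p, q]`. -/
structure IsBump (ρ : ℝ → ℝ) (p q : ℝ) : Prop where
  cont : Continuous ρ
  nonneg : ∀ t, 0 ≤ ρ t
  off : ∀ t, t ∉ Icc p q → ρ t = 0
  int : ∫ t, ρ t = 1

theorem IsBump.integrable {ρ : ℝ → ℝ} {p q : ℝ} (h : IsBump ρ p q) : Integrable ρ volume := by
  by_contra hi
  have := h.int
  rw [integral_undef hi] at this
  simp at this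

theorem isBump_deriv {A : ℝ → ℝ} (hA : ContDiff ℝ ∞ A) (hm : Monotone A) {p q : ℝ} (hpq : p ≤ q)
    (h0 : ∀ t ≤ p, A t = 0) (h1 : ∀ t, q ≤ t → A t = 1) : IsBump (deriv A) p q := by
  have hc : Continuous (deriv A) := hA.continuous_deriv (by simp)
  have hoff : ∀ t, t ∉ Icc p q → deriv A t = 0 := by
    intro t ht
    rw [mem_Icc, not_and_or, not_le, not_le] at ht
    rcases ht with ht | ht
    · have : A =ᶠ[𝓝 t] fun _ => 0 := by
        filter_upwards [Iio_mem_nhds ht] with s hs using h0 s hs.le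
      simp [this.deriv_eq]
    · have : A =ᶠ[𝓝 t] fun _ => 1 := by
        filter_upwards [Ioi_mem_nhds ht] with s hs using h1 s hs.le
      simp [this.deriv_eq]
  refine ⟨hc, fun t => hm.deriv_nonneg, hoff, ?_⟩
  rw [← setIntegral_eq_integral_of_forall_compl_eq_zero (s := Icc p q) hoff,
    integral_Icc_eq_integral_Ioc, ← intervalIntegral.integral_of_le hpq,
    intervalIntegral.integral_deriv_eq_sub (fun x _ => hA.differentiable (by simp) x)
      (hc.intervalIntegrable _ _), h0 p le_rfl, h1 q le_rfl, sub_zero]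

theorem contDiff_smoothTransition_affine (a c : ℝ) :
    ContDiff ℝ ∞ (fun t : ℝ => Real.smoothTransition (a * t + c)) :=
  Real.smoothTransition.contDiff.comp (by fun_prop)

/-- A smooth function increasing from `0` to `1` on `[δ, 2δ]`. -/
noncomputable def ramp (δ t : ℝ) : ℝ := Real.smoothTransition (δ⁻¹ * t + (-1))

/-- A smooth function increasing from `0` to `1` on `[τ, τ + δ]`. -/
noncomputable def ramp' (δ τ t : ℝ) : ℝ := 1 - Real.smoothTransition ((-δ⁻¹) * t + (τ + δ) / δ)

theorem isBump_ramp {δ : ℝ} (hδ : 0 < δ) : IsBump (deriv (ramp δ)) δ (2 * δ) := by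
  refine isBump_deriv (contDiff_smoothTransition_affine _ _) ?_ (by linarith) (fun t ht => ?_)
    fun t ht => ?_
  · intro s t hst
    exact Real.smoothTransition.monotone (by gcongr)
  · refine Real.smoothTransition.zero_of_nonpos ?_
    have : δ⁻¹ * t ≤ 1 := by rw [inv_mul_le_iff₀ hδ]; linarith
    linarith
  · refine Real.smoothTransition.one_of_one_le ?_
    have : 2 ≤ δ⁻¹ * t := by rw [le_inv_mul_iff₀ hδ]; linarith
    linarith

theorem ramp'_zero {δ τ t : ℝ} (hδ : 0 < δ) (h : t ≤ τ) : ramp' δ τ t = 0 := by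
  have : 1 ≤ (-δ⁻¹) * t + (τ + δ) / δ := by
    have : (-δ⁻¹) * t + (τ + δ) / δ = 1 + (τ - t) / δ := by field_simp; ring
    rw [this]
    have := div_nonneg (sub_nonneg.mpr h) hδ.le
    linarith
  rw [ramp', Real.smoothTransition.one_of_one_le this, sub_self]

theorem ramp'_one {δ τ t : ℝ} (hδ : 0 < δ) (h : τ + δ ≤ t) : ramp' δ τ t = 1 := by
  have : (-δ⁻¹) * t + (τ + δ) / δ ≤ 0 := by
    have : (-δ⁻¹) * t + (τ + δ) / δ = -((t - (τ + δ)) / δ) := by field_simp; ring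
    rw [this]
    have := div_nonneg (sub_nonneg.mpr h) hδ.le
    linarith
  rw [ramp', Real.smoothTransition.zero_of_nonpos this, sub_zero]

theorem contDiff_ramp' (δ τ : ℝ) : ContDiff ℝ ∞ (ramp' δ τ) :=
  contDiff_const.sub (contDiff_smoothTransition_affine _ _)

theorem isBump_ramp' {δ : ℝ} (τ : ℝ) (hδ : 0 < δ) : IsBump (deriv (ramp' δ τ)) τ (τ + δ) := by
  refine isBump_deriv (contDiff_ramp' δ τ) ?_ (by linarith)
    (fun t ht => ramp'_zero hδ ht) fun t ht => ramp'_one hδ ht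
  intro s t hst
  refine sub_le_sub_left (Real.smoothTransition.monotone ?_) _
  have : δ⁻¹ * s ≤ δ⁻¹ * t := by gcongr
  linarith

theorem ramp_mem (δ t : ℝ) : 0 ≤ ramp δ t ∧ ramp δ t ≤ 1 :=
  ⟨Real.smoothTransition.nonneg _, Real.smoothTransition.le_one _⟩

theorem ramp'_mem (δ τ t : ℝ) : 0 ≤ ramp' δ τ t ∧ ramp' δ τ t ≤ 1 := by
  have h1 := Real.smoothTransition.nonneg ((-δ⁻¹) * t + (τ + δ) / δ)
  have h2 := Real.smoothTransition.le_one ((-δ⁻¹) * t + (τ + δ) / δ)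
  constructor <;> simp only [ramp'] <;> linarith

theorem ramp_zero {δ t : ℝ} (hδ : 0 < δ) (h : t ≤ δ) : ramp δ t = 0 := by
  refine Real.smoothTransition.zero_of_nonpos ?_
  have : δ⁻¹ * t ≤ 1 := by rw [inv_mul_le_iff₀ hδ]; linarith
  linarith

theorem ramp_one {δ t : ℝ} (hδ : 0 < δ) (h : 2 * δ ≤ t) : ramp δ t = 1 := by
  refine Real.smoothTransition.one_of_one_le ?_
  have : 2 ≤ δ⁻¹ * t := by rw [le_inv_mul_iff₀ hδ]; linarith
  linarith

theorem contDiff_ramp (δ : ℝ) : ContDiff ℝ ∞ (ramp δ) := contDiff_smoothTransition_affine _ _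

theorem W0.ae_zero_off {U : Set (Space N × ℝ)} {u : Space N × ℝ → ℝ} {Du : Space N × ℝ → Space N}
    (h : W0 U u Du) : ∀ᵐ z, z ∉ U → u z = 0 ∧ Du z = 0 := by
  obtain ⟨φ, hφ, -, -, h3, h4⟩ := h.exists_seq
  filter_upwards [h3, h4] with z h3 h4 hz
  refine ⟨tendsto_nhds_unique h3 ?_, tendsto_nhds_unique h4 ?_⟩
  · simp [(hφ _).eq_zero hz]
  · simp [(hφ _).grad_eq_zero hz]

/-! ### Energy and mass estimates -/

namespace Sol

variable {Ω : Opens (Space N)} {T : ℝ} {b : ℝ → ℝ} {h : Space N × ℝ → ℝ} {m₀ : ℝ}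
  {v : Space N × ℝ → ℝ} {Dv : Space N × ℝ → Space N}

/-- Integration of the mass against a bump in time. -/
theorem integral_bump (hs : Sol Ω T b h m₀ v Dv) {c : ℝ → ℝ}
    (hc : ∀ᵐ t, t ∈ Ioo 0 T → ∫ x, |b (v (x, t))| = c t) {ρ : ℝ → ℝ} {p q : ℝ}
    (hρ : IsBump ρ p q) (hp : 0 < p) (hq : q < T) :
    Integrable (fun z => |b (v z)| * ρ z.2) volume ∧
    ∫ z, |b (v z)| * ρ z.2 = ∫ t, ρ t * c t ∧ Integrable (fun t => ρ t * c t) volume := by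
  have hb1 : Integrable (fun z => |b (v z)|) volume :=
    (memLp_one_iff_integrable.mp (hs.memLp_comp hs.cont hs.zero 1)).abs
  have hsupp : HasCompactSupport ρ := HasCompactSupport.intro isCompact_Icc hρ.off
  obtain ⟨C, hC⟩ := hsupp.exists_bound_of_continuous hρ.cont
  have hi : Integrable (fun z : Space N × ℝ => |b (v z)| * ρ z.2) volume :=
    hb1.mul_bdd (c := C) (Continuous.aestronglyMeasurable (by have := hρ.cont; fun_prop))
      (Eventually.of_forall fun z => hC _)
  have hi' : Integrable (fun z : Space N × ℝ => |b (v z)| * ρ z.2)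
    ((volume : Measure (Space N)).prod (volume : Measure ℝ)) := hi
  have heq : (fun t => ∫ x, |b (v (x, t))| * ρ t) =ᵐ[volume] fun t => ρ t * c t := by
    filter_upwards [hc] with t ht
    rw [integral_mul_const, mul_comm]
    by_cases h1 : t ∈ Icc p q
    · rw [ht ⟨by linarith [h1.1], by linarith [h1.2]⟩]
    · rw [hρ.off t h1]; simp
  refine ⟨hi, ?_, ?_⟩
  · rw [Measure.volume_eq_prod, integral_prod_symm _ hi']
    exact integral_congr_ae heq
  · exact hi'.integral_prod_right.congr heq

theorem integral_bump_le (hs : Sol Ω T b h m₀ v Dv) {c : ℝ → ℝ}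
    (hc : ∀ᵐ t, t ∈ Ioo 0 T → ∫ x, |b (v (x, t))| = c t) {ρ : ℝ → ℝ} {p q : ℝ}
    (hρ : IsBump ρ p q) (hp : 0 < p) (hq : q < T) {K : ℝ} (hK : ∀ t ∈ Icc p q, c t ≤ K) :
    ∫ z, |b (v z)| * ρ z.2 ≤ K := by
  obtain ⟨-, h1, h2⟩ := hs.integral_bump hc hρ hp hq
  rw [h1]
  calc ∫ t, ρ t * c t ≤ ∫ t, ρ t * K := by
        refine integral_mono h2 (hρ.integrable.mul_const K) fun t => ?_
        by_cases ht : t ∈ Icc p q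
        · exact mul_le_mul_of_nonneg_left (hK t ht) (hρ.nonneg t)
        · simp [hρ.off t ht]
    _ = K := by rw [integral_mul_const, hρ.int, one_mul]

theorem le_integral_bump (hs : Sol Ω T b h m₀ v Dv) {c : ℝ → ℝ}
    (hc : ∀ᵐ t, t ∈ Ioo 0 T → ∫ x, |b (v (x, t))| = c t) {ρ : ℝ → ℝ} {p q : ℝ}
    (hρ : IsBump ρ p q) (hp : 0 < p) (hq : q < T) {K : ℝ} (hK : ∀ t ∈ Icc p q, K ≤ c t) :
    K ≤ ∫ z, |b (v z)| * ρ z.2 := by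
  obtain ⟨-, h1, h2⟩ := hs.integral_bump hc hρ hp hq
  rw [h1]
  calc K = ∫ t, ρ t * K := by rw [integral_mul_const, hρ.int, one_mul]
    _ ≤ ∫ t, ρ t * c t := by
        refine integral_mono (hρ.integrable.mul_const K) h2 fun t => ?_
        by_cases ht : t ∈ Icc p q
        · exact mul_le_mul_of_nonneg_left (hK t ht) (hρ.nonneg t)
        · simp [hρ.off t ht]

theorem integrable_grad_sq (hs : Sol Ω T b h m₀ v Dv) {g : ℝ → ℝ} (hg : Measurable g) {L : ℝ}
    (hL : ∀ s, |g s| ≤ L) : Integrable (fun z => g (v z) * ‖Dv z‖ ^ 2) volume := by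
  have h1 : Integrable (fun z => ‖Dv z‖ ^ 2) volume := by
    simpa only [real_inner_self_eq_norm_sq] using
      integrable_inner hs.mem.memLp_grad hs.mem.memLp_grad
  exact h1.bdd_mul (c := L) (hg.comp hs.meas).aestronglyMeasurable
    (Eventually.of_forall fun z => hL _)

/-- The energy identity, localised in time. -/
theorem energy_core (hs : Sol Ω T b h m₀ v Dv) {c : ℝ → ℝ}
    (hc : ∀ᵐ t, t ∈ Ioo 0 T → ∫ x, |b (v (x, t))| = c t) {ψ ψ' : ℝ → ℝ} {L : ℝ}
    (hψ : LipRight ψ ψ' L) (hm : Monotone ψ) (h0 : ψ 0 = 0) (h1 : ∀ s, |ψ s| ≤ 1)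
    {δ τ K : ℝ} (hδ : 0 < δ) (hτ : 2 * δ < τ) (hT : τ + δ < T)
    (hK : ∀ t ∈ Icc δ (2 * δ), c t ≤ K) :
    (∫ z, (ramp δ z.2 * (1 - ramp' δ τ z.2)) * (ψ' (v z) * ‖Dv z‖ ^ 2)) +
      ∫ z, prim b ψ ψ' (v z) * deriv (ramp' δ τ) z.2 ≤ (∫ z, |h z|) + K := by
  -- The cutoff rises on `[δ, 2δ]` and falls on `[τ, τ + δ]`. Its derivative is at most the bump
  -- after time zero, which sees the initial mass, minus the bump after `τ`, which sees `∫ B(v(τ))`.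
  set η : ℝ → ℝ := fun t => ramp δ t * (1 - ramp' δ τ t) with hη
  have hηs : ContDiff ℝ ∞ η := (contDiff_ramp δ).mul (contDiff_const.sub (contDiff_ramp' δ τ))
  have hη0 : ∀ t, 0 ≤ η t := fun t =>
    mul_nonneg (ramp_mem δ t).1 (by linarith [(ramp'_mem δ τ t).2])
  have hη1 : ∀ t, η t ≤ 1 := fun t =>
    mul_le_one₀ (ramp_mem δ t).2 (by linarith [(ramp'_mem δ τ t).2])
      (by linarith [(ramp'_mem δ τ t).1])
  have hηabs : ∀ t, |η t| ≤ 1 := fun t => by rw [abs_of_nonneg (hη0 t)]; exact hη1 t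
  have hηoff : ∀ t, t ∉ Icc δ (τ + δ) → η t = 0 := by
    intro t ht
    rw [mem_Icc, not_and_or, not_le, not_le] at ht
    rcases ht with ht | ht
    · simp [hη, ramp_zero hδ ht.le]
    · simp [hη, ramp'_one hδ ht.le]
  have hB1 := isBump_ramp hδ
  have hB2 := isBump_ramp' τ hδ
  have hd : ∀ t, deriv η t = deriv (ramp δ) t * (1 - ramp' δ τ t) - ramp δ t * deriv (ramp' δ τ) t := by
    intro t
    have d1 := ((contDiff_ramp δ).differentiable (by simp) t).hasDerivAt
    have d2 := ((contDiff_ramp' δ τ).differentiable (by simp) t).hasDerivAt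
    rw [(d1.fun_mul (d2.const_sub 1)).deriv]
    ring
  have hd' : ∀ t, deriv η t ≤ deriv (ramp δ) t - deriv (ramp' δ τ) t := by
    intro t
    rw [hd]
    have e1 : deriv (ramp δ) t * (1 - ramp' δ τ t) ≤ deriv (ramp δ) t :=
      mul_le_of_le_one_right (hB1.nonneg t) (by linarith [(ramp'_mem δ τ t).1])
    -- Since `2δ < τ`, the first ramp already equals `1` on the support of the second bump.
    have e2 : ramp δ t * deriv (ramp' δ τ) t = deriv (ramp' δ τ) t := by
      by_cases ht : 2 * δ ≤ t
      · rw [ramp_one hδ ht, one_mul]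
      · rw [hB2.off t (fun h => ht (by linarith [h.1])), mul_zero]
    linarith
  have hηsupp : HasCompactSupport η := HasCompactSupport.intro isCompact_Icc hηoff
  obtain ⟨C', hC'⟩ : ∃ C', ∀ t, |deriv η t| ≤ C' := by
    obtain ⟨C', hC'⟩ := (hηsupp.deriv).exists_bound_of_continuous (hηs.continuous_deriv (by simp))
    exact ⟨C', hC'⟩
  -- the test function
  have hW : W0 ((Ω : Set (Space N)) ×ˢ Ioo (δ / 2) ((τ + δ + T) / 2))
      (fun z => η z.2 * ψ (v z)) (fun z => η z.2 • (ψ' (v z) • Dv z) +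
        ψ (v z) • spaceGrad (fun z : Space N × ℝ => η z.2) z) := by
    refine (hs.mem.comp hψ h0).mul (η := fun z : Space N × ℝ => η z.2) (C := 1)
      (hηs.comp contDiff_snd)
      (fun z => hηabs _) (fun z => by rw [spaceGrad_time]; simp) ?_
    rintro z ⟨hz1, hz2⟩
    have hz3 : z.2 ∈ Icc δ (τ + δ) := by
      have hcl : IsClosed {z : Space N × ℝ | z.2 ∈ Icc δ (τ + δ)} :=
        isClosed_Icc.preimage continuous_snd
      refine closure_minimal ?_ hcl hz1
      intro w hw
      by_contra hcon
      exact hw (hηoff _ hcon)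
    exact ⟨hz2.1, by linarith [hz3.1], by linarith [hz3.2]⟩
  have hchain := hs.time_chain (continuous_prim hs.cont hψ) (prim_zero hs.zero)
    (prim_sub_ge hs.cont hs.mono.monotone hψ hm) (φ := fun z => η z.2) (C := max 1 C')
    ((hηs.comp contDiff_snd).of_le (by norm_cast)) (fun z => hη0 _)
    (fun z => (hηabs _).trans (le_max_left _ _))
    (fun z => (hC' z.2).trans (le_max_right _ _)) (by linarith) (by linarith) hW
  have hgrad : ∀ z, inner ℝ (Dv z) (η z.2 • (ψ' (v z) • Dv z) +
      ψ (v z) • spaceGrad (fun z : Space N × ℝ => η z.2) z) = η z.2 * (ψ' (v z) * ‖Dv z‖ ^ 2) := by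
    intro z
    rw [spaceGrad_time, smul_zero, add_zero, inner_smul_right, inner_smul_right,
      real_inner_self_eq_norm_sq]
  simp only [hgrad, timeDeriv_time] at hchain
  -- bounding the terms
  have hsrc : ∫ z, h z * (η z.2 * ψ (v z)) ≤ ∫ z, |h z| := by
    have hbd : ∀ z : Space N × ℝ, ‖η z.2 * ψ (v z)‖ ≤ 1 := fun z => by
      rw [norm_mul]
      exact mul_le_one₀ (hηabs _) (norm_nonneg _) (h1 _)
    refine integral_mono (hs.source_one.mul_bdd (c := 1) ?_ (Eventually.of_forall hbd))
      hs.source_one.abs fun z => ?_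
    · exact ((hηs.continuous.measurable.comp measurable_snd).mul
        (hψ.cont.measurable.comp hs.meas)).aestronglyMeasurable
    · calc h z * (η z.2 * ψ (v z)) ≤ |h z * (η z.2 * ψ (v z))| := le_abs_self _
        _ = |h z| * ‖η z.2 * ψ (v z)‖ := abs_mul _ _
        _ ≤ |h z| * 1 := by gcongr; exact hbd z
        _ = |h z| := mul_one _
  have hBint : Integrable (fun z => prim b ψ ψ' (v z)) volume :=
    memLp_one_iff_integrable.mp (hs.memLp_comp (continuous_prim hs.cont hψ) (prim_zero hs.zero) 1)
  have hBd : ∀ {ρ : ℝ → ℝ}, Continuous ρ → HasCompactSupport ρ →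
      Integrable (fun z => prim b ψ ψ' (v z) * ρ z.2) volume := by
    intro ρ hρ hρ'
    obtain ⟨C, hC⟩ := hρ'.exists_bound_of_continuous hρ
    exact hBint.mul_bdd (c := C) (Continuous.aestronglyMeasurable (by fun_prop))
      (Eventually.of_forall fun z => hC _)
  have hi1 := hBd (hηs.continuous_deriv (by simp)) hηsupp.deriv
  have hi2 := hBd hB1.cont (HasCompactSupport.intro isCompact_Icc hB1.off)
  have hi3 := hBd hB2.cont (HasCompactSupport.intro isCompact_Icc hB2.off)
  have hle1 : ∫ z, prim b ψ ψ' (v z) * deriv η z.2 ≤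
      (∫ z, prim b ψ ψ' (v z) * deriv (ramp δ) z.2) -
        ∫ z, prim b ψ ψ' (v z) * deriv (ramp' δ τ) z.2 := by
    rw [← integral_sub hi2 hi3]
    refine integral_mono hi1 (hi2.sub hi3) fun z => ?_
    have := mul_le_mul_of_nonneg_left (hd' z.2)
      (prim_nonneg hs.cont hs.mono.monotone hs.zero hψ hm h0 (v z))
    linarith
  have hle2 : ∫ z, prim b ψ ψ' (v z) * deriv (ramp δ) z.2 ≤ K := by
    refine le_trans (integral_mono hi2 (hs.integral_bump hc hB1 hδ (by linarith)).1 fun z => ?_)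
      (hs.integral_bump_le hc hB1 hδ (by linarith) hK)
    exact mul_le_mul_of_nonneg_right
      (prim_le hs.cont hs.mono.monotone hs.zero hψ hm h1 (v z)) (hB1.nonneg _)
  linarith

theorem integrable_ramp_grad (hs : Sol Ω T b h m₀ v Dv) {ψ ψ' : ℝ → ℝ} {L : ℝ}
    (hψ : LipRight ψ ψ' L) (δ τ : ℝ) :
    Integrable (fun z => (ramp δ z.2 * (1 - ramp' δ τ z.2)) * (ψ' (v z) * ‖Dv z‖ ^ 2)) volume := by
  refine (hs.integrable_grad_sq hψ.measurable_deriv hψ.bound).bdd_mul (c := 1)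
    (Continuous.aestronglyMeasurable ?_) (Eventually.of_forall fun z => ?_)
  · have h1 := (contDiff_ramp δ).continuous
    have h2 := (contDiff_ramp' δ τ).continuous
    fun_prop
  · rw [norm_mul, Real.norm_of_nonneg (ramp_mem δ _).1,
      Real.norm_of_nonneg (by linarith [(ramp'_mem δ τ z.2).2])]
    exact mul_le_one₀ (ramp_mem δ _).2 (by linarith [(ramp'_mem δ τ z.2).2])
      (by linarith [(ramp'_mem δ τ z.2).1])

/-- The initial datum enters the estimates through continuity of the mass at `t = 0`. The slack `1`
is harmless, since only bounds uniform in `n` are wanted. -/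
theorem exists_small (hs : Sol Ω T b h m₀ v Dv) {c : ℝ → ℝ} (hc : ContinuousOn c (Ico 0 T))
    (hc0 : c 0 = m₀) : ∃ δ₀ > 0, δ₀ ≤ T ∧ ∀ t, 0 ≤ t → t < δ₀ → c t ≤ m₀ + 1 := by
  have h1 : ContinuousWithinAt c (Ico 0 T) 0 := hc 0 ⟨le_rfl, hs.pos⟩
  obtain ⟨δ, hδ, h2⟩ := Metric.continuousWithinAt_iff.mp h1 1 one_pos
  refine ⟨min δ T, lt_min hδ hs.pos, min_le_right _ _, fun t ht0 ht => ?_⟩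
  have h3 := h2 (x := t) ⟨ht0, ht.trans_le (min_le_right _ _)⟩
    (by rw [Real.dist_eq, sub_zero, abs_of_nonneg ht0]; exact ht.trans_le (min_le_left _ _))
  rw [Real.dist_eq, hc0] at h3
  linarith [(abs_lt.mp h3).2]

/-- The energy estimate. -/
theorem energy (hs : Sol Ω T b h m₀ v Dv) {ψ ψ' : ℝ → ℝ} {L : ℝ}
    (hψ : LipRight ψ ψ' L) (hm : Monotone ψ) (h0 : ψ 0 = 0) (h1 : ∀ s, |ψ s| ≤ 1) :
    ∫ z, ψ' (v z) * ‖Dv z‖ ^ 2 ≤ (∫ z, |h z|) + (m₀ + 1) := by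
  obtain ⟨c, hc1, hc2, hc3⟩ := hs.mass
  obtain ⟨δ₀, hδ₀, hδT, hsmall⟩ := hs.exists_small hc1 hc3
  set δ : ℕ → ℝ := fun j => δ₀ / 8 / ((j : ℝ) + 1) with hδdef
  have hδ : ∀ j, 0 < δ j := fun j => by positivity
  have hδle : ∀ j, δ j ≤ δ₀ / 8 := fun j => div_le_self (by positivity) (by simp)
  have hδlim : Tendsto δ atTop (𝓝 0) := by
    have := tendsto_one_div_add_atTop_nhds_zero_nat.const_mul (δ₀ / 8)
    simpa [hδdef, div_eq_mul_inv] using this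
  -- The cutoffs exhaust `(0, T)` as `δ → 0` with `τ = T - 2δ`; the nonnegative term at time `τ` is
  -- then dropped.
  have hlim : Tendsto (fun j => ∫ z, (ramp (δ j) z.2 * (1 - ramp' (δ j) (T - 2 * δ j) z.2)) *
      (ψ' (v z) * ‖Dv z‖ ^ 2)) atTop (𝓝 (∫ z, ψ' (v z) * ‖Dv z‖ ^ 2)) := by
    refine tendsto_integral_of_dominated_convergence (fun z => |ψ' (v z) * ‖Dv z‖ ^ 2|)
      (fun j => (hs.integrable_ramp_grad hψ _ _).1)
      (hs.integrable_grad_sq hψ.measurable_deriv hψ.bound).abs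
      (fun j => Eventually.of_forall fun z => ?_) ?_
    · rw [norm_mul]
      refine mul_le_of_le_one_left (abs_nonneg _) ?_
      rw [norm_mul, Real.norm_of_nonneg (ramp_mem _ _).1,
        Real.norm_of_nonneg (by linarith [(ramp'_mem (δ j) (T - 2 * δ j) z.2).2])]
      exact mul_le_one₀ (ramp_mem _ _).2 (by linarith [(ramp'_mem (δ j) (T - 2 * δ j) z.2).2])
        (by linarith [(ramp'_mem (δ j) (T - 2 * δ j) z.2).1])
    · filter_upwards [hs.mem.ae_zero_off] with z hz
      by_cases hzc : z ∈ (cyl Ω T : Set (Space N × ℝ))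
      · have e1 : ∀ᶠ j in atTop, 2 * δ j < min z.2 (T - z.2) := by
          have h2 : Tendsto (fun j => 2 * δ j) atTop (𝓝 0) := by simpa using hδlim.const_mul 2
          exact h2.eventually (gt_mem_nhds (lt_min hzc.2.1 (by linarith [hzc.2.2])))
        refine tendsto_const_nhds.congr' ?_
        filter_upwards [e1] with j hj
        rw [lt_min_iff] at hj
        rw [ramp_one (hδ j) hj.1.le, ramp'_zero (hδ j) (by linarith)]
        ring
      · rw [(hz hzc).2]; simp
  refine le_of_tendsto' hlim fun j => ?_
  have hj := hδ j
  have hj' := hδle j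
  have hcore := hs.energy_core hc2 hψ hm h0 h1 (δ := δ j) (τ := T - 2 * δ j) (K := m₀ + 1) hj
    (by linarith) (by linarith) (fun t ht => hsmall t (by linarith [ht.1]) (by linarith [ht.2]))
  have hpos : 0 ≤ ∫ z, prim b ψ ψ' (v z) * deriv (ramp' (δ j) (T - 2 * δ j)) z.2 :=
    integral_nonneg fun z => mul_nonneg
      (prim_nonneg hs.cont hs.mono.monotone hs.zero hψ hm h0 (v z))
      ((isBump_ramp' _ hj).nonneg _)
  linarith

/-- The estimate of the mass, uniformly in time. -/
theorem mass_le (hs : Sol Ω T b h m₀ v Dv) {ψ ψ' : ℝ → ℝ} {L : ℝ}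
    (hψ : LipRight ψ ψ' L) (hm : Monotone ψ) (h0 : ψ 0 = 0) (h1 : ∀ s, |ψ s| ≤ 1) {K₀ : ℝ}
    (hK₀ : ∀ s, |b s| ≤ 2 * prim b ψ ψ' s + K₀) :
    ∀ᵐ t, t ∈ Ioo 0 T → ∫ x, |b (v (x, t))| ≤
      2 * ((∫ z, |h z|) + (m₀ + 1)) + K₀ * (volume (Ω : Set (Space N))).toReal := by
  obtain ⟨c, hc1, hc2, hc3⟩ := hs.mass
  obtain ⟨δ₀, hδ₀, hδT, hsmall⟩ := hs.exists_small hc1 hc3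
  set X := 2 * ((∫ z, |h z|) + (m₀ + 1)) + K₀ * (volume (Ω : Set (Space N))).toReal with hX
  have hK₀' : 0 ≤ K₀ := by
    have := hK₀ 0
    rwa [prim_zero hs.zero, hs.zero, abs_zero, mul_zero, zero_add] at this
  have hΩfin : volume (Ω : Set (Space N)) ≠ ⊤ := hs.bdd.measure_lt_top.ne
  -- If `c τ > X`, continuity keeps `c` above some `Y > X` near `τ`, so a narrow bump after `τ`
  -- averages the mass to at least `Y`. The localised energy identity and `hK₀` bound the same
  -- average by `X`.
  have key : ∀ τ ∈ Ioo 0 T, c τ ≤ X := by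
    intro τ hτ
    by_contra hcon
    push Not at hcon
    have h2 : ContinuousAt c τ := (hc1 τ ⟨hτ.1.le, hτ.2⟩).continuousAt
      (mem_of_superset (Ioo_mem_nhds hτ.1 hτ.2) Ioo_subset_Ico_self)
    obtain ⟨Y, hY1, hY2⟩ := exists_between hcon
    obtain ⟨ε, hε, hball⟩ := Metric.eventually_nhds_iff_ball.mp (h2.eventually (lt_mem_nhds hY2))
    obtain ⟨δ, hδ, hδ'⟩ := exists_between
      (show 0 < min (min (ε / 2) ((T - τ) / 2)) (min (τ / 4) (δ₀ / 4)) from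
        lt_min (lt_min (by linarith) (by linarith [hτ.2])) (lt_min (by linarith [hτ.1])
          (by linarith)))
    rw [lt_min_iff, lt_min_iff, lt_min_iff] at hδ'
    obtain ⟨⟨hd1, hd2⟩, hd3, hd4⟩ := hδ'
    have hB2 := isBump_ramp' τ hδ
    have hcore := hs.energy_core hc2 hψ hm h0 h1 (δ := δ) (τ := τ) (K := m₀ + 1) hδ
      (by linarith [hτ.1]) (by linarith)
      (fun t ht => hsmall t (by linarith [ht.1]) (by linarith [ht.2]))
    have hpos : 0 ≤ ∫ z, (ramp δ z.2 * (1 - ramp' δ τ z.2)) * (ψ' (v z) * ‖Dv z‖ ^ 2) :=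
      integral_nonneg fun z => mul_nonneg (mul_nonneg (ramp_mem _ _).1
        (by linarith [(ramp'_mem δ τ z.2).2])) (mul_nonneg (hψ.deriv_nonneg hm _) (by positivity))
    have hlow := hs.le_integral_bump hc2 hB2 hτ.1 (by linarith) (K := Y) fun t ht =>
      (hball t (by rw [Real.ball_eq_Ioo]; exact ⟨by linarith [ht.1], by linarith [ht.2]⟩)).le
    have hsupp := HasCompactSupport.intro isCompact_Icc hB2.off
    obtain ⟨C, hC⟩ := hsupp.exists_bound_of_continuous hB2.cont
    have hmeasρ : AEStronglyMeasurable (fun z : Space N × ℝ => deriv (ramp' δ τ) z.2) volume :=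
      Continuous.aestronglyMeasurable (by have := hB2.cont; fun_prop)
    have hi1 : Integrable (fun z => prim b ψ ψ' (v z) * deriv (ramp' δ τ) z.2) volume :=
      (memLp_one_iff_integrable.mp (hs.memLp_comp (continuous_prim hs.cont hψ)
        (prim_zero hs.zero) 1)).mul_bdd (c := C) hmeasρ (Eventually.of_forall fun z => hC _)
    have hprod : Integrable (fun z : Space N × ℝ =>
        (Ω : Set (Space N)).indicator (fun _ => K₀) z.1 * deriv (ramp' δ τ) z.2) volume := by
      refine Integrable.mul_prod (f := (Ω : Set (Space N)).indicator (fun _ => K₀))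
        (g := deriv (ramp' δ τ)) ?_ hB2.integrable
      exact (integrable_indicator_iff Ω.isOpen.measurableSet).mpr
        (integrableOn_const hΩfin)
    have hup : ∫ z, |b (v z)| * deriv (ramp' δ τ) z.2 ≤
        2 * (∫ z, prim b ψ ψ' (v z) * deriv (ramp' δ τ) z.2) +
          K₀ * (volume (Ω : Set (Space N))).toReal := by
      have e1 : ∫ z : Space N × ℝ, (Ω : Set (Space N)).indicator (fun _ => K₀) z.1 *
          deriv (ramp' δ τ) z.2 = K₀ * (volume (Ω : Set (Space N))).toReal := by
        rw [Measure.volume_eq_prod, integral_prod_mul, hB2.int, mul_one,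
          integral_indicator Ω.isOpen.measurableSet]
        simp [Measure.real, mul_comm]
      rw [← e1, ← integral_const_mul, ← integral_add (hi1.const_mul 2) hprod]
      refine integral_mono (hs.integral_bump hc2 hB2 hτ.1 (by linarith)).1
        ((hi1.const_mul 2).add hprod) fun z => ?_
      have hρ0 := hB2.nonneg z.2
      by_cases hz : z.1 ∈ (Ω : Set (Space N))
      · simp only [hz, indicator_of_mem]
        have := mul_le_mul_of_nonneg_right (hK₀ (v z)) hρ0
        linarith
      · have hv0 : v z = 0 := hs.zero_off z fun h => hz h.1
        simp [hz, hv0, hs.zero, prim_zero hs.zero]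
    rw [hX] at hY1
    linarith
  filter_upwards [hc2] with t ht htT
  rw [ht htT]
  exact key t htT

end Sol

end EllipticParabolic

namespace EllipticParabolic

variable {N : ℕ}

/-! ### Uniform `L¹` bounds from weak-* convergence -/

/-- Duality between `L¹` and continuous functions vanishing off `U`: the sign of `h` is approximated
in `L¹` by continuous functions, truncated to `[-1, 1]` and cut off by `min 1 (j · dist(z, Uᶜ))`,
which tends to `1` on `U`. Approximation in `L¹` suffices because `h` is essentially bounded. -/
theorem integral_abs_le_of_pairing {X : Type*} [MetricSpace X] [MeasurableSpace X] [BorelSpace X]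
    [WeaklyLocallyCompactSpace X] {μ : Measure X} [IsFiniteMeasure μ]
    [μ.Regular] {U : Set X} (hU : IsOpen U)
    (hUc : Uᶜ.Nonempty) (hμ : ∀ᵐ z ∂μ, z ∈ U) {h : X → ℝ} (hh : MemLp h ⊤ μ) {C : ℝ}
    (hC : ∀ φ : X → ℝ, Continuous φ → (∀ z, z ∉ U → φ z = 0) → (∀ z, |φ z| ≤ 1) →
      |∫ z, h z * φ z ∂μ| ≤ C) : ∫ z, |h z| ∂μ ≤ C := by
  obtain ⟨M, hM⟩ : ∃ M : ℝ, ∀ᵐ z ∂μ, |h z| ≤ M := by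
    refine ⟨(eLpNorm h ⊤ μ).toReal, ?_⟩
    have := ae_le_eLpNormEssSup (f := h) (μ := μ)
    filter_upwards [this] with z hz
    rw [← eLpNorm_exponent_top] at hz
    have h2 := ENNReal.toReal_mono hh.2.ne hz
    simpa using h2
  have hM0 : 0 ≤ |M| := abs_nonneg M
  have hMM : ∀ᵐ z ∂μ, |h z| ≤ |M| := hM.mono fun z hz => hz.trans (le_abs_self M)
  have hint : Integrable h μ := memLp_one_iff_integrable.mp (hh.mono_exponent le_top)
  set h' := hint.1.mk h with hh'
  have hh'm : StronglyMeasurable h' := hint.1.stronglyMeasurable_mk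
  have hheq : h =ᵐ[μ] h' := hint.1.ae_eq_mk
  set f : X → ℝ := fun z => (SignType.sign (h' z) : ℝ) with hf
  have hfm : Measurable f := by
    have h1 : f = fun z => if 0 < h' z then (1 : ℝ) else if h' z < 0 then -1 else 0 := by
      ext z
      simp only [hf, sign_apply]
      split_ifs <;> simp
    rw [h1]
    exact Measurable.ite (measurableSet_lt measurable_const hh'm.measurable) measurable_const
      (Measurable.ite (measurableSet_lt hh'm.measurable measurable_const) measurable_const
        measurable_const)
  have hf1 : ∀ z, |f z| ≤ 1 := fun z => by
    rcases lt_trichotomy (h' z) 0 with h | h | h <;> simp [hf, h]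
  have hfi : Integrable f μ := Integrable.of_bound hfm.aestronglyMeasurable 1
    (Eventually.of_forall hf1)
  have habs : ∫ z, |h z| ∂μ = ∫ z, h z * f z ∂μ := by
    refine integral_congr_ae (hheq.mono fun z hz => ?_)
    simp only [hf, hz]
    rw [mul_comm]
    exact (sign_mul_self _).symm
  rw [habs]
  refine le_of_forall_pos_le_add fun ε hε => ?_
  obtain ⟨g, -, hgi, hgc, hg1⟩ := hfi.exists_hasCompactSupport_integral_sub_le
    (ε := ε / (|M| + 1)) (by positivity)
  set G : X → ℝ := fun z => max (-1) (min 1 (g z)) with hG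
  have hGc : Continuous G := by fun_prop
  have hG1 : ∀ z, |G z| ≤ 1 := fun z => abs_le.mpr ⟨le_max_left _ _, max_le (by norm_num)
    (min_le_left _ _)⟩
  have hfG : ∀ z, |f z - G z| ≤ |f z - g z| := by
    intro z
    have h1 := abs_le.mp (hf1 z)
    simp only [hG]
    rcases le_total 1 (g z) with h2 | h2
    · rw [min_eq_left h2, max_eq_right (by norm_num), abs_sub_comm, abs_sub_comm (f z),
        abs_of_nonneg (by linarith), abs_of_nonneg (by linarith)]
      linarith
    · rw [min_eq_right h2]
      rcases le_total (-1) (g z) with h3 | h3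
      · rw [max_eq_right h3]
      · rw [max_eq_left h3, abs_of_nonneg (by linarith), abs_of_nonneg (by linarith)]
        linarith
  have hGi : Integrable G μ := Integrable.of_bound hGc.aestronglyMeasurable 1
    (Eventually.of_forall hG1)
  have hlim : Tendsto (fun j : ℕ => ∫ z, h z * (G z * min 1 (j * Metric.infDist z Uᶜ)) ∂μ) atTop
      (𝓝 (∫ z, h z * G z ∂μ)) := by
    refine tendsto_integral_of_dominated_convergence (fun z => |h z|)
      (fun j => hint.1.mul (Continuous.aestronglyMeasurable ?_)) hint.abs
      (fun j => Eventually.of_forall fun z => ?_) ?_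
    · have := Metric.continuous_infDist_pt Uᶜ
      fun_prop
    · rw [norm_mul, norm_mul]
      refine mul_le_of_le_one_right (norm_nonneg _) (mul_le_one₀ (hG1 z) (norm_nonneg _) ?_)
      rw [Real.norm_of_nonneg (le_min zero_le_one (by positivity [Metric.infDist_nonneg (x := z) (s := Uᶜ)]))]
      exact min_le_left _ _
    · filter_upwards [hμ] with z hz
      have hpos : 0 < Metric.infDist z Uᶜ :=
        (hU.isClosed_compl.notMem_iff_infDist_pos hUc).mp (by simpa using hz)
      have h2 : Tendsto (fun j : ℕ => (j : ℝ) * Metric.infDist z Uᶜ) atTop atTop :=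
        tendsto_natCast_atTop_atTop.atTop_mul_const hpos
      refine tendsto_const_nhds.congr' ?_
      filter_upwards [h2.eventually_ge_atTop 1] with j hj
      rw [min_eq_left hj, mul_one]
  have hle : ∫ z, h z * G z ∂μ ≤ C := by
    refine le_of_tendsto' hlim fun j => (le_abs_self _).trans (hC _ ?_ (fun z hz => ?_)
      fun z => ?_)
    · have := Metric.continuous_infDist_pt Uᶜ
      fun_prop
    · rw [Metric.infDist_zero_of_mem (by simpa using hz)]
      simp
    · rw [abs_mul]
      refine mul_le_one₀ (hG1 z) (abs_nonneg _) ?_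
      rw [abs_of_nonneg (le_min zero_le_one (mul_nonneg (Nat.cast_nonneg _) Metric.infDist_nonneg))]
      exact min_le_left _ _
  have hdiff : ∫ z, h z * f z ∂μ - ∫ z, h z * G z ∂μ ≤ ε := by
    have hi1 : Integrable (fun z => h z * f z) μ :=
      hint.mul_bdd (c := 1) hfm.aestronglyMeasurable (Eventually.of_forall hf1)
    have hi2 : Integrable (fun z => h z * G z) μ :=
      hint.mul_bdd (c := 1) hGc.aestronglyMeasurable (Eventually.of_forall hG1)
    rw [← integral_sub hi1 hi2]
    calc ∫ z, (h z * f z - h z * G z) ∂μ ≤ ∫ z, |M| * ‖f z - g z‖ ∂μ := by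
          refine integral_mono_ae (hi1.sub hi2) ?_ ?_
          · exact (hfi.sub hg1).norm.const_mul _
          · filter_upwards [hMM] with z hz
            calc h z * f z - h z * G z ≤ |h z * f z - h z * G z| := le_abs_self _
              _ = |h z| * |f z - G z| := by rw [← mul_sub, abs_mul]
              _ ≤ |M| * ‖f z - g z‖ := mul_le_mul hz (hfG z) (abs_nonneg _) hM0
      _ = |M| * ∫ z, ‖f z - g z‖ ∂μ := integral_const_mul _ _
      _ ≤ |M| * (ε / (|M| + 1)) := by gcongr
      _ ≤ ε := by
          rw [mul_div_assoc', div_le_iff₀ (by positivity)]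
          nlinarith
  linarith

/-- Uniform boundedness on a closed subspace. -/
theorem exists_bound_on_submodule {E : Type*} [NormedAddCommGroup E] [NormedSpace ℝ E]
    [CompleteSpace E] {V : Submodule ℝ E} (hV : IsClosed (V : Set E)) {g : ℕ → E →L[ℝ] ℝ}
    (h : ∀ x ∈ V, ∃ C, ∀ n, ‖g n x‖ ≤ C) : ∃ C, ∀ n, ∀ x ∈ V, ‖g n x‖ ≤ C * ‖x‖ := by
  have : CompleteSpace V := hV.completeSpace_coe
  obtain ⟨C, hC⟩ := banach_steinhaus (g := fun n => (g n).comp V.subtypeL) fun x => h x.1 x.2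
  exact ⟨C, fun n x hx => (((g n).comp V.subtypeL).le_opNorm ⟨x, hx⟩).trans
    (mul_le_mul_of_nonneg_right (hC n) (norm_nonneg _))⟩

/-- Convergent sequences are bounded, so Banach–Steinhaus applies on the closed subspace of bounded
continuous functions vanishing off `U`. -/
theorem exists_bound_of_pairing_tendsto {X : Type*} [TopologicalSpace X] [MeasurableSpace X]
    [OpensMeasurableSpace X] {μ : Measure X} [IsFiniteMeasure μ] {U : Set X}
    {h : ℕ → X → ℝ} (hh : ∀ n, Integrable (h n) μ)
    (hlim : ∀ φ : BoundedContinuousFunction X ℝ, (∀ z, z ∉ U → φ z = 0) →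
      ∃ l, Tendsto (fun n => ∫ z, h n z * φ z ∂μ) atTop (𝓝 l)) :
    ∃ C, ∀ n, ∀ φ : BoundedContinuousFunction X ℝ, (∀ z, z ∉ U → φ z = 0) → (∀ z, |φ z| ≤ 1) →
      |∫ z, h n z * φ z ∂μ| ≤ C := by
  have hi : ∀ n, ∀ φ : BoundedContinuousFunction X ℝ, Integrable (fun z => h n z * φ z) μ :=
    fun n φ => (hh n).mul_bdd (c := ‖φ‖) φ.continuous.aestronglyMeasurable
      (Eventually.of_forall fun z => φ.norm_coe_le_norm z)
  let ℓ : ℕ → BoundedContinuousFunction X ℝ →ₗ[ℝ] ℝ := fun n =>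
    { toFun := fun φ => ∫ z, h n z * φ z ∂μ
      map_add' := fun φ ψ => by
        rw [← integral_add (hi n φ) (hi n ψ)]
        congr 1; ext z; simp [mul_add]
      map_smul' := fun c φ => by
        simp only [RingHom.id_apply, smul_eq_mul]
        rw [← integral_const_mul]
        congr 1; ext z; simp; ring }
  have hℓ : ∀ n φ, ‖ℓ n φ‖ ≤ (∫ z, |h n z| ∂μ) * ‖φ‖ := by
    intro n φ
    rw [← integral_mul_const]
    refine (norm_integral_le_integral_norm _).trans (integral_mono_of_nonneg
      (Eventually.of_forall fun z => norm_nonneg _) ((hh n).abs.mul_const _)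
      (Eventually.of_forall fun z => ?_))
    simp only [norm_mul]
    exact mul_le_mul_of_nonneg_left (φ.norm_coe_le_norm z) (norm_nonneg _)
  let V : Submodule ℝ (BoundedContinuousFunction X ℝ) :=
    { carrier := {φ | ∀ z, z ∉ U → φ z = 0}
      add_mem' := fun {a b} ha hb z hz => by simp [ha z hz, hb z hz]
      zero_mem' := fun z _ => rfl
      smul_mem' := fun c {a} ha z hz => by simp [ha z hz] }
  have hV : IsClosed (V : Set (BoundedContinuousFunction X ℝ)) := by
    have : (V : Set (BoundedContinuousFunction X ℝ)) = ⋂ z ∈ Uᶜ, {φ | φ z = 0} := by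
      ext φ
      simp only [mem_iInter, mem_compl_iff, mem_ofPred_eq]
      exact Iff.rfl
    rw [this]
    refine isClosed_biInter fun z _ => isClosed_eq ?_ continuous_const
    exact (BoundedContinuousFunction.evalCLM ℝ z).continuous
  obtain ⟨C, hC⟩ := exists_bound_on_submodule hV (g := fun n => (ℓ n).mkContinuous _ (hℓ n))
    (fun φ hφ => by
      obtain ⟨l, hl⟩ := hlim φ hφ
      obtain ⟨K, hK⟩ := hl.norm.bddAbove_range
      exact ⟨K, fun n => hK (mem_range_self n)⟩)
  refine ⟨|C|, fun n φ hφ h1 => (hC n φ hφ).trans ?_⟩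
  have hnorm : ‖φ‖ ≤ 1 := (BoundedContinuousFunction.norm_le zero_le_one).mpr h1
  calc C * ‖φ‖ ≤ |C| * 1 := mul_le_mul (le_abs_self C) hnorm (norm_nonneg _) (abs_nonneg C)
    _ = |C| := mul_one _

theorem WeakStarConv.exists_bound {Ω : Opens (Space N)}
    (hΩ : Bornology.IsBounded (Ω : Set (Space N))) {T : ℝ} {h : ℕ → Space N × ℝ → ℝ}
    {μ : SignedMeasure (Space N × ℝ)} (hh : ∀ n, MemLp (h n) ⊤ (cylMeasure Ω T))
    (hhμ : WeakStarConv Ω T h μ) : ∃ C, ∀ n, ∫ z, |h n z| ∂(cylMeasure Ω T) ≤ C := by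
  have hfin : IsFiniteMeasure (cylMeasure Ω T) :=
    ⟨by simpa [cylMeasure] using (isBounded_cyl hΩ T).measure_lt_top⟩
  obtain ⟨C, hC⟩ := exists_bound_of_pairing_tendsto (μ := cylMeasure Ω T)
    (U := (cyl Ω T : Set (Space N × ℝ))) (h := h)
    (fun n => memLp_one_iff_integrable.mp ((hh n).mono_exponent le_top))
    (fun φ hφ => ⟨_, hhμ φ φ.continuous hφ⟩)
  refine ⟨C, fun n => integral_abs_le_of_pairing (cyl Ω T).isOpen ?_ ?_ (hh n)
    fun φ hφ hφ0 hφ1 => ?_⟩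
  · exact ⟨(0, 0), fun h => lt_irrefl _ h.2.1⟩
  · exact ae_restrict_mem (measurableSet_cyl Ω T)
  · exact hC n (BoundedContinuousFunction.ofNormedAddCommGroup φ hφ 1 hφ1) hφ0 hφ1

end EllipticParabolic

namespace EllipticParabolic

variable {N : ℕ}

/-! ### Passing between the frozen definitions and functions extended by zero -/

/-- A test function on the cylinder, bundled. -/
def IsTest.toTestFunction {Ω : Opens (Space N)} {T : ℝ} {φ : Space N × ℝ → ℝ}
    (hφ : IsTest (cyl Ω T) φ) : 𝓓(cyl Ω T, ℝ) :=
  ⟨φ, hφ.smooth, hφ.compact, hφ.supp⟩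

theorem IsTest.of_testFunction {Ω : Opens (Space N)} {T : ℝ} (φ : 𝓓(cyl Ω T, ℝ)) :
    IsTest (cyl Ω T) φ :=
  ⟨φ.contDiff, φ.hasCompactSupport, φ.tsupport_subset⟩

theorem testPair_add {Ω : Opens (Space N)} {T : ℝ} (p : ℝ≥0∞) (φ ψ : 𝓓(cyl Ω T, ℝ)) :
    testPair p φ + testPair p ψ = testPair p (φ + ψ) := by
  refine Prod.ext ?_ ?_
  · simp only [testPair, Prod.fst_add, ← MemLp.toLp_add]
    rfl
  · simp only [testPair, Prod.snd_add, ← MemLp.toLp_add]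
    congr 1
    ext1 z
    exact (spaceGrad_add (IsTest.of_testFunction φ).differentiable
      (IsTest.of_testFunction ψ).differentiable z).symm

theorem testPair_smul {Ω : Opens (Space N)} {T : ℝ} (p : ℝ≥0∞) (c : ℝ) (φ : 𝓓(cyl Ω T, ℝ)) :
    c • testPair p φ = testPair p (c • φ) := by
  refine Prod.ext ?_ ?_
  · simp only [testPair, Prod.smul_fst, ← MemLp.toLp_const_smul]
    rfl
  · simp only [testPair, Prod.smul_snd, ← MemLp.toLp_const_smul]
    congr 1
    ext1 z
    exact (spaceGrad_const_mul c (IsTest.of_testFunction φ).differentiable z).symm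

/-- Test functions already form a vector space, so the span adds nothing and elements of `LpW0` are
limits of single test functions. -/
theorem exists_testPair_of_mem_span {Ω : Opens (Space N)} {T : ℝ} {p : ℝ≥0∞}
    [Fact (1 ≤ p)] {w : Lp ℝ p (cylMeasure Ω T) × Lp (Space N) p (cylMeasure Ω T)}
    (hw : w ∈ Submodule.span ℝ (range (testPair p))) :
    ∃ φ : 𝓓(cyl Ω T, ℝ), testPair p φ = w := by
  induction hw using Submodule.span_induction with
  | mem x hx => exact hx
  | zero => exact ⟨0, by simpa using (testPair_smul p (0 : ℝ) (0 : 𝓓(cyl Ω T, ℝ))).symm⟩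
  | add x y _ _ hx hy =>
    obtain ⟨φ, rfl⟩ := hx
    obtain ⟨ψ, rfl⟩ := hy
    exact ⟨φ + ψ, (testPair_add p φ ψ).symm⟩
  | smul c x _ hx =>
    obtain ⟨φ, rfl⟩ := hx
    exact ⟨c • φ, (testPair_smul p c φ).symm⟩

theorem integral_cylMeasure {F : Type*} [NormedAddCommGroup F] [NormedSpace ℝ F]
    {Ω : Opens (Space N)} {T : ℝ}
    {f : Space N × ℝ → F} (hf : ∀ z, z ∉ (cyl Ω T : Set (Space N × ℝ)) → f z = 0) :
    ∫ z, f z ∂(cylMeasure Ω T) = ∫ z, f z :=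
  setIntegral_eq_integral_of_forall_compl_eq_zero hf

theorem ae_cylMeasure {Ω : Opens (Space N)} {T : ℝ} {p : Space N × ℝ → Prop} :
    (∀ᵐ z ∂(cylMeasure Ω T), p z) ↔ ∀ᵐ z, z ∈ (cyl Ω T : Set (Space N × ℝ)) → p z :=
  ae_restrict_iff' (measurableSet_cyl Ω T)

theorem LpW0.toW0 {Ω : Opens (Space N)} {T : ℝ} (V : LpW0 2 Ω T) :
    W0 (cyl Ω T) ((cyl Ω T : Set (Space N × ℝ)).indicator V.1.1)
      ((cyl Ω T : Set (Space N × ℝ)).indicator V.1.2) := by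
  have hm := measurableSet_cyl Ω T
  have hind : ∀ {F : Type} [NormedAddCommGroup F] {f g : Space N × ℝ → F},
      (∀ z, z ∉ (cyl Ω T : Set (Space N × ℝ)) → f z = 0) →
      eLpNorm (f - (cyl Ω T : Set (Space N × ℝ)).indicator g) 2 volume =
        eLpNorm (f - g) 2 (cylMeasure Ω T) := by
    intro F _ f g hf
    rw [cylMeasure, ← eLpNorm_indicator_eq_eLpNorm_restrict hm]
    congr 1
    ext z
    by_cases hz : z ∈ (cyl Ω T : Set (Space N × ℝ))
    · simp [hz]
    · simp [hz, hf z hz]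
  refine ⟨((Lp.stronglyMeasurable V.1.1).indicator hm).aestronglyMeasurable,
    ((Lp.stronglyMeasurable V.1.2).indicator hm).aestronglyMeasurable, fun ε hε => ?_⟩
  have hcl : V.1 ∈ closure ((Submodule.span ℝ (range (testPair (Ω := Ω) (T := T) 2)) :
      Submodule ℝ (Lp ℝ 2 (cylMeasure Ω T) × Lp (Space N) 2 (cylMeasure Ω T))) :
      Set (Lp ℝ 2 (cylMeasure Ω T) × Lp (Space N) 2 (cylMeasure Ω T))) := V.2
  obtain ⟨w, hw, hw'⟩ := EMetric.mem_closure_iff.mp hcl ε hε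
  obtain ⟨φ, rfl⟩ := exists_testPair_of_mem_span hw
  rw [edist_comm, Prod.edist_eq, max_lt_iff] at hw'
  have hφ := IsTest.of_testFunction φ
  refine ⟨φ, hφ, ?_, ?_⟩
  · rw [hind fun z hz => hφ.eq_zero hz]
    refine le_trans (le_of_eq ?_) hw'.1.le
    rw [Lp.edist_def]
    exact eLpNorm_congr_ae ((memLp_testFunction 2 φ).coeFn_toLp.symm.sub EventuallyEq.rfl)
  · rw [hind fun z hz => hφ.grad_eq_zero hz]
    refine le_trans (le_of_eq ?_) hw'.2.le
    rw [Lp.edist_def]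
    exact eLpNorm_congr_ae ((memLp_spaceGrad 2 φ).coeFn_toLp.symm.sub EventuallyEq.rfl)

theorem W0.exists_LpW0 {Ω : Opens (Space N)} {T : ℝ} {u : Space N × ℝ → ℝ}
    {Du : Space N × ℝ → Space N} (h : W0 (cyl Ω T) u Du) :
    ∃ W : LpW0 2 Ω T, (W.1.1 : Space N × ℝ → ℝ) =ᵐ[cylMeasure Ω T] u ∧
      ‖W‖ ≤ max (eLpNorm u 2 volume).toReal (eLpNorm Du 2 volume).toReal := by
  have hu : MemLp u 2 (cylMeasure Ω T) := h.memLp.restrict _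
  have hDu : MemLp Du 2 (cylMeasure Ω T) := h.memLp_grad.restrict _
  refine ⟨⟨(hu.toLp u, hDu.toLp Du), ?_⟩, hu.coeFn_toLp, ?_⟩
  · refine EMetric.mem_closure_iff.mpr fun ε hε => ?_
    obtain ⟨δ, hδ, hδε⟩ := exists_between hε
    obtain ⟨φ, hφ, h1, h2⟩ := h.approx δ hδ
    refine ⟨testPair 2 hφ.toTestFunction, Submodule.subset_span ⟨_, rfl⟩, ?_⟩
    rw [edist_comm, Prod.edist_eq]
    refine lt_of_le_of_lt (max_le ?_ ?_) hδε
    · simp only [testPair]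
      rw [Lp.edist_toLp_toLp]
      exact (eLpNorm_mono_measure _ Measure.restrict_le_self).trans h1
    · simp only [testPair]
      rw [Lp.edist_toLp_toLp]
      exact (eLpNorm_mono_measure _ Measure.restrict_le_self).trans h2
  · rw [Submodule.coe_norm, Prod.norm_def]
    refine max_le_max ?_ ?_
    · rw [Lp.norm_toLp]
      exact ENNReal.toReal_mono h.memLp.2.ne (eLpNorm_mono_measure _ Measure.restrict_le_self)
    · rw [Lp.norm_toLp]
      exact ENNReal.toReal_mono h.memLp_grad.2.ne (eLpNorm_mono_measure _ Measure.restrict_le_self)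

/-- Almost every time slice of an almost everywhere property. -/
theorem ae_slice {p : Space N × ℝ → Prop} (h : ∀ᵐ z, p z) : ∀ᵐ t : ℝ, ∀ᵐ x : Space N, p (x, t) := by
  have h1 : ∀ᵐ w ∂((volume : Measure ℝ).prod (volume : Measure (Space N))), p w.swap :=
    (Measure.measurePreserving_swap (μ := (volume : Measure ℝ))
      (ν := (volume : Measure (Space N)))).quasiMeasurePreserving.ae h
  exact Measure.ae_ae_of_ae_prod h1

/-- The representative is cut off at the essential bound and set to zero outside the cylinder.
Boundedness, vanishing and measurability then hold everywhere, so compositions and time slices can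
be handled pointwise. Continuity in time is needed with `q = 1` only. -/
theorem IsWeakSolution.exists_sol {Ω : Opens (Space N)}
    (hΩ : Bornology.IsBounded (Ω : Set (Space N))) {T : ℝ} (hT : 0 < T) {b : ℝ → ℝ}
    (hb : Continuous b) (hbm : StrictMono b) (hb0 : b 0 = 0) {h : Space N × ℝ → ℝ}
    {g : Space N → ℝ} (hh : MemLp h ⊤ (cylMeasure Ω T)) {v : Space N × ℝ → ℝ}
    {Dv : Space N × ℝ → Space N} (hv : IsWeakSolution Ω T b h g v Dv) :
    ∃ (u : Space N × ℝ → ℝ) (Du : Space N × ℝ → Space N),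
      Sol Ω T b ((cyl Ω T : Set (Space N × ℝ)).indicator h)
        (eLpNorm g 1 (volume.restrict (Ω : Set (Space N)))).toReal u Du ∧
      u =ᵐ[cylMeasure Ω T] v ∧ Du =ᵐ[cylMeasure Ω T] Dv := by
  obtain ⟨V, hV1, hV2⟩ := hv.mem_energy
  obtain ⟨M, hM⟩ := hv.bounded
  obtain ⟨ξ, hξ1, hξ2⟩ := hv.equation
  have : Fact ((1 : ℝ≥0∞) ≤ 1) := ⟨le_rfl⟩
  obtain ⟨B, hB1, hB2, hB3⟩ := hv.continuous_in_time 1 ENNReal.one_ne_top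
  set S : Set (Space N × ℝ) := (cyl Ω T : Set (Space N × ℝ)) with hS
  have hSm : MeasurableSet S := measurableSet_cyl Ω T
  have hfin : IsFiniteMeasure (cylMeasure Ω T) :=
    ⟨by simpa [cylMeasure] using (isBounded_cyl hΩ T).measure_lt_top⟩
  have hcut : Continuous (fun s : ℝ => max (-|M|) (min |M| s)) := by fun_prop
  -- The bound `|M|` replaces `M` because nothing says that `M` is nonnegative when the cylinder is
  -- null.
  set u : Space N × ℝ → ℝ := S.indicator fun z => max (-|M|) (min |M| (V.1.1 z)) with hu
  have huv : u =ᵐ[cylMeasure Ω T] v := by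
    filter_upwards [hV1, hM, ae_restrict_mem hSm] with z h1 h2 h3
    have h4 := abs_le.mp (h2.trans (le_abs_self M))
    have h3' : z ∈ S := h3
    show S.indicator _ z = v z
    rw [indicator_of_mem h3', h1, min_eq_right h4.2, max_eq_right h4.1]
  have huV : S.indicator V.1.1 =ᵐ[volume] u := by
    have h1 := ae_cylMeasure.mp (huv.trans hV1.symm)
    filter_upwards [h1] with z hz
    by_cases hzS : z ∈ S
    · rw [hz hzS, indicator_of_mem hzS]
    · simp [hu, hzS]
  have hMem : MemLp h 2 (cylMeasure Ω T) := hh.mono_exponent le_top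
  refine ⟨u, S.indicator V.1.2, ?_, huv, ?_⟩
  swap
  · filter_upwards [hV2, ae_restrict_mem hSm] with z h1 h2
    rw [indicator_of_mem h2, h1]
  refine ⟨hb, hbm, hb0, hT, hΩ,
    (hcut.measurable.comp (Lp.stronglyMeasurable V.1.1).measurable).indicator hSm,
    fun z hz => by simp [hu, hS, hz], ⟨|M|, fun z => ?_⟩,
    (memLp_indicator_iff_restrict hSm).mpr hMem,
    (memLp_one_iff_integrable.mp ((memLp_indicator_iff_restrict hSm).mpr
      (hh.mono_exponent le_top))), (LpW0.toW0 V).congr huV EventuallyEq.rfl, fun φ hφ => ?_, ?_⟩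
  · by_cases hz : z ∈ S
    · simp only [hu, indicator_of_mem hz]
      exact abs_le.mpr ⟨le_max_left _ _, max_le (by linarith [abs_nonneg M]) (min_le_left _ _)⟩
    · simp [hu, hz]
  · have h1 := hξ1 hφ.toTestFunction
    have h2 := hξ2 (testElt 2 hφ.toTestFunction)
    have e1 : (((testElt 2 hφ.toTestFunction : LpW0 2 Ω T).1.1 : Space N × ℝ → ℝ))
        =ᵐ[cylMeasure Ω T] φ := (memLp_testFunction 2 hφ.toTestFunction).coeFn_toLp
    have e2 : (((testElt 2 hφ.toTestFunction : LpW0 2 Ω T).1.2 : Space N × ℝ → Space N))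
        =ᵐ[cylMeasure Ω T] spaceGrad φ := (memLp_spaceGrad 2 hφ.toTestFunction).coeFn_toLp
    rw [h1, distTimeDeriv] at h2
    have i1 : ∫ z, b (v z) * timeDeriv (hφ.toTestFunction) z ∂(cylMeasure Ω T)
        = ∫ z, b (u z) * timeDeriv φ z := by
      rw [← integral_cylMeasure (Ω := Ω) (T := T)]
      · refine integral_congr_ae (huv.mono fun z hz => ?_)
        simp only [hz]; rfl
      · intro z hz
        have : u z = 0 := by simp only [hu]; exact indicator_of_notMem hz _
        rw [this, hb0, zero_mul]
    have i2 : ∫ z, inner ℝ (Dv z) ((testElt 2 hφ.toTestFunction : LpW0 2 Ω T).1.2 z)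
        ∂(cylMeasure Ω T) = ∫ z, inner ℝ (S.indicator V.1.2 z) (spaceGrad φ z) := by
      rw [← integral_cylMeasure (Ω := Ω) (T := T)]
      · refine integral_congr_ae ?_
        filter_upwards [hV2, e2, ae_restrict_mem hSm] with z h3 h4 h5
        rw [h4, indicator_of_mem h5, h3]
      · intro z hz
        rw [hφ.grad_eq_zero hz, inner_zero_right]
    have i3 : ∫ z, h z * (testElt 2 hφ.toTestFunction : LpW0 2 Ω T).1.1 z
        ∂(cylMeasure Ω T) = ∫ z, S.indicator h z * φ z := by
      rw [← integral_cylMeasure (Ω := Ω) (T := T)]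
      · refine integral_congr_ae ?_
        filter_upwards [e1, ae_restrict_mem hSm] with z h4 h5
        rw [h4, indicator_of_mem h5]
      · intro z hz
        rw [hφ.eq_zero hz, mul_zero]
    rw [i1, i2, i3] at h2
    linarith
  · refine ⟨fun t => ‖B t‖, hB1.norm, ?_, ?_⟩
    · have h1 := ae_slice (ae_cylMeasure.mp huv)
      have h2 := (ae_restrict_iff' measurableSet_Ioo).mp hB2
      filter_upwards [h1, h2] with t h1 h2 ht
      rw [L1.norm_eq_integral_norm]
      rw [← setIntegral_eq_integral_of_forall_compl_eq_zero (s := (Ω : Set (Space N)))]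
      · refine integral_congr_ae ?_
        have h3 := (ae_restrict_of_ae (s := (Ω : Set (Space N))) h1)
        filter_upwards [h2 ht, h3, ae_restrict_mem Ω.isOpen.measurableSet] with x h4 h5 h6
        rw [h4, h5 ⟨h6, ht⟩, Real.norm_eq_abs]
      · intro x hx
        have : u (x, t) = 0 := by
          simp only [hu]; exact indicator_of_notMem (fun h => hx h.1) _
        rw [this, hb0, abs_zero]
    · beta_reduce
      rw [Lp.norm_def, eLpNorm_congr_ae hB3]

end EllipticParabolic

/-! ### Test nonlinearities and weighted energy estimates -/

namespace EllipticParabolic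
variable {N : ℕ}

/-- The odd extension of a function given on `[0, ∞)`. -/
noncomputable def oddExt (P : ℝ → ℝ) (s : ℝ) : ℝ := if 0 ≤ s then P s else -P (-s)

theorem abs_oddExt_le {P : ℝ → ℝ} {C : ℝ} (h : ∀ s, 0 ≤ s → |P s| ≤ C) (s : ℝ) :
    |oddExt P s| ≤ C := by
  rw [oddExt]
  split_ifs with hs
  · exact h s hs
  · rw [abs_neg]
    exact h _ (by linarith)

namespace LipRight

variable {P p ψ ψ' : ℝ → ℝ} {L : ℝ}

theorem monotone_of_nonneg (h : LipRight ψ ψ' L) (h0 : ∀ s, 0 ≤ ψ' s) : Monotone ψ := by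
  intro r s hrs
  have := intervalIntegral.integral_nonneg (μ := volume) hrs fun x _ => h0 x
  rw [h.integral] at this
  linarith

theorem oddExt (hP : ∀ s, 0 ≤ s → HasDerivAt P (p s) s) (h0 : P 0 = 0)
    (hL : ∀ s, 0 ≤ s → |p s| ≤ L) : LipRight (oddExt P) (fun s => p |s|) L := by
  have hneg : ∀ s : ℝ, s ≤ 0 → EllipticParabolic.oddExt P s = -P (-s) := by
    intro s hs
    rw [EllipticParabolic.oddExt]
    split_ifs with h
    · have : s = 0 := le_antisymm hs h
      simp [this, h0]
    · rfl
  have hpos : ∀ s : ℝ, 0 ≤ s → EllipticParabolic.oddExt P s = P s := fun s hs => if_pos hs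
  have hn : ∀ s : ℝ, s ≤ 0 → HasDerivAt (fun s => -P (-s)) (p (-s)) s := by
    intro s hs
    have := ((hP (-s) (by linarith)).comp s (hasDerivAt_neg s)).neg
    exact this.congr_deriv (by ring)
  have hr : ∀ s, 0 ≤ s → HasDerivWithinAt (EllipticParabolic.oddExt P) (p |s|) (Ici s) s := by
    intro s hs
    rw [abs_of_nonneg hs]
    exact (hP s hs).hasDerivWithinAt.congr (fun y hy => hpos y (hs.trans hy)) (hpos s hs)
  have hl : ∀ s, s < 0 → HasDerivAt (EllipticParabolic.oddExt P) (p |s|) s := by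
    intro s hs
    rw [abs_of_neg hs]
    exact (hn s hs.le).congr_of_eventuallyEq
      ((eventually_lt_nhds hs).mono fun y hy => hneg y hy.le)
  refine ⟨continuous_iff_continuousAt.mpr fun s => ?_, fun s => ?_, fun s => hL _ (abs_nonneg s)⟩
  · rcases lt_trichotomy s 0 with hs | hs | hs
    · exact (hl s hs).continuousAt
    · subst hs
      refine continuousAt_iff_continuous_left_right.mpr ⟨?_, (hr 0 le_rfl).continuousWithinAt⟩
      exact (hn 0 le_rfl).continuousAt.continuousWithinAt.congr (fun y hy => hneg y hy)
        (hneg 0 le_rfl)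
    · exact ((hP s hs.le).continuousAt).congr
        ((eventually_gt_nhds hs).mono fun y hy => (hpos y hy.le).symm)
  · rcases lt_or_ge s 0 with hs | hs
    · exact (hl s hs).hasDerivWithinAt
    · exact (hr s hs).mono Ioi_subset_Ici_self

theorem evenExt (hP : ∀ s, 0 ≤ s → HasDerivAt P (p s) s)
    (hL : ∀ s, 0 ≤ s → |p s| ≤ L) :
    LipRight (fun s => P |s|) (fun s => if 0 ≤ s then p |s| else -p |s|) L := by
  refine ⟨continuous_iff_continuousAt.mpr fun s => ?_, fun s => ?_, fun s => ?_⟩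
  · exact ContinuousAt.comp (f := fun s => |s|) (hP |s| (abs_nonneg s)).continuousAt
      continuous_abs.continuousAt
  · split_ifs with hs
    · rw [abs_of_nonneg hs]
      exact (hP s hs).hasDerivWithinAt.congr
        (fun y hy => by rw [abs_of_nonneg (hs.trans (le_of_lt hy))]) (by rw [abs_of_nonneg hs])
    · push Not at hs
      rw [abs_of_neg hs]
      have h1 : HasDerivAt (fun s => P (-s)) (-p (-s)) s := by
        exact ((hP (-s) (by linarith)).comp s (hasDerivAt_neg s)).congr_deriv (by ring)
      exact (h1.congr_of_eventuallyEq ((eventually_lt_nhds hs).mono fun y hy => by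
        show P |y| = P (-y)
        rw [abs_of_neg hy])).hasDerivWithinAt
  · split_ifs with hs
    · exact hL _ (abs_nonneg s)
    · rw [abs_neg]
      exact hL _ (abs_nonneg s)

/-- A test nonlinearity adapted to the scale `k`: its derivative is at least `1/(4k)` where `|s| <
k`. The case `k = 1` also serves the mass bound and the renormalisation. -/
theorem frac {k : ℝ} (hk : 0 < k) :
    LipRight (EllipticParabolic.oddExt fun s => s / (k + s)) (fun s => k / (k + |s|) ^ 2) (1 / k) := by
  refine LipRight.oddExt (P := fun s => s / (k + s)) (p := fun s => k / (k + s) ^ 2)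
    (fun s hs => ?_) (by simp) fun s hs => ?_
  · have h1 : k + s ≠ 0 := by positivity
    have := (hasDerivAt_id s).div ((hasDerivAt_id s).const_add k) h1
    refine this.congr_deriv ?_
    simp
  · rw [abs_of_nonneg (by positivity), div_le_div_iff₀ (by positivity) hk]
    nlinarith

/-- A bounded nonlinearity whose derivative is, up to the factor `α`, the weight of the weighted
gradient estimate. -/
theorem pow_neg {α : ℝ} (hα : 0 < α) :
    LipRight (EllipticParabolic.oddExt fun s => 1 - (1 + s) ^ (-α))
      (fun s => α / (1 + |s|) ^ (α + 1)) α := by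
  refine LipRight.oddExt (P := fun s => 1 - (1 + s) ^ (-α)) (p := fun s => α / (1 + s) ^ (α + 1))
    (fun s hs => ?_) (by simp) fun s hs => ?_
  · have h1 : 0 < 1 + s := by positivity
    have := (((hasDerivAt_id s).const_add 1).rpow_const (p := -α) (Or.inl h1.ne')).const_sub 1
    refine this.congr_deriv ?_
    rw [show -α - 1 = -(α + 1) by ring, id, Real.rpow_neg h1.le]
    field_simp
  · rw [abs_of_nonneg (by positivity), div_le_iff₀ (by positivity)]
    have : 1 ≤ (1 + s) ^ (α + 1) := Real.one_le_rpow (by linarith) (by linarith)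
    nlinarith

end LipRight

variable {Ω : Opens (Space N)} {T m₀ : ℝ} {b : ℝ → ℝ} {h v : Space N × ℝ → ℝ}
  {Dv : Space N × ℝ → Space N}

theorem abs_oddExt_frac_le {k : ℝ} (hk : 0 < k) (s : ℝ) :
    |oddExt (fun s => s / (k + s)) s| ≤ 1 := by
  refine abs_oddExt_le (fun s hs => ?_) s
  rw [abs_of_nonneg (by positivity), div_le_one (by positivity)]
  linarith

namespace Sol

/-- Sublevel energy estimate. -/
theorem integral_grad_sq_sublevel_le (hs : Sol Ω T b h m₀ v Dv) {k : ℝ} (hk : 0 < k) :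
    ∫ z, (if |v z| < k then ‖Dv z‖ ^ 2 else 0) ≤ 4 * k * ((∫ z, |h z|) + (m₀ + 1)) := by
  have hL := LipRight.frac hk
  have hm := hL.monotone_of_nonneg fun s => by positivity
  have h1 := hs.energy hL hm (by simp [oddExt]) (abs_oddExt_frac_le hk)
  have hint : Integrable (fun z => k / (k + |v z|) ^ 2 * ‖Dv z‖ ^ 2) volume :=
    hs.integrable_grad_sq hL.measurable_deriv hL.bound
  have h2 : ∫ z, (if |v z| < k then ‖Dv z‖ ^ 2 else 0) ≤
      ∫ z, 4 * k * (k / (k + |v z|) ^ 2 * ‖Dv z‖ ^ 2) := by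
    refine integral_mono_of_nonneg (Eventually.of_forall fun z => ?_) (hint.const_mul _)
      (Eventually.of_forall fun z => ?_)
    · simp only [Pi.zero_apply]; split_ifs <;> positivity
    · dsimp only
      split_ifs with hz
      · have : 1 ≤ 4 * k * (k / (k + |v z|) ^ 2) := by
          rw [← mul_div_assoc, le_div_iff₀ (by positivity)]
          nlinarith [abs_nonneg (v z)]
        nlinarith [sq_nonneg ‖Dv z‖]
      · positivity
  rw [integral_const_mul] at h2
  exact h2.trans (mul_le_mul_of_nonneg_left h1 (by positivity))

theorem integrable_weighted (hs : Sol Ω T b h m₀ v Dv) {α : ℝ} (hα : 0 < α) :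
    Integrable (fun z => ‖Dv z‖ ^ 2 / (1 + |v z|) ^ (α + 1)) volume := by
  have hL := LipRight.pow_neg hα
  refine ((hs.integrable_grad_sq hL.measurable_deriv hL.bound).const_mul α⁻¹).congr
    (Eventually.of_forall fun z => ?_)
  dsimp only
  field_simp

theorem integral_weighted_le (hs : Sol Ω T b h m₀ v Dv) {α : ℝ} (hα : 0 < α) :
    ∫ z, ‖Dv z‖ ^ 2 / (1 + |v z|) ^ (α + 1) ≤ α⁻¹ * ((∫ z, |h z|) + (m₀ + 1)) := by
  have hL := LipRight.pow_neg hα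
  have hm := hL.monotone_of_nonneg fun s => by positivity
  have h1 := hs.energy hL hm (by simp [oddExt]) (abs_oddExt_le fun s hs => by
    have h1 : (1 + s) ^ (-α) ≤ 1 := Real.rpow_le_one_of_one_le_of_nonpos (by linarith) (by linarith)
    have h2 : 0 ≤ (1 + s) ^ (-α) := by positivity
    rw [abs_le]
    constructor <;> linarith)
  refine le_trans (le_of_eq ?_) (mul_le_mul_of_nonneg_left h1 (by positivity))
  rw [← integral_const_mul]
  congr 1
  ext z
  field_simp

/-- For `ψ(s) = s/(1+|s|)` one has `ψ(±1) = ±1/2`. The convexity inequality based at `1` and at `-1`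
therefore gives `|b| ≤ 2B + b(1) - b(-1)`, the comparison required by `Sol.mass_le`. -/
theorem mass_bound (hs : Sol Ω T b h m₀ v Dv) :
    ∀ᵐ t, t ∈ Ioo 0 T → ∫ x, |b (v (x, t))| ≤
      2 * ((∫ z, |h z|) + (m₀ + 1)) + (b 1 - b (-1)) * (volume (Ω : Set (Space N))).toReal := by
  have hL := LipRight.frac one_pos
  have hm := hL.monotone_of_nonneg fun s => by positivity
  have h0 : oddExt (fun s : ℝ => s / (1 + s)) 0 = 0 := by simp [oddExt]
  refine hs.mass_le hL hm h0 (abs_oddExt_frac_le one_pos) fun s => ?_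
  have hp := prim_nonneg hs.cont hs.mono.monotone hs.zero hL hm h0
  have hge := prim_sub_ge hs.cont hs.mono.monotone hL hm
  have e1 : oddExt (fun s : ℝ => s / (1 + s)) 1 = 1 / 2 := by norm_num [oddExt]
  have e2 : oddExt (fun s : ℝ => s / (1 + s)) (-1) = -(1 / 2) := by norm_num [oddExt]
  have b1 : 0 ≤ b 1 := hs.zero ▸ hs.mono.monotone zero_le_one
  have b2 : b (-1) ≤ 0 := hs.zero ▸ hs.mono.monotone (by norm_num : (-1 : ℝ) ≤ 0)
  have g1 := hge 1 s
  have g2 := hge (-1) s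
  rw [e1] at g1
  rw [e2] at g2
  have p1 := hp 1
  have p2 := hp (-1)
  have p3 := hp s
  rw [abs_le]
  constructor <;> linarith

end Sol

/-! ### Spatial translations and the Poincaré inequality -/

/-- Translation in space is controlled by the spatial gradient. -/
theorem IsTest.eLpNorm_space_shift_sub_le {U : Set (Space N × ℝ)} {φ : Space N × ℝ → ℝ}
    (hφ : IsTest U φ) (y : Space N) :
    eLpNorm (fun z => φ (z + (y, 0)) - φ z) 2 volume ≤ ‖y‖ₑ * eLpNorm (spaceGrad φ) 2 volume := by
  have hg := hφ.continuous_grad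
  -- Fundamental theorem of calculus along the segment from `z` to `z + (y, 0)`, then Jensen's
  -- inequality on the unit interval; integration in `z` uses translation invariance.
  have hpt : ∀ z : Space N × ℝ, ‖φ (z + (y, 0)) - φ z‖ₑ ^ (2 : ℝ) ≤
      ‖y‖ₑ ^ (2 : ℝ) * ∫⁻ r in Ioc (0 : ℝ) 1, ‖spaceGrad φ (z + (r • y, 0))‖ₑ ^ (2 : ℝ) := by
    intro z
    have hd : ∀ r : ℝ, HasDerivAt (fun r : ℝ => φ (z + (r • y, 0)))
        (inner ℝ (spaceGrad φ (z + (r • y, 0))) y) r := by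
      intro r
      rw [inner_spaceGrad (hφ.differentiable _)]
      have h1 : HasDerivAt (fun r : ℝ => z + (r • y, (0 : ℝ))) (y, 0) r := by
        have h2 : HasDerivAt (fun r : ℝ => r • y) y r := by
          simpa using (hasDerivAt_id r).smul_const y
        exact (h2.prodMk (hasDerivAt_const r (0 : ℝ))).const_add z
      exact (hφ.differentiable _).hasFDerivAt.comp_hasDerivAt r h1
    have hcont : Continuous fun r : ℝ => spaceGrad φ (z + (r • y, 0)) := by fun_prop
    have h1 := intervalIntegral.integral_eq_sub_of_hasDerivAt (a := 0) (b := 1)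
      (fun r _ => hd r) ((hcont.inner continuous_const).intervalIntegrable 0 1)
    simp only [one_smul, zero_smul, shift_zero] at h1
    rw [← h1, intervalIntegral.integral_of_le zero_le_one]
    have h2 : ‖∫ r in Ioc (0 : ℝ) 1, inner ℝ (spaceGrad φ (z + (r • y, 0))) y‖ₑ ≤
        ‖y‖ₑ * ∫⁻ r in Ioc (0 : ℝ) 1, ‖spaceGrad φ (z + (r • y, 0))‖ₑ := by
      refine (enorm_integral_le_lintegral_enorm _).trans ?_
      rw [← lintegral_const_mul _ hcont.enorm.measurable]
      refine lintegral_mono fun r => ?_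
      rw [← ofReal_norm, ← ofReal_norm, ← ofReal_norm, ← ENNReal.ofReal_mul (norm_nonneg _),
        mul_comm]
      exact ENNReal.ofReal_le_ofReal (norm_inner_le_norm _ _)
    refine (ENNReal.rpow_le_rpow h2 zero_le_two).trans ?_
    rw [ENNReal.mul_rpow_of_nonneg _ _ zero_le_two]
    gcongr
    have : IsProbabilityMeasure (volume.restrict (Ioc (0 : ℝ) 1)) := ⟨by simp⟩
    have h3 := eLpNorm_le_eLpNorm_of_exponent_le (μ := volume.restrict (Ioc (0 : ℝ) 1))
      (p := 1) (q := 2) (by norm_num) hcont.aestronglyMeasurable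
    rw [eLpNorm_one_eq_lintegral_enorm, eLpNorm_eq_lintegral_rpow_enorm_toReal (by simp)
      (by simp)] at h3
    have h4 := ENNReal.rpow_le_rpow h3 (zero_le_two (α := ℝ))
    rw [← ENNReal.rpow_mul] at h4
    simpa using h4
  have hsq : ∫⁻ z, ‖φ (z + (y, 0)) - φ z‖ₑ ^ (2 : ℝ) ≤
      ‖y‖ₑ ^ (2 : ℝ) * ∫⁻ z, ‖spaceGrad φ z‖ₑ ^ (2 : ℝ) := by
    refine (lintegral_mono hpt).trans ?_
    have hm : Measurable (Function.uncurry fun (z : Space N × ℝ) (r : ℝ) =>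
        ‖spaceGrad φ (z + (r • y, 0))‖ₑ ^ (2 : ℝ)) := by
      have : Continuous (Function.uncurry fun (z : Space N × ℝ) (r : ℝ) =>
        spaceGrad φ (z + (r • y, 0))) := by
        unfold Function.uncurry
        fun_prop
      exact this.enorm.measurable.pow_const _
    rw [lintegral_const_mul' _ _ (by simp)]
    refine mul_le_mul_right ?_ _
    rw [lintegral_lintegral_swap hm.aemeasurable]
    have : ∀ r : ℝ, ∫⁻ z, ‖spaceGrad φ (z + (r • y, 0))‖ₑ ^ (2 : ℝ) =
        ∫⁻ z, ‖spaceGrad φ z‖ₑ ^ (2 : ℝ) := fun r =>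
      (measurePreserving_shift (r • y, (0 : ℝ))).lintegral_comp
        (hg.enorm.measurable.pow_const _)
    refine (lintegral_congr this).trans_le ?_
    simp
  rw [eLpNorm_eq_lintegral_rpow_enorm_toReal (by simp) (by simp),
    eLpNorm_eq_lintegral_rpow_enorm_toReal (by simp) (by simp)]
  refine (ENNReal.rpow_le_rpow (by simpa using hsq) (by positivity)).trans (le_of_eq ?_)
  rw [ENNReal.mul_rpow_of_nonneg _ _ (by positivity), ← ENNReal.rpow_natCast, ← ENNReal.rpow_mul]
  norm_num

theorem W0.eLpNorm_space_shift_sub_le {U : Set (Space N × ℝ)} {u : Space N × ℝ → ℝ}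
    {Du : Space N × ℝ → Space N} (hu : W0 U u Du) (y : Space N) :
    eLpNorm (fun z => u (z + (y, 0)) - u z) 2 volume ≤ ‖y‖ₑ * eLpNorm Du 2 volume := by
  obtain ⟨φ, hφ, h1, h2, -, -⟩ := hu.exists_seq
  have hsh := measurePreserving_shift (N := N) (y, 0)
  have hb : ∀ k, eLpNorm (fun z => u (z + (y, 0)) - u z) 2 volume ≤
      ‖y‖ₑ * (eLpNorm (spaceGrad (φ k) - Du) 2 volume + eLpNorm Du 2 volume) +
        2 * eLpNorm (φ k - u) 2 volume := by
    intro k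
    have m1 : AEStronglyMeasurable (φ k - u) volume :=
      (hφ k).continuous.aestronglyMeasurable.sub hu.meas
    have m2 : AEStronglyMeasurable (fun z => (φ k - u) (z + (y, 0))) volume :=
      m1.comp_measurePreserving hsh
    have m3 : AEStronglyMeasurable (fun z => φ k (z + (y, 0)) - φ k z) volume := by
      have := (hφ k).continuous
      exact Continuous.aestronglyMeasurable (by fun_prop)
    have e1 : (fun z => u (z + (y, 0)) - u z) =
        ((fun z => φ k (z + (y, 0)) - φ k z) + (φ k - u)) -
          fun z => (φ k - u) (z + (y, 0)) := by
      ext z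
      simp only [Pi.add_apply, Pi.sub_apply]
      ring
    have e2 : eLpNorm (fun z => (φ k - u) (z + (y, 0))) 2 volume = eLpNorm (φ k - u) 2 volume :=
      eLpNorm_comp_measurePreserving m1 hsh
    have e3 : eLpNorm (spaceGrad (φ k)) 2 volume ≤
        eLpNorm (spaceGrad (φ k) - Du) 2 volume + eLpNorm Du 2 volume := by
      have := eLpNorm_add_le (p := 2)
        ((hφ k).continuous_grad.aestronglyMeasurable.sub hu.meas_grad) hu.meas_grad (by norm_num)
      simpa using this
    rw [e1]
    refine (eLpNorm_sub_le (m3.add m1) m2 (by norm_num)).trans ?_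
    rw [e2, two_mul, ← add_assoc]
    gcongr
    refine (eLpNorm_add_le m3 m1 (by norm_num)).trans ?_
    gcongr
    exact ((hφ k).eLpNorm_space_shift_sub_le y).trans (by gcongr)
  have hlim : Tendsto (fun k => ‖y‖ₑ * (eLpNorm (spaceGrad (φ k) - Du) 2 volume +
      eLpNorm Du 2 volume) + 2 * eLpNorm (φ k - u) 2 volume) atTop
      (𝓝 (‖y‖ₑ * (0 + eLpNorm Du 2 volume) + 2 * 0)) := by
    refine Tendsto.add (ENNReal.Tendsto.const_mul (h2.add tendsto_const_nhds) (Or.inr (by simp)))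
      (ENNReal.Tendsto.const_mul h1 (Or.inr (by simp)))
  simp only [zero_add, mul_zero, add_zero] at hlim
  exact ge_of_tendsto' hlim hb

/-- **Poincaré inequality** on a bounded cylinder. -/
theorem exists_poincare (hN : 1 ≤ N) (hΩ : Bornology.IsBounded (Ω : Set (Space N))) (T : ℝ) :
    ∃ C : ℝ, ∀ (u : Space N × ℝ → ℝ) (Du : Space N × ℝ → Space N), W0 (cyl Ω T) u Du →
      (∀ z, z ∉ cyl Ω T → u z = 0) →
      eLpNorm u 2 volume ≤ ENNReal.ofReal C * eLpNorm Du 2 volume := by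
  obtain ⟨R, hR⟩ := hΩ.subset_closedBall 0
  have : Nontrivial (Space N) := by
    have : Nonempty (Fin N) := ⟨⟨0, hN⟩⟩
    infer_instance
  -- A shift longer than the diameter of a ball containing `Ω` moves every point of `Ω` out of it,
  -- so on the cylinder the translation difference is `-u`. Such a vector exists because `N ≥ 1`.
  obtain ⟨y, hy⟩ := exists_norm_eq (Space N) (c := 2 * |R| + 1) (by positivity)
  refine ⟨‖y‖, fun u Du hu h0 => ?_⟩
  rw [ofReal_norm]
  refine le_trans (eLpNorm_mono fun z => ?_) (hu.eLpNorm_space_shift_sub_le y)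
  by_cases hz : z ∈ cyl Ω T
  · rw [h0 (z + (y, 0)) fun hzy => ?_]
    · simp
    · have h1 := hR (mem_cyl.mp hz).1
      have h2 := hR (mem_cyl.mp hzy).1
      rw [mem_closedBall_zero_iff] at h1 h2
      have h3 : ‖y‖ ≤ ‖z.1 + y‖ + ‖z.1‖ := by
        simpa using norm_sub_le (z.1 + y) z.1
      have h4 : ‖z.1 + y‖ ≤ R := h2
      linarith [le_abs_self R]
  · rw [h0 z hz]
    simp

end EllipticParabolic

/-! ### Powers of the solution, mass on slices and weighted gradients -/

namespace EllipticParabolic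
variable {N : ℕ}

theorem eLpNorm_two_toReal {α F : Type*} [MeasurableSpace α] {μ : Measure α}
    [NormedAddCommGroup F] {f : α → F} (hf : MemLp f 2 μ) :
    (eLpNorm f 2 μ).toReal = √(∫ z, ‖f z‖ ^ 2 ∂μ) := by
  rw [hf.eLpNorm_eq_integral_rpow_norm (by simp) (by simp), ENNReal.toReal_ofReal (by positivity),
    Real.sqrt_eq_rpow]
  norm_num

variable {Ω : Opens (Space N)} {T m₀ : ℝ} {b : ℝ → ℝ} {h v : Space N × ℝ → ℝ}
  {Dv : Space N × ℝ → Space N}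

theorem LipRight.one_add_rpow {β : ℝ} (hβ : β < 1) :
    LipRight (fun s => (|s| + 1) ^ β - 1)
      (fun s => if 0 ≤ s then β * (|s| + 1) ^ (β - 1) else -(β * (|s| + 1) ^ (β - 1))) |β| := by
  refine LipRight.evenExt (P := fun s => (s + 1) ^ β - 1) (p := fun s => β * (s + 1) ^ (β - 1))
    (fun s hs => ?_) fun s hs => ?_
  · have h1 : 0 < s + 1 := by positivity
    have := (((hasDerivAt_id s).add_const 1).rpow_const (p := β) (Or.inl h1.ne')).sub_const 1
    exact this.congr_deriv (by simp)
  · rw [abs_mul]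
    refine mul_le_of_le_one_right (abs_nonneg _) ?_
    rw [abs_of_nonneg (by positivity)]
    exact Real.rpow_le_one_of_one_le_of_nonpos (by linarith) (by linarith)

/-- The squared gradient of `(|v|+1)^β - 1` is `β²|∇v|²/(1+|v|)^(2-2β)`, controlled by the weighted
estimate with `α = 1 - 2β`; this is positive precisely for `β < 1/2`. The Poincaré inequality
controls the function itself. -/
theorem Sol.exists_LpW0_rpow (hs : Sol Ω T b h m₀ v Dv) {β : ℝ}
    (hβ' : β < 1 / 2) {K : ℝ} (hK : (∫ z, |h z|) + (m₀ + 1) ≤ K) {P : ℝ} (hP : 0 ≤ P)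
    (hPoin : ∀ (u : Space N × ℝ → ℝ) (Du : Space N × ℝ → Space N), W0 (cyl Ω T) u Du →
      (∀ z, z ∉ cyl Ω T → u z = 0) →
      eLpNorm u 2 volume ≤ ENNReal.ofReal P * eLpNorm Du 2 volume) :
    ∃ W : LpW0 2 Ω T, ((W.1.1 : Space N × ℝ → ℝ) =ᵐ[cylMeasure Ω T]
      fun z => (|v z| + 1) ^ β - 1) ∧
      ‖W‖ ≤ (P + 1) * √(β ^ 2 * ((1 - 2 * β)⁻¹ * K)) := by
  have hW := hs.mem.comp (LipRight.one_add_rpow (by linarith : β < 1)) (by simp)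
  obtain ⟨W, hW1, hW2⟩ := hW.exists_LpW0
  refine ⟨W, hW1, hW2.trans ?_⟩
  have hg := eLpNorm_two_toReal hW.memLp_grad
  have h1 := hs.integral_weighted_le (α := 1 - 2 * β) (by linarith)
  have hα : 0 < 1 - 2 * β := by linarith
  have h2 : ∫ z, ‖(if 0 ≤ v z then β * (|v z| + 1) ^ (β - 1) else
      -(β * (|v z| + 1) ^ (β - 1))) • Dv z‖ ^ 2 ≤ β ^ 2 * ((1 - 2 * β)⁻¹ * K) := by
    refine le_trans (le_of_eq ?_) (mul_le_mul_of_nonneg_left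
      (h1.trans (mul_le_mul_of_nonneg_left hK (by positivity))) (sq_nonneg β))
    rw [← integral_const_mul]
    congr 1
    ext z
    have h3 : ‖(if 0 ≤ v z then β * (|v z| + 1) ^ (β - 1) else
      -(β * (|v z| + 1) ^ (β - 1)))‖ ^ 2 = (β * (|v z| + 1) ^ (β - 1)) ^ 2 := by
      rw [Real.norm_eq_abs, sq_abs]
      split_ifs <;> ring
    have h5 : 0 < |v z| + 1 := by positivity
    rw [norm_smul, mul_pow, h3, mul_pow, ← Real.rpow_natCast ((|v z| + 1) ^ (β - 1)),
      ← Real.rpow_mul h5.le, div_eq_mul_inv, add_comm 1 |v z|, ← Real.rpow_neg h5.le]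
    have : (β - 1) * ((2 : ℕ) : ℝ) = -(1 - 2 * β + 1) := by push_cast; ring
    rw [this]
    ring
  have h4 : (eLpNorm (fun z => (if 0 ≤ v z then β * (|v z| + 1) ^ (β - 1) else
      -(β * (|v z| + 1) ^ (β - 1))) • Dv z) 2 volume).toReal ≤
      √(β ^ 2 * ((1 - 2 * β)⁻¹ * K)) := by
    rw [hg]
    exact Real.sqrt_le_sqrt h2
  have h5 := ENNReal.toReal_mono (ENNReal.mul_ne_top ENNReal.ofReal_ne_top hW.memLp_grad.2.ne)
    (hPoin _ _ hW fun z hz => by simp [hs.zero_off z hz])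
  rw [ENNReal.toReal_mul, ENNReal.toReal_ofReal hP] at h5
  have h6 : 0 ≤ √(β ^ 2 * ((1 - 2 * β)⁻¹ * K)) := Real.sqrt_nonneg _
  refine max_le (h5.trans ?_) (h4.trans ?_)
  · nlinarith
  · nlinarith

theorem Sol.lintegral_slice_le (hs : Sol Ω T b h m₀ v Dv) {K : ℝ}
    (hK : (∫ z, |h z|) + (m₀ + 1) ≤ K) :
    ∀ᵐ t, t ∈ Ioo 0 T → ∫⁻ x, ‖b (v (x, t))‖ₑ ≤
      ENNReal.ofReal (2 * K + (b 1 - b (-1)) * (volume (Ω : Set (Space N))).toReal) := by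
  filter_upwards [hs.mass_bound] with t ht htT
  obtain ⟨C, hC⟩ := hs.bounded
  have hbC : ∀ z, |b (v z)| ≤ max |b C| |b (-C)| := fun z =>
    abs_le_max_abs_abs (hs.mono.monotone (abs_le.mp (hC z)).1)
      (hs.mono.monotone (abs_le.mp (hC z)).2) |>.trans (by rw [max_comm])
  have hint : Integrable (fun x => b (v (x, t))) volume := by
    have hmeas : Measurable fun x => b (v (x, t)) :=
      hs.cont.measurable.comp (hs.meas.comp measurable_prodMk_right)
    refine memLp_one_iff_integrable.mp (memLp_of_bounded_off hmeas.aestronglyMeasurable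
      Ω.isOpen.measurableSet hs.bdd.measure_lt_top (fun x => hbC (x, t)) (fun x hx => ?_) 1)
    rw [hs.zero_off (x, t) fun h => hx h.1, hs.zero]
  rw [← ofReal_integral_norm_eq_lintegral_enorm hint]
  refine ENNReal.ofReal_le_ofReal ((ht htT).trans ?_)
  linarith

theorem Sol.lintegral_weighted_le (hs : Sol Ω T b h m₀ v Dv) {K : ℝ}
    (hK : (∫ z, |h z|) + (m₀ + 1) ≤ K) {α : ℝ} (hα : 0 < α) :
    ∫⁻ z, ENNReal.ofReal (‖Dv z‖ ^ 2 / (1 + |v z|) ^ (α + 1)) ≤ ENNReal.ofReal (α⁻¹ * K) := by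
  rw [← ofReal_integral_eq_lintegral_ofReal (hs.integrable_weighted hα)
    (Eventually.of_forall fun z => by positivity)]
  exact ENNReal.ofReal_le_ofReal ((hs.integral_weighted_le hα).trans
    (mul_le_mul_of_nonneg_left hK (by positivity)))

theorem exists_eLpNorm_one_bound {α : Type*} [MeasurableSpace α] {μ : Measure α} [IsFiniteMeasure μ]
    {g : ℕ → α → ℝ} {g₀ : α → ℝ} (hg : ∀ n, MemLp (g n) ⊤ μ) (hg₀ : Integrable g₀ μ)
    (h : Tendsto (fun n => eLpNorm (fun x => g n x - g₀ x) 1 μ) atTop (𝓝 0)) :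
    ∃ C, ∀ n, (eLpNorm (g n) 1 μ).toReal ≤ C := by
  have h1 : ∀ n, MemLp (g n) 1 μ := fun n => (hg n).mono_exponent le_top
  have h2 := memLp_one_iff_integrable.mpr hg₀
  have h3 : Tendsto (fun n => (eLpNorm (fun x => g n x - g₀ x) 1 μ).toReal) atTop (𝓝 0) :=
    (ENNReal.tendsto_toReal_zero_iff fun n => ((h1 n).sub h2).2.ne).mpr h
  obtain ⟨C, hC⟩ := h3.bddAbove_range
  refine ⟨C + (eLpNorm g₀ 1 μ).toReal, fun n => ?_⟩
  have h4 := eLpNorm_add_le ((h1 n).sub h2).1 h2.1 le_rfl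
  rw [sub_add_cancel] at h4
  refine (ENNReal.toReal_mono (ENNReal.add_ne_top.mpr ⟨((h1 n).sub h2).2.ne, h2.2.ne⟩) h4).trans ?_
  rw [ENNReal.toReal_add ((h1 n).sub h2).2.ne h2.2.ne]
  gcongr
  exact hC ⟨n, rfl⟩

end EllipticParabolic

/-! ### Sobolev inequalities on time slices -/

namespace EllipticParabolic
variable {N : ℕ}

theorem enorm_gradient {f : Space N → ℝ} (x : Space N) :
    ‖gradient f x‖ₑ = ‖fderiv ℝ f x‖ₑ := by
  rw [gradient, ← ofReal_norm, LinearIsometryEquiv.norm_map, ofReal_norm]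

theorem eLpNorm_gradient {f : Space N → ℝ} (p : ℝ≥0∞) :
    eLpNorm (gradient f) p volume = eLpNorm (fderiv ℝ f) p volume :=
  eLpNorm_congr_enorm_ae (Eventually.of_forall fun x => enorm_gradient x)

/-- The endpoint embedding of `W^{1,1}` into `L^∞` in dimension one, by integrating the derivative
along a half-line. -/
theorem enorm_le_lintegral_gradient {f : Space 1 → ℝ} (hf : ContDiff ℝ 1 f)
    (hc : HasCompactSupport f) (x : Space 1) : ‖f x‖ₑ ≤ ∫⁻ y, ‖gradient f y‖ₑ := by
  let e : ℝ ≃ₗᵢ[ℝ] Space 1 := (OrthonormalBasis.singleton (Fin 1) ℝ).repr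
  have h1 : ContDiff ℝ 1 (f ∘ e) := hf.comp e.contDiff
  have h2 : HasCompactSupport (f ∘ e) := hc.comp_homeomorph e.toHomeomorph
  have h3 := HasCompactSupport.enorm_le_lintegral_Ici_deriv h1 h2 (e.symm x)
  simp only [Function.comp_apply, LinearIsometryEquiv.apply_symm_apply] at h3
  refine h3.trans ((setLIntegral_le_lintegral _ _).trans ?_)
  rw [← e.measurePreserving.lintegral_comp_emb e.toHomeomorph.measurableEmbedding]
  refine lintegral_mono fun s => ?_
  have h4 : HasDerivAt (f ∘ e) (fderiv ℝ f (e s) (e 1)) s := by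
    have h5 : HasDerivAt e (e 1) s := e.toContinuousLinearEquiv.toContinuousLinearMap.hasDerivAt
    exact (hf.differentiable one_ne_zero (e s)).hasFDerivAt.comp_hasDerivAt s h5
  rw [h4.deriv, enorm_gradient, ← ofReal_norm, ← ofReal_norm]
  refine ENNReal.ofReal_le_ofReal ((ContinuousLinearMap.le_opNorm _ _).trans ?_)
  simp

/-- Weak form of the Sobolev embedding of `W^{1,1}`. -/
theorem exists_sobolev_one (hN : 1 ≤ N) : ∃ (p : ℝ≥0∞) (C : NNReal), p ≠ 0 ∧
    (∀ f : Space N → ℝ, ContDiff ℝ 1 f → HasCompactSupport f →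
      eLpNorm f p volume ≤ C * eLpNorm (gradient f) 1 volume) ∧
    1 / p.toReal = ((N : ℝ) - 1) / N := by
  rcases hN.eq_or_lt with rfl | hN
  -- In dimension one the exponent is `⊤`. The conventions `⊤.toReal = 0` and `1 / 0 = 0` make `1 /
  -- p.toReal = (N - 1) / N` true here as well.
  · refine ⟨⊤, 1, by simp, fun f hf hc => ?_, by simp⟩
    rw [eLpNorm_exponent_top, ENNReal.coe_one, one_mul, eLpNorm_one_eq_lintegral_enorm]
    exact eLpNormEssSup_le_of_ae_enorm_bound
      (Eventually.of_forall (enorm_le_lintegral_gradient hf hc))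
  · have hN' : (1 : ℝ) < N := by exact_mod_cast hN
    have h1 : ((N : NNReal)).HolderConjugate (NNReal.conjExponent N) :=
      NNReal.HolderConjugate.conjExponent (by exact_mod_cast hN)
    refine ⟨NNReal.conjExponent N, eLpNormLESNormFDerivOneConst (volume : Measure (Space N)) (NNReal.conjExponent N),
      ?_, fun f hf hc => ?_, ?_⟩
    · exact_mod_cast h1.symm.pos.ne'
    · rw [eLpNorm_gradient]
      exact eLpNorm_le_eLpNorm_fderiv_one volume hf hc (by simpa using h1)
    · have h2 := h1.coe.inv_add_inv_eq_one
      have h3 : ((N : NNReal) : ℝ)⁻¹ = 1 / (N : ℝ) := by simp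
      rw [ENNReal.coe_toReal, one_div, eq_sub_of_add_eq' h2, h3]
      field_simp

theorem exists_sobolev_two (hN : 3 ≤ N) : ∃ (p : ℝ≥0∞) (C : NNReal), p ≠ 0 ∧
    (∀ f : Space N → ℝ, ContDiff ℝ 1 f → HasCompactSupport f →
      eLpNorm f p volume ≤ C * eLpNorm (gradient f) 2 volume) ∧
    1 / p.toReal = ((N : ℝ) - 2) / (2 * N) := by
  have hN' : (3 : ℝ) ≤ N := by exact_mod_cast hN
  have h0 : (0 : ℝ) < 2 * N / (N - 2) := div_pos (by linarith) (by linarith)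
  obtain ⟨r, h2⟩ : ∃ r : NNReal, (r : ℝ) = 2 * N / (N - 2) := ⟨⟨_, h0.le⟩, rfl⟩
  refine ⟨(r : ℝ≥0∞),
    eLpNormLESNormFDerivOfEqInnerConst (volume : Measure (Space N)) 2, ?_, fun f hf hc => ?_, ?_⟩
  · rw [Ne, ENNReal.coe_eq_zero, ← NNReal.coe_eq_zero, h2]
    exact h0.ne'
  · rw [eLpNorm_gradient]
    refine eLpNorm_le_eLpNorm_fderiv_of_eq_inner volume hf hc (p := 2) (by norm_num)
      (by simp; omega) ?_
    rw [h2]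
    have : (N : ℝ) - 2 ≠ 0 := by linarith
    have : (N : ℝ) ≠ 0 := by linarith
    simp
    field_simp
  · rw [ENNReal.coe_toReal, h2, one_div_div]

/-- Almost every time slice is a limit of compactly supported `C^1` functions. -/
theorem W0.ae_slice_seq {Ω : Opens (Space N)} {T : ℝ} {u : Space N × ℝ → ℝ}
    {Du : Space N × ℝ → Space N} (h : W0 (cyl Ω T) u Du) :
    ∀ᵐ t : ℝ, ∃ f : ℕ → Space N → ℝ, (∀ k, ContDiff ℝ 1 (f k)) ∧ (∀ k, HasCompactSupport (f k)) ∧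
      (∀ k x, x ∉ Ω → gradient (f k) x = 0) ∧
      (∀ᵐ x, Tendsto (fun k => f k x) atTop (𝓝 (u (x, t)))) ∧
      Tendsto (fun k => eLpNorm (fun x => gradient (f k) x - Du (x, t)) 2 volume) atTop (𝓝 0) := by
  -- Geometric errors make the squared slice norms summable in `k` for almost every `t`, so the
  -- whole sequence converges in `L²` on these slices. A subsequence, depending on `t`, is taken
  -- only for pointwise convergence.
  have hε : ∀ k : ℕ, (0 : ℝ≥0∞) < 2⁻¹ ^ k := fun k => ENNReal.pow_pos (by simp) k
  choose φ hφ h1 h2 using fun k => h.approx _ (hε k)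
  have key : ∀ {F : Type} [NormedAddCommGroup F] (g : ℕ → Space N × ℝ → F),
      (∀ k, AEStronglyMeasurable (g k) volume) → (∀ k, eLpNorm (g k) 2 volume ≤ 2⁻¹ ^ k) →
      ∀ᵐ t : ℝ, Tendsto (fun k => eLpNorm (fun x => g k (x, t)) 2 volume) atTop (𝓝 0) := by
    intro F _ g hg hgk
    have hm : ∀ k, AEMeasurable (fun z => ‖g k z‖ₑ ^ (2 : ℝ)) (volume.prod volume) := fun k =>
      (hg k).enorm.pow_const _
    have e1 : ∀ k, ∫⁻ t, ∫⁻ x, ‖g k (x, t)‖ₑ ^ (2 : ℝ) ≤ 2⁻¹ ^ k := by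
      intro k
      rw [← lintegral_prod_symm _ (hm k)]
      have := hgk k
      rw [eLpNorm_eq_lintegral_rpow_enorm_toReal (by simp) (by simp)] at this
      have h3 := ENNReal.rpow_le_rpow this (zero_le_two (α := ℝ))
      rw [← ENNReal.rpow_mul] at h3
      simp only [ENNReal.toReal_ofNat, one_div, ne_eq, OfNat.ofNat_ne_zero, not_false_eq_true,
        inv_mul_cancel₀, ENNReal.rpow_one] at h3
      refine h3.trans ?_
      rw [ENNReal.rpow_ofNat, ← pow_mul]
      exact pow_le_pow_right_of_le_one' (by simp) (by omega)
    have hm' : ∀ k, AEMeasurable (fun t => ∫⁻ x, ‖g k (x, t)‖ₑ ^ (2 : ℝ)) volume := fun k =>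
      (hm k).lintegral_prod_left'
    have e2 : ∫⁻ t, ∑' k, ∫⁻ x, ‖g k (x, t)‖ₑ ^ (2 : ℝ) ≠ ⊤ := by
      rw [lintegral_tsum hm']
      refine ne_top_of_le_ne_top ?_ (ENNReal.tsum_le_tsum e1)
      rw [ENNReal.tsum_geometric]
      simp
    filter_upwards [ae_lt_top' (AEMeasurable.tsum hm') e2] with t ht
    have h3 := ENNReal.tendsto_atTop_zero_of_tsum_ne_top ht.ne
    have h4 := (ENNReal.continuous_rpow_const (y := (1 / 2 : ℝ))).tendsto 0 |>.comp h3
    rw [ENNReal.zero_rpow_of_pos (by norm_num)] at h4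
    refine h4.congr fun k => ?_
    rw [eLpNorm_eq_lintegral_rpow_enorm_toReal (by simp) (by simp)]
    simp
  have k1 := key (fun k => φ k - u) (fun k => (hφ k).continuous.aestronglyMeasurable.sub h.meas) h1
  have k2 := key (fun k => spaceGrad (φ k) - Du)
    (fun k => (hφ k).continuous_grad.aestronglyMeasurable.sub h.meas_grad) h2
  have hum : ∀ᵐ t : ℝ, AEStronglyMeasurable (fun x => u (x, t)) volume :=
    (h.meas.prod_swap : AEStronglyMeasurable _ (volume.prod volume)).prodMk_left
  filter_upwards [k1, k2, hum] with t h3 h4 h5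
  have hcont : ∀ k, ContDiff ℝ 1 fun x => φ k (x, t) := fun k =>
    ((hφ k).smooth.of_le (by norm_cast)).comp (contDiff_prodMk_left t)
  obtain ⟨s, hs, hs'⟩ := exists_subseq_tendsto_ae (p := 2) (by simp)
    (f := fun k x => φ k (x, t)) (g := fun x => u (x, t))
    (fun k => (hcont k).continuous.aestronglyMeasurable) h5 h3
  refine ⟨fun k x => φ (s k) (x, t), fun k => hcont _, fun k => ?_, fun k x hx => ?_, hs',
    h4.comp hs.tendsto_atTop⟩
  · refine HasCompactSupport.intro ((hφ (s k)).compact.isCompact.image continuous_fst)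
      fun x hx => image_eq_zero_of_notMem_tsupport fun hz => hx ⟨(x, t), hz, rfl⟩
  · exact (hφ (s k)).grad_eq_zero (z := (x, t)) fun hz => hx hz.1

/-- The slice gradients converge in `L²` and vanish off the bounded set `Ω`, hence also converge in
`L^q` for `q ≤ 2`; the left side passes to the limit by Fatou's lemma. -/
theorem W0.ae_slice_sobolev {Ω : Opens (Space N)} (hΩ : Bornology.IsBounded (Ω : Set (Space N)))
    {T : ℝ} {u : Space N × ℝ → ℝ}
    {Du : Space N × ℝ → Space N} (h : W0 (cyl Ω T) u Du) {p q : ℝ≥0∞} {C : NNReal} (hq : 1 ≤ q)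
    (hq' : q ≤ 2) (hS : ∀ f : Space N → ℝ, ContDiff ℝ 1 f → HasCompactSupport f →
      eLpNorm f p volume ≤ C * eLpNorm (gradient f) q volume) :
    ∀ᵐ t : ℝ, eLpNorm (fun x => u (x, t)) p volume ≤
      C * eLpNorm (fun x => Du (x, t)) q volume := by
  have hum : ∀ᵐ t : ℝ, AEStronglyMeasurable (fun x => Du (x, t)) volume :=
    (h.meas_grad.prod_swap : AEStronglyMeasurable _ (volume.prod volume)).prodMk_left
  filter_upwards [h.ae_slice_seq, hum, ae_slice h.ae_zero_off] with t ⟨f, hf, hfc, hf0, hfu, hfg⟩ hDu h0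
  have hg : ∀ k, Continuous (gradient (f k)) := fun k =>
    (LinearIsometryEquiv.continuous _).comp ((hf k).continuous_fderiv one_ne_zero)
  have hm : ∀ k, AEStronglyMeasurable (fun x => gradient (f k) x - Du (x, t)) volume := fun k =>
    (hg k).aestronglyMeasurable.sub hDu
  have hfin : IsFiniteMeasure (volume.restrict (Ω : Set (Space N))) :=
    ⟨by simpa using hΩ.measure_lt_top⟩
  have hle : ∀ k, eLpNorm (fun x => gradient (f k) x - Du (x, t)) q volume ≤
      eLpNorm (fun x => gradient (f k) x - Du (x, t)) 2 volume *
        volume (Ω : Set (Space N)) ^ (1 / q.toReal - 1 / (2 : ℝ≥0∞).toReal) := by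
    intro k
    have e1 : (Ω : Set (Space N)).indicator (fun x => gradient (f k) x - Du (x, t)) =ᵐ[volume]
        fun x => gradient (f k) x - Du (x, t) := by
      filter_upwards [h0] with x hx
      by_cases hxΩ : x ∈ (Ω : Set (Space N))
      · simp [hxΩ]
      · rw [indicator_of_notMem hxΩ, hf0 k x hxΩ, (hx fun hz => hxΩ hz.1).2, sub_zero]
    rw [← eLpNorm_congr_ae e1, ← eLpNorm_congr_ae e1,
      eLpNorm_indicator_eq_eLpNorm_restrict Ω.isOpen.measurableSet,
      eLpNorm_indicator_eq_eLpNorm_restrict Ω.isOpen.measurableSet]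
    have := eLpNorm_le_eLpNorm_mul_rpow_measure_univ (μ := volume.restrict (Ω : Set (Space N)))
      hq' (hm k).restrict
    rwa [Measure.restrict_apply_univ] at this
  have hlim : Tendsto (fun k => C * (eLpNorm (fun x => gradient (f k) x - Du (x, t)) 2 volume *
        volume (Ω : Set (Space N)) ^ (1 / q.toReal - 1 / (2 : ℝ≥0∞).toReal) +
        eLpNorm (fun x => Du (x, t)) q volume)) atTop
      (𝓝 (C * (0 * volume (Ω : Set (Space N)) ^ (1 / q.toReal - 1 / (2 : ℝ≥0∞).toReal) +
        eLpNorm (fun x => Du (x, t)) q volume))) := by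
    refine ENNReal.Tendsto.const_mul (Tendsto.add (ENNReal.Tendsto.mul_const hfg (Or.inr ?_))
      tendsto_const_nhds) (Or.inr (by simp))
    have hq1 : q.toReal ≤ 2 := by simpa using ENNReal.toReal_mono (by simp) hq'
    have hq0 : 0 < q.toReal :=
      ENNReal.toReal_pos (by positivity) (ne_top_of_le_ne_top (by simp) hq')
    refine ENNReal.rpow_ne_top_of_nonneg ?_ hΩ.measure_lt_top.ne
    simp only [ENNReal.toReal_ofNat, sub_nonneg]
    exact one_div_le_one_div_of_le hq0 hq1
  rw [zero_mul, zero_add] at hlim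
  refine (Lp.eLpNorm_lim_le_liminf_eLpNorm (fun k => (hf k).continuous.aestronglyMeasurable)
    _ hfu).trans ?_
  rw [← hlim.liminf_eq]
  refine liminf_le_liminf (Eventually.of_forall fun k => ?_)
  refine (hS _ (hf k) (hfc k)).trans ?_
  gcongr
  have := eLpNorm_add_le (hm k) hDu hq
  refine le_trans (le_of_eq ?_) (this.trans (add_le_add (hle k) le_rfl))
  congr 1
  ext1 x
  simp

/-- Weak type inequality from a bound in `L^p`. -/
theorem measure_eq_zero_or_mul_rpow_le {α : Type*} [MeasurableSpace α] {μ : Measure α}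
    {f : α → ℝ} (hf : AEStronglyMeasurable f μ) {p : ℝ≥0∞} (hp : p ≠ 0) {K : ℝ} :
    μ {x | K < |f x|} = 0 ∨
      ENNReal.ofReal K * μ {x | K < |f x|} ^ (1 / p.toReal) ≤ eLpNorm f p μ := by
  have hsub : {x | K < |f x|} ⊆ {x | ENNReal.ofReal K ≤ ‖f x‖ₑ} := fun x hx => by
    rw [mem_ofPred_eq, ← ofReal_norm]
    exact ENNReal.ofReal_le_ofReal (le_of_lt hx)
  -- For `p = ⊤` the exponent `1 / p.toReal` is `0`, and `0 ^ 0 = 1` would make the inequality false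
  -- for null sets; hence the alternative in the statement.
  rcases eq_or_ne p ⊤ with rfl | hp'
  · by_cases h0 : μ {x | K < |f x|} = 0
    · exact Or.inl h0
    · right
      simp only [ENNReal.toReal_top, div_zero, ENNReal.rpow_zero, mul_one, eLpNorm_exponent_top]
      by_contra! hlt
      refine h0 (measure_mono_null hsub ?_)
      refine measure_mono_null (fun x hx => ?_) (meas_eLpNormEssSup_lt (f := f) (μ := μ))
      exact lt_of_lt_of_le hlt hx
  · right
    have := mul_meas_ge_le_pow_eLpNorm' μ hp hp' hf (ENNReal.ofReal K)
    have hp0 := ENNReal.toReal_pos hp hp'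
    have h2 := ENNReal.rpow_le_rpow this (one_div_nonneg.mpr hp0.le)
    rw [ENNReal.mul_rpow_of_nonneg _ _ (one_div_nonneg.mpr hp0.le), ← ENNReal.rpow_mul,
      ← ENNReal.rpow_mul, mul_one_div_cancel hp0.ne', ENNReal.rpow_one, ENNReal.rpow_one] at h2
    refine le_trans ?_ h2
    gcongr

end EllipticParabolic

/-! ### Level set estimate on time slices -/

namespace EllipticParabolic
variable {N : ℕ}

/-- This truncation has height `k/2` where `s ≥ k`, while its gradient only sees `k/2 ≤ s < k`.
Sobolev's inequality thus compares a superlevel set with the energy of a sublevel set. -/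
theorem LipRight.window {k : ℝ} (hk : 0 < k) :
    LipRight (fun s => min (max (s - k / 2) 0) (k / 2))
      (fun s => if k / 2 ≤ s ∧ s < k then 1 else 0) 1 := by
  refine ⟨by fun_prop, fun s => ?_, fun s => by split_ifs <;> simp⟩
  split_ifs with hs
  · refine ((hasDerivWithinAt_id s (Ioi s)).sub_const (k / 2)).congr_of_eventuallyEq ?_ ?_
    · filter_upwards [mem_nhdsWithin_of_mem_nhds (Iio_mem_nhds hs.2), self_mem_nhdsWithin]
        with x hx hx'
      have h1 : x < k := hx
      have h2 : s < x := hx'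
      rw [max_eq_left (by linarith), min_eq_left (by linarith), id]
    · rw [max_eq_left (by linarith), min_eq_left (by linarith), id]
  · rw [not_and_or, not_le, not_lt] at hs
    rcases hs with hs | hs
    · refine (hasDerivWithinAt_const s (Ioi s) 0).congr_of_eventuallyEq ?_ ?_
      · filter_upwards [mem_nhdsWithin_of_mem_nhds (Iio_mem_nhds hs)] with x hx
        have h1 : x < k / 2 := hx
        rw [max_eq_right (by linarith), min_eq_left (by linarith)]
      · rw [max_eq_right (by linarith), min_eq_left (by linarith)]
    · refine (hasDerivWithinAt_const s (Ioi s) (k / 2)).congr (fun x hx => ?_) ?_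
      · have h1 : s < x := hx
        rw [max_eq_left (by linarith), min_eq_right (by linarith)]
      · rw [max_eq_left (by linarith), min_eq_right (by linarith)]

theorem ENNReal.rpow_two_mul_le {x y l : ℝ≥0∞} (hx : x ≠ 0) (hx' : x ≠ ⊤) {a : ℝ}
    (h : x * l ^ a ≤ y) : l ^ (2 * a) ≤ x⁻¹ ^ 2 * y ^ 2 := by
  have h1 : l ^ a ≤ x⁻¹ * y := by
    rw [← one_mul (l ^ a), ← ENNReal.inv_mul_cancel hx hx', mul_assoc]
    gcongr
  rw [← mul_pow, mul_comm, ENNReal.rpow_mul, ENNReal.rpow_ofNat]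
  gcongr

/-- Level set estimate on almost every time slice. -/
theorem exists_ae_level_le (hN : 1 ≤ N) : ∃ C : NNReal, ∀ (Ω : Opens (Space N)) (T : ℝ)
    (u : Space N × ℝ → ℝ) (Du : Space N × ℝ → Space N),
    Bornology.IsBounded (Ω : Set (Space N)) → W0 (cyl Ω T) u Du → Measurable u →
    ∀ k : ℝ, 0 < k → ∀ᵐ t : ℝ, volume {x | k < u (x, t)} ≤
      (C * (ENNReal.ofReal (k / 4))⁻¹ ^ 2) *
        (∫⁻ x, if |u (x, t)| < k then ‖Du (x, t)‖ₑ ^ 2 else 0) *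
        volume {x | k / 3 < u (x, t)} ^ (2 / (N : ℝ)) := by
  have hN0 : (0 : ℝ) < N := by exact_mod_cast hN
  have hx : ∀ k : ℝ, 0 < k → ENNReal.ofReal (k / 4) ≠ 0 := fun k hk => by
    simp only [ne_eq, ENNReal.ofReal_eq_zero, not_le]; linarith
  -- The thresholds `k/4` and, below, `k/3` only need to lie strictly under `k/2`: the first under
  -- the height of the window, the second under its starting point.
  have hsub : ∀ {u : Space N × ℝ → ℝ} {t k : ℝ}, 0 < k → volume {x | k < u (x, t)} ≤
      volume {x | k / 4 < |min (max (u (x, t) - k / 2) 0) (k / 2)|} := by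
    intro u t k hk
    refine measure_mono fun x hx => ?_
    have h1 : k < u (x, t) := hx
    rw [mem_ofPred_eq, max_eq_left (by linarith), min_eq_right (by linarith),
      abs_of_pos (by linarith)]
    linarith
  have hsub3 : ∀ {u : Space N × ℝ → ℝ} {t k : ℝ}, 0 < k → volume {x | k < u (x, t)} ≤
      volume {x | k / 3 < u (x, t)} := by
    intro u t k hk
    exact measure_mono fun x hx => lt_trans (by linarith : k / 3 < k) hx
  have hwm : ∀ {u : Space N × ℝ → ℝ} {t k : ℝ}, Measurable u →
      AEStronglyMeasurable (fun x => min (max (u (x, t) - k / 2) 0) (k / 2))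
        (volume : Measure (Space N)) := by
    intro u t k hu
    have : Measurable fun x => u (x, t) := hu.comp measurable_prodMk_right
    exact (((this.sub_const _).max measurable_const).min measurable_const).aestronglyMeasurable
  by_cases hN3 : 3 ≤ N
  -- For `N ≥ 3` the embedding of `W^{1,2}` bounds the power `(N-2)/N` of the measure, and the
  -- missing power `2/N` is put in by monotonicity.
  · obtain ⟨p, C, hp, hS, hpN⟩ := exists_sobolev_two hN3
    have hN3' : (3 : ℝ) ≤ N := by exact_mod_cast hN3
    refine ⟨C ^ 2, fun Ω T u Du hΩ hu hum k hk => ?_⟩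
    have hW := hu.comp (LipRight.window hk) (by rw [max_eq_right (by linarith), min_eq_left (by linarith)])
    filter_upwards [hW.ae_slice_sobolev hΩ one_le_two le_rfl hS] with t ht
    rcases measure_eq_zero_or_mul_rpow_le (μ := volume) (hwm (t := t) (k := k) hum) hp
      (K := k / 4) with h0 | h1
    · rw [nonpos_iff_eq_zero.mp ((hsub hk).trans h0.le)]
      exact zero_le
    · have h2 := (mul_le_mul_right (ENNReal.rpow_le_rpow (hsub hk) (by positivity)) _).trans
        (h1.trans ht)
      have h3 := ENNReal.rpow_two_mul_le (hx k hk) ENNReal.ofReal_ne_top h2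
      have h4 : eLpNorm (fun x => (if k / 2 ≤ u (x, t) ∧ u (x, t) < k then (1 : ℝ) else 0) •
          Du (x, t)) 2 volume ^ 2 ≤ ∫⁻ x, if |u (x, t)| < k then ‖Du (x, t)‖ₑ ^ 2 else 0 := by
        rw [eLpNorm_eq_lintegral_rpow_enorm_toReal (by simp) (by simp), ← ENNReal.rpow_natCast,
          ← ENNReal.rpow_mul]
        norm_num
        refine lintegral_mono fun x => ?_
        split_ifs with h5 h6 h6
        · simp
        · exact absurd (abs_lt.mpr ⟨by linarith, h5.2⟩) h6
        · simp
        · simp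
      calc volume {x | k < u (x, t)}
          = volume {x | k < u (x, t)} ^ (2 * (1 / p.toReal)) *
            volume {x | k < u (x, t)} ^ (2 / (N : ℝ)) := by
            rw [← ENNReal.rpow_add_of_nonneg _ _ (by positivity) (by positivity), hpN]
            have : 2 * (((N : ℝ) - 2) / (2 * N)) + 2 / N = 1 := by field_simp; ring
            rw [this, ENNReal.rpow_one]
        _ ≤ _ := by
            refine mul_le_mul' (h3.trans ?_) (ENNReal.rpow_le_rpow (hsub3 hk) (by positivity))
            rw [mul_pow, ← mul_assoc, ENNReal.coe_pow, mul_comm (_⁻¹ ^ 2)]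
            gcongr
  -- For `N ≤ 2` the embedding of `W^{1,1}` is used, with Cauchy–Schwarz on `{u > k/3}`. This bounds
  -- the power `2(N-1)/N` at the cost of one factor `|{u > k/3}|`; the remaining power `2/N - 1` is
  -- nonnegative exactly because `N ≤ 2`.
  · obtain ⟨p, C, hp, hS, hpN⟩ := exists_sobolev_one hN
    have hN2' : (N : ℝ) ≤ 2 := by exact_mod_cast (by omega : N ≤ 2)
    refine ⟨C ^ 2, fun Ω T u Du hΩ hu hum k hk => ?_⟩
    have hW := hu.comp (LipRight.window hk) (by rw [max_eq_right (by linarith), min_eq_left (by linarith)])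
    have hDm : ∀ᵐ t : ℝ, AEStronglyMeasurable (fun x => Du (x, t)) volume :=
      (hu.meas_grad.prod_swap : AEStronglyMeasurable _ (volume.prod volume)).prodMk_left
    filter_upwards [hW.ae_slice_sobolev hΩ le_rfl one_le_two hS, hDm] with t ht hDm
    rcases measure_eq_zero_or_mul_rpow_le (μ := volume) (hwm (t := t) (k := k) hum) hp
      (K := k / 4) with h0 | h1
    · rw [nonpos_iff_eq_zero.mp ((hsub hk).trans h0.le)]
      exact zero_le
    · have h2 := (mul_le_mul_right (ENNReal.rpow_le_rpow (hsub hk) (by positivity)) _).trans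
        (h1.trans ht)
      have h3 := ENNReal.rpow_two_mul_le (hx k hk) ENNReal.ofReal_ne_top h2
      have hut : Measurable fun x => u (x, t) := hum.comp measurable_prodMk_right
      have hSm : MeasurableSet {x | k / 3 < u (x, t)} := measurableSet_lt measurable_const hut
      have h4 : eLpNorm (fun x => (if k / 2 ≤ u (x, t) ∧ u (x, t) < k then (1 : ℝ) else 0) •
          Du (x, t)) 1 volume ^ 2 ≤ (∫⁻ x, if |u (x, t)| < k then ‖Du (x, t)‖ₑ ^ 2 else 0) *
            volume {x | k / 3 < u (x, t)} := by
        rw [eLpNorm_one_eq_lintegral_enorm]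
        have hm1 : AEMeasurable (fun x => if |u (x, t)| < k then ‖Du (x, t)‖ₑ else 0)
            (volume : Measure (Space N)) := by
          have : MeasurableSet {x | |u (x, t)| < k} := measurableSet_lt (by fun_prop) measurable_const
          exact (hDm.enorm.indicator this).congr (Eventually.of_forall fun x => by
            simp [indicator_apply])
        have h5 : ∫⁻ x, ‖(if k / 2 ≤ u (x, t) ∧ u (x, t) < k then (1 : ℝ) else 0) •
            Du (x, t)‖ₑ ≤ ∫⁻ x, ((fun x => if |u (x, t)| < k then ‖Du (x, t)‖ₑ else 0) *
              {x | k / 3 < u (x, t)}.indicator 1 : Space N → ℝ≥0∞) x := by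
          refine lintegral_mono fun x => ?_
          simp only [Pi.mul_apply]
          split_ifs with h5 h6 h6
          · rw [indicator_of_mem (by rw [mem_ofPred_eq]; linarith)]
            simp
          · exact absurd (abs_lt.mpr ⟨by linarith, h5.2⟩) h6
          · simp
          · simp
        have h6 := h5.trans (ENNReal.lintegral_mul_le_Lp_mul_Lq volume
          (Real.HolderConjugate.two_two) hm1 ((measurable_one.indicator hSm).aemeasurable))
        have h7 := pow_le_pow_left' h6 2
        refine h7.trans (le_of_eq ?_)
        rw [mul_pow, ← ENNReal.rpow_natCast, ← ENNReal.rpow_natCast, ← ENNReal.rpow_mul,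
          ← ENNReal.rpow_mul]
        norm_num
        congr 1
        refine Eq.trans (lintegral_congr fun x => ?_) (lintegral_indicator_one hSm)
        by_cases hx : x ∈ {x | k / 3 < u (x, t)}
        · simp [indicator_of_mem hx]
        · simp [indicator_of_notMem hx]
      have hpp : 2 * (1 / p.toReal) + (2 / (N : ℝ) - 1) = 1 := by rw [hpN]; field_simp; ring
      have hN2 : 0 ≤ 2 / (N : ℝ) - 1 := by rw [sub_nonneg, le_div_iff₀ hN0]; linarith
      calc volume {x | k < u (x, t)}
          = volume {x | k < u (x, t)} ^ (2 * (1 / p.toReal)) *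
            volume {x | k < u (x, t)} ^ (2 / (N : ℝ) - 1) := by
            rw [← ENNReal.rpow_add_of_nonneg _ _ (by positivity) hN2, hpp, ENNReal.rpow_one]
        _ ≤ (C ^ 2 * (ENNReal.ofReal (k / 4))⁻¹ ^ 2 *
              ((∫⁻ x, if |u (x, t)| < k then ‖Du (x, t)‖ₑ ^ 2 else 0) *
                volume {x | k / 3 < u (x, t)})) *
              volume {x | k / 3 < u (x, t)} ^ (2 / (N : ℝ) - 1) := by
            refine mul_le_mul' (h3.trans ?_) (ENNReal.rpow_le_rpow (hsub3 hk) hN2)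
            rw [mul_pow, ← mul_assoc, mul_comm (_⁻¹ ^ 2)]
            gcongr
        _ = _ := by
            rw [← mul_assoc, mul_assoc _ (volume {x | k / 3 < u (x, t)})]
            have : volume {x | k / 3 < u (x, t)} * volume {x | k / 3 < u (x, t)} ^ (2 / (N : ℝ) - 1)
                = volume {x | k / 3 < u (x, t)} ^ (2 / (N : ℝ)) := by
              nth_rewrite 1 [← ENNReal.rpow_one (volume {x | k / 3 < u (x, t)})]
              rw [← ENNReal.rpow_add_of_nonneg _ _ zero_le_one hN2]
              congr 1
              ring
            rw [this, ENNReal.coe_pow]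

end EllipticParabolic

/-! ### Level sets of solutions -/

namespace EllipticParabolic
variable {N : ℕ} {Ω : Opens (Space N)} {T m₀ : ℝ} {b : ℝ → ℝ} {h v : Space N × ℝ → ℝ}
  {Dv : Space N × ℝ → Space N}

/-- The bound for the mass of a solution that comes with the bound `K` of its data. -/
noncomputable def massBound (Ω : Opens (Space N)) (b : ℝ → ℝ) (K : ℝ) : ℝ :=
  2 * K + (b 1 - b (-1)) * (volume (Ω : Set (Space N))).toReal

namespace Sol

theorem ae_slice_level_le (hs : Sol Ω T b h m₀ v Dv) {K : ℝ}
    (hK : (∫ z, |h z|) + (m₀ + 1) ≤ K) :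
    ∀ᵐ t : ℝ, ∀ L : ℝ, 0 < L →
      volume {x | L < b (v (x, t))} ≤ ENNReal.ofReal (massBound Ω b K / L) := by
  filter_upwards [hs.lintegral_slice_le hK] with t ht L hL
  by_cases htT : t ∈ Ioo 0 T
  · have hsub : {x | L < b (v (x, t))} ⊆ {x | ENNReal.ofReal L ≤ ‖b (v (x, t))‖ₑ} := by
      intro x hx
      rw [mem_ofPred_eq, ← ofReal_norm]
      exact ENNReal.ofReal_le_ofReal ((le_of_lt hx).trans (le_abs_self _))
    have h1 := mul_meas_ge_le_lintegral₀ (μ := volume) (f := fun x => ‖b (v (x, t))‖ₑ)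
      (hs.cont.measurable.comp (hs.meas.comp measurable_prodMk_right)).enorm.aemeasurable
      (ENNReal.ofReal L)
    rw [ENNReal.ofReal_div_of_pos hL, ENNReal.le_div_iff_mul_le (Or.inl (by simpa using hL))
      (Or.inl ENNReal.ofReal_ne_top), mul_comm]
    exact (mul_le_mul_right (measure_mono hsub) _).trans (h1.trans (ht htT))
  · have : {x | L < b (v (x, t))} = ∅ := by
      refine eq_empty_of_forall_notMem fun x hx => ?_
      have h1 : L < b (v (x, t)) := hx
      rw [hs.zero_off (x, t) fun hz => htT hz.2, hs.zero] at h1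
      linarith
    simp [this]

theorem integrable_sublevel (hs : Sol Ω T b h m₀ v Dv) (k : ℝ) :
    Integrable (fun z => if |v z| < k then ‖Dv z‖ ^ 2 else 0) volume := by
  have : Measurable fun s : ℝ => if |s| < k then (1 : ℝ) else 0 :=
    Measurable.ite (measurableSet_lt (by fun_prop) measurable_const) measurable_const
      measurable_const
  refine (hs.integrable_grad_sq (L := 1) this fun s => by split_ifs <;> simp).congr
    (Eventually.of_forall fun z => ?_)
  simp

theorem lintegral_sublevel_le (hs : Sol Ω T b h m₀ v Dv) {K : ℝ}
    (hK : (∫ z, |h z|) + (m₀ + 1) ≤ K) {k : ℝ} (hk : 0 < k) :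
    ∫⁻ z, (if |v z| < k then ‖Dv z‖ₑ ^ 2 else 0) ≤ ENNReal.ofReal (4 * k * K) := by
  have h1 := (hs.integral_grad_sq_sublevel_le hk).trans
    (mul_le_mul_of_nonneg_left hK (by positivity))
  refine le_trans (le_of_eq ?_) (ENNReal.ofReal_le_ofReal h1)
  rw [ofReal_integral_eq_lintegral_ofReal (hs.integrable_sublevel k)
    (Eventually.of_forall fun z => by simp only [Pi.zero_apply]; split_ifs <;> positivity)]
  refine lintegral_congr fun z => ?_
  split_ifs
  · rw [← ofReal_norm, ENNReal.ofReal_pow (norm_nonneg _)]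
  · simp

/-- In `Sol` the number `m₀` is only a limit of masses; at almost every small time the mass is
nonnegative and at most `m₀ + 1`. -/
theorem m_nonneg (hs : Sol Ω T b h m₀ v Dv) : 0 ≤ m₀ + 1 := by
  obtain ⟨c, hc, hc1, hc2⟩ := hs.mass
  obtain ⟨δ, hδ, hδT, hle⟩ := hs.exists_small hc hc2
  obtain ⟨t, ht, ht'⟩ : ∃ t, (t ∈ Ioo 0 T → ∫ x, |b (v (x, t))| = c t) ∧ t ∈ Ioo 0 δ := by
    have : (volume.restrict (Ioo (0 : ℝ) δ)) ≠ 0 := by simp [hδ]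
    have : NeZero (volume.restrict (Ioo (0 : ℝ) δ)) := ⟨this⟩
    exact ((ae_restrict_of_ae hc1).and (ae_restrict_mem measurableSet_Ioo)).exists
  have h3 := ht ⟨ht'.1, ht'.2.trans_le hδT⟩
  have h4 : 0 ≤ c t := h3 ▸ integral_nonneg fun x => abs_nonneg _
  exact h4.trans (hle t ht'.1.le ht'.2)

theorem K_nonneg (hs : Sol Ω T b h m₀ v Dv) {K : ℝ} (hK : (∫ z, |h z|) + (m₀ + 1) ≤ K) :
    0 ≤ K := by
  have h3 : 0 ≤ ∫ z, |h z| := integral_nonneg fun z => abs_nonneg _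
  linarith [hs.m_nonneg]

/-- The symmetry `v ↦ -v`, `b ↦ -b(-·)` transfers estimates for large positive values to large
negative ones; this is why the structural condition is also imposed on `-b(-s)`. -/
theorem neg (hs : Sol Ω T b h m₀ v Dv) :
    Sol Ω T (fun s => -b (-s)) (fun z => -h z) m₀ (fun z => -v z) (fun z => -Dv z) := by
  refine ⟨by have := hs.cont; fun_prop, fun r s hrs => neg_lt_neg (hs.mono (neg_lt_neg hrs)),
    by simp [hs.zero], hs.pos, hs.bdd, hs.meas.neg, fun z hz => by simp [hs.zero_off z hz], ?_,
    hs.source.neg, hs.source_one.neg, hs.mem.neg, fun φ hφ => ?_, ?_⟩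
  · obtain ⟨M, hM⟩ := hs.bounded
    exact ⟨M, fun z => by simpa using hM z⟩
  · have := hs.eqn φ hφ
    simp only [neg_neg, neg_mul, integral_neg, inner_neg_left] at this ⊢
    linarith
  · simpa using hs.mass

end Sol

/-- For large `k` the growth of `b` and Chebyshev give `|{v(t) > k/3}| ≤ C k^(-a₁)`. Inserted into
the slice estimate and integrated in time, this yields `k⁻² · 4kK · k^(-2a₁/N)`, the claimed decay.
For small `k` the measure of the cylinder suffices. -/
theorem exists_level_le (hN : 1 ≤ N) (Ω : Opens (Space N)) (T : ℝ) {a₁ c s₀ : ℝ}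
    (ha : 0 < a₁) (hc : 0 < c) (hgrow : ∀ s, s₀ ≤ s → c * s ^ a₁ ≤ b s) (K : ℝ) :
    ∃ C : ℝ, 0 ≤ C ∧ ∀ h m₀ v Dv, Sol Ω T b h m₀ v Dv → (∫ z, |h z|) + (m₀ + 1) ≤ K →
      ∀ k : ℝ, 0 < k →
        volume {z | k < v z} ≤ ENNReal.ofReal (C / k ^ (((N : ℝ) + 2 * a₁) / N)) := by
  obtain ⟨C, hC⟩ := exists_ae_level_le hN
  have hN0 : (0 : ℝ) < N := by exact_mod_cast hN
  set r : ℝ := ((N : ℝ) + 2 * a₁) / N with hr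
  have hr0 : 0 < r := by positivity
  set s₁ : ℝ := max s₀ 1
  have hs₁ : 0 < s₁ := lt_max_of_lt_right one_pos
  set M : ℝ := max (massBound Ω b K) 0
  have hM : 0 ≤ M := le_max_right _ _
  set C₁ : ℝ := (volume (cyl Ω T : Set (Space N × ℝ))).toReal * (3 * s₁) ^ r with hC₁
  -- The factor `64` comes from `(k/4)⁻² · 4k = 64/k`.
  set C₂ : ℝ := C * 64 * |K| * (M / c * 3 ^ a₁) ^ (2 / (N : ℝ)) with hC₂
  refine ⟨max C₁ C₂, le_max_of_le_left (by positivity), fun h m₀ v Dv hs hK k hk => ?_⟩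
  have hkr : 0 < k ^ r := by positivity
  rcases lt_or_ge k (3 * s₁) with hk1 | hk1
  · have h1 : volume {z | k < v z} ≤ volume (cyl Ω T : Set (Space N × ℝ)) := by
      refine measure_mono fun z hz => ?_
      by_contra hz'
      have h2 : k < v z := hz
      rw [hs.zero_off z hz'] at h2
      linarith
    rw [← ENNReal.ofReal_toReal hs.fin.ne] at h1
    refine h1.trans (ENNReal.ofReal_le_ofReal ?_)
    rw [le_div_iff₀ hkr]
    refine le_trans ?_ (le_max_left _ _)
    exact mul_le_mul_of_nonneg_left (Real.rpow_le_rpow hk.le hk1.le hr0.le) ENNReal.toReal_nonneg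
  · have h1 : ∀ᵐ t : ℝ, volume {x | k < v (x, t)} ≤
        (C * (ENNReal.ofReal (k / 4))⁻¹ ^ 2) *
        (∫⁻ x, if |v (x, t)| < k then ‖Dv (x, t)‖ₑ ^ 2 else 0) *
        ENNReal.ofReal (M / (c * (k / 3) ^ a₁)) ^ (2 / (N : ℝ)) := by
      filter_upwards [hC Ω T v Dv hs.bdd hs.mem hs.meas k hk, hs.ae_slice_level_le hK]
        with t h2 h3
      refine h2.trans (mul_le_mul_right (ENNReal.rpow_le_rpow ?_ (by positivity)) _)
      have h4 : s₀ ≤ k / 3 := by linarith [le_max_left s₀ 1]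
      have h5 : 0 < c * (k / 3) ^ a₁ := by positivity
      have h6 := hgrow _ h4
      refine le_trans (measure_mono fun x hx => hs.mono hx)
        ((h3 (b (k / 3)) (h5.trans_le h6)).trans (ENNReal.ofReal_le_ofReal ?_))
      exact (div_le_div_of_nonneg_right (le_max_left _ _) (h5.trans_le h6).le).trans
        (div_le_div_of_nonneg_left hM h5 h6)
    have hmeas : MeasurableSet {z | k < v z} := measurableSet_lt measurable_const hs.meas
    have h2 : volume {z | k < v z} = ∫⁻ t, volume {x | k < v (x, t)} :=
      Measure.prod_apply_symm hmeas
    have hDm : AEMeasurable (fun z => if |v z| < k then ‖Dv z‖ₑ ^ 2 else 0)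
        ((volume : Measure (Space N)).prod (volume : Measure ℝ)) := by
      have : MeasurableSet {z | |v z| < k} := measurableSet_lt hs.meas.abs measurable_const
      exact ((hs.mem.meas_grad.enorm.pow_const 2).indicator this).congr
        (Eventually.of_forall fun x => by simp [indicator_apply])
    rw [h2]
    refine (lintegral_mono_ae h1).trans ?_
    rw [lintegral_mul_const'' _ (hDm.lintegral_prod_left'.const_mul _),
      lintegral_const_mul'' _ hDm.lintegral_prod_left', ← lintegral_prod_symm _ hDm]
    have h3 := hs.lintegral_sublevel_le hK hk
    have hK0 := hs.K_nonneg hK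
    calc _ ≤ (C * (ENNReal.ofReal (k / 4))⁻¹ ^ 2) * ENNReal.ofReal (4 * k * K) *
          ENNReal.ofReal (M / (c * (k / 3) ^ a₁)) ^ (2 / (N : ℝ)) := by
          gcongr
          exact h3
      _ = ENNReal.ofReal (C * (k / 4)⁻¹ ^ 2 * (4 * k * K) *
          (M / (c * (k / 3) ^ a₁)) ^ (2 / (N : ℝ))) := by
          have hX : 0 ≤ 4 * k * K := by positivity
          generalize 4 * k * K = X at hX
          rw [ENNReal.ofReal_mul (by positivity), ENNReal.ofReal_mul (by positivity),
            ENNReal.ofReal_mul (by positivity), ENNReal.ofReal_pow (by positivity),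
            ENNReal.ofReal_inv_of_pos (by positivity), ENNReal.ofReal_coe_nnreal,
            ENNReal.ofReal_rpow_of_nonneg (by positivity) (by positivity)]
      _ ≤ _ := by
          refine ENNReal.ofReal_le_ofReal ?_
          rw [le_div_iff₀ hkr]
          refine le_trans (le_of_eq ?_) (le_max_right _ _)
          have e1 : M / (c * (k / 3) ^ a₁) = M / c * 3 ^ a₁ * (k ^ a₁)⁻¹ := by
            rw [Real.div_rpow hk.le (by norm_num)]
            field_simp
          have e2 : k ^ r = k * (k ^ a₁) ^ (2 / (N : ℝ)) := by
            rw [← Real.rpow_mul hk.le, hr, show ((N : ℝ) + 2 * a₁) / N = 1 + a₁ * (2 / N) by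
              field_simp, Real.rpow_add hk, Real.rpow_one]
          have e3 : 0 < (k ^ a₁) ^ (2 / (N : ℝ)) := by positivity
          rw [e1, e2, Real.mul_rpow (by positivity) (by positivity),
            Real.inv_rpow (by positivity), hC₂, abs_of_nonneg hK0]
          field_simp
          norm_num
          ring

end EllipticParabolic

/-! ### Marcinkiewicz bound for the gradient and the time derivative -/

namespace EllipticParabolic
variable {N : ℕ} {Ω : Opens (Space N)} {T m₀ : ℝ} {b : ℝ → ℝ} {h v : Space N × ℝ → ℝ}
  {Dv : Space N × ℝ → Space N}

/-- A weak `L^q` bound on a set of finite measure gives an `L^p` bound for `p < q`. -/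
theorem lintegral_rpow_le_of_weak {α : Type*} [MeasurableSpace α] {μ : Measure α} {f : α → ℝ}
    (hf0 : ∀ x, 0 ≤ f x) (hf : AEMeasurable f μ) {p q A C : ℝ} (hp : 0 < p) (hpq : p < q)
    (hA : 0 ≤ A) (hC : 0 ≤ C) (h1 : ∀ k : ℝ, 0 < k → μ {x | k < f x} ≤ ENNReal.ofReal A)
    (h2 : ∀ k : ℝ, 0 < k → μ {x | k < f x} ≤ ENNReal.ofReal (C / k ^ q)) :
    ∫⁻ x, ENNReal.ofReal (f x ^ p) ∂μ ≤ ENNReal.ofReal (A + p * C / (q - p)) := by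
  -- Layer cake formula, split at height `1`: the bound `A` is used below, and above it the weak
  -- bound, whose integral converges since `p < q`.
  rw [lintegral_rpow_eq_lintegral_meas_lt_mul μ (Eventually.of_forall hf0) hf hp,
    ← Ioc_union_Ioi_eq_Ioi zero_le_one, lintegral_union measurableSet_Ioi
      (Ioc_disjoint_Ioi le_rfl)]
  have e1 : ∫⁻ t in Ioc (0 : ℝ) 1, μ {a | t < f a} * ENNReal.ofReal (t ^ (p - 1)) ≤
      ENNReal.ofReal (A / p) := by
    calc _ ≤ ∫⁻ t in Ioc (0 : ℝ) 1, ENNReal.ofReal (A * t ^ (p - 1)) := by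
          refine setLIntegral_mono' measurableSet_Ioc fun t ht => ?_
          rw [ENNReal.ofReal_mul hA]
          gcongr
          exact h1 t ht.1
      _ = ENNReal.ofReal (∫ t in Ioc (0 : ℝ) 1, A * t ^ (p - 1)) := by
          rw [ofReal_integral_eq_lintegral_ofReal]
          · have := (intervalIntegral.intervalIntegrable_rpow' (a := 0) (b := 1)
              (by linarith : -1 < p - 1)).const_mul A
            rwa [intervalIntegrable_iff_integrableOn_Ioc_of_le zero_le_one] at this
          · filter_upwards [ae_restrict_mem measurableSet_Ioc] with t ht
            have := ht.1
            simp only [Pi.zero_apply]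
            positivity
      _ = ENNReal.ofReal (A / p) := by
          rw [← intervalIntegral.integral_of_le zero_le_one, intervalIntegral.integral_const_mul,
            integral_rpow (Or.inl (by linarith))]
          simp [hp.ne', div_eq_mul_inv]
  have e2 : ∫⁻ t in Ioi (1 : ℝ), μ {a | t < f a} * ENNReal.ofReal (t ^ (p - 1)) ≤
      ENNReal.ofReal (C / (q - p)) := by
    calc _ ≤ ∫⁻ t in Ioi (1 : ℝ), ENNReal.ofReal (C * t ^ (p - 1 - q)) := by
          refine setLIntegral_mono' measurableSet_Ioi fun t ht => ?_
          have ht0 : (0 : ℝ) < t := zero_lt_one.trans ht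
          refine (mul_le_mul_left (h2 t ht0) _).trans (le_of_eq ?_)
          rw [← ENNReal.ofReal_mul (by positivity), Real.rpow_sub ht0 (p - 1) q]
          congr 1
          ring
      _ = ENNReal.ofReal (∫ t in Ioi (1 : ℝ), C * t ^ (p - 1 - q)) := by
          rw [ofReal_integral_eq_lintegral_ofReal]
          · exact (integrableOn_Ioi_rpow_of_lt (by linarith) one_pos).const_mul C
          · filter_upwards [ae_restrict_mem measurableSet_Ioi] with t ht
            have : (0 : ℝ) < t := zero_lt_one.trans ht
            simp only [Pi.zero_apply]
            positivity
      _ = ENNReal.ofReal (C / (q - p)) := by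
          rw [integral_const_mul, integral_Ioi_rpow_of_lt (by linarith) one_pos, Real.one_rpow]
          congr 1
          have : p - 1 - q + 1 ≠ 0 := by linarith
          have : q - p ≠ 0 := by linarith
          rw [show p - 1 - q + 1 = -(q - p) by ring]
          field_simp
  have hqp : 0 < q - p := by linarith
  refine (mul_le_mul_right (add_le_add e1 e2) _).trans (le_of_eq ?_)
  rw [← ENNReal.ofReal_add (by positivity) (by positivity), ← ENNReal.ofReal_mul hp.le]
  congr 1
  field_simp

/-- Where `|∇v| > l`, either `|v| > k/2` or `|v| < k`; the second part has measure at most `4kK/l²`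
by the sublevel energy. The choice `k = l^(N/(N+a₁))` balances `k^(-(N+2a₁)/N)` against `k/l²`. -/
theorem Sol.grad_level_le (hs : Sol Ω T b h m₀ v Dv) {K : ℝ}
    (hK : (∫ z, |h z|) + (m₀ + 1) ≤ K) {a₁ C : ℝ} (hN : 1 ≤ N) (ha : 0 < a₁)
    (hC0 : 0 ≤ C) (hC : ∀ k : ℝ, 0 < k →
      volume {z | k < |v z|} ≤ ENNReal.ofReal (C / k ^ (((N : ℝ) + 2 * a₁) / N)))
    {l : ℝ} (hl : 0 < l) :
    volume {z | l < ‖Dv z‖} ≤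
      ENNReal.ofReal ((C * 2 ^ (((N : ℝ) + 2 * a₁) / N) + 4 * K) /
        l ^ (((N : ℝ) + 2 * a₁) / (N + a₁))) := by
  have hN0 : (0 : ℝ) < N := by exact_mod_cast hN
  have hK0 := hs.K_nonneg hK
  set k : ℝ := l ^ ((N : ℝ) / (N + a₁)) with hk
  have hk0 : 0 < k := by positivity
  have hsub : {z | l < ‖Dv z‖} ⊆ {z | k / 2 < |v z|} ∪
      {z | ENNReal.ofReal (l ^ 2) ≤ if |v z| < k then ‖Dv z‖ₑ ^ 2 else 0} := by
    intro z hz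
    have hz' : l < ‖Dv z‖ := hz
    by_cases hv : |v z| < k
    · right
      rw [mem_ofPred_eq, if_pos hv, ← ofReal_norm, ← ENNReal.ofReal_pow (norm_nonneg _)]
      exact ENNReal.ofReal_le_ofReal (by gcongr)
    · left
      rw [mem_ofPred_eq]
      linarith
  have hDm : AEMeasurable (fun z => if |v z| < k then ‖Dv z‖ₑ ^ 2 else 0) volume := by
    have : MeasurableSet {z | |v z| < k} := measurableSet_lt hs.meas.abs measurable_const
    exact ((hs.mem.meas_grad.enorm.pow_const 2).indicator this).congr
      (Eventually.of_forall fun x => by simp [indicator_apply])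
  have h1 := (mul_meas_ge_le_lintegral₀ hDm (ENNReal.ofReal (l ^ 2))).trans
    (hs.lintegral_sublevel_le hK hk0)
  have hl2 : 0 < l ^ 2 := by positivity
  rw [mul_comm, ← ENNReal.le_div_iff_mul_le (Or.inl (by simpa using hl2.ne'))
    (Or.inl ENNReal.ofReal_ne_top), ← ENNReal.ofReal_div_of_pos hl2] at h1
  refine (measure_mono hsub).trans ((measure_union_le _ _).trans
    ((add_le_add (hC (k / 2) (by positivity)) h1).trans ?_))
  rw [← ENNReal.ofReal_add (by positivity) (by positivity)]
  refine ENNReal.ofReal_le_ofReal (le_of_eq ?_)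
  have e1 : (k / 2) ^ (((N : ℝ) + 2 * a₁) / N) =
      l ^ (((N : ℝ) + 2 * a₁) / (N + a₁)) / 2 ^ (((N : ℝ) + 2 * a₁) / N) := by
    rw [Real.div_rpow hk0.le zero_le_two, hk, ← Real.rpow_mul hl.le]
    congr 2
    field_simp
  have e2 : k * l ^ (((N : ℝ) + 2 * a₁) / (N + a₁)) = l ^ 2 := by
    rw [hk, ← Real.rpow_add hl, ← Real.rpow_natCast]
    congr 1
    push_cast
    field_simp
    ring
  have hlq : 0 < l ^ (((N : ℝ) + 2 * a₁) / (N + a₁)) := by positivity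
  rw [e1, ← e2]
  field_simp

/-- Pairing with a vector field, as an element of the dual of `L^p(0, T; W₀^{1,p})`. -/
theorem exists_dual_bound (Ω : Opens (Space N)) (T : ℝ) {p q : ℝ≥0∞} [Fact (1 ≤ p)] [Fact (1 ≤ q)]
    [ENNReal.HolderConjugate p q] : ∃ C : ℝ, 0 ≤ C ∧
    ∀ D : Space N × ℝ → Space N, MemLp D p (cylMeasure Ω T) →
      ∃ Λ : DualLpW0 q Ω T, ‖Λ‖ ≤ C * (eLpNorm D p (cylMeasure Ω T)).toReal ∧
        ∀ Φ : LpW0 q Ω T, Λ Φ = -∫ z, inner ℝ (D z) (Φ.1.2 z) ∂(cylMeasure Ω T) := by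
  let B : Space N →L[ℝ] Space N →L[ℝ] ℝ := innerSL ℝ
  let P := B.lpPairing (cylMeasure Ω T) p q
  let Q : LpW0 q Ω T →L[ℝ] Lp (Space N) q (cylMeasure Ω T) :=
    (ContinuousLinearMap.snd ℝ _ _).comp (LpW0 q Ω T).subtypeL
  refine ⟨‖P‖ * ‖Q‖, by positivity, fun D hD => ⟨(P (hD.neg.toLp (-D))).comp Q, ?_, fun Φ => ?_⟩⟩
  · refine (ContinuousLinearMap.opNorm_comp_le _ _).trans ?_
    have h1 := P.le_opNorm (hD.neg.toLp (-D))
    rw [Lp.norm_toLp, eLpNorm_neg] at h1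
    calc _ ≤ ‖P‖ * (eLpNorm D p (cylMeasure Ω T)).toReal * ‖Q‖ := by gcongr
      _ = _ := by ring
  · rw [ContinuousLinearMap.comp_apply, ContinuousLinearMap.lpPairing_eq_integral, ← integral_neg]
    refine integral_congr_ae ?_
    filter_upwards [hD.neg.coeFn_toLp] with z hz
    rw [hz, ← inner_neg_left]
    rfl

/-- The equation is the decomposition: `h` is the `L¹` part and `Δv` the other. As `(N+2a₁)/(N+a₁) >
1`, the weak bound on `∇v` gives a bound in `L^s` for the midpoint `s` between `1` and this
exponent. -/
theorem timeDerivBounded_of_sol (hN : 1 ≤ N) {h : ℕ → Space N × ℝ → ℝ} {m : ℕ → ℝ}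
    {v : ℕ → Space N × ℝ → ℝ} {Dv : ℕ → Space N × ℝ → Space N}
    (hs : ∀ n, Sol Ω T b (h n) (m n) (v n) (Dv n)) {K : ℝ}
    (hK : ∀ n, (∫ z, |h n z|) + (m n + 1) ≤ K) {a₁ C : ℝ} (ha : 0 < a₁) (hC0 : 0 ≤ C)
    (hC : ∀ n, ∀ l : ℝ, 0 < l → volume {z | l < ‖Dv n z‖} ≤ ENNReal.ofReal (C /
        l ^ (((N : ℝ) + 2 * a₁) / (N + a₁)))) :
    TimeDerivBounded Ω T (fun n z => b (v n z)) := by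
  have hN0 : (0 : ℝ) < N := by exact_mod_cast hN
  set q : ℝ := ((N : ℝ) + 2 * a₁) / (N + a₁) with hq
  have hq1 : 1 < q := by rw [hq, one_lt_div (by positivity)]; linarith
  set s : ℝ := (1 + q) / 2 with hsdef
  have hs1 : 1 < s := by rw [hsdef]; linarith
  have hsq : s < q := by rw [hsdef]; linarith
  have hconj : s.HolderConjugate (s.conjExponent) := Real.HolderConjugate.conjExponent hs1
  have hH : ENNReal.HolderConjugate (ENNReal.ofReal s) (ENNReal.ofReal s.conjExponent) :=
    hconj.ennrealOfReal
  have f1 : Fact (1 ≤ ENNReal.ofReal s) := ⟨by simpa using hs1.le⟩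
  have f2 : Fact (1 ≤ ENNReal.ofReal s.conjExponent) := ⟨by simpa using hconj.symm.lt.le⟩
  obtain ⟨C₁, hC₁, hdual⟩ := exists_dual_bound Ω T (p := ENNReal.ofReal s)
    (q := ENNReal.ofReal s.conjExponent)
  set A : ℝ := (volume (cyl Ω T : Set (Space N × ℝ))).toReal
  set E : ℝ := (A + s * C / (q - s)) ^ (1 / s)
  have hE : ∀ n, eLpNorm (Dv n) (ENNReal.ofReal s) volume ≤ ENNReal.ofReal E := by
    intro n
    have hqs : 0 < q - s := by linarith
    have h1 := lintegral_rpow_le_of_weak (μ := volume) (f := fun z => ‖Dv n z‖)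
      (fun z => norm_nonneg _) (hs n).mem.meas_grad.norm.aemeasurable (p := s) (q := q) (A := A)
      (C := C) (by linarith) hsq ENNReal.toReal_nonneg hC0 (fun k hk => ?_) (hC n)
    · rw [eLpNorm_eq_lintegral_rpow_enorm_toReal (by simp; linarith) (by simp),
        ENNReal.toReal_ofReal (by linarith), ← ENNReal.ofReal_rpow_of_nonneg (by positivity)
        (by positivity)]
      refine ENNReal.rpow_le_rpow (le_trans (le_of_eq ?_) h1) (by positivity)
      refine lintegral_congr fun z => ?_
      rw [← ENNReal.ofReal_rpow_of_nonneg (norm_nonneg _) (by linarith), ofReal_norm]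
    · rw [ENNReal.ofReal_toReal (hs n).fin.ne]
      refine measure_mono_ae ((hs n).mem.ae_zero_off.mono fun z hz hzk => ?_)
      by_contra hz'
      have : k < ‖Dv n z‖ := hzk
      rw [(hz hz').2, norm_zero] at this
      linarith
  refine ⟨ENNReal.ofReal s, ENNReal.ofReal s.conjExponent, f2, by simpa using hs1, by simp, hH,
    max K (C₁ * E), fun n => ?_⟩
  have hD : MemLp (Dv n) (ENNReal.ofReal s) (cylMeasure Ω T) :=
    MemLp.restrict _ ⟨(hs n).mem.meas_grad, (hE n).trans_lt ENNReal.ofReal_lt_top⟩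
  obtain ⟨Λ, hΛ, hΛ'⟩ := hdual (Dv n) hD
  have hh : MemLp (h n) 1 (cylMeasure Ω T) :=
    (memLp_one_iff_integrable.mpr (hs n).source_one).restrict _
  refine ⟨hh.toLp (h n), Λ, ?_, ?_, fun φ => ?_⟩
  · refine le_trans ?_ (le_max_left _ _)
    rw [Lp.norm_toLp]
    have h1 : (eLpNorm (h n) 1 (cylMeasure Ω T)).toReal ≤ ∫ z, |h n z| := by
      refine (ENNReal.toReal_mono (memLp_one_iff_integrable.mpr (hs n).source_one).2.ne
        (eLpNorm_mono_measure _ Measure.restrict_le_self)).trans (le_of_eq ?_)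
      rw [eLpNorm_one_eq_lintegral_enorm, ← integral_norm_eq_lintegral_enorm
        (hs n).source_one.1]
      rfl
    linarith [hK n, (hs n).m_nonneg]
  · refine hΛ.trans (le_trans ?_ (le_max_right _ _))
    refine mul_le_mul_of_nonneg_left ?_ hC₁
    refine ENNReal.toReal_le_of_le_ofReal ?_
      ((eLpNorm_mono_measure _ Measure.restrict_le_self).trans (hE n))
    have hqs : 0 < q - s := by linarith
    positivity
  · have hφ := IsTest.of_testFunction φ
    have h1 := (hs n).eqn φ hφ
    rw [hΛ', distTimeDeriv, integral_cylMeasure, h1, ← sub_eq_add_neg]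
    · congr 1
      · rw [← integral_cylMeasure (Ω := Ω) (T := T)]
        · exact integral_congr_ae (hh.coeFn_toLp.mono fun z hz => by simp only [hz])
        · intro z hz
          rw [hφ.eq_zero hz, mul_zero]
      · rw [← integral_cylMeasure (Ω := Ω) (T := T)]
        · refine integral_congr_ae
            ((memLp_spaceGrad (ENNReal.ofReal s.conjExponent) φ).coeFn_toLp.mono fun z hz => ?_)
          simp only [testElt, testPair, hz]
        · intro z hz
          rw [hφ.grad_eq_zero hz, inner_zero_right]
    · intro z hz
      simp only [(hs n).zero_off z hz, (hs n).zero, zero_mul]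

end EllipticParabolic

/-! ### Higher integrability of `b(v)` -/

namespace EllipticParabolic
variable {N : ℕ} {Ω : Opens (Space N)} {T m₀ : ℝ} {b : ℝ → ℝ} {h v : Space N × ℝ → ℝ}
  {Dv : Space N × ℝ → Space N}

/-- Freezing `G` outside `[s₀, M]` produces an admissible nonlinearity from regularity on that
interval alone. With `M` above the range of a bounded solution, the upper truncation is invisible.
-/
theorem LipRight.clamp {G g : ℝ → ℝ} {s₀ M L : ℝ} (hM : s₀ ≤ M) (hL0 : 0 ≤ L)
    (hG : ∀ s ∈ Icc s₀ M, HasDerivAt G (g s) s) (hL : ∀ s ∈ Icc s₀ M, |g s| ≤ L) :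
    LipRight (fun s => G (min (max s s₀) M) - G s₀)
      (fun s => if s₀ ≤ s ∧ s < M then g s else 0) L := by
  have hmem : ∀ s : ℝ, min (max s s₀) M ∈ Icc s₀ M := fun s =>
    ⟨le_min (le_max_right _ _) hM, min_le_right _ _⟩
  have hcl : ∀ s, s ≤ s₀ → G (min (max s s₀) M) = G s₀ := fun s hs => by
    rw [max_eq_right hs, min_eq_left hM]
  have hcm : ∀ s, s₀ ≤ s → s ≤ M → G (min (max s s₀) M) = G s := fun s hs hs' => by
    rw [max_eq_left hs, min_eq_left hs']
  have hcr : ∀ s, M ≤ s → G (min (max s s₀) M) = G M := fun s hs => by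
    rw [max_eq_left (hM.trans hs), min_eq_right hs]
  refine ⟨Continuous.sub ?_ continuous_const, fun s => HasDerivWithinAt.sub_const _ ?_,
    fun s => ?_⟩
  · have h1 : ContinuousOn G (Icc s₀ M) := fun s hs => (hG s hs).continuousAt.continuousWithinAt
    exact h1.comp_continuous (by fun_prop) hmem
  · split_ifs with hs
    · refine (hG s ⟨hs.1, hs.2.le⟩).hasDerivWithinAt.congr_of_eventuallyEq ?_ (hcm s hs.1 hs.2.le)
      filter_upwards [mem_nhdsWithin_of_mem_nhds (Iio_mem_nhds hs.2), self_mem_nhdsWithin]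
        with x hx hx'
      exact hcm x (hs.1.trans (le_of_lt hx')) (le_of_lt hx)
    · rw [not_and_or, not_le, not_lt] at hs
      rcases hs with hs | hs
      · refine (hasDerivWithinAt_const s (Ioi s) (G s₀)).congr_of_eventuallyEq ?_ (hcl s hs.le)
        filter_upwards [mem_nhdsWithin_of_mem_nhds (Iio_mem_nhds hs)] with x hx
        exact hcl x (le_of_lt hx)
      · exact (hasDerivWithinAt_const s (Ioi s) (G M)).congr
          (fun x hx => hcr x (hs.trans (le_of_lt hx))) (hcr s hs)
  · split_ifs with hs
    · exact hL s ⟨hs.1, hs.2.le⟩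
    · simpa using hL0

/-- The consequence of `ConditionB` that gives the higher integrability of `b (v)`. -/
theorem ConditionB.exists_growth (hN : 1 ≤ N) {a₁ : ℝ} (hB : ConditionB N b a₁) :
    ∃ a₃ α s₀ p c : ℝ, ((N : ℝ) - 1) / N < a₃ ∧ 0 < α ∧ 1 ≤ s₀ ∧ 0 < p ∧
      p < ((N : ℝ) + 2 * a₁) / N ∧ 0 < c ∧ ∀ s, s₀ ≤ s → c * s ^ a₁ ≤ b s ∧ 1 ≤ b s ∧
        DifferentiableAt ℝ b s ∧ deriv b s * b s ^ (2 * a₃ - 1 + α) ≤ b s + s ^ p := by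
  obtain ⟨ha, c, hc, hgrow⟩ := hB.growth
  obtain ⟨a₃, h1, -, ε, hε, h2⟩ := hB.near_infinity
  have hN0 : (0 : ℝ) < N := by exact_mod_cast hN
  set r : ℝ := ((N : ℝ) + 2 * a₁) / N with hr
  have hr0 : 0 < r := by positivity
  have hb1 : ∀ᶠ s in atTop, 1 ≤ b s := by
    have : Tendsto (fun s : ℝ => c * s ^ a₁) atTop atTop :=
      (tendsto_rpow_atTop ha).const_mul_atTop hc
    filter_upwards [hgrow, this.eventually_ge_atTop 1] with s h3 h4
    exact h4.trans h3
  rcases h2 with ⟨hC1, h2⟩ | h2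
  · obtain ⟨s₀, hs₀⟩ := eventually_atTop.mp
      (((hgrow.and hb1).and h2).and (eventually_ge_atTop (1 : ℝ)))
    refine ⟨a₃, min (1 / 2) (ε / (4 * r)), max s₀ 1, max (r / 2) (r - ε / 2), c, h1,
      lt_min (by norm_num) (by positivity), le_max_right _ _, lt_max_of_lt_left (by positivity),
      max_lt (by linarith) (by linarith), hc, fun s hs => ?_⟩
    obtain ⟨⟨⟨h3, h4⟩, h5⟩, h6⟩ := hs₀ s ((le_max_left _ _).trans hs)
    have hs1 : 1 ≤ s := (le_max_right _ _).trans hs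
    have hs0 : 0 < s := by linarith
    have hb0 : 0 < b s := by linarith
    set α : ℝ := min (1 / 2) (ε / (4 * r))
    have hα : 0 < α := lt_min (by norm_num) (by positivity)
    refine ⟨h3, h4, (hC1.contDiffAt (Ici_mem_nhds hs0)).differentiableAt one_ne_zero, ?_⟩
    rw [Real.rpow_add hb0, ← mul_assoc]
    have h7 : deriv b s * b s ^ (2 * a₃ - 1) ≤ s ^ (r - ε) :=
      (mul_le_mul_of_nonneg_right (le_abs_self _) (by positivity)).trans h5
    refine (mul_le_mul_of_nonneg_right h7 (by positivity)).trans ?_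
    -- The factor `b^α` must be absorbed. If `b ≤ s^(2r)`, it costs at most `s^(ε/2)`, since `α ≤
    -- ε/(4r)`. Otherwise `s^(r-ε) ≤ b^(1/2)`, and `b^(1/2+α) ≤ b` since `α ≤ 1/2`.
    rcases le_total (b s) (s ^ (2 * r)) with h8 | h8
    · have h9 : b s ^ α ≤ s ^ (ε / 2) := by
        refine (Real.rpow_le_rpow hb0.le h8 hα.le).trans ?_
        rw [← Real.rpow_mul hs0.le]
        refine Real.rpow_le_rpow_of_exponent_le hs1 ?_
        calc 2 * r * α ≤ 2 * r * (ε / (4 * r)) :=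
              mul_le_mul_of_nonneg_left (min_le_right _ _) (by positivity)
          _ = ε / 2 := by field_simp; norm_num
      calc s ^ (r - ε) * b s ^ α ≤ s ^ (r - ε) * s ^ (ε / 2) := by gcongr
        _ = s ^ (r - ε / 2) := by rw [← Real.rpow_add hs0]; congr 1; ring
        _ ≤ s ^ max (r / 2) (r - ε / 2) :=
            Real.rpow_le_rpow_of_exponent_le hs1 (le_max_right _ _)
        _ ≤ _ := by linarith
    · have h9 : s ^ (r - ε) ≤ b s ^ (1 / 2 : ℝ) := by
        calc s ^ (r - ε) ≤ s ^ (2 * r * (1 / 2)) :=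
              Real.rpow_le_rpow_of_exponent_le hs1 (by linarith)
          _ = (s ^ (2 * r)) ^ (1 / 2 : ℝ) := Real.rpow_mul hs0.le _ _
          _ ≤ _ := by gcongr
      calc s ^ (r - ε) * b s ^ α ≤ b s ^ (1 / 2 : ℝ) * b s ^ α := by gcongr
        _ = b s ^ (1 / 2 + α) := (Real.rpow_add hb0 _ _).symm
        _ ≤ b s ^ (1 : ℝ) := Real.rpow_le_rpow_of_exponent_le h4 (by
            have : α ≤ 1 / 2 := min_le_left _ _
            linarith)
        _ = b s := Real.rpow_one _
        _ ≤ _ := by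
            have : 0 < s ^ max (r / 2) (r - ε / 2) := by positivity
            linarith
  · obtain ⟨s₀, hs₀⟩ := eventually_atTop.mp
      (((hgrow.and hb1).and h2).and (eventually_ge_atTop (1 : ℝ)))
    -- With `α = ε` the two exponents of `b` add up to exactly `1`. The power `s^p` plays no role in
    -- this case, so any `p` in `(0, r)` will do.
    refine ⟨a₃, ε, max s₀ 1, r / 2, c, h1, hε, le_max_right _ _, by positivity, by linarith, hc,
      fun s hs => ?_⟩
    obtain ⟨⟨⟨h3, h4⟩, h5, h5'⟩, h6⟩ := hs₀ s ((le_max_left _ _).trans hs)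
    have hb0 : 0 < b s := by linarith
    refine ⟨h3, h4, h5, ?_⟩
    calc deriv b s * b s ^ (2 * a₃ - 1 + ε)
        ≤ b s ^ (2 - 2 * a₃ - ε) * b s ^ (2 * a₃ - 1 + ε) := by
          gcongr
          exact (le_abs_self _).trans h5'
      _ = b s := by
          rw [← Real.rpow_add hb0]
          conv_rhs => rw [← Real.rpow_one (b s)]
          congr 1
          ring
      _ ≤ _ := by
          have : 0 < s ^ (r / 2) := by positivity
          linarith

theorem exists_abs_rpow_mul_le (b : ℝ → ℝ) (hm : Monotone b) {s₀ M : ℝ} (e : ℝ)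
    (h1 : ∀ s, s₀ ≤ s → 1 ≤ b s) : ∀ s ∈ Icc s₀ M, b s ^ e ≤ b M ^ |e| := by
  intro s hs
  have h2 := h1 s hs.1
  exact (Real.rpow_le_rpow_of_exponent_le h2 (le_abs_self e)).trans
    (Real.rpow_le_rpow (by linarith) (hm hs.2) (abs_nonneg e))

/-- The integral bound for the gradient of a power of `b (v)`. -/
theorem Sol.exists_grad_rpow (hs : Sol Ω T b h m₀ v Dv) {K : ℝ}
    (hK : (∫ z, |h z|) + (m₀ + 1) ≤ K) {a₃ α s₀ p : ℝ} (ha₃ : 0 < a₃) (hα : 0 < α) (hs₀ : 1 ≤ s₀)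
    (hg : ∀ s, s₀ ≤ s → 1 ≤ b s ∧
        DifferentiableAt ℝ b s ∧ deriv b s * b s ^ (2 * a₃ - 1 + α) ≤ b s + s ^ p) :
    ∃ (F : ℝ → ℝ) (DF : Space N × ℝ → Space N), W0 (cyl Ω T) (fun z => F (v z)) DF ∧
      (∀ z, s₀ ≤ v z → F (v z) = b (v z) ^ a₃ - b s₀ ^ a₃) ∧ Measurable F ∧
      ∫⁻ z, ‖DF z‖ₑ ≤ ENNReal.ofReal a₃ * ((∫⁻ z, ‖b (v z)‖ₑ) +
        (∫⁻ z, ENNReal.ofReal ((max (v z) 0) ^ p)) + ENNReal.ofReal (K / α)) := by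
  obtain ⟨M₀, hM₀⟩ := hs.bounded
  set M : ℝ := max s₀ (M₀ + 1) with hMdef
  have hM : s₀ ≤ M := le_max_left _ _
  have hvM : ∀ z, v z < M := fun z => by
    have := (abs_le.mp (hM₀ z)).2
    have := le_max_right s₀ (M₀ + 1)
    linarith
  have hb1 : ∀ s, s₀ ≤ s → 1 ≤ b s := fun s h => (hg s h).1
  have hb'0 : ∀ s, 0 ≤ deriv b s := fun s => hs.mono.monotone.deriv_nonneg
  have hpow := fun e : ℝ => exists_abs_rpow_mul_le b hs.mono.monotone (s₀ := s₀) (M := M) e hb1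
  -- This bound depends on the supremum of `v`. It only makes the clamped functions Lipschitz and
  -- does not enter the final estimate.
  have hbM : ∀ s ∈ Icc s₀ M, deriv b s ≤ (b M + M ^ |p|) * b M ^ |-(2 * a₃ - 1 + α)| := by
    intro s hsM
    have h1 := (hg s hsM.1).2.2
    have h2 : 0 < b s := lt_of_lt_of_le one_pos (hb1 s hsM.1)
    have h3 : deriv b s ≤ (b s + s ^ p) * b s ^ (-(2 * a₃ - 1 + α)) := by
      rw [Real.rpow_neg h2.le, ← div_eq_mul_inv, le_div_iff₀ (by positivity)]
      exact h1
    refine h3.trans ?_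
    have hs1 : 1 ≤ s := hs₀.trans hsM.1
    have h4 : s ^ p ≤ M ^ |p| :=
      (Real.rpow_le_rpow_of_exponent_le hs1 (le_abs_self p)).trans
        (Real.rpow_le_rpow (by linarith) hsM.2 (abs_nonneg p))
    have h5 : 0 < s ^ p := by positivity
    refine mul_le_mul (add_le_add (hs.mono.monotone hsM.2) h4) (hpow _ s hsM) (by positivity) ?_
    have : 0 < b M := lt_of_lt_of_le one_pos (hb1 M hM)
    have : 0 < M ^ |p| := by linarith
    positivity
  have hbMpos : 0 < b M := lt_of_lt_of_le one_pos (hb1 M hM)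
  have hMpos : 0 < M := by linarith
  set B : ℝ := (b M + M ^ |p|) * b M ^ |-(2 * a₃ - 1 + α)| with hBdef
  have hB0 : 0 ≤ B := by positivity
  -- derivatives of powers of `b`
  have hd : ∀ e : ℝ, ∀ s ∈ Icc s₀ M,
      HasDerivAt (fun s => b s ^ e) (deriv b s * e * b s ^ (e - 1)) s := by
    intro e s hsM
    have h2 : 0 < b s := lt_of_lt_of_le one_pos (hb1 s hsM.1)
    exact (hg s hsM.1).2.1.hasDerivAt.rpow_const (Or.inl h2.ne')
  have hdb : ∀ e : ℝ, ∀ s ∈ Icc s₀ M, |deriv b s * e * b s ^ (e - 1)| ≤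
      B * |e| * b M ^ |e - 1| := by
    intro e s hsM
    have h2 : 0 < b s := lt_of_lt_of_le one_pos (hb1 s hsM.1)
    rw [abs_mul, abs_mul, abs_of_nonneg (hb'0 s), abs_of_nonneg (by positivity : 0 ≤ b s ^ (e - 1))]
    gcongr
    · exact hbM s hsM
    · exact hpow _ s hsM
  have hF := LipRight.clamp hM (by positivity) (hd a₃) (hdb a₃)
  -- The test nonlinearity is `b(s₀)^(-α) - b(s)^(-α)`, which is bounded by `1`; the energy estimate
  -- controls `α b' b^(-α-1) |∇v|²`.
  have hψ := LipRight.clamp hM (by positivity) (fun s hsM => (hd (-α) s hsM).neg)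
    (fun s hsM => (abs_neg _).trans_le (hdb (-α) s hsM))
  have hψ0 : ∀ s, 0 ≤ if s₀ ≤ s ∧ s < M then -(deriv b s * -α * b s ^ (-α - 1)) else 0 := by
    intro s
    split_ifs with h1
    · have h2 : 0 < b s := lt_of_lt_of_le one_pos (hb1 s h1.1)
      have := hb'0 s
      have h3 : -(deriv b s * -α * b s ^ (-α - 1)) = deriv b s * α * b s ^ (-α - 1) := by ring
      rw [h3]
      positivity
    · exact le_rfl
  have hzero : min (max (0 : ℝ) s₀) M = s₀ := by
    rw [max_eq_right (by linarith), min_eq_left hM]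
  have hE := hs.energy hψ (hψ.monotone_of_nonneg hψ0) (by simp [hzero]) (fun s => by
    have hmem : s₀ ≤ min (max s s₀) M := le_min (le_max_right _ _) hM
    have e1 : ∀ s, s₀ ≤ s → 0 ≤ b s ^ (-α) ∧ b s ^ (-α) ≤ 1 := fun s h =>
      ⟨by have := hb1 s h; positivity,
        Real.rpow_le_one_of_one_le_of_nonpos (hb1 s h) (by linarith)⟩
    have e2 := e1 _ hmem
    have e3 := e1 s₀ le_rfl
    simp only [Pi.neg_apply]
    rw [abs_le]
    constructor <;> linarith)
  have hW := hs.mem.comp hF (by simp [hzero])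
  refine ⟨_, _, hW, fun z hz => ?_, hF.cont.measurable, ?_⟩
  · rw [max_eq_left hz, min_eq_left (hvM z).le]
  · have hint := hs.integrable_grad_sq hψ.measurable_deriv hψ.bound
    have hEl : ∫⁻ z, ENNReal.ofReal ((if s₀ ≤ v z ∧ v z < M then
        -(deriv b (v z) * -α * b (v z) ^ (-α - 1)) else 0) * ‖Dv z‖ ^ 2) ≤ ENNReal.ofReal K := by
      rw [← ofReal_integral_eq_lintegral_ofReal hint (Eventually.of_forall fun z =>
        mul_nonneg (hψ0 _) (sq_nonneg _))]
      exact ENNReal.ofReal_le_ofReal (hE.trans hK)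
    -- Young's inequality for `b^(a₃-1)`, the geometric mean of `b^(2a₃-1+α)` and `b^(-α-1)`, splits
    -- `b' b^(a₃-1) |∇v|` in two. The structural condition bounds the first part by `b + s^p`, the
    -- energy the second.
    have hpt : ∀ z, ‖(if s₀ ≤ v z ∧ v z < M then deriv b (v z) * a₃ * b (v z) ^ (a₃ - 1) else 0) •
        Dv z‖ₑ ≤ ENNReal.ofReal a₃ * (‖b (v z)‖ₑ + ENNReal.ofReal ((max (v z) 0) ^ p) +
          ENNReal.ofReal (1 / α) * ENNReal.ofReal ((if s₀ ≤ v z ∧ v z < M then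
        -(deriv b (v z) * -α * b (v z) ^ (-α - 1)) else 0) * ‖Dv z‖ ^ 2)) := by
      intro z
      split_ifs with hz
      · have h1 := hg (v z) hz.1
        have h2 : 0 < b (v z) := lt_of_lt_of_le one_pos h1.1
        have hv0 : 0 < v z := by linarith [hz.1]
        have hv1 : max (v z) 0 = v z := max_eq_left hv0.le
        have h3 : 0 ≤ deriv b (v z) := hb'0 _
        rw [← ofReal_norm, ← ofReal_norm, hv1, ← ENNReal.ofReal_mul (by positivity),
          ← ENNReal.ofReal_add (by positivity) (by positivity), Real.norm_of_nonneg h2.le,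
          ← ENNReal.ofReal_add (by positivity) ?_, ← ENNReal.ofReal_mul ha₃.le]
        · refine ENNReal.ofReal_le_ofReal ?_
          rw [norm_smul, Real.norm_of_nonneg (by positivity)]
          have e2 : b (v z) ^ (2 * a₃ - 1 + α) * b (v z) ^ (-α - 1) =
              (b (v z) ^ (a₃ - 1)) ^ 2 := by
            rw [← Real.rpow_add h2, ← Real.rpow_natCast, ← Real.rpow_mul h2.le]
            congr 1
            push_cast
            ring
          set X := b (v z) ^ (a₃ - 1)
          set Y := b (v z) ^ (2 * a₃ - 1 + α)
          set Z := b (v z) ^ (-α - 1)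
          have hY : 0 ≤ Y := by positivity
          have hZ : 0 ≤ Z := by positivity
          have hX : 0 ≤ X := by positivity
          have e3 : 1 / α * (-(deriv b (v z) * -α * Z) * ‖Dv z‖ ^ 2) =
              deriv b (v z) * (Z * ‖Dv z‖ ^ 2) := by field_simp
          rw [e3]
          have e4 : X * ‖Dv z‖ ≤ Y + Z * ‖Dv z‖ ^ 2 := by
            have hn := norm_nonneg (Dv z)
            have h5 : (X * ‖Dv z‖) ^ 2 ≤ (Y + Z * ‖Dv z‖ ^ 2) ^ 2 := by
              rw [mul_pow, ← e2]
              nlinarith [sq_nonneg (Y - Z * ‖Dv z‖ ^ 2), mul_nonneg hY hZ, sq_nonneg ‖Dv z‖,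
                mul_nonneg (mul_nonneg hY hZ) (sq_nonneg ‖Dv z‖)]
            exact abs_le_of_sq_le_sq' h5 (by positivity) |>.2
          have e5 := mul_le_mul_of_nonneg_left e4 (mul_nonneg ha₃.le h3)
          have e6 := mul_le_mul_of_nonneg_left h1.2.2 ha₃.le
          nlinarith
        · have := hψ0 (v z)
          rw [if_pos hz] at this
          positivity
      · simp
    refine (lintegral_mono hpt).trans ?_
    have hm1 : AEMeasurable (fun z => ‖b (v z)‖ₑ) volume :=
      (hs.cont.measurable.comp hs.meas).enorm.aemeasurable
    have hm2 : AEMeasurable (fun z => ENNReal.ofReal ((max (v z) 0) ^ p)) volume :=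
      ((hs.meas.max measurable_const).pow_const p).ennreal_ofReal.aemeasurable
    have hm12 : AEMeasurable (fun z => ‖b (v z)‖ₑ + ENNReal.ofReal ((max (v z) 0) ^ p)) volume :=
      hm1.add hm2
    rw [lintegral_const_mul' _ _ ENNReal.ofReal_ne_top, lintegral_add_left' hm12,
      lintegral_add_left' hm1, lintegral_const_mul' _ _ ENNReal.ofReal_ne_top]
    refine mul_le_mul_right (add_le_add le_rfl ?_) _
    refine (mul_le_mul_right hEl _).trans (le_of_eq ?_)
    rw [← ENNReal.ofReal_mul (by positivity)]
    congr 1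
    ring

theorem Sol.lintegral_b_le (hs : Sol Ω T b h m₀ v Dv) {K : ℝ}
    (hK : (∫ z, |h z|) + (m₀ + 1) ≤ K) :
    ∫⁻ z, ‖b (v z)‖ₑ ≤ ENNReal.ofReal (massBound Ω b K) * ENNReal.ofReal T := by
  have hm : Measurable fun z => ‖b (v z)‖ₑ := (hs.cont.measurable.comp hs.meas).enorm
  have h1 : ∫⁻ z, ‖b (v z)‖ₑ = ∫⁻ t, ∫⁻ x, ‖b (v (x, t))‖ₑ :=
    lintegral_prod_symm _ hm.aemeasurable
  rw [h1]
  calc ∫⁻ t, ∫⁻ x, ‖b (v (x, t))‖ₑ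
      ≤ ∫⁻ t, (Ioo 0 T).indicator (fun _ => ENNReal.ofReal (massBound Ω b K)) t := by
        refine lintegral_mono_ae ((hs.lintegral_slice_le hK).mono fun t ht => ?_)
        by_cases htT : t ∈ Ioo 0 T
        · rw [indicator_of_mem htT]
          exact ht htT
        · rw [indicator_of_notMem htT, nonpos_iff_eq_zero]
          have : ∀ x, ‖b (v (x, t))‖ₑ = 0 := fun x => by
            rw [hs.zero_off (x, t) fun hz => htT hz.2, hs.zero, enorm_zero]
          simp [this]
    _ = _ := by
        rw [lintegral_indicator measurableSet_Ioo, setLIntegral_const, Real.volume_Ioo, sub_zero]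

/-- Higher integrability of the positive part of `b (v)`. -/
theorem exists_level_b_le (hN : 1 ≤ N) (Ω : Opens (Space N)) (T : ℝ) {a₁ : ℝ}
    (hB : ConditionB N b a₁) (K : ℝ) :
    ∃ C d : ℝ, 0 ≤ C ∧ 0 < d ∧ ∀ h m₀ v Dv, Sol Ω T b h m₀ v Dv → (∫ z, |h z|) + (m₀ + 1) ≤ K →
      ∀ L : ℝ, 0 < L → volume {z | L < b (v z)} ≤ ENNReal.ofReal (C / L ^ (1 + d)) := by
  obtain ⟨a₃, α, s₀, p, c, ha₃κ, hα, hs₀, hp, hpr, hc, hg⟩ := hB.exists_growth hN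
  obtain ⟨C₁, hC₁, hlev⟩ := exists_level_le hN Ω T hB.growth.1 hc (fun s hs => (hg s hs).1) K
  obtain ⟨e, C₂, he, hS, heN⟩ := exists_sobolev_one hN
  have hN0 : (0 : ℝ) < N := by exact_mod_cast hN
  have hN1 : (1 : ℝ) ≤ N := by exact_mod_cast hN
  set κ : ℝ := ((N : ℝ) - 1) / N with hκ
  have hκ0 : 0 ≤ κ := div_nonneg (by linarith) hN0.le
  have hκ1 : κ ≤ 1 := by rw [hκ, div_le_one hN0]; linarith
  have ha₃ : 0 < a₃ := by linarith
  set r : ℝ := ((N : ℝ) + 2 * a₁) / N with hr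
  set A : ℝ := (volume (cyl Ω T : Set (Space N × ℝ))).toReal
  set m : ℝ := max (massBound Ω b K) 0
  have hm : 0 ≤ m := le_max_right _ _
  set Y : ℝ := a₃ * (m * |T| + (A + p * C₁ / (r - p)) + |K| / α) with hY
  have hrp : 0 < r - p := by linarith
  have hA : 0 ≤ A := ENNReal.toReal_nonneg
  have hY0 : 0 ≤ Y := by positivity
  have hb₀ : 1 ≤ b s₀ := (hg s₀ le_rfl).2.1
  -- beyond `L₀` the value `b s₀` is negligible
  set L₀ : ℝ := b s₀ * 4 ^ (1 / a₃) with hL₀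
  have hL₀1 : b s₀ ≤ L₀ := le_mul_of_one_le_right (by linarith)
    (Real.one_le_rpow (by norm_num) (by positivity))
  have hL₀pos : 0 < L₀ := by linarith
  have hL₀' : ∀ L, L₀ ≤ L → L ^ a₃ / 4 < L ^ a₃ - b s₀ ^ a₃ := by
    intro L hL
    have h1 : L₀ ^ a₃ = b s₀ ^ a₃ * 4 := by
      rw [hL₀, Real.mul_rpow (by linarith) (by positivity), ← Real.rpow_mul (by norm_num),
        one_div_mul_cancel ha₃.ne', Real.rpow_one]
    have h2 : L₀ ^ a₃ ≤ L ^ a₃ := Real.rpow_le_rpow hL₀pos.le hL ha₃.le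
    have h3 : 0 < b s₀ ^ a₃ := by positivity
    linarith
  set D₁ : ℝ := A * L₀ ^ (1 + (a₃ - κ))
  set D₂ : ℝ := C₂ * 4 * Y * m ^ (1 - κ)
  refine ⟨max D₁ D₂, a₃ - κ, le_max_of_le_left (by positivity), by linarith,
    fun h m₀ v Dv hs hK L hL => ?_⟩
  have hLd : 0 < L ^ (1 + (a₃ - κ)) := by positivity
  have hcyl : ∀ k : ℝ, 0 ≤ k → ∀ {G : ℝ → ℝ}, G 0 = 0 →
      volume {z | k < G (v z)} ≤ ENNReal.ofReal A := by
    intro k hk G hG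
    rw [ENNReal.ofReal_toReal hs.fin.ne]
    refine measure_mono fun z hz => ?_
    by_contra hz'
    have h2 : k < G (v z) := hz
    rw [hs.zero_off z hz', hG] at h2
    linarith
  rcases lt_or_ge L L₀ with hLL | hLL
  · refine (hcyl L hL.le hs.zero).trans (ENNReal.ofReal_le_ofReal ?_)
    rw [le_div_iff₀ hLd]
    refine le_trans ?_ (le_max_left _ _)
    exact mul_le_mul_of_nonneg_left (Real.rpow_le_rpow hL.le hLL.le (by linarith)) hA
  · obtain ⟨F, DF, hW, hF, hFm, hDF⟩ := hs.exists_grad_rpow hK ha₃ hα hs₀ fun s h => (hg s h).2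
    have hK0 := hs.K_nonneg hK
    have hDF' : ∫⁻ z, ‖DF z‖ₑ ≤ ENNReal.ofReal Y := by
      refine hDF.trans ?_
      have h1 : ∫⁻ z, ENNReal.ofReal ((max (v z) 0) ^ p) ≤
          ENNReal.ofReal (A + p * C₁ / (r - p)) := by
        refine lintegral_rpow_le_of_weak (fun z => le_max_right _ _)
          (hs.meas.max measurable_const).aemeasurable hp hpr hA hC₁
          (fun k hk => hcyl k hk.le (G := fun s => max s 0) (by simp)) fun k hk => ?_
        refine (measure_mono fun z hz => ?_).trans (hlev h m₀ v Dv hs hK k hk)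
        have h2 : k < max (v z) 0 := hz
        exact (lt_max_iff.mp h2).resolve_right (by linarith)
      have h2 := hs.lintegral_b_le hK
      have h3 : ENNReal.ofReal (massBound Ω b K) * ENNReal.ofReal T ≤ ENNReal.ofReal (m * |T|) := by
        rw [ENNReal.ofReal_mul hm]
        exact mul_le_mul' (ENNReal.ofReal_le_ofReal (le_max_left _ _))
          (ENNReal.ofReal_le_ofReal (le_abs_self T))
      rw [hY, ENNReal.ofReal_mul ha₃.le, ENNReal.ofReal_add (by positivity) (by positivity),
        ENNReal.ofReal_add (by positivity) (by positivity), abs_of_nonneg hK0]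
      exact mul_le_mul_right (add_le_add (add_le_add (h2.trans h3) h1) le_rfl) _
    have hx : ENNReal.ofReal (L ^ a₃ / 4) ≠ 0 := by
      simp only [ne_eq, ENNReal.ofReal_eq_zero, not_le]
      positivity
    -- On a slice, the embedding of `W^{1,1}` bounds `|{b > L}|^κ` by a multiple of `L^(-a₃) ∫|DF|`,
    -- and the mass bounds the remaining power `1 - κ` through `m/L`. The total decay exponent `a₃ +
    -- 1 - κ` exceeds `1` precisely because `a₃ > (N-1)/N`.
    have hslice : ∀ᵐ t : ℝ, volume {x | L < b (v (x, t))} ≤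
        (ENNReal.ofReal (L ^ a₃ / 4))⁻¹ * (C₂ * ∫⁻ x, ‖DF (x, t)‖ₑ) *
          ENNReal.ofReal (m / L) ^ (1 - κ) := by
      filter_upwards [hW.ae_slice_sobolev hs.bdd le_rfl one_le_two hS, hs.ae_slice_level_le hK]
        with t h1 h2
      have hsub : volume {x | L < b (v (x, t))} ≤ volume {x | L ^ a₃ / 4 < |F (v (x, t))|} := by
        refine measure_mono fun x hx => ?_
        have h3 : L < b (v (x, t)) := hx
        have h4 : s₀ ≤ v (x, t) := (hs.mono.lt_iff_lt.mp (by linarith)).le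
        rw [mem_ofPred_eq, hF _ h4]
        refine lt_of_lt_of_le ?_ (le_abs_self _)
        have := hL₀' (b (v (x, t))) (by linarith)
        have h5 : L ^ a₃ ≤ b (v (x, t)) ^ a₃ := Real.rpow_le_rpow hL.le h3.le ha₃.le
        linarith
      rcases measure_eq_zero_or_mul_rpow_le (μ := volume) (f := fun x => F (v (x, t)))
        (hFm.comp (hs.meas.comp measurable_prodMk_right)).aestronglyMeasurable he
        (K := L ^ a₃ / 4) with h0 | h3
      · rw [nonpos_iff_eq_zero.mp (hsub.trans h0.le)]
        exact zero_le
      · rw [heN] at h3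
        have h4 := (mul_le_mul_right (ENNReal.rpow_le_rpow hsub hκ0) _).trans (h3.trans h1)
        rw [eLpNorm_one_eq_lintegral_enorm] at h4
        have h5 : volume {x | L < b (v (x, t))} ^ κ ≤
            (ENNReal.ofReal (L ^ a₃ / 4))⁻¹ * (C₂ * ∫⁻ x, ‖DF (x, t)‖ₑ) := by
          rw [← one_mul (volume {x | L < b (v (x, t))} ^ κ),
            ← ENNReal.inv_mul_cancel hx ENNReal.ofReal_ne_top, mul_assoc]
          gcongr
        calc volume {x | L < b (v (x, t))} = volume {x | L < b (v (x, t))} ^ κ *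
              volume {x | L < b (v (x, t))} ^ (1 - κ) := by
              rw [← ENNReal.rpow_add_of_nonneg _ _ hκ0 (by linarith), add_sub_cancel,
                ENNReal.rpow_one]
          _ ≤ _ := by
              refine mul_le_mul' h5 (ENNReal.rpow_le_rpow ((h2 L hL).trans ?_) (by linarith))
              exact ENNReal.ofReal_le_ofReal (by gcongr; exact le_max_left _ _)
    have hmeas : MeasurableSet {z | L < b (v z)} :=
      measurableSet_lt measurable_const (hs.cont.measurable.comp hs.meas)
    have h2 : volume {z | L < b (v z)} = ∫⁻ t, volume {x | L < b (v (x, t))} :=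
      Measure.prod_apply_symm hmeas
    have hDm : AEMeasurable (fun z => ‖DF z‖ₑ)
        ((volume : Measure (Space N)).prod (volume : Measure ℝ)) := hW.meas_grad.enorm
    rw [h2]
    refine (lintegral_mono_ae hslice).trans ?_
    rw [lintegral_mul_const'' _ ((hDm.lintegral_prod_left'.const_mul _).const_mul _),
      lintegral_const_mul'' _ (hDm.lintegral_prod_left'.const_mul _),
      lintegral_const_mul'' _ hDm.lintegral_prod_left', ← lintegral_prod_symm _ hDm]
    clear_value Y
    calc _ ≤ (ENNReal.ofReal (L ^ a₃ / 4))⁻¹ * (C₂ * ENNReal.ofReal Y) *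
          ENNReal.ofReal (m / L) ^ (1 - κ) := by
          gcongr
          exact hDF'
      _ = ENNReal.ofReal ((L ^ a₃ / 4)⁻¹ * (C₂ * Y) * (m / L) ^ (1 - κ)) := by
          rw [ENNReal.ofReal_mul (by positivity), ENNReal.ofReal_mul (by positivity),
            ENNReal.ofReal_mul (p := (C₂ : ℝ)) (by positivity),
            ENNReal.ofReal_inv_of_pos (by positivity), ENNReal.ofReal_coe_nnreal,
            ENNReal.ofReal_rpow_of_nonneg (by positivity) (by linarith)]
      _ ≤ _ := by
          refine ENNReal.ofReal_le_ofReal ?_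
          rw [le_div_iff₀ hLd]
          refine le_trans (le_of_eq ?_) (le_max_right _ _)
          have e1 : L ^ (1 + (a₃ - κ)) = L ^ a₃ * L ^ (1 - κ) := by
            rw [← Real.rpow_add hL]
            congr 1
            ring
          have e3 : 0 < L ^ (1 - κ) := by positivity
          have e4 : 0 < L ^ a₃ := by positivity
          rw [e1, Real.div_rpow hm hL.le]
          field_simp
          simp only [D₂]
          ring

end EllipticParabolic

/-! ### Two-sided bounds for the sequence -/

namespace EllipticParabolic
variable {N : ℕ} {Ω : Opens (Space N)} {T : ℝ} {b : ℝ → ℝ} {h v : ℕ → Space N × ℝ → ℝ}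
  {m : ℕ → ℝ} {Dv : ℕ → Space N × ℝ → Space N} {K a₁ : ℝ}

theorem exists_lintegral_b_rpow_le (hN : 1 ≤ N) (Ω : Opens (Space N)) (T : ℝ)
    (hB : ConditionB N b a₁) (K : ℝ) : ∃ d : ℝ, 0 < d ∧ ∀ p : ℝ, 0 < p → p < 1 + d →
      ∃ C : ℝ, 0 ≤ C ∧ ∀ h m₀ v Dv, Sol Ω T b h m₀ v Dv → (∫ z, |h z|) + (m₀ + 1) ≤ K →
        ∫⁻ z, ENNReal.ofReal ((max (b (v z)) 0) ^ p) ≤ ENNReal.ofReal C := by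
  obtain ⟨C, d, hC, hd, hlev⟩ := exists_level_b_le hN Ω T hB K
  refine ⟨d, hd, fun p hp hpd => ?_⟩
  have hpd' : 0 < 1 + d - p := by linarith
  refine ⟨(volume (cyl Ω T : Set (Space N × ℝ))).toReal + p * C / (1 + d - p), by positivity,
    fun h m₀ v Dv hs hK => ?_⟩
  have hset : ∀ k : ℝ, 0 < k → {z | k < max (b (v z)) 0} = {z | k < b (v z)} := by
    intro k hk
    ext z
    simp only [mem_ofPred_eq, lt_max_iff, or_iff_left hk.not_gt]
  refine lintegral_rpow_le_of_weak (f := fun z => max (b (v z)) 0) (fun z => le_max_right _ _)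
    ((hs.cont.measurable.comp hs.meas).max measurable_const).aemeasurable hp hpd
    ENNReal.toReal_nonneg hC (fun k hk => ?_) fun k hk => ?_
  · rw [hset k hk, ENNReal.ofReal_toReal hs.fin.ne]
    refine measure_mono fun z hz => ?_
    by_contra hz'
    have h2 : k < b (v z) := hz
    rw [hs.zero_off z hz', hs.zero] at h2
    linarith
  · rw [hset k hk]
    exact hlev h m₀ v Dv hs hK k hk

/-- The level set estimate for `|v_n|`. -/
theorem exists_abs_level_le (hN : 1 ≤ N) (hB : ConditionB N b a₁)
    (hs : ∀ n, Sol Ω T b (h n) (m n) (v n) (Dv n))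
    (hK : ∀ n, (∫ z, |h n z|) + (m n + 1) ≤ K)
    (hpos : (∀ n, ∀ᵐ z, 0 ≤ v n z) ∨ ConditionB N (fun s => -b (-s)) a₁) :
    ∃ C : ℝ, 0 ≤ C ∧ ∀ n, ∀ k : ℝ, 0 < k →
      volume {z | k < |v n z|} ≤ ENNReal.ofReal (C / k ^ (((N : ℝ) + 2 * a₁) / N)) := by
  obtain ⟨_, _, s₀, _, c, -, -, -, -, -, hc, hg⟩ := hB.exists_growth hN
  obtain ⟨C₁, hC₁, h1⟩ := exists_level_le hN Ω T hB.growth.1 hc (fun s hs => (hg s hs).1) K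
  rcases hpos with hpos | hB'
  · refine ⟨C₁, hC₁, fun n k hk => ?_⟩
    refine (measure_mono_ae ((hpos n).mono fun z hz hzk => ?_)).trans (h1 _ _ _ _ (hs n) (hK n) k hk)
    have h2 : k < |v n z| := hzk
    rwa [abs_of_nonneg hz] at h2
  · obtain ⟨_, _, s₀', _, c', -, -, -, -, -, hc', hg'⟩ := hB'.exists_growth hN
    obtain ⟨C₂, hC₂, h2⟩ := exists_level_le hN Ω T hB'.growth.1 hc' (fun s hs => (hg' s hs).1) K
    refine ⟨C₁ + C₂, by positivity, fun n k hk => ?_⟩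
    have hsub : {z | k < |v n z|} ⊆ {z | k < v n z} ∪ {z | k < -v n z} := by
      intro z hz
      have : k < |v n z| := hz
      exact lt_abs.mp this
    have hkr : 0 < k ^ (((N : ℝ) + 2 * a₁) / N) := by positivity
    rw [add_div, ENNReal.ofReal_add (by positivity) (by positivity)]
    exact (measure_mono hsub).trans ((measure_union_le _ _).trans (add_le_add
      (h1 _ _ _ _ (hs n) (hK n) k hk) (h2 _ _ _ _ (hs n).neg (by simpa using hK n) k hk)))

/-- The sequence `b (v_n)` is bounded in `L^p` for some `p > 1`. -/
theorem exists_lintegral_abs_b_rpow_le (hN : 1 ≤ N) (hB : ConditionB N b a₁)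
    (hs : ∀ n, Sol Ω T b (h n) (m n) (v n) (Dv n))
    (hK : ∀ n, (∫ z, |h n z|) + (m n + 1) ≤ K)
    (hpos : (∀ n, ∀ᵐ z, 0 ≤ v n z) ∨ ConditionB N (fun s => -b (-s)) a₁) :
    ∃ p C : ℝ, 1 < p ∧ ∀ n, ∫⁻ z, ENNReal.ofReal (|b (v n z)| ^ p) ≤ ENNReal.ofReal C := by
  obtain ⟨d₁, hd₁, h1⟩ := exists_lintegral_b_rpow_le hN Ω T hB K
  rcases hpos with hpos | hB'
  · obtain ⟨C, -, hC⟩ := h1 (1 + d₁ / 2) (by linarith) (by linarith)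
    refine ⟨1 + d₁ / 2, C, by linarith, fun n => ?_⟩
    refine (lintegral_mono_ae ((hpos n).mono fun z hz => ?_)).trans (hC _ _ _ _ (hs n) (hK n))
    have h2 : 0 ≤ b (v n z) := (hs n).zero ▸ (hs n).mono.monotone hz
    rw [abs_of_nonneg h2, max_eq_left h2]
  · obtain ⟨d₂, hd₂, h2⟩ := exists_lintegral_b_rpow_le hN Ω T hB' K
    have hd : 0 < min d₁ d₂ := lt_min hd₁ hd₂
    have hl := min_le_left d₁ d₂
    have hr := min_le_right d₁ d₂
    obtain ⟨C₁, hC₁, h1⟩ := h1 (1 + min d₁ d₂ / 2) (by linarith) (by linarith)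
    obtain ⟨C₂, hC₂, h2⟩ := h2 (1 + min d₁ d₂ / 2) (by linarith) (by linarith)
    refine ⟨1 + min d₁ d₂ / 2, C₁ + C₂, by linarith, fun n => ?_⟩
    rw [ENNReal.ofReal_add hC₁ hC₂]
    have h3 := h2 _ _ _ _ (hs n).neg (by simpa using hK n)
    simp only [neg_neg] at h3
    refine le_trans ?_ (add_le_add (h1 _ _ _ _ (hs n) (hK n)) h3)
    have hm : Measurable fun z => ENNReal.ofReal ((max (b (v n z)) 0) ^ (1 + min d₁ d₂ / 2)) :=
      ((((hs n).cont.measurable.comp (hs n).meas).max measurable_const).pow_const _).ennreal_ofReal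
    rw [← lintegral_add_left hm]
    refine lintegral_mono fun z => ?_
    have hp0 : 1 + min d₁ d₂ / 2 ≠ 0 := by linarith
    rcases le_total 0 (b (v n z)) with hb | hb
    · rw [abs_of_nonneg hb, max_eq_left hb]
      exact le_self_add
    · rw [abs_of_nonpos hb, max_eq_left (neg_nonneg.mpr hb)]
      exact le_add_self

end EllipticParabolic

/-! ### The renormalised time derivative -/

namespace EllipticParabolic
variable {N : ℕ}

namespace LipRight

variable {ψ ψ' : ℝ → ℝ} {L : ℝ}

theorem posPart (hψ : LipRight ψ ψ' L) (h1 : ∀ s, 0 ≤ s → 0 ≤ ψ s) (h2 : ∀ s, s ≤ 0 → ψ s ≤ 0) :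
    LipRight (fun s => max (ψ s) 0) (fun s => if 0 ≤ s then ψ' s else 0) L := by
  refine ⟨hψ.cont.max continuous_const, fun s => ?_, fun s => ?_⟩
  · split_ifs with hs
    · exact (hψ.deriv s).congr (fun y hy => max_eq_left (h1 y (hs.trans (le_of_lt hy))))
        (max_eq_left (h1 s hs))
    · push Not at hs
      refine (hasDerivWithinAt_const s (Ioi s) 0).congr_of_eventuallyEq ?_ (max_eq_right (h2 s hs.le))
      filter_upwards [mem_nhdsWithin_of_mem_nhds (Iio_mem_nhds hs)] with x hx
      exact max_eq_right (h2 x (le_of_lt hx))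
  · split_ifs
    · exact hψ.bound s
    · simpa using hψ.nonneg

theorem negPart (hψ : LipRight ψ ψ' L) (h1 : ∀ s, 0 ≤ s → 0 ≤ ψ s) (h2 : ∀ s, s ≤ 0 → ψ s ≤ 0) :
    LipRight (fun s => min (ψ s) 0) (fun s => if 0 ≤ s then 0 else ψ' s) L := by
  refine ⟨hψ.cont.min continuous_const, fun s => ?_, fun s => ?_⟩
  · split_ifs with hs
    · exact (hasDerivWithinAt_const s (Ioi s) 0).congr
        (fun y hy => min_eq_right (h1 y (hs.trans (le_of_lt hy)))) (min_eq_right (h1 s hs))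
    · push Not at hs
      refine (hψ.deriv s).congr_of_eventuallyEq ?_ (min_eq_left (h2 s hs.le))
      filter_upwards [mem_nhdsWithin_of_mem_nhds (Iio_mem_nhds hs)] with x hx
      exact min_eq_left (h2 x (le_of_lt hx))
  · split_ifs
    · simpa using hψ.nonneg
    · exact hψ.bound s

end LipRight

theorem exists_isTest_eq_one {U K : Set (Space N × ℝ)} (hU : IsOpen U) (hK : IsCompact K)
    (hKU : K ⊆ U) : ∃ χ : Space N × ℝ → ℝ, IsTest U χ ∧ (∀ z, 0 ≤ χ z ∧ χ z ≤ 1) ∧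
      ∀ z ∈ K, χ z = 1 := by
  obtain ⟨V, hV, hKV, hVU, hVc⟩ := exists_open_between_and_isCompact_closure hK hU hKU
  obtain ⟨f, hf, hf01, hfs, hf1⟩ := exists_contMDiff_support_eq_eq_one_iff
    (modelWithCornersSelf ℝ (Space N × ℝ)) hV hK.isClosed hKV
  refine ⟨f, ⟨hf.contDiff, ?_, ?_⟩, fun z => hf01 ⟨z, rfl⟩, fun z hz => (hf1 z).mp hz⟩
  · rw [HasCompactSupport, tsupport, hfs]
    exact hVc
  · rw [tsupport, hfs]
    exact hVU

theorem IsTest.exists_time_margin {Ω : Opens (Space N)} {T : ℝ} {φ : Space N × ℝ → ℝ}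
    (hφ : IsTest (cyl Ω T) φ) :
    ∃ δ > 0, tsupport φ ⊆ (Ω : Set (Space N)) ×ˢ Ioo δ (T - δ) := by
  have hK : IsCompact (Prod.snd '' tsupport φ) := hφ.compact.isCompact.image continuous_snd
  have hKU : Prod.snd '' tsupport φ ⊆ Ioo 0 T := by
    rintro _ ⟨z, hz, rfl⟩
    exact (hφ.supp hz).2
  obtain ⟨δ, hδ, hδ'⟩ := hK.exists_cthickening_subset_open isOpen_Ioo hKU
  refine ⟨δ, hδ, fun z hz => ⟨(hφ.supp hz).1, ?_⟩⟩
  have hz' : z.2 ∈ Prod.snd '' tsupport φ := ⟨z, hz, rfl⟩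
  have h1 : z.2 - δ ∈ Ioo 0 T := hδ' (Metric.mem_cthickening_of_dist_le _ _ _ _ hz' (by
    simp [abs_of_pos hδ]))
  have h2 : z.2 + δ ∈ Ioo 0 T := hδ' (Metric.mem_cthickening_of_dist_le _ _ _ _ hz' (by
    simp [abs_of_pos hδ]))
  exact ⟨by linarith [h1.1], by linarith [h2.2]⟩

variable {Ω : Opens (Space N)} {T m₀ : ℝ} {b : ℝ → ℝ} {h v : Space N × ℝ → ℝ}
  {Dv : Space N × ℝ → Space N}

namespace Sol

variable {ψ ψ' : ℝ → ℝ} {L : ℝ}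

theorem integrable_prim_mul (hs : Sol Ω T b h m₀ v Dv) (hψ : LipRight ψ ψ' L)
    {φ : Space N × ℝ → ℝ} (hφ : IsTest (cyl Ω T) φ) :
    Integrable (fun z => prim b ψ ψ' (v z) * timeDeriv φ z) volume := by
  have h1 := memLp_one_iff_integrable.mp
    (hs.memLp_comp (continuous_prim hs.cont hψ) (prim_zero hs.zero) 1)
  have hφ1 : ContDiff ℝ 1 φ := hφ.smooth.of_le (by norm_cast)
  obtain ⟨C, hC⟩ := bounded_timeDeriv hφ1 hφ.compact
  exact h1.mul_bdd (c := C) (continuous_timeDeriv hφ1).aestronglyMeasurable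
    (Eventually.of_forall hC)

theorem integrable_source_mul (hs : Sol Ω T b h m₀ v Dv) (hψ : Continuous ψ)
    (h1 : ∀ s, |ψ s| ≤ 1) {φ : Space N × ℝ → ℝ} (hφ : IsTest (cyl Ω T) φ) :
    Integrable (fun z => h z * (φ z * ψ (v z))) volume := by
  obtain ⟨C, hC⟩ := hφ.compact.exists_bound_of_continuous hφ.continuous
  refine hs.source_one.mul_bdd (c := C) (hφ.continuous.aestronglyMeasurable.mul
    (hψ.measurable.comp hs.meas).aestronglyMeasurable) (Eventually.of_forall fun z => ?_)
  rw [norm_mul]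
  exact (mul_le_of_le_one_right (norm_nonneg _) (h1 _)).trans (hC z)

theorem integrable_deriv_mul (hs : Sol Ω T b h m₀ v Dv) (hψ : LipRight ψ ψ' L)
    {φ : Space N × ℝ → ℝ} (hφ : IsTest (cyl Ω T) φ) :
    Integrable (fun z => φ z * (ψ' (v z) * ‖Dv z‖ ^ 2)) volume := by
  obtain ⟨C, hC⟩ := hφ.compact.exists_bound_of_continuous hφ.continuous
  exact (hs.integrable_grad_sq hψ.measurable_deriv hψ.bound).bdd_mul (c := C)
    hφ.continuous.aestronglyMeasurable (Eventually.of_forall hC)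

theorem integrable_flux_mul (hs : Sol Ω T b h m₀ v Dv) (hψ : Continuous ψ)
    (h1 : ∀ s, |ψ s| ≤ 1) {φ : Space N × ℝ → ℝ} (hφ : IsTest (cyl Ω T) φ) :
    Integrable (fun z => ψ (v z) * inner ℝ (Dv z) (spaceGrad φ z)) volume :=
  (integrable_inner hs.mem.memLp_grad (hφ.memLp_grad 2)).bdd_mul (c := 1)
    (hψ.measurable.comp hs.meas).aestronglyMeasurable (Eventually.of_forall fun _ => h1 _)

theorem chain_test_nonneg (hs : Sol Ω T b h m₀ v Dv) (hψ : LipRight ψ ψ' L) (hm : Monotone ψ)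
    (h0 : ψ 0 = 0) (h1 : ∀ s, |ψ s| ≤ 1) {φ : Space N × ℝ → ℝ} (hφ : IsTest (cyl Ω T) φ)
    (hφ0 : ∀ z, 0 ≤ φ z) :
    -∫ z, prim b ψ ψ' (v z) * timeDeriv φ z = (∫ z, h z * (φ z * ψ (v z))) -
      (∫ z, φ z * (ψ' (v z) * ‖Dv z‖ ^ 2)) -
      ∫ z, ψ (v z) * inner ℝ (Dv z) (spaceGrad φ z) := by
  obtain ⟨δ, hδ, hsupp⟩ := hφ.exists_time_margin
  have hφ1 : ContDiff ℝ 1 φ := hφ.smooth.of_le (by norm_cast)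
  obtain ⟨C₁, hC₁⟩ := hφ.compact.exists_bound_of_continuous hφ.continuous
  obtain ⟨C₂, hC₂⟩ := hφ.compact_grad.exists_bound_of_continuous hφ.continuous_grad
  obtain ⟨C₃, hC₃⟩ := bounded_timeDeriv hφ1 hφ.compact
  have hW := (hs.mem.comp hψ h0).mul hφ.smooth (C := max C₁ C₂)
    (fun z => (hC₁ z).trans (le_max_left _ _)) (fun z => (hC₂ z).trans (le_max_right _ _))
    (inter_subset_left.trans hsupp)
  have h2 := hs.time_chain (continuous_prim hs.cont hψ) (prim_zero hs.zero)
    (prim_sub_ge hs.cont hs.mono.monotone hψ hm) hφ1 hφ0 (C := max C₁ C₃)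
    (fun z => (hC₁ z).trans (le_max_left _ _)) (fun z => (hC₃ z).trans (le_max_right _ _)) hδ
    (by linarith) hW
  rw [h2, sub_sub, ← integral_add (hs.integrable_deriv_mul hψ hφ)
    (hs.integrable_flux_mul hψ.cont h1 hφ)]
  congr 2
  ext z
  rw [inner_add_right, inner_smul_right, inner_smul_right, inner_smul_right,
    real_inner_self_eq_norm_sq]

/-- The minimum argument behind `Sol.time_chain` needs a nonnegative test function, but the identity
is linear in it. It is therefore applied to `Cχ` and `φ + Cχ`, with `χ = 1` on the support of `φ`
and `C ≥ |φ|`, and subtracted. -/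
theorem chain_test (hs : Sol Ω T b h m₀ v Dv) (hψ : LipRight ψ ψ' L) (hm : Monotone ψ)
    (h0 : ψ 0 = 0) (h1 : ∀ s, |ψ s| ≤ 1) {φ : Space N × ℝ → ℝ} (hφ : IsTest (cyl Ω T) φ) :
    -∫ z, prim b ψ ψ' (v z) * timeDeriv φ z = (∫ z, h z * (φ z * ψ (v z))) -
      (∫ z, φ z * (ψ' (v z) * ‖Dv z‖ ^ 2)) -
      ∫ z, ψ (v z) * inner ℝ (Dv z) (spaceGrad φ z) := by
  obtain ⟨C, hC⟩ := hφ.compact.exists_bound_of_continuous hφ.continuous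
  obtain ⟨χ, hχ, hχ0, hχ1⟩ := exists_isTest_eq_one (cyl Ω T).isOpen hφ.compact.isCompact hφ.supp
  have hC0 : 0 ≤ C := (norm_nonneg _).trans (hC 0)
  have hχ' := hχ.const_mul C
  have hsum := hφ.add hχ'
  have e1 := hs.chain_test_nonneg hψ hm h0 h1 hχ' fun z => mul_nonneg hC0 (hχ0 z).1
  have e2 := hs.chain_test_nonneg hψ hm h0 h1 hsum fun z => by
    by_cases hz : z ∈ tsupport φ
    · rw [hχ1 z hz]
      have := neg_le_of_abs_le (hC z)
      linarith
    · rw [image_eq_zero_of_notMem_tsupport hz]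
      have := mul_nonneg hC0 (hχ0 z).1
      linarith
  have t1 : ∀ z, timeDeriv (fun z => φ z + C * χ z) z =
      timeDeriv φ z + timeDeriv (fun z => C * χ z) z := by
    intro z
    rw [timeDeriv_eq_fderiv (hsum.differentiable z), timeDeriv_eq_fderiv (hφ.differentiable z),
      timeDeriv_eq_fderiv (hχ'.differentiable z)]
    rw [fderiv_fun_add (hφ.differentiable z) (hχ'.differentiable z)]
    rfl
  have a1 : ∫ z, prim b ψ ψ' (v z) * timeDeriv (fun z => φ z + C * χ z) z =
      (∫ z, prim b ψ ψ' (v z) * timeDeriv φ z) +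
      ∫ z, prim b ψ ψ' (v z) * timeDeriv (fun z => C * χ z) z := by
    rw [← integral_add (hs.integrable_prim_mul hψ hφ) (hs.integrable_prim_mul hψ hχ')]
    congr 1
    ext z
    rw [t1, mul_add]
  have a2 : ∫ z, h z * ((φ z + C * χ z) * ψ (v z)) = (∫ z, h z * (φ z * ψ (v z))) +
      ∫ z, h z * (C * χ z * ψ (v z)) := by
    rw [← integral_add (hs.integrable_source_mul hψ.cont h1 hφ)
      (hs.integrable_source_mul hψ.cont h1 hχ')]
    congr 1
    ext z
    ring
  have a3 : ∫ z, (φ z + C * χ z) * (ψ' (v z) * ‖Dv z‖ ^ 2) =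
      (∫ z, φ z * (ψ' (v z) * ‖Dv z‖ ^ 2)) + ∫ z, C * χ z * (ψ' (v z) * ‖Dv z‖ ^ 2) := by
    rw [← integral_add (hs.integrable_deriv_mul hψ hφ) (hs.integrable_deriv_mul hψ hχ')]
    congr 1
    ext z
    ring
  have a4 : ∫ z, ψ (v z) * inner ℝ (Dv z) (spaceGrad (fun z => φ z + C * χ z) z) =
      (∫ z, ψ (v z) * inner ℝ (Dv z) (spaceGrad φ z)) +
      ∫ z, ψ (v z) * inner ℝ (Dv z) (spaceGrad (fun z => C * χ z) z) := by
    rw [← integral_add (hs.integrable_flux_mul hψ.cont h1 hφ)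
      (hs.integrable_flux_mul hψ.cont h1 hχ')]
    congr 1
    ext z
    rw [spaceGrad_add hφ.differentiable hχ'.differentiable, inner_add_right, mul_add]
  rw [a1, a2, a3, a4] at e2
  linarith

end Sol

/-- The function `s / (1 + |s|)`. -/
noncomputable def sat (s : ℝ) : ℝ := oddExt (fun s => s / (1 + s)) s

theorem lipRight_sat : LipRight sat (fun s => 1 / (1 + |s|) ^ 2) 1 := by
  have h := LipRight.frac one_pos
  rw [one_div_one] at h
  exact h

theorem sat_nonneg {s : ℝ} (hs : 0 ≤ s) : 0 ≤ sat s := by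
  rw [sat, oddExt, if_pos hs]
  positivity

theorem sat_nonpos {s : ℝ} (hs : s ≤ 0) : sat s ≤ 0 := by
  rcases hs.eq_or_lt with rfl | hs
  · simp [sat, oddExt]
  · rw [sat, oddExt, if_neg (not_le.mpr hs), neg_nonpos]
    have : 0 < -s := by linarith
    positivity

theorem monotone_sat : Monotone sat :=
  lipRight_sat.monotone_of_nonneg fun s => by positivity

theorem one_sub_abs_sat (s : ℝ) : 1 - |sat s| = 1 / (1 + |s|) := by
  rcases le_total 0 s with hs | hs
  · rw [abs_of_nonneg (sat_nonneg hs), abs_of_nonneg hs, sat, oddExt, if_pos hs]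
    field_simp
    ring
  · rcases hs.eq_or_lt with rfl | hs
    · simp [sat, oddExt]
    · rw [abs_of_nonpos (sat_nonpos hs.le), abs_of_neg hs, sat, oddExt, if_neg (not_le.mpr hs)]
      have : 0 < -s := by linarith
      field_simp
      ring

/-- The renormalisation `∫₀ˢ db (r) / (1 + |r|)` of `b`. -/
noncomputable def renorm (b : ℝ → ℝ) (s : ℝ) : ℝ :=
  b s + prim b (fun s => min (sat s) 0) (fun s => if 0 ≤ s then 0 else 1 / (1 + |s|) ^ 2) s -
    prim b (fun s => max (sat s) 0) (fun s => if 0 ≤ s then 1 / (1 + |s|) ^ 2 else 0) s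

/-- The density `1/(1+|s|)` of the renormalisation is `1 - |sat s|`, and `-|sat|` is not monotone.
Writing it as `min(sat, 0) - max(sat, 0)` gives two monotone functions, to each of which the chain
rule applies. -/
theorem lipRight_sat_neg : LipRight (fun s => min (sat s) 0)
    (fun s => if 0 ≤ s then 0 else 1 / (1 + |s|) ^ 2) 1 :=
  lipRight_sat.negPart (fun _ => sat_nonneg) fun _ => sat_nonpos

theorem lipRight_sat_pos : LipRight (fun s => max (sat s) 0)
    (fun s => if 0 ≤ s then 1 / (1 + |s|) ^ 2 else 0) 1 :=
  lipRight_sat.posPart (fun _ => sat_nonneg) fun _ => sat_nonpos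

theorem continuous_renorm (hb : Continuous b) : Continuous (renorm b) :=
  (hb.add (continuous_prim hb lipRight_sat_neg)).sub (continuous_prim hb lipRight_sat_pos)

theorem renorm_zero (hb0 : b 0 = 0) : renorm b 0 = 0 := by
  simp [renorm, prim_zero hb0, hb0]

/-- The convexity inequality for the negative part at `r` and for the positive part at `s` bounds
the increment below by `(b(s) - b(r))(1 + min(sat r, 0) - max(sat s, 0))`. Without a sign change
between `r` and `s` only one correction is active, and `|sat| < 1` makes the factor positive; other
intervals are split at `0`. -/
theorem strictMono_renorm (hb : Continuous b) (hbm : StrictMono b) : StrictMono (renorm b) := by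
  have hn : Monotone fun s => min (sat s) 0 := fun r s hrs => min_le_min_right _ (monotone_sat hrs)
  have hp : Monotone fun s => max (sat s) 0 := fun r s hrs => max_le_max_right _ (monotone_sat hrs)
  have key : ∀ r s, r < s → (0 ≤ r ∨ s ≤ 0) → renorm b r < renorm b s := by
    intro r s hrs h0
    have h1 := prim_sub_ge hb hbm.monotone lipRight_sat_neg hn r s
    have h2 := prim_sub_ge hb hbm.monotone lipRight_sat_pos hp s r
    have h3 : 0 < 1 + min (sat r) 0 - max (sat s) 0 := by
      have pr : 0 < 1 - |sat r| := by rw [one_sub_abs_sat]; positivity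
      have ps : 0 < 1 - |sat s| := by rw [one_sub_abs_sat]; positivity
      rcases h0 with h0 | h0
      · rw [min_eq_right (sat_nonneg h0), max_eq_left (sat_nonneg (h0.trans hrs.le))]
        linarith [le_abs_self (sat s)]
      · rw [max_eq_right (sat_nonpos h0), min_eq_left (sat_nonpos (hrs.le.trans h0))]
        linarith [neg_abs_le (sat r)]
    have h4 : 0 < b s - b r := sub_pos.mpr (hbm hrs)
    simp only [renorm]
    nlinarith
  intro r s hrs
  by_cases h0 : 0 ≤ r ∨ s ≤ 0
  · exact key r s hrs h0
  · push Not at h0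
    exact (key r 0 h0.1 (Or.inr le_rfl)).trans (key 0 s h0.2 (Or.inl le_rfl))

namespace Sol

/-- The renormalised time derivative, tested with a bounded test function. -/
theorem abs_integral_renorm_le (hs : Sol Ω T b h m₀ v Dv) {K : ℝ}
    (hK : (∫ z, |h z|) + (m₀ + 1) ≤ K) {φ : Space N × ℝ → ℝ} (hφ : IsTest (cyl Ω T) φ) {c : ℝ}
    (hc : ∀ z, |φ z| ≤ c) :
    |∫ z, renorm b (v z) * timeDeriv φ z| ≤
      2 * c * K + √K * (eLpNorm (spaceGrad φ) 2 volume).toReal := by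
  have hn : Monotone fun s => min (sat s) 0 := fun r s hrs => min_le_min_right _ (monotone_sat hrs)
  have hp : Monotone fun s => max (sat s) 0 := fun r s hrs => max_le_max_right _ (monotone_sat hrs)
  have sat0 : sat 0 = 0 := by simp [sat, oddExt]
  have hsat : ∀ s, |sat s| ≤ 1 := abs_oddExt_frac_le one_pos
  have hn1 : ∀ s, |min (sat s) 0| ≤ 1 := fun s => by
    have := abs_le.mp (hsat s)
    rw [abs_le]
    exact ⟨le_min this.1 (by norm_num), (min_le_right _ _).trans zero_le_one⟩
  have hp1 : ∀ s, |max (sat s) 0| ≤ 1 := fun s => by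
    have := abs_le.mp (hsat s)
    rw [abs_le]
    exact ⟨le_trans (by norm_num) (le_max_right _ _), max_le this.2 zero_le_one⟩
  have h1c : ∀ s : ℝ, |(fun _ => (1 : ℝ)) s| ≤ 1 := by simp
  -- The combination `c0 + c1 - c2` is the equation for the renormalisation: source `h(1 - |sat
  -- v|)`, flux `(1 - |sat v|)∇v` and a defect of absolute value `|∇v|²/(1+|v|)²`. As `(1 - |sat|)²
  -- = sat'`, the energy estimate with `ψ = sat` bounds both the defect in `L¹` and the flux in
  -- `L²`.
  have c0 := hs.eqn φ hφ
  have c1 := hs.chain_test lipRight_sat_neg hn (by simp [sat0]) hn1 hφ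
  have c2 := hs.chain_test lipRight_sat_pos hp (by simp [sat0]) hp1 hφ
  have hφ1 : ContDiff ℝ 1 φ := hφ.smooth.of_le (by norm_cast)
  obtain ⟨C, hC⟩ := bounded_timeDeriv hφ1 hφ.compact
  have ib : Integrable (fun z => b (v z) * timeDeriv φ z) volume :=
    (memLp_one_iff_integrable.mp (hs.memLp_comp hs.cont hs.zero 1)).mul_bdd (c := C)
      (continuous_timeDeriv hφ1).aestronglyMeasurable (Eventually.of_forall hC)
  have i1 := hs.integrable_prim_mul lipRight_sat_neg hφ
  have i2 := hs.integrable_prim_mul lipRight_sat_pos hφ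
  have e0 : ∫ z, renorm b (v z) * timeDeriv φ z = (∫ z, b (v z) * timeDeriv φ z) +
      (∫ z, prim b (fun s => min (sat s) 0)
        (fun s => if 0 ≤ s then 0 else 1 / (1 + |s|) ^ 2) (v z) * timeDeriv φ z) -
      ∫ z, prim b (fun s => max (sat s) 0)
        (fun s => if 0 ≤ s then 1 / (1 + |s|) ^ 2 else 0) (v z) * timeDeriv φ z := by
    have i01 : Integrable (fun z => b (v z) * timeDeriv φ z + prim b (fun s => min (sat s) 0)
        (fun s => if 0 ≤ s then 0 else 1 / (1 + |s|) ^ 2) (v z) * timeDeriv φ z) volume := ib.add i1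
    rw [← integral_add ib i1, ← integral_sub i01 i2]
    congr 1
    ext z
    simp only [renorm]
    ring
  have s0 : Integrable (fun z => h z * φ z) volume := by
    simpa using hs.integrable_source_mul continuous_const h1c hφ
  have s1 := hs.integrable_source_mul lipRight_sat_neg.cont hn1 hφ
  have s2 := hs.integrable_source_mul lipRight_sat_pos.cont hp1 hφ
  have e1 : (∫ z, h z * φ z) + (∫ z, h z * (φ z * min (sat (v z)) 0)) -
      (∫ z, h z * (φ z * max (sat (v z)) 0)) = ∫ z, h z * (φ z * (1 - |sat (v z)|)) := by
    have s01 : Integrable (fun z => h z * φ z + h z * (φ z * min (sat (v z)) 0)) volume := s0.add s1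
    rw [← integral_add s0 s1, ← integral_sub s01 s2]
    congr 1
    ext z
    rcases le_total 0 (sat (v z)) with h | h
    · rw [min_eq_right h, max_eq_left h, abs_of_nonneg h]; ring
    · rw [min_eq_left h, max_eq_right h, abs_of_nonpos h]; ring
  have d1 := hs.integrable_deriv_mul lipRight_sat_neg hφ
  have d2 := hs.integrable_deriv_mul lipRight_sat_pos hφ
  have d0 := hs.integrable_grad_sq lipRight_sat.measurable_deriv lipRight_sat.bound
  have f0 : Integrable (fun z => inner ℝ (Dv z) (spaceGrad φ z)) volume :=
    integrable_inner hs.mem.memLp_grad (hφ.memLp_grad 2)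
  have f1 := hs.integrable_flux_mul lipRight_sat_neg.cont hn1 hφ
  have f2 := hs.integrable_flux_mul lipRight_sat_pos.cont hp1 hφ
  have e3 : (∫ z, inner ℝ (Dv z) (spaceGrad φ z)) +
      (∫ z, min (sat (v z)) 0 * inner ℝ (Dv z) (spaceGrad φ z)) -
      (∫ z, max (sat (v z)) 0 * inner ℝ (Dv z) (spaceGrad φ z)) =
      ∫ z, inner ℝ ((1 - |sat (v z)|) • Dv z) (spaceGrad φ z) := by
    have f01 : Integrable (fun z => inner ℝ (Dv z) (spaceGrad φ z) +
        min (sat (v z)) 0 * inner ℝ (Dv z) (spaceGrad φ z)) volume := f0.add f1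
    rw [← integral_add f0 f1, ← integral_sub f01 f2]
    congr 1
    ext z
    simp only [inner_smul_left, conj_trivial]
    rcases le_total 0 (sat (v z)) with h | h
    · rw [min_eq_right h, max_eq_left h, abs_of_nonneg h]; ring
    · rw [min_eq_left h, max_eq_right h, abs_of_nonpos h]; ring
  have hE := (hs.energy lipRight_sat monotone_sat sat0 hsat).trans hK
  have hc0 : 0 ≤ c := (abs_nonneg _).trans (hc 0)
  -- the source term
  have b1 : |∫ z, h z * (φ z * (1 - |sat (v z)|))| ≤ c * ∫ z, |h z| := by
    rw [← integral_const_mul]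
    refine (abs_integral_le_integral_abs).trans (integral_mono_of_nonneg
      (Eventually.of_forall fun z => abs_nonneg _) (hs.source_one.abs.const_mul c)
      (Eventually.of_forall fun z => ?_))
    simp only [abs_mul]
    have h1 : |(1 - |sat (v z)|)| ≤ 1 := by
      rw [abs_le]
      constructor <;> linarith [hsat (v z), abs_nonneg (sat (v z))]
    calc |h z| * (|φ z| * |(1 - |sat (v z)|)|) ≤ |h z| * (c * 1) := by
          gcongr
          exact hc z
      _ = c * |h z| := by ring
  -- the absorption term
  have b2 : |(∫ z, φ z * ((if 0 ≤ v z then 0 else 1 / (1 + |v z|) ^ 2) * ‖Dv z‖ ^ 2)) -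
      ∫ z, φ z * ((if 0 ≤ v z then 1 / (1 + |v z|) ^ 2 else 0) * ‖Dv z‖ ^ 2)| ≤ c * K := by
    rw [← integral_sub d1 d2]
    refine (abs_integral_le_integral_abs).trans (le_trans (integral_mono_of_nonneg
      (Eventually.of_forall fun z => abs_nonneg _) (d0.const_mul c)
      (Eventually.of_forall fun z => ?_)) ?_)
    · have h2 : |φ z * ((if 0 ≤ v z then 0 else 1 / (1 + |v z|) ^ 2) * ‖Dv z‖ ^ 2) -
          φ z * ((if 0 ≤ v z then 1 / (1 + |v z|) ^ 2 else 0) * ‖Dv z‖ ^ 2)| =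
          |φ z| * (1 / (1 + |v z|) ^ 2 * ‖Dv z‖ ^ 2) := by
        have h3 : 0 ≤ 1 / (1 + |v z|) ^ 2 * ‖Dv z‖ ^ 2 := by positivity
        rw [← mul_sub, abs_mul]
        congr 1
        split_ifs
        · rw [zero_mul, zero_sub, abs_neg, abs_of_nonneg h3]
        · rw [zero_mul, sub_zero, abs_of_nonneg h3]
      simp only [h2]
      gcongr
      exact hc z
    · rw [integral_const_mul]
      exact mul_le_mul_of_nonneg_left hE hc0
  -- the flux term
  have hm1 : AEStronglyMeasurable (fun z => (1 - |sat (v z)|) • Dv z) volume :=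
    (((continuous_const.sub lipRight_sat.cont.abs).measurable.comp
      hs.meas).aestronglyMeasurable).smul hs.mem.meas_grad
  have hG : MemLp (fun z => (1 - |sat (v z)|) • Dv z) 2 volume :=
    hs.mem.memLp_grad.of_le hm1 (Eventually.of_forall fun z => by
      rw [norm_smul, Real.norm_eq_abs]
      refine mul_le_of_le_one_left (norm_nonneg _) ?_
      rw [abs_le]
      constructor <;> linarith [hsat (v z), abs_nonneg (sat (v z))])
  have b3 : |∫ z, inner ℝ ((1 - |sat (v z)|) • Dv z) (spaceGrad φ z)| ≤
      √K * (eLpNorm (spaceGrad φ) 2 volume).toReal := by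
    refine (abs_integral_inner_le hG (hφ.memLp_grad 2)).trans
      (mul_le_mul_of_nonneg_right ?_ ENNReal.toReal_nonneg)
    rw [eLpNorm_two_toReal hG]
    refine Real.sqrt_le_sqrt (le_trans (le_of_eq ?_) hE)
    congr 1
    ext z
    rw [one_sub_abs_sat, norm_smul, mul_pow, Real.norm_eq_abs, sq_abs]
    field_simp
  have hh : c * ∫ z, |h z| ≤ c * K := mul_le_mul_of_nonneg_left
    (by linarith [hs.m_nonneg]) hc0
  rw [e0]
  rw [abs_le] at b1 b2 b3 ⊢
  constructor <;> linarith

end Sol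

end EllipticParabolic

/-! ### Time differences of the renormalised solution -/

namespace EllipticParabolic
variable {N : ℕ} {Ω : Opens (Space N)} {T m₀ : ℝ} {b : ℝ → ℝ} {h v : Space N × ℝ → ℝ}
  {Dv : Space N × ℝ → Space N}

theorem abs_arctan_le (s : ℝ) : |Real.arctan s| ≤ 2 := by
  have := Real.pi_le_four
  rw [abs_le]
  constructor <;> linarith [Real.arctan_lt_pi_div_two s, Real.neg_pi_div_two_lt_arctan s]

theorem abs_deriv_arctan_le (s : ℝ) : |deriv Real.arctan s| ≤ 1 := by
  rw [Real.deriv_arctan, abs_of_nonneg (by positivity)]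
  exact (div_le_one (by positivity)).mpr (by nlinarith)

theorem eLpNorm_shift {F : Type*} [NormedAddCommGroup F] {f : Space N × ℝ → F}
    (hf : AEStronglyMeasurable f volume) (p : ℝ≥0∞) (a : Space N × ℝ) :
    eLpNorm (fun z => f (z + a)) p volume = eLpNorm f p volume :=
  eLpNorm_comp_measurePreserving hf (measurePreserving_shift a)

namespace Sol

theorem mem_arctan (hs : Sol Ω T b h m₀ v Dv) :
    W0 (cyl Ω T) (fun z => Real.arctan (v z)) (fun z => deriv Real.arctan (v z) • Dv z) :=
  hs.mem.comp_smooth Real.contDiff_arctan Real.arctan_zero abs_deriv_arctan_le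

theorem eLpNorm_grad_arctan_le (hs : Sol Ω T b h m₀ v Dv) {K : ℝ}
    (hK : (∫ z, |h z|) + (m₀ + 1) ≤ K) :
    (eLpNorm (fun z => deriv Real.arctan (v z) • Dv z) 2 volume).toReal ≤ √(2 * K) := by
  rw [eLpNorm_two_toReal hs.mem_arctan.memLp_grad]
  refine Real.sqrt_le_sqrt ?_
  have h1 := (hs.integral_weighted_le one_pos).trans
    (mul_le_mul_of_nonneg_left hK (by positivity))
  rw [inv_one, one_mul] at h1
  refine le_trans ?_ (mul_le_mul_of_nonneg_left h1 zero_le_two)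
  rw [← integral_const_mul]
  refine integral_mono_of_nonneg (Eventually.of_forall fun z => by positivity)
    ((hs.integrable_weighted one_pos).const_mul 2) (Eventually.of_forall fun z => ?_)
  simp only [norm_smul, Real.norm_eq_abs, Real.deriv_arctan]
  have e : ((1 : ℝ) + 1) = ((2 : ℕ) : ℝ) := by norm_num
  rw [e, Real.rpow_natCast, mul_pow, sq_abs, ← mul_div_assoc, div_pow, one_pow, one_div_mul_eq_div,
    div_le_div_iff₀ (by positivity) (by positivity)]
  have h2 : (1 + |v z|) ^ 2 ≤ 2 * (1 + v z ^ 2) ^ 2 := by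
    nlinarith [sq_abs (v z), sq_nonneg (|v z| - 1), sq_nonneg (v z), sq_nonneg (v z ^ 2)]
  nlinarith [sq_nonneg ‖Dv z‖, mul_le_mul_of_nonneg_left h2 (sq_nonneg ‖Dv z‖)]

theorem memLp_renorm (hs : Sol Ω T b h m₀ v Dv) (p : ℝ≥0∞) :
    MemLp (fun z => renorm b (v z)) p volume :=
  hs.memLp_comp (continuous_renorm hs.cont) (renorm_zero hs.zero) p

theorem abs_integral_renorm_shift_le (hs : Sol Ω T b h m₀ v Dv) {K : ℝ}
    (hK : (∫ z, |h z|) + (m₀ + 1) ≤ K) {δ : ℝ} {φ : Space N × ℝ → ℝ}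
    (hφ : IsTest ((Ω : Set (Space N)) ×ˢ Ioo δ (T - δ)) φ) {c : ℝ} (hc : ∀ z, |φ z| ≤ c)
    {s : ℝ} (hsδ : |s| ≤ δ) :
    |∫ z, renorm b (v z) * (φ z - φ (z + (0, s)))| ≤
      |s| * (2 * c * K + √K * (eLpNorm (spaceGrad φ) 2 volume).toReal) := by
  obtain ⟨ξ, hξ, e⟩ := exists_shift_eq (memLp_one_iff_integrable.mp (hs.memLp_renorm 1)) hφ s
  have h1 : IsTest (cyl Ω T) (fun z => φ (z + (0, ξ))) := hφ.shift _ fun z hz => by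
    have hz1 : z.1 + 0 ∈ Ω := hz.1
    have hz2 : z.2 + ξ ∈ Ioo δ (T - δ) := hz.2
    have h3 := abs_le.mp (hξ.trans hsδ)
    refine mem_cyl.mpr ⟨by simpa using hz1, ?_, ?_⟩ <;> linarith [hz2.1, hz2.2, h3.1, h3.2]
  have h2 := hs.abs_integral_renorm_le hK h1 fun z => hc _
  simp only [timeDeriv_shift] at h2
  have h3 : (spaceGrad fun z => φ (z + (0, ξ))) = fun z => spaceGrad φ (z + (0, ξ)) :=
    funext fun z => spaceGrad_shift φ _ z
  rw [h3, eLpNorm_shift hφ.continuous_grad.aestronglyMeasurable] at h2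
  rw [e, abs_mul, abs_neg]
  exact mul_le_mul_of_nonneg_left h2 (abs_nonneg _)

/-- The duality estimate involves the sup norm of the test function, which is not controlled by `L²`
convergence; so the approximants must share one bound `c`. -/
theorem abs_integral_renorm_shift_le_of_tendsto (hs : Sol Ω T b h m₀ v Dv) {K : ℝ}
    (hK : (∫ z, |h z|) + (m₀ + 1) ≤ K) {δ : ℝ} {φ : ℕ → Space N × ℝ → ℝ}
    (hφ : ∀ k, IsTest ((Ω : Set (Space N)) ×ˢ Ioo δ (T - δ)) (φ k)) {c : ℝ}
    (hc : ∀ k z, |φ k z| ≤ c) {f : Space N × ℝ → ℝ} {Df : Space N × ℝ → Space N}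
    (hf : MemLp f 2 volume) (hDf : MemLp Df 2 volume)
    (h1 : Tendsto (fun k => eLpNorm (φ k - f) 2 volume) atTop (𝓝 0))
    (h2 : Tendsto (fun k => eLpNorm (spaceGrad (φ k) - Df) 2 volume) atTop (𝓝 0))
    {s : ℝ} (hsδ : |s| ≤ δ) :
    |∫ z, renorm b (v z) * (f z - f (z + (0, s)))| ≤
      |s| * (2 * c * K + √K * (eLpNorm Df 2 volume).toReal) := by
  have hφ2 : ∀ k, MemLp (φ k) 2 volume := fun k => (hφ k).memLp 2
  have t1 := tendsto_integral_inner (hs.memLp_renorm 2) hφ2 hf h1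
  have t2 := tendsto_integral_inner (hs.memLp_renorm 2)
    (fun k => memLp_shift (hφ2 k) ((0 : Space N), s)) (memLp_shift hf ((0 : Space N), s)) (by
      refine h1.congr fun k => ?_
      exact (eLpNorm_shift ((hφ2 k).sub hf).1 2 _).symm)
  have t3 := tendsto_integral_inner hDf (fun k => (hφ k).memLp_grad 2) hDf h2
  have split : ∀ g : Space N × ℝ → ℝ, MemLp g 2 volume →
      ∫ z, renorm b (v z) * (g z - g (z + (0, s))) =
      (∫ z, inner ℝ (renorm b (v z)) (g z)) - ∫ z, inner ℝ (renorm b (v z)) (g (z + (0, s))) := by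
    intro g hg
    rw [← integral_sub (integrable_inner (hs.memLp_renorm 2) hg)
      (integrable_inner (hs.memLp_renorm 2) (memLp_shift hg _))]
    congr 1
    ext z
    rw [real_inner_eq, real_inner_eq, mul_sub]
  have t4 : Tendsto (fun k => (eLpNorm (spaceGrad (φ k)) 2 volume).toReal) atTop
      (𝓝 (eLpNorm Df 2 volume).toReal) := by
    have t5 : Tendsto (fun k => (eLpNorm (spaceGrad (φ k) - Df) 2 volume).toReal) atTop (𝓝 0) := by
      simpa [Function.comp_def] using (ENNReal.tendsto_toReal ENNReal.zero_ne_top).comp h2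
    rw [tendsto_iff_dist_tendsto_zero]
    refine squeeze_zero (fun _ => dist_nonneg) (fun k => ?_) t5
    have hk := (hφ k).memLp_grad 2
    rw [Real.dist_eq, ← Lp.norm_toLp _ hk, ← Lp.norm_toLp _ hDf, ← Lp.norm_toLp _ (hk.sub hDf),
      MemLp.toLp_sub]
    exact abs_norm_sub_norm_le _ _
  rw [split f hf]
  refine le_of_tendsto_of_tendsto (t1.sub t2).abs
    ((tendsto_const_nhds.add (tendsto_const_nhds.mul t4)).const_mul |s|)
    (Eventually.of_forall fun k => ?_)
  have := hs.abs_integral_renorm_shift_le hK (hφ k) (hc k) hsδ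
  rw [split _ (hφ2 k)] at this
  exact this

/-- The duality estimate for time differences, tested with localised translates of
`arctan v`. -/
theorem abs_integral_renorm_arctan_le (hs : Sol Ω T b h m₀ v Dv) {K : ℝ}
    (hK : (∫ z, |h z|) + (m₀ + 1) ≤ K) {δ : ℝ} {χ : Space N × ℝ → ℝ}
    (hχ : IsTest ((Ω : Set (Space N)) ×ˢ Ioo δ (T - δ)) χ) {C : ℝ} (hC : ∀ z, |χ z| ≤ C)
    (hC' : ∀ z, ‖spaceGrad χ z‖ ≤ C) (a : ℝ) {s : ℝ} (hsδ : |s| ≤ δ) :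
    |∫ z, renorm b (v z) * (χ z * Real.arctan (v (z + (0, a))) -
      χ (z + (0, s)) * Real.arctan (v (z + (0, s) + (0, a))))| ≤
      |s| * (2 * (C * 2) * K + √K * (C * √(2 * K) + 2 * (eLpNorm (spaceGrad χ) 2 volume).toReal)) := by
  -- The approximants are values of `arctan`, hence bounded by `2`; this supplies the uniform sup
  -- bound.
  obtain ⟨ψ, h1, h2, h3, h4⟩ := hs.mem.exists_seq_comp Real.contDiff_arctan Real.arctan_zero
    abs_deriv_arctan_le
  have hC0 : 0 ≤ C := (abs_nonneg _).trans (hC 0)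
  set A : Space N × ℝ := (0, a)
  set u : Space N × ℝ → ℝ := fun z => Real.arctan (v z) with hu
  set Du : Space N × ℝ → Space N := fun z => deriv Real.arctan (v z) • Dv z with hDu
  have hW : W0 (cyl Ω T) u Du := hs.mem_arctan
  have s1 : ∀ k, IsTest univ (fun z => ψ k (z + A)) := fun k => (h1 k).shift _ fun _ _ => trivial
  have s3 : Tendsto (fun k => eLpNorm ((fun z => ψ k (z + A)) - fun z => u (z + A)) 2 volume)
      atTop (𝓝 0) :=
    h3.congr fun k => (eLpNorm_shift (((h1 k).memLp 2).sub hW.memLp).1 2 A).symm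
  have s4 : Tendsto (fun k => eLpNorm (spaceGrad (fun z => ψ k (z + A)) - fun z => Du (z + A)) 2
      volume) atTop (𝓝 0) := by
    refine h4.congr fun k => ?_
    have e : (spaceGrad fun z => ψ k (z + A)) = fun z => spaceGrad (ψ k) (z + A) :=
      funext fun z => spaceGrad_shift _ _ z
    rw [e]
    exact (eLpNorm_shift (((h1 k).memLp_grad 2).sub hW.memLp_grad).1 2 A).symm
  obtain ⟨r1, r2, r3⟩ := W0.exists_seq_mul (V := (Ω : Set (Space N)) ×ˢ Ioo δ (T - δ))
    (memLp_shift hW.memLp A).1 (memLp_shift hW.memLp_grad A).1 s1 s3 s4 hχ.smooth hC hC'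
    (inter_subset_left.trans hχ.supp)
  have hu2 : ∀ z, |u z| ≤ 2 := fun z => abs_arctan_le _
  have d1 : MemLp (fun z => χ z • Du (z + A)) 2 volume :=
    (memLp_shift hW.memLp_grad A).of_le_mul (c := C)
      (hχ.continuous.aestronglyMeasurable.smul (memLp_shift hW.memLp_grad A).1)
      (Eventually.of_forall fun z => by
        rw [norm_smul]
        exact mul_le_mul_of_nonneg_right (hC z) (norm_nonneg _))
  have d2 : MemLp (fun z => u (z + A) • spaceGrad χ z) 2 volume :=
    (hχ.memLp_grad 2).of_le_mul (c := 2)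
      ((memLp_shift hW.memLp A).1.smul hχ.continuous_grad.aestronglyMeasurable)
      (Eventually.of_forall fun z => by
        rw [norm_smul]
        exact mul_le_mul_of_nonneg_right (hu2 _) (norm_nonneg _))
  have d3 : MemLp (fun z => χ z * u (z + A)) 2 volume :=
    (memLp_shift hW.memLp A).of_le_mul (c := C)
      (hχ.continuous.aestronglyMeasurable.mul (memLp_shift hW.memLp A).1)
      (Eventually.of_forall fun z => by
        rw [norm_mul]
        exact mul_le_mul_of_nonneg_right (hC z) (norm_nonneg _))
  have key := hs.abs_integral_renorm_shift_le_of_tendsto hK r1 (c := C * 2) (fun k z => by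
    rw [abs_mul]
    obtain ⟨y, hy⟩ := h2 k (z + A)
    rw [hy]
    exact mul_le_mul (hC z) (abs_arctan_le y) (abs_nonneg _) hC0) d3 (d1.add d2) r2 r3 hsδ
  refine key.trans (mul_le_mul_of_nonneg_left (add_le_add le_rfl
    (mul_le_mul_of_nonneg_left ?_ (Real.sqrt_nonneg _))) (abs_nonneg _))
  have n1 : (eLpNorm (fun z => χ z • Du (z + A)) 2 volume).toReal ≤ C * √(2 * K) := by
    have e1 := eLpNorm_le_mul_eLpNorm_of_ae_le_mul (μ := volume) (f := fun z => χ z • Du (z + A))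
      (g := fun z => Du (z + A)) (c := C) (Eventually.of_forall fun z => by
        rw [norm_smul]
        exact mul_le_mul_of_nonneg_right (hC z) (norm_nonneg _)) 2
    rw [eLpNorm_shift hW.meas_grad] at e1
    have e2 := ENNReal.toReal_mono
      (ENNReal.mul_ne_top ENNReal.ofReal_ne_top hW.memLp_grad.2.ne) e1
    rw [ENNReal.toReal_mul, ENNReal.toReal_ofReal hC0] at e2
    exact e2.trans (mul_le_mul_of_nonneg_left (hs.eLpNorm_grad_arctan_le hK) hC0)
  have n2 : (eLpNorm (fun z => u (z + A) • spaceGrad χ z) 2 volume).toReal ≤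
      2 * (eLpNorm (spaceGrad χ) 2 volume).toReal := by
    have e1 := eLpNorm_le_mul_eLpNorm_of_ae_le_mul (μ := volume)
      (f := fun z => u (z + A) • spaceGrad χ z)
      (g := spaceGrad χ) (c := 2) (Eventually.of_forall fun z => by
        rw [norm_smul]
        exact mul_le_mul_of_nonneg_right (hu2 _) (norm_nonneg _)) 2
    have e2 := ENNReal.toReal_mono
      (ENNReal.mul_ne_top ENNReal.ofReal_ne_top (hχ.memLp_grad 2).2.ne) e1
    rwa [ENNReal.toReal_mul, ENNReal.toReal_ofReal zero_le_two] at e2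
  refine le_trans ?_ (add_le_add n1 n2)
  rw [← ENNReal.toReal_add d1.2.ne d2.2.ne]
  exact ENNReal.toReal_mono (ENNReal.add_ne_top.mpr ⟨d1.2.ne, d2.2.ne⟩)
    (eLpNorm_add_le d1.1 d2.1 (by norm_num))

/-- Expanding the product and moving every shift off the renormalisation leaves two pairings of it
with differences under the shift `-s`, of `χ arctan v` and of `χ arctan v(· + s)`. Each obeys the
duality estimate, hence the factor `2`. -/
theorem integral_renorm_sub_mul_arctan_sub_le (hs : Sol Ω T b h m₀ v Dv) {K : ℝ}
    (hK : (∫ z, |h z|) + (m₀ + 1) ≤ K) {δ : ℝ} {χ : Space N × ℝ → ℝ}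
    (hχ : IsTest ((Ω : Set (Space N)) ×ˢ Ioo δ (T - δ)) χ) {C : ℝ} (hC : ∀ z, |χ z| ≤ C)
    (hC' : ∀ z, ‖spaceGrad χ z‖ ≤ C) {s : ℝ} (hsδ : |s| ≤ δ) :
    ∫ z, χ z * ((renorm b (v (z + (0, s))) - renorm b (v z)) *
      (Real.arctan (v (z + (0, s))) - Real.arctan (v z))) ≤
      2 * (|s| * (2 * (C * 2) * K +
        √K * (C * √(2 * K) + 2 * (eLpNorm (spaceGrad χ) 2 volume).toReal))) := by
  have hC0 : 0 ≤ C := (abs_nonneg _).trans (hC 0)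
  have k1 := hs.abs_integral_renorm_arctan_le hK hχ hC hC' 0 (s := -s) (by rwa [abs_neg])
  have k2 := hs.abs_integral_renorm_arctan_le hK hχ hC hC' s (s := -s) (by rwa [abs_neg])
  rw [abs_neg] at k1 k2
  set Z : Space N × ℝ → ℝ := fun z => renorm b (v z) with hZ
  set u : Space N × ℝ → ℝ := fun z => Real.arctan (v z) with hu
  have hZ2 : MemLp Z 2 volume := hs.memLp_renorm 2
  have hu2 : MemLp u 2 volume := hs.mem_arctan.memLp
  have back : ∀ z : Space N × ℝ, z + (0, -s) + (0, s) = z := fun z => by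
    have e : ((0 : Space N), -s) + ((0 : Space N), s) = 0 := by simp
    rw [add_assoc, e, add_zero]
  have hint : ∀ a a' a'' : Space N × ℝ, Integrable (fun z => Z (z + a) * (χ (z + a'') * u (z + a')))
      volume := by
    intro a a' a''
    have d3 : MemLp (fun z => χ (z + a'') * u (z + a')) 2 volume :=
      (memLp_shift hu2 a').of_le_mul (c := C)
        ((memLp_shift (hχ.memLp 2) a'').1.mul (memLp_shift hu2 a').1)
        (Eventually.of_forall fun z => by
          rw [norm_mul]
          exact mul_le_mul_of_nonneg_right (hC _) (norm_nonneg _))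
    exact (memLp_shift hZ2 a).integrable_mul d3
  have hint' : ∀ a a' : Space N × ℝ, Integrable (fun z => Z (z + a) * (χ z * u (z + a')))
      volume := fun a a' => by simpa using hint a a' 0
  have i1 := hint' (0, s) (0, s)
  have i2 := hint' (0, s) 0
  have i3 := hint' 0 (0, s)
  have i4 := hint' 0 0
  simp only [add_zero] at i2 i3 i4
  have m1 : ∫ z, Z (z + (0, s)) * (χ z * u (z + (0, s))) =
      ∫ z, Z z * (χ (z + (0, -s)) * u (z + (0, -s) + (0, s))) := by
    rw [← integral_shift _ ((0 : Space N), -s)]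
    simp only [back]
  have m2 : ∫ z, Z (z + (0, s)) * (χ z * u z) =
      ∫ z, Z z * (χ (z + (0, -s)) * u (z + (0, -s))) := by
    rw [← integral_shift _ ((0 : Space N), -s)]
    simp only [back]
  have j1 := hint 0 0 (0, -s)
  have j2 := hint 0 (0, -s) (0, -s)
  simp only [add_zero] at j1 j2
  have e1 : ∫ z, χ z * ((Z (z + (0, s)) - Z z) * (u (z + (0, s)) - u z)) =
      ((∫ z, Z (z + (0, s)) * (χ z * u (z + (0, s)))) - ∫ z, Z z * (χ z * u (z + (0, s)))) -
      ((∫ z, Z (z + (0, s)) * (χ z * u z)) - ∫ z, Z z * (χ z * u z)) := by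
    rw [← integral_sub i1 i3, ← integral_sub i2 i4, ← integral_sub]
    · congr 1
      ext z
      ring
    · exact i1.sub i3
    · exact i2.sub i4
  have e2 : ∫ z, Z z * (χ z * u (z + (0, s)) - χ (z + (0, -s)) * u (z + (0, -s) + (0, s))) =
      (∫ z, Z z * (χ z * u (z + (0, s)))) -
        ∫ z, Z z * (χ (z + (0, -s)) * u (z + (0, -s) + (0, s))) := by
    simp only [back]
    rw [← integral_sub i3 j1]
    congr 1
    ext z
    ring
  have e3 : ∫ z, Z z * (χ z * u (z + (0, 0)) - χ (z + (0, -s)) * u (z + (0, -s) + (0, 0))) =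
      (∫ z, Z z * (χ z * u z)) - ∫ z, Z z * (χ (z + (0, -s)) * u (z + (0, -s))) := by
    simp only [shift_zero]
    rw [← integral_sub i4 j2]
    congr 1
    ext z
    ring
  have k1' := e3 ▸ k1
  have k2' := e2 ▸ k2
  have e1' : ∫ z, χ z * ((renorm b (v (z + (0, s))) - renorm b (v z)) *
      (Real.arctan (v (z + (0, s))) - Real.arctan (v z))) =
      ∫ z, χ z * ((Z (z + (0, s)) - Z z) * (u (z + (0, s)) - u z)) := rfl
  rw [e1', e1, m1, m2]
  rw [abs_le] at k1' k2'
  linarith [k1'.1, k1'.2, k2'.1, k2'.2]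

end Sol

end EllipticParabolic

/-! ### Modulus of continuity under translations -/

namespace EllipticParabolic
variable {N : ℕ} {Ω : Opens (Space N)} {T m₀ : ℝ} {b : ℝ → ℝ} {h v : Space N × ℝ → ℝ}
  {Dv : Space N × ℝ → Space N}

/-- A strictly increasing continuous function controls `arctan` up to a small error. -/
theorem exists_abs_arctan_sub_le {B : ℝ → ℝ} (hB : Continuous B) (hBm : StrictMono B) {ε : ℝ}
    (hε : 0 < ε) : ∃ C : ℝ, 0 ≤ C ∧ ∀ r s, |Real.arctan r - Real.arctan s| ≤
      ε + C * ((B r - B s) * (Real.arctan r - Real.arctan s)) := by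
  set p := Real.pi / 2 with hp
  -- If `arctan s - arctan r > ε`, the points `θ + ε/3` and `θ + 2ε/3` with `θ = arctan r` lie
  -- between the two values, so `B s - B r ≥ g θ`. The offsets keep `tan` away from its poles on the
  -- whole compact interval, endpoints included, so `g` has a positive minimum there.
  set g : ℝ → ℝ := fun θ => B (Real.tan (θ + 2 * ε / 3)) - B (Real.tan (θ + ε / 3)) with hg
  have hgc : ContinuousOn g (Icc (-p) (p - ε)) := by
    refine (hB.comp_continuousOn ?_).sub (hB.comp_continuousOn ?_)
    · refine Real.continuousOn_tan_Ioo.comp (by fun_prop) fun θ hθ => ⟨?_, ?_⟩ <;>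
        linarith [hθ.1, hθ.2]
    · refine Real.continuousOn_tan_Ioo.comp (by fun_prop) fun θ hθ => ⟨?_, ?_⟩ <;>
        linarith [hθ.1, hθ.2]
  have hgpos : ∀ θ ∈ Icc (-p) (p - ε), 0 < g θ := by
    intro θ hθ
    refine sub_pos.mpr (hBm (Real.strictMonoOn_tan ?_ ?_ ?_))
    · constructor <;> linarith [hθ.1, hθ.2]
    · constructor <;> linarith [hθ.1, hθ.2]
    · linarith
  obtain ⟨c, hc, hcg⟩ : ∃ c > 0, ∀ θ ∈ Icc (-p) (p - ε), c ≤ g θ := by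
    rcases (Icc (-p) (p - ε)).eq_empty_or_nonempty with h | h
    · exact ⟨1, one_pos, by simp [h]⟩
    · obtain ⟨θ, hθ, hmin⟩ := isCompact_Icc.exists_isMinOn h hgc
      exact ⟨g θ, hgpos θ hθ, hmin⟩
  have main : ∀ r s, r ≤ s → |Real.arctan r - Real.arctan s| ≤
      ε + c⁻¹ * ((B r - B s) * (Real.arctan r - Real.arctan s)) := by
    intro r s hrs
    have h1 : Real.arctan r ≤ Real.arctan s := Real.arctan_strictMono.monotone hrs
    have h2 : B r ≤ B s := hBm.monotone hrs
    rw [abs_sub_comm, abs_of_nonneg (sub_nonneg.mpr h1)]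
    have e : (B r - B s) * (Real.arctan r - Real.arctan s) =
        (B s - B r) * (Real.arctan s - Real.arctan r) := by ring
    rw [e]
    have hprod := mul_nonneg (sub_nonneg.mpr h2) (sub_nonneg.mpr h1)
    by_cases hlt : Real.arctan s - Real.arctan r ≤ ε
    · have := mul_nonneg (inv_nonneg.mpr hc.le) hprod
      linarith
    · push Not at hlt
      have l1 := Real.neg_pi_div_two_lt_arctan r
      have l2 := Real.arctan_lt_pi_div_two s
      have hm : Real.arctan r ∈ Icc (-p) (p - ε) := ⟨l1.le, by linarith⟩
      have h3 := hcg _ hm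
      have h4 : B (Real.tan (Real.arctan r + 2 * ε / 3)) ≤ B s := by
        refine hBm.monotone ?_
        rw [← Real.tan_arctan s]
        refine (Real.strictMonoOn_tan ?_ ?_ ?_).le
        · constructor <;> linarith
        · constructor <;> linarith
        · linarith
      have h5 : B r ≤ B (Real.tan (Real.arctan r + ε / 3)) := by
        refine hBm.monotone ?_
        conv_lhs => rw [← Real.tan_arctan r]
        refine (Real.strictMonoOn_tan ?_ ?_ ?_).le
        · constructor <;> linarith
        · constructor <;> linarith
        · linarith
      have h6 : c ≤ B s - B r := by simp only [hg] at h3; linarith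
      have h7 : 1 ≤ c⁻¹ * (B s - B r) := by
        rw [inv_mul_eq_div, one_le_div hc]
        exact h6
      have h8 := mul_le_mul_of_nonneg_right h7 (sub_nonneg.mpr h1)
      rw [← mul_assoc]
      linarith
  refine ⟨c⁻¹, by positivity, fun r s => ?_⟩
  rcases le_total r s with hrs | hrs
  · exact main r s hrs
  · have := main s r hrs
    rw [abs_sub_comm]
    refine this.trans (le_of_eq ?_)
    ring

/-- Uniform modulus of continuity under translations of localisations of `arctan v`. -/
theorem exists_modulus_arctan (hb : Continuous b) (hbm : StrictMono b) (K : ℝ)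
    {χ : Space N × ℝ → ℝ} (hχ : IsTest (cyl Ω T) χ) (hχ0 : ∀ z, 0 ≤ χ z) {ε : ℝ} (hε : 0 < ε) :
    ∃ δ > 0, ∀ h m₀ v Dv, Sol Ω T b h m₀ v Dv → (∫ z, |h z|) + (m₀ + 1) ≤ K →
      ∀ a : Space N × ℝ, ‖a‖ < δ →
        ∫ z, χ z * |Real.arctan (v (z + a)) - Real.arctan (v z)| ≤ ε := by
  obtain ⟨δ₀, hδ₀, hsupp⟩ := hχ.exists_time_margin
  have hχ' : IsTest ((Ω : Set (Space N)) ×ˢ Ioo δ₀ (T - δ₀)) χ := ⟨hχ.smooth, hχ.compact, hsupp⟩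
  obtain ⟨C₁, hC₁⟩ := hχ.compact.exists_bound_of_continuous hχ.continuous
  obtain ⟨C₂, hC₂⟩ := hχ.compact_grad.exists_bound_of_continuous hχ.continuous_grad
  set I := ∫ z, χ z with hI
  have hI0 : 0 ≤ I := integral_nonneg hχ0
  obtain ⟨D, hD, hstr⟩ := exists_abs_arctan_sub_le (continuous_renorm hb)
    (strictMono_renorm hb hbm) (ε := ε / (3 * (I + 1))) (by positivity)
  set C := max C₁ C₂ with hC
  set M : ℝ := |2 * (C * 2) * K + √K * (C * √(2 * K) + 2 * (eLpNorm (spaceGrad χ) 2 volume).toReal)|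
    with hM
  have hM0 : 0 ≤ M := abs_nonneg _
  set S := (eLpNorm χ 2 volume).toReal * √(2 * K) with hS
  have hS0 : 0 ≤ S := by positivity
  have hχi : Integrable χ volume := memLp_one_iff_integrable.mp (hχ.memLp 1)
  -- The margin `δ₀` keeps time shifts admissible, the second term makes `D` times the duality
  -- estimate at most `ε/3`, and the third does the same for the spatial shift. The last `ε/3` is
  -- the additive error of `hstr` weighted with `χ`.
  refine ⟨min δ₀ (min (ε / (3 * (2 * D * M + 1))) (ε / (3 * (S + 1)))), by positivity,
    fun h m₀ v Dv hs hK a ha => ?_⟩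
  obtain ⟨y, s⟩ := a
  have hy : ‖y‖ < _ := (norm_fst_le (y, s)).trans_lt ha
  have hs' : |s| < _ := (norm_snd_le (y, s)).trans_lt ha
  rw [lt_min_iff, lt_min_iff] at hy hs'
  set u : Space N × ℝ → ℝ := fun z => Real.arctan (v z) with hu
  have hu2 : MemLp u 2 volume := hs.mem_arctan.memLp
  have hdiff : ∀ a a' : Space N × ℝ, MemLp (fun z => |u (z + a) - u (z + a')|) 2 volume :=
    fun a a' => ((memLp_shift hu2 a).sub (memLp_shift hu2 a')).abs
  have hint : ∀ a a' : Space N × ℝ, Integrable (fun z => χ z * |u (z + a) - u (z + a')|) volume :=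
    fun a a' => (hχ.memLp 2).integrable_mul (hdiff a a')
  have time : ∫ z, χ z * |u (z + (0, s)) - u z| ≤ 2 * ε / 3 := by
    have k := hs.integral_renorm_sub_mul_arctan_sub_le hK hχ' (C := C)
      (fun z => (hC₁ z).trans (le_max_left _ _)) (fun z => (hC₂ z).trans (le_max_right _ _))
      hs'.1.le
    have hZ := hs.memLp_renorm 2
    have hp : Integrable (fun z => χ z * ((renorm b (v (z + (0, s))) - renorm b (v z)) *
        (u (z + (0, s)) - u z))) volume :=
      (((memLp_shift hZ ((0 : Space N), s)).sub hZ).integrable_mul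
        ((memLp_shift hu2 ((0 : Space N), s)).sub hu2)).bdd_mul (c := C₁)
        hχ.continuous.aestronglyMeasurable (Eventually.of_forall hC₁)
    have h1 : ∫ z, χ z * |u (z + (0, s)) - u z| ≤
        ∫ z, (ε / (3 * (I + 1)) * χ z + D * (χ z * ((renorm b (v (z + (0, s))) - renorm b (v z)) *
        (u (z + (0, s)) - u z)))) := by
      have hi := hint (0, s) 0
      simp only [add_zero] at hi
      refine integral_mono hi ((hχi.const_mul _).add (hp.const_mul D)) fun z => ?_
      have := mul_le_mul_of_nonneg_left (hstr (v (z + (0, s))) (v z)) (hχ0 z)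
      refine this.trans (le_of_eq ?_)
      simp only [hu]
      ring
    rw [integral_add (hχi.const_mul _) (hp.const_mul D), integral_const_mul,
      integral_const_mul] at h1
    have h2 : ε / (3 * (I + 1)) * I ≤ ε / 3 := by
      rw [div_mul_eq_mul_div, div_le_div_iff₀ (by positivity) (by positivity)]
      nlinarith
    have h3 : D * (2 * (|s| * (2 * (C * 2) * K +
        √K * (C * √(2 * K) + 2 * (eLpNorm (spaceGrad χ) 2 volume).toReal)))) ≤ ε / 3 := by
      have h4 : |s| * (3 * (2 * D * M + 1)) ≤ ε := ((lt_div_iff₀ (by positivity)).mp hs'.2.1).le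
      have h5 := mul_le_mul_of_nonneg_left (le_abs_self (2 * (C * 2) * K +
        √K * (C * √(2 * K) + 2 * (eLpNorm (spaceGrad χ) 2 volume).toReal))) (abs_nonneg s)
      have h6 := mul_le_mul_of_nonneg_left h5 (mul_nonneg hD zero_le_two)
      rw [← hM] at h6
      nlinarith [abs_nonneg s]
    have h7 := mul_le_mul_of_nonneg_left k hD
    have h8 := h1.trans (add_le_add h2 (h7.trans h3))
    linarith
  have space : ∫ z, χ z * |u (z + (y, s)) - u (z + (0, s))| ≤ ε / 3 := by
    have h1 := (le_abs_self _).trans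
      (abs_integral_inner_le (hχ.memLp 2) (hdiff (y, s) (0, s)))
    simp only [real_inner_eq] at h1
    refine h1.trans ?_
    have h2 : (eLpNorm (fun z => |u (z + (y, s)) - u (z + (0, s))|) 2 volume).toReal ≤
        ‖y‖ * √(2 * K) := by
      have e1 : eLpNorm (fun z => |u (z + (y, s)) - u (z + (0, s))|) 2 volume =
          eLpNorm (fun z => u (z + (y, 0)) - u z) 2 volume := by
        rw [← eLpNorm_shift (f := fun z => u (z + (y, 0)) - u z)
          ((memLp_shift hu2 (y, 0)).sub hu2).1 2 ((0 : Space N), s)]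
        refine eLpNorm_congr_norm_ae (Eventually.of_forall fun z => ?_)
        have e2 : z + (0, s) + (y, 0) = z + (y, s) := by
          have e3 : ((0 : Space N), s) + (y, 0) = (y, s) := by simp
          rw [add_assoc, e3]
        simp only [Real.norm_eq_abs, abs_abs, e2]
      rw [e1]
      have h3 := hs.mem_arctan.eLpNorm_space_shift_sub_le y
      have h4 := ENNReal.toReal_mono
        (ENNReal.mul_ne_top enorm_ne_top hs.mem_arctan.memLp_grad.2.ne) h3
      rw [ENNReal.toReal_mul, toReal_enorm] at h4
      exact h4.trans (mul_le_mul_of_nonneg_left (hs.eLpNorm_grad_arctan_le hK) (norm_nonneg _))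
    have h3 := mul_le_mul_of_nonneg_left h2
      (ENNReal.toReal_nonneg : 0 ≤ (eLpNorm χ 2 volume).toReal)
    refine h3.trans ?_
    have h4 : ‖y‖ * (3 * (S + 1)) ≤ ε := ((lt_div_iff₀ (by positivity)).mp hy.2.2).le
    have h5 : (eLpNorm χ 2 volume).toReal * (‖y‖ * √(2 * K)) = ‖y‖ * S := by rw [hS]; ring
    rw [h5]
    nlinarith [norm_nonneg y]
  have i1 := hint (y, s) (0, s)
  have i2 := hint (0, s) 0
  have i3 := hint (y, s) 0
  simp only [add_zero] at i2 i3
  have tri : ∫ z, χ z * |u (z + (y, s)) - u z| ≤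
      (∫ z, χ z * |u (z + (y, s)) - u (z + (0, s))|) + ∫ z, χ z * |u (z + (0, s)) - u z| := by
    rw [← integral_add i1 i2]
    refine integral_mono i3 (i1.add i2) fun z => ?_
    have := mul_le_mul_of_nonneg_left
      (abs_sub_le (u (z + (y, s))) (u (z + (0, s))) (u z)) (hχ0 z)
    simpa [mul_add] using this
  refine tri.trans ?_
  linarith

end EllipticParabolic

/-! ### Compactness from weak convergence and a translation modulus -/

namespace EllipticParabolic
variable {N : ℕ}

/-- Sequences bounded in `L²` have weakly convergent subsequences. -/
theorem exists_subseq_weak {f : ℕ → Space N × ℝ → ℝ} (hf : ∀ n, MemLp (f n) 2 volume) {C : ℝ}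
    (hC : ∀ n, (eLpNorm (f n) 2 volume).toReal ≤ C) :
    ∃ s : ℕ → ℕ, StrictMono s ∧ ∀ g : Space N × ℝ → ℝ, MemLp g 2 volume →
      ∃ l : ℝ, Tendsto (fun j => ∫ z, f (s j) z * g z) atTop (𝓝 l) := by
  have : Fact ((2 : ℝ≥0∞) ≠ ⊤) := ⟨by simp⟩
  let E := Lp ℝ 2 (volume : Measure (Space N × ℝ))
  let F : ℕ → WeakDual ℝ E := fun n =>
    StrongDual.toWeakDual (InnerProductSpace.toDual ℝ E ((hf n).toLp (f n)))
  have hF : ∀ n, F n ∈ WeakDual.toStrongDual ⁻¹' Metric.closedBall (0 : StrongDual ℝ E) C := by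
    intro n
    have h1 : ‖InnerProductSpace.toDual ℝ E ((hf n).toLp (f n))‖ ≤ C := by
      rw [LinearIsometryEquiv.norm_map, Lp.norm_toLp]
      exact hC n
    simpa [F] using h1
  obtain ⟨G, -, s, hs, hG⟩ := WeakDual.isSeqCompact_closedBall (𝕜 := ℝ) (E := E) 0 C hF
  refine ⟨s, hs, fun g hg => ⟨G (hg.toLp g), ?_⟩⟩
  have h2 := ((WeakDual.eval_continuous (𝕜 := ℝ) (E := E) (hg.toLp g)).tendsto G).comp hG
  refine h2.congr fun j => ?_
  have e : (F (s j)) (hg.toLp g) = inner ℝ ((hf (s j)).toLp (f (s j))) (hg.toLp g) := rfl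
  simp only [Function.comp_apply]
  rw [e, L2.inner_def]
  refine integral_congr_ae ?_
  filter_upwards [(hf (s j)).coeFn_toLp, hg.coeFn_toLp] with z h1 h2
  rw [h1, h2, real_inner_eq]

/-- The mean of `f` over the ball of radius `ρ` about `z`. -/
noncomputable def ballMean (f : Space N × ℝ → ℝ) (ρ : ℝ) (z : Space N × ℝ) : ℝ :=
  ∫ a, f (z + a) ∂(ProbabilityTheory.cond volume (Metric.ball (0 : Space N × ℝ) ρ))

theorem isProbabilityMeasure_cond_ball {ρ : ℝ} (hρ : 0 < ρ) : IsProbabilityMeasure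
    (ProbabilityTheory.cond volume (Metric.ball (0 : Space N × ℝ) ρ)) :=
  ProbabilityTheory.cond_isProbabilityMeasure_of_finite (Metric.measure_ball_pos volume 0 hρ).ne'
    measure_ball_lt_top.ne

theorem measurable_ballMean {f : Space N × ℝ → ℝ} (hf : Measurable f) (ρ : ℝ) :
    Measurable (ballMean f ρ) := by
  have h1 : StronglyMeasurable (fun p : (Space N × ℝ) × (Space N × ℝ) => f (p.1 + p.2)) :=
    (hf.comp (measurable_fst.add measurable_snd)).stronglyMeasurable
  exact h1.integral_prod_right'.measurable

theorem abs_ballMean_le {f : Space N × ℝ → ℝ} {c : ℝ} (hc : ∀ z, |f z| ≤ c) {ρ : ℝ} (hρ : 0 < ρ)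
    (z : Space N × ℝ) : |ballMean f ρ z| ≤ c := by
  have := isProbabilityMeasure_cond_ball (N := N) hρ
  have h1 := norm_integral_le_of_norm_le_const (μ := ProbabilityTheory.cond volume
    (Metric.ball (0 : Space N × ℝ) ρ)) (f := fun a => f (z + a)) (C := c)
    (Eventually.of_forall fun a => hc (z + a))
  simpa [ballMean] using h1

/-- In this form the mean is a pairing with an `L²` function independent of `f`, so weak convergence
implies pointwise convergence of means. -/
theorem ballMean_eq {f : Space N × ℝ → ℝ} (ρ : ℝ) (z : Space N × ℝ) :
    ballMean f ρ z = (volume (Metric.ball (0 : Space N × ℝ) ρ))⁻¹.toReal *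
      ∫ y, f y * (Metric.ball z ρ).indicator 1 y := by
  rw [ballMean, ProbabilityTheory.cond, integral_smul_measure, smul_eq_mul,
    ← integral_indicator measurableSet_ball, ← integral_shift _ (-z)]
  congr 2
  ext y
  have e : z + (y + -z) = y := by abel
  by_cases hy : y ∈ Metric.ball z ρ
  · have hy' : y + -z ∈ Metric.ball (0 : Space N × ℝ) ρ := by
      rwa [mem_ball_zero_iff, ← sub_eq_add_neg, ← dist_eq_norm]
    simp [hy, hy', e]
  · have hy' : y + -z ∉ Metric.ball (0 : Space N × ℝ) ρ := by
      rwa [mem_ball_zero_iff, ← sub_eq_add_neg, ← dist_eq_norm]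
    simp [hy, hy']

/-- The deviation from the mean is an average of translation differences; Fubini moves the average
outside. -/
theorem lintegral_ballMean_sub_le {f : Space N × ℝ → ℝ} (hf : Measurable f) {c : ℝ}
    (hc : ∀ z, |f z| ≤ c) {w : Space N × ℝ → ℝ≥0∞} (hw : Measurable w) {ρ : ℝ} (hρ : 0 < ρ)
    {ε : ℝ≥0∞} (hε : ∀ a, ‖a‖ < ρ → ∫⁻ z, w z * ‖f (z + a) - f z‖ₑ ≤ ε) :
    ∫⁻ z, w z * ‖ballMean f ρ z - f z‖ₑ ≤ ε := by
  have hp := isProbabilityMeasure_cond_ball (N := N) hρ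
  set κ := ProbabilityTheory.cond volume (Metric.ball (0 : Space N × ℝ) ρ) with hκ
  have hm : Measurable (fun p : (Space N × ℝ) × (Space N × ℝ) =>
      w p.1 * ‖f (p.1 + p.2) - f p.1‖ₑ) :=
    (hw.comp measurable_fst).mul
      ((hf.comp (measurable_fst.add measurable_snd)).sub (hf.comp measurable_fst)).enorm
  calc ∫⁻ z, w z * ‖ballMean f ρ z - f z‖ₑ
      ≤ ∫⁻ z, ∫⁻ a, w z * ‖f (z + a) - f z‖ₑ ∂κ := by
        refine lintegral_mono fun z => ?_
        have hi : Integrable (fun a => f (z + a)) κ :=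
          Integrable.of_bound (hf.comp (measurable_const_add z)).aestronglyMeasurable c
            (Eventually.of_forall fun a => hc _)
        have e : ballMean f ρ z - f z = ∫ a, (f (z + a) - f z) ∂κ := by
          rw [integral_sub hi (integrable_const _), integral_const]
          simp [ballMean, hκ]
        have hm' : Measurable fun a => ‖f (z + a) - f z‖ₑ :=
          ((hf.comp (measurable_const_add z)).sub_const _).enorm
        rw [lintegral_const_mul _ hm', e]
        gcongr
        exact enorm_integral_le_lintegral_enorm _
    _ = ∫⁻ a, (∫⁻ z, w z * ‖f (z + a) - f z‖ₑ) ∂κ := lintegral_lintegral_swap hm.aemeasurable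
    _ ≤ ∫⁻ a, ε ∂κ := by
        refine lintegral_mono_ae ?_
        have h1 : ∀ᵐ a ∂κ, a ∈ Metric.ball (0 : Space N × ℝ) ρ :=
          ProbabilityTheory.ae_cond_mem measurableSet_ball
        filter_upwards [h1] with a ha
        exact hε a (mem_ball_zero_iff.mp ha)
    _ = ε := by simp

/-- A bounded, weakly convergent sequence with a uniform modulus of continuity under translations
is a Cauchy sequence. -/
theorem cauchy_of_weak_of_modulus {f : ℕ → Space N × ℝ → ℝ} (hf : ∀ n, Measurable (f n)) {c : ℝ}
    (hc : ∀ n z, |f n z| ≤ c) (hweak : ∀ g : Space N × ℝ → ℝ, MemLp g 2 volume →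
      ∃ l : ℝ, Tendsto (fun j => ∫ z, f j z * g z) atTop (𝓝 l))
    {w : Space N × ℝ → ℝ≥0∞} (hw : Measurable w) (hw' : ∫⁻ z, w z ≠ ⊤)
    (hmod : ∀ ε : ℝ≥0∞, 0 < ε → ∃ δ > 0, ∀ n, ∀ a : Space N × ℝ, ‖a‖ < δ →
      ∫⁻ z, w z * ‖f n (z + a) - f n z‖ₑ ≤ ε) {ε : ℝ≥0∞} (hε : 0 < ε) :
    ∃ J, ∀ i ≥ J, ∀ j ≥ J, ∫⁻ z, w z * ‖f i z - f j z‖ₑ ≤ ε := by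
  -- At a fixed radius the means are bounded and converge pointwise, hence in weighted `L¹`. Two
  -- functions are compared through their means and the common limit of these: four errors of `ε/4`.
  obtain ⟨ρ, hρ, hmodρ⟩ := hmod (ε / 4) (ENNReal.div_pos hε.ne' (by norm_num))
  have hlim : ∀ z, ∃ l : ℝ, Tendsto (fun j => ballMean (f j) ρ z) atTop (𝓝 l) := by
    intro z
    have hg : MemLp ((Metric.ball z ρ).indicator (1 : Space N × ℝ → ℝ)) 2 volume :=
      memLp_indicator_const 2 measurableSet_ball (1 : ℝ) (Or.inr measure_ball_lt_top.ne)
    obtain ⟨l, hl⟩ := hweak _ hg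
    exact ⟨_, (hl.const_mul (volume (Metric.ball (0 : Space N × ℝ) ρ))⁻¹.toReal).congr
      fun j => (ballMean_eq ρ z).symm⟩
  choose L hL using hlim
  have hLm : Measurable L := measurable_of_tendsto_metrizable
    (fun j => measurable_ballMean (hf j) ρ) (tendsto_pi_nhds.mpr hL)
  have hLc : ∀ z, |L z| ≤ c := fun z =>
    le_of_tendsto' (hL z).abs fun j => abs_ballMean_le (hc j) hρ z
  have hdom : Tendsto (fun j => ∫⁻ z, w z * ‖ballMean (f j) ρ z - L z‖ₑ) atTop (𝓝 0) := by
    have h1 : Tendsto (fun j => ∫⁻ z, w z * ‖ballMean (f j) ρ z - L z‖ₑ) atTop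
        (𝓝 (∫⁻ z : Space N × ℝ, 0)) := by
      refine tendsto_lintegral_of_dominated_convergence' (fun z => w z * ENNReal.ofReal (2 * c))
        (fun j => (hw.mul ((measurable_ballMean (hf j) ρ).sub hLm).enorm).aemeasurable)
        (fun j => Eventually.of_forall fun z => ?_) ?_ ?_
      · simp only [Real.enorm_eq_ofReal_abs]
        gcongr
        exact (abs_sub _ _).trans (by linarith [abs_ballMean_le (hc j) hρ z, hLc z])
      · rw [lintegral_mul_const _ hw]
        exact ENNReal.mul_ne_top hw' ENNReal.ofReal_ne_top
      · filter_upwards [ae_lt_top hw hw'] with z hz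
        have h2 : Tendsto (fun j => ‖ballMean (f j) ρ z - L z‖ₑ) atTop (𝓝 0) := by
          have := ((hL z).sub_const (L z)).enorm
          simpa using this
        have := ENNReal.Tendsto.const_mul (a := w z) h2 (Or.inr hz.ne)
        simpa using this
    simpa using h1
  have hev := hdom.eventually (ge_mem_nhds (ENNReal.div_pos hε.ne' (by norm_num : (4 : ℝ≥0∞) ≠ ⊤)))
  obtain ⟨J, hJ⟩ := eventually_atTop.mp hev
  refine ⟨J, fun i hi j hj => ?_⟩
  have mA : ∀ n, Measurable fun z => w z * ‖ballMean (f n) ρ z - f n z‖ₑ := fun n =>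
    hw.mul ((measurable_ballMean (hf n) ρ).sub (hf n)).enorm
  have mL : ∀ n, Measurable fun z => w z * ‖ballMean (f n) ρ z - L z‖ₑ := fun n =>
    hw.mul ((measurable_ballMean (hf n) ρ).sub hLm).enorm
  calc ∫⁻ z, w z * ‖f i z - f j z‖ₑ
      ≤ ∫⁻ z, (w z * ‖ballMean (f i) ρ z - f i z‖ₑ + w z * ‖ballMean (f i) ρ z - L z‖ₑ +
        (w z * ‖ballMean (f j) ρ z - L z‖ₑ + w z * ‖ballMean (f j) ρ z - f j z‖ₑ)) := by
        refine lintegral_mono fun z => ?_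
        simp only [← mul_add]
        gcongr
        have e : f i z - f j z = (-(ballMean (f i) ρ z - f i z) + (ballMean (f i) ρ z - L z)) +
            (-(ballMean (f j) ρ z - L z) + (ballMean (f j) ρ z - f j z)) := by ring
        rw [e]
        refine (enorm_add_le _ _).trans (add_le_add ((enorm_add_le _ _).trans ?_)
          ((enorm_add_le _ _).trans ?_)) <;> rw [enorm_neg]
    _ = (∫⁻ z, w z * ‖ballMean (f i) ρ z - f i z‖ₑ) + (∫⁻ z, w z * ‖ballMean (f i) ρ z - L z‖ₑ) +
        ((∫⁻ z, w z * ‖ballMean (f j) ρ z - L z‖ₑ) + ∫⁻ z, w z * ‖ballMean (f j) ρ z - f j z‖ₑ) := by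
        have mAL : Measurable fun z => w z * ‖ballMean (f i) ρ z - f i z‖ₑ +
          w z * ‖ballMean (f i) ρ z - L z‖ₑ := (mA i).add (mL i)
        rw [lintegral_add_left mAL, lintegral_add_left (mA i), lintegral_add_left (mL j)]
    _ ≤ (ε / 4 + ε / 4) + (ε / 4 + ε / 4) :=
        add_le_add (add_le_add (lintegral_ballMean_sub_le (hf i) (hc i) hw hρ (hmodρ i)) (hJ i hi))
          (add_le_add (hJ j hj) (lintegral_ballMean_sub_le (hf j) (hc j) hw hρ (hmodρ j)))
    _ = ε := by
        rw [show ε / 4 + ε / 4 + (ε / 4 + ε / 4) = 4 * (ε / 4) by ring]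
        exact ENNReal.mul_div_cancel (by norm_num) (by norm_num)

end EllipticParabolic

/-! ### Extraction of the limit and convergence in `L¹` -/

namespace EllipticParabolic
variable {N : ℕ} {Ω : Opens (Space N)} {T : ℝ} {b : ℝ → ℝ} {h v : ℕ → Space N × ℝ → ℝ}
  {m : ℕ → ℝ} {Dv : ℕ → Space N × ℝ → Space N} {K a₁ : ℝ}

/-- The modulus is available only with a compactly supported weight. A weight equal to `1` on a
compact set that misses less than `ε/8` of the cylinder is enough, since differences of `arctan` are
at most `4`. The weakly convergent subsequence is then Cauchy in `L¹`. -/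
theorem exists_subseq_arctan_tendsto (hs : ∀ n, Sol Ω T b (h n) (m n) (v n) (Dv n))
    (hK : ∀ n, (∫ z, |h n z|) + (m n + 1) ≤ K) :
    ∃ (s : ℕ → ℕ) (F : Space N × ℝ → ℝ), StrictMono s ∧ Measurable F ∧
      ∀ᵐ z, Tendsto (fun j => Real.arctan (v (s j) z)) atTop (𝓝 (F z)) := by
  set f : ℕ → Space N × ℝ → ℝ := fun n z => Real.arctan (v n z) with hf
  have hfm : ∀ n, Measurable (f n) := fun n =>
    Real.continuous_arctan.measurable.comp (hs n).meas
  have hf2 : ∀ n z, |f n z| ≤ 2 := fun n z => abs_arctan_le _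
  have hf0 : ∀ n z, z ∉ (cyl Ω T : Set (Space N × ℝ)) → f n z = 0 := fun n z hz => by
    simp [hf, (hs n).zero_off z hz]
  have hfL : ∀ n p, MemLp (f n) p volume := fun n p =>
    (hs n).memLp_comp Real.continuous_arctan Real.arctan_zero p
  have hcyl := (hs 0).fin
  have hbd : ∀ n, (eLpNorm (f n) 2 volume).toReal ≤
      √(2 ^ 2 * (volume (cyl Ω T : Set (Space N × ℝ))).toReal) := by
    intro n
    rw [eLpNorm_two_toReal (hfL n 2)]
    refine Real.sqrt_le_sqrt ?_
    rw [← integral_cylMeasure (Ω := Ω) (T := T) fun z hz => by simp [hf0 n z hz]]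
    have : IsFiniteMeasure (cylMeasure Ω T) := ⟨by simpa [cylMeasure] using hcyl⟩
    refine (integral_mono_of_nonneg (Eventually.of_forall fun z => by positivity)
      (integrable_const ((2 : ℝ) ^ 2)) (Eventually.of_forall fun z => ?_)).trans (le_of_eq ?_)
    · exact pow_le_pow_left₀ (norm_nonneg _) (hf2 n z) 2
    · rw [integral_const, smul_eq_mul, mul_comm]
      simp [cylMeasure, Measure.real]
  obtain ⟨s, hsm, hweak⟩ := exists_subseq_weak (fun n => hfL n 2) hbd
  have hcauchy : ∀ ε : ℝ≥0∞, 0 < ε → ∃ J, ∀ i ≥ J, ∀ j ≥ J,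
      ∫⁻ z, ‖f (s i) z - f (s j) z‖ₑ ≤ ε := by
    intro ε hε
    obtain ⟨C, hCU, hC, hCε⟩ := (measurableSet_cyl Ω T).exists_isCompact_sdiff_lt hcyl.ne
      (ENNReal.div_pos hε.ne' (by norm_num : (8 : ℝ≥0∞) ≠ ⊤)).ne'
    obtain ⟨χ, hχ, hχ01, hχ1⟩ := exists_isTest_eq_one (cyl Ω T).isOpen hC hCU
    have hχi : Integrable χ volume := memLp_one_iff_integrable.mp (hχ.memLp 1)
    have hwm : Measurable fun z => ENNReal.ofReal (χ z) := hχ.continuous.measurable.ennreal_ofReal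
    have hmod : ∀ η : ℝ≥0∞, 0 < η → ∃ δ > 0, ∀ n, ∀ a : Space N × ℝ, ‖a‖ < δ →
        ∫⁻ z, ENNReal.ofReal (χ z) * ‖f (s n) (z + a) - f (s n) z‖ₑ ≤ η := by
      intro η hη
      have h1 : min η 1 ≠ ⊤ := (min_le_right η 1).trans_lt ENNReal.one_lt_top |>.ne
      obtain ⟨δ, hδ, hmod⟩ := exists_modulus_arctan (hs 0).cont (hs 0).mono K hχ
        (fun z => (hχ01 z).1) (ENNReal.toReal_pos (lt_min hη one_pos).ne' h1)
      refine ⟨δ, hδ, fun n a ha => ?_⟩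
      have h2 := ENNReal.ofReal_le_ofReal (hmod _ _ _ _ (hs (s n)) (hK (s n)) a ha)
      rw [ENNReal.ofReal_toReal h1] at h2
      refine le_trans (le_of_eq ?_) (h2.trans (min_le_left _ _))
      rw [ofReal_integral_eq_lintegral_ofReal]
      · refine lintegral_congr fun z => ?_
        rw [ENNReal.ofReal_mul (hχ01 z).1, Real.enorm_eq_ofReal_abs]
      · exact (hχ.memLp 2).integrable_mul ((memLp_shift (hfL (s n) 2) a).sub (hfL (s n) 2)).abs
      · exact Eventually.of_forall fun z => mul_nonneg (hχ01 z).1 (abs_nonneg _)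
    have hwi : ∫⁻ z, ENNReal.ofReal (χ z) ≠ ⊤ := by
      rw [← ofReal_integral_eq_lintegral_ofReal hχi (Eventually.of_forall fun z => (hχ01 z).1)]
      exact ENNReal.ofReal_ne_top
    obtain ⟨J, hJ⟩ := cauchy_of_weak_of_modulus (fun n => hfm (s n)) (fun n => hf2 (s n)) hweak
      hwm hwi hmod (ENNReal.half_pos hε.ne')
    refine ⟨J, fun i hi j hj => ?_⟩
    have hm : MeasurableSet ((cyl Ω T : Set (Space N × ℝ)) \ C) :=
      (measurableSet_cyl Ω T).diff hC.measurableSet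
    calc ∫⁻ z, ‖f (s i) z - f (s j) z‖ₑ
        ≤ ∫⁻ z, (ENNReal.ofReal (χ z) * ‖f (s i) z - f (s j) z‖ₑ +
          ((cyl Ω T : Set (Space N × ℝ)) \ C).indicator (fun _ => 4) z) := by
          refine lintegral_mono fun z => ?_
          by_cases hz : z ∈ (cyl Ω T : Set (Space N × ℝ))
          · by_cases hzC : z ∈ C
            · simp [hχ1 z hzC]
            · rw [indicator_of_mem (show z ∈ (cyl Ω T : Set (Space N × ℝ)) \ C from ⟨hz, hzC⟩)]
              refine le_trans ?_ le_add_self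
              rw [Real.enorm_eq_ofReal_abs, ← ENNReal.ofReal_ofNat 4]
              refine ENNReal.ofReal_le_ofReal ((abs_sub _ _).trans ?_)
              have h1 := hf2 (s i) z
              have h2 := hf2 (s j) z
              norm_num
              linarith
          · simp [hf0 _ z hz]
      _ ≤ ε / 2 + 4 * (ε / 8) := by
          rw [lintegral_add_right _ (measurable_const.indicator hm), lintegral_indicator_const hm]
          gcongr
          exact hJ i hi j hj
      _ = ε := by
          have e : (4 : ℝ≥0∞) * (ε / 8) = ε / 2 := by
            rw [ENNReal.div_eq_inv_mul, ENNReal.div_eq_inv_mul, ← mul_assoc]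
            congr 1
            rw [show (8 : ℝ≥0∞) = 4 * 2 by norm_num,
              ENNReal.mul_inv (Or.inl (by norm_num)) (Or.inl (by norm_num)), ← mul_assoc,
              ENNReal.mul_inv_cancel (by norm_num) (by norm_num), one_mul]
          rw [e, ENNReal.add_halves]
  have hcs : CauchySeq fun j => (hfL (s j) 1).toLp (f (s j)) := by
    rw [EMetric.cauchySeq_iff]
    intro ε hε
    obtain ⟨J, hJ⟩ := hcauchy (min ε 1 / 2) (ENNReal.half_pos (lt_min hε one_pos).ne')
    refine ⟨J, fun i hi j hj => ?_⟩
    rw [Lp.edist_toLp_toLp, eLpNorm_one_eq_lintegral_enorm]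
    refine (hJ i hi j hj).trans_lt (lt_of_lt_of_le (ENNReal.half_lt_self ?_ ?_) (min_le_left ε 1))
    · exact (lt_min hε one_pos).ne'
    · exact ((min_le_right ε 1).trans_lt ENNReal.one_lt_top).ne
  obtain ⟨G, hG⟩ := cauchySeq_tendsto_of_complete hcs
  rw [Lp.tendsto_Lp_iff_tendsto_eLpNorm'] at hG
  have hG' : Tendsto (fun j => eLpNorm (f (s j) - (G : Space N × ℝ → ℝ)) 1 volume) atTop (𝓝 0) :=
    hG.congr fun j => eLpNorm_congr_ae ((hfL (s j) 1).coeFn_toLp.sub EventuallyEq.rfl)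
  obtain ⟨s', hs', hae⟩ := exists_subseq_tendsto_ae one_ne_zero (fun j => (hfL (s j) 1).1)
    (Lp.aestronglyMeasurable G) hG'
  exact ⟨s ∘ s', G, hsm.comp hs', (Lp.stronglyMeasurable G).measurable, hae⟩

/-- Where the limit `F` of `arctan v_n` satisfies `|F| ≥ π/2`, eventually `|v_n| > k` for every `k`.
By continuity from below this set has measure at most `C/kʳ` for all `k`, so it is null, and `v_n →
tan F` elsewhere. -/
theorem exists_subseq_tendsto (hs : ∀ n, Sol Ω T b (h n) (m n) (v n) (Dv n))
    (hK : ∀ n, (∫ z, |h n z|) + (m n + 1) ≤ K) {C r : ℝ} (hr : 0 < r)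
    (hC : ∀ n, ∀ k : ℝ, 0 < k → volume {z | k < |v n z|} ≤ ENNReal.ofReal (C / k ^ r)) :
    ∃ (s : ℕ → ℕ) (w : Space N × ℝ → ℝ), StrictMono s ∧ Measurable w ∧
      ∀ᵐ z, Tendsto (fun j => v (s j) z) atTop (𝓝 (w z)) := by
  obtain ⟨s, F, hsm, hF, hae⟩ := exists_subseq_arctan_tendsto hs hK
  have hlev : ∀ k : ℝ, 0 < k → volume {z | ∀ᶠ j in atTop, k < |v (s j) z|} ≤
      ENNReal.ofReal (C / k ^ r) := by
    intro k hk
    have e : {z | ∀ᶠ j in atTop, k < |v (s j) z|} =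
        ⋃ J : ℕ, {z | ∀ j ≥ J, k < |v (s j) z|} := by
      ext z
      simp [eventually_atTop]
    have hmono : Monotone fun J : ℕ => {z | ∀ j ≥ J, k < |v (s j) z|} :=
      fun J J' hJ z hz j hj => hz j (hJ.trans hj)
    rw [e, hmono.measure_iUnion]
    refine iSup_le fun J => le_trans (measure_mono ?_) (hC (s J) k hk)
    intro z hz
    have hz' : ∀ j ≥ J, k < |v (s j) z| := hz
    exact hz' J le_rfl
  have hbound : ∀ᵐ z, |F z| < Real.pi / 2 := by
    rw [ae_iff]
    have h1 : ∀ k : ℝ, 0 < k → volume {z | ¬|F z| < Real.pi / 2} ≤ ENNReal.ofReal (C / k ^ r) := by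
      intro k hk
      refine (measure_mono_ae ?_).trans (hlev k hk)
      filter_upwards [hae] with z hz hzF
      have h2 : Real.pi / 2 ≤ |F z| := not_lt.mp hzF
      have h3 := hz.abs.eventually (lt_mem_nhds ((Real.arctan_lt_pi_div_two k).trans_le h2))
      refine h3.mono fun j hj => ?_
      rcases abs_cases (Real.arctan (v (s j) z)) with h4 | h4
      · rw [h4.1] at hj
        exact (Real.arctan_strictMono.lt_iff_lt.mp hj).trans_le (le_abs_self _)
      · rw [h4.1, ← Real.arctan_neg] at hj
        exact (Real.arctan_strictMono.lt_iff_lt.mp hj).trans_le (neg_le_abs _)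
    have h2 : Tendsto (fun k : ℝ => ENNReal.ofReal (C / k ^ r)) atTop (𝓝 0) := by
      rw [← ENNReal.ofReal_zero]
      refine ENNReal.tendsto_ofReal ?_
      exact (tendsto_rpow_atTop hr).const_div_atTop C
    exact le_antisymm (ge_of_tendsto h2 ((eventually_gt_atTop 0).mono fun k hk => h1 k hk))
      (zero_le)
  refine ⟨s, fun z => Real.tan (F z), hsm, ?_, ?_⟩
  · simp only [Real.tan_eq_sin_div_cos]
    exact (Real.measurable_sin.comp hF).div (Real.measurable_cos.comp hF)
  · filter_upwards [hae, hbound] with z hz hzF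
    have hc : Real.cos (F z) ≠ 0 := (Real.cos_pos_of_mem_Ioo (abs_lt.mp hzF)).ne'
    have := ((Real.continuousAt_tan.mpr hc).tendsto).comp hz
    simpa [Function.comp_def, Real.tan_arctan] using this

/-- A sequence bounded in `L^p`, `p > 1`, which converges almost everywhere on a space of finite
measure, converges in `L¹`. -/
theorem tendsto_one_of_bounded {α : Type*} [MeasurableSpace α] {μ : Measure α} [IsFiniteMeasure μ]
    {f : ℕ → α → ℝ} {g : α → ℝ} (hf : ∀ n, AEStronglyMeasurable (f n) μ) {p C : ℝ} (hp : 1 < p)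
    (hC : ∀ n, ∫⁻ z, ENNReal.ofReal (|f n z| ^ p) ∂μ ≤ ENNReal.ofReal C)
    (hlim : ∀ᵐ z ∂μ, Tendsto (fun n => f n z) atTop (𝓝 (g z))) :
    Integrable g μ ∧ Tendsto (fun n => eLpNorm (fun z => f n z - g z) 1 μ) atTop (𝓝 0) := by
  have hg : AEStronglyMeasurable g μ := aestronglyMeasurable_of_tendsto_ae atTop hf hlim
  have hp1 : 0 < p - 1 := by linarith
  have htail : ∀ n, ∀ k : ℝ, 0 < k →
      ∫⁻ z, ENNReal.ofReal (k ^ (p - 1)) * ({z | k ≤ |f n z|}.indicator (fun z => ‖f n z‖ₑ) z) ∂μ ≤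
        ENNReal.ofReal C := by
    intro n k hk
    refine (lintegral_mono fun z => ?_).trans (hC n)
    by_cases hz : z ∈ {z | k ≤ |f n z|}
    · have hz' : k ≤ |f n z| := hz
      have h0 : 0 < |f n z| := hk.trans_le hz'
      rw [indicator_of_mem hz, Real.enorm_eq_ofReal_abs, ← ENNReal.ofReal_mul (by positivity)]
      refine ENNReal.ofReal_le_ofReal ?_
      calc k ^ (p - 1) * |f n z| ≤ |f n z| ^ (p - 1) * |f n z| := by gcongr
        _ = |f n z| ^ p := by
          rw [← Real.rpow_add_one h0.ne']
          congr 1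
          ring
    · simp [indicator_of_notMem hz]
  have hone : ∀ n, ∫⁻ z, ‖f n z‖ₑ ∂μ ≤ μ univ + ENNReal.ofReal C := by
    intro n
    rw [← lintegral_one]
    have h1 := htail n 1 one_pos
    simp only [Real.one_rpow, ENNReal.ofReal_one, one_mul] at h1
    refine le_trans ?_ (add_le_add le_rfl h1)
    rw [← lintegral_add_left measurable_const]
    refine lintegral_mono fun z => ?_
    by_cases hz : z ∈ {z | 1 ≤ |f n z|}
    · rw [indicator_of_mem hz]
      exact le_add_self
    · have hz' : |f n z| < 1 := not_le.mp hz
      rw [indicator_of_notMem hz, add_zero, Real.enorm_eq_ofReal_abs, ← ENNReal.ofReal_one]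
      exact ENNReal.ofReal_le_ofReal hz'.le
  have hgi : MemLp g 1 μ := by
    refine ⟨hg, ?_⟩
    rw [eLpNorm_one_eq_lintegral_enorm]
    have h1 : ∫⁻ z, ‖g z‖ₑ ∂μ ≤ liminf (fun n => ∫⁻ z, ‖f n z‖ₑ ∂μ) atTop := by
      refine le_trans (le_of_eq ?_) (lintegral_liminf_le' fun n => (hf n).enorm)
      refine lintegral_congr_ae (hlim.mono fun z hz => ?_)
      exact hz.enorm.liminf_eq.symm
    have h2 : liminf (fun n => ∫⁻ z, ‖f n z‖ₑ ∂μ) atTop ≤ μ univ + ENNReal.ofReal C :=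
      liminf_le_of_le (by isBoundedDefault) fun b hb => by
        obtain ⟨n, hn⟩ := hb.exists
        exact hn.trans (hone n)
    exact (h1.trans h2).trans_lt
      (ENNReal.add_lt_top.mpr ⟨measure_lt_top _ _, ENNReal.ofReal_lt_top⟩)
  refine ⟨memLp_one_iff_integrable.mp hgi, ?_⟩
  refine tendsto_Lp_finite_of_tendsto_ae le_rfl ENNReal.one_ne_top hf hgi ?_ hlim
  refine unifIntegrable_of le_rfl ENNReal.one_ne_top hf fun ε hε => ?_
  -- The tail of `|f_n|` above `k` is at most `C/k^(p-1)`; this `k` makes it at most `ε` for all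
  -- `n`, which is the uniform integrability in Vitali's theorem.
  set k : ℝ := (|C| / ε + 1) ^ (p - 1)⁻¹ with hk
  have hk0 : 0 < k := by positivity
  have hkp : k ^ (p - 1) = |C| / ε + 1 := by
    rw [hk, ← Real.rpow_mul (by positivity), inv_mul_cancel₀ hp1.ne', Real.rpow_one]
  refine ⟨k.toNNReal, fun n => ?_⟩
  have h1 := htail n k hk0
  have hset : {x | k.toNNReal ≤ ‖f n x‖₊} = {z | k ≤ |f n z|} := by
    ext z
    exact Real.toNNReal_le_iff_le_coe
  rw [hset, eLpNorm_one_eq_lintegral_enorm]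
  simp only [enorm_indicator_eq_indicator_enorm]
  rw [lintegral_const_mul' _ _ ENNReal.ofReal_ne_top, hkp] at h1
  have h2 : 0 < |C| / ε + 1 := by positivity
  have h3 : ENNReal.ofReal C ≤ ENNReal.ofReal (|C| / ε + 1) * ENNReal.ofReal ε := by
    rw [← ENNReal.ofReal_mul h2.le]
    refine ENNReal.ofReal_le_ofReal ?_
    rw [add_mul, div_mul_cancel₀ _ hε.ne']
    linarith [le_abs_self C]
  exact (ENNReal.mul_le_mul_iff_right (ENNReal.ofReal_pos.mpr h2).ne'
    ENNReal.ofReal_ne_top).mp (h1.trans h3)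

end EllipticParabolic

/-! ### Assembly of the claims -/

open EllipticParabolic in
theorem proposition2p3 (N : ℕ) (hN : 1 ≤ N) (Ω : Opens (Space N))
    (hΩ : Bornology.IsBounded (Ω : Set (Space N))) (T : ℝ) (hT : 0 < T)
    (b : ℝ → ℝ) (hb_cont : Continuous b) (hb_mono : StrictMono b) (hb_zero : b 0 = 0)
    (a₁ : ℝ) (hb : ConditionB N b a₁)
    -- the limit data
    (μ : SignedMeasure (Space N × ℝ)) (v₀ : Space N → ℝ)
    (hv₀ : Integrable (fun x => b (v₀ x)) (volume.restrict (Ω : Set (Space N))))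
    -- the approximating data
    (h : ℕ → Space N × ℝ → ℝ) (g : ℕ → Space N → ℝ)
    (hh : ∀ n, MemLp (h n) ⊤ (cylMeasure Ω T))
    (hg : ∀ n, MemLp (g n) ⊤ (volume.restrict (Ω : Set (Space N))))
    (hhμ : WeakStarConv Ω T h μ)
    (hgv₀ : Tendsto (fun n => eLpNorm (fun x => g n x - b (v₀ x)) 1
      (volume.restrict (Ω : Set (Space N)))) atTop (𝓝 0))
    -- the solutions of the approximate problems
    (v : ℕ → Space N × ℝ → ℝ) (Dv : ℕ → Space N × ℝ → Space N)
    (hv : ∀ n, IsWeakSolution Ω T b (h n) (g n) (v n) (Dv n)) :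
    (∀ β : ℝ, 0 < β → β < 1 / 2 → ∃ C : ℝ, ∀ n, ∃ W : LpW0 2 Ω T,
      ((W.1.1 : Space N × ℝ → ℝ) =ᵐ[cylMeasure Ω T] fun z => (|v n z| + 1) ^ β - 1) ∧ ‖W‖ ≤ C) ∧
    (∃ C : ℝ, ∀ n, ∀ᵐ t ∂(volume.restrict (Ioo 0 T)),
      ∫⁻ x in (Ω : Set (Space N)), ‖b (v n (x, t))‖ₑ ≤ ENNReal.ofReal C) ∧
    (∀ α : ℝ, 0 < α → ∃ C : ℝ, ∀ n,
      ∫⁻ z, ENNReal.ofReal (‖Dv n z‖ ^ 2 / (1 + |v n z|) ^ (α + 1)) ∂(cylMeasure Ω T)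
        ≤ ENNReal.ofReal C) ∧
    -- the claims that use the growth of `b` need it on the range of the `v n`
    (((∀ n, ∀ᵐ z ∂(cylMeasure Ω T), 0 ≤ v n z) ∨ ConditionB N (fun s => -b (-s)) a₁) →
      TimeDerivBounded Ω T (fun n z => b (v n z)) ∧
      BoundedInMarcinkiewicz Ω T (((N : ℝ) + 2 * a₁) / (N + a₁)) (fun n z => ‖Dv n z‖) ∧
      BoundedInMarcinkiewicz Ω T (((N : ℝ) + 2 * a₁) / N) v ∧
      ∃ (w : Space N × ℝ → ℝ) (s : ℕ → ℕ), Measurable w ∧ StrictMono s ∧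
        (∀ᵐ z ∂(cylMeasure Ω T), Tendsto (fun j => v (s j) z) atTop (𝓝 (w z))) ∧
        Integrable (fun z => b (w z)) (cylMeasure Ω T) ∧
        Tendsto (fun j => eLpNorm (fun z => b (v (s j) z) - b (w z)) 1 (cylMeasure Ω T))
          atTop (𝓝 0)) := by
  choose u Du hS hu hDu using fun n =>
    (hv n).exists_sol hΩ hT hb_cont hb_mono hb_zero (hh n)
  obtain ⟨C₁, hC₁⟩ := hhμ.exists_bound hΩ hh
  have hfin : IsFiniteMeasure (volume.restrict (Ω : Set (Space N))) :=
    ⟨by simpa using hΩ.measure_lt_top⟩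
  obtain ⟨C₂, hC₂⟩ := exists_eLpNorm_one_bound hg hv₀ hgv₀
  obtain ⟨P, hP⟩ := exists_poincare hN hΩ T
  -- A single bound for all data: `C₁` for the sources, `C₂` for the initial data, and the slack `1`
  -- of the energy estimate.
  set K : ℝ := C₁ + (C₂ + 1) with hKdef
  have hK : ∀ n, (∫ z, |(cyl Ω T : Set (Space N × ℝ)).indicator (h n) z|) +
      ((eLpNorm (g n) 1 (volume.restrict (Ω : Set (Space N)))).toReal + 1) ≤ K := by
    intro n
    refine add_le_add ?_ (add_le_add (hC₂ n) le_rfl)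
    refine le_trans (le_of_eq ?_) (hC₁ n)
    rw [cylMeasure, ← integral_indicator (measurableSet_cyl Ω T)]
    congr 1
    ext z
    by_cases hz : z ∈ (cyl Ω T : Set (Space N × ℝ)) <;> simp [hz]
  refine ⟨fun β hβ hβ' => ?_, ?_, fun α hα => ?_, fun hpos => ?_⟩
  · refine ⟨(|P| + 1) * √(β ^ 2 * ((1 - 2 * β)⁻¹ * K)), fun n => ?_⟩
    obtain ⟨W, hW, hW'⟩ := (hS n).exists_LpW0_rpow hβ' (hK n) (abs_nonneg P)
      fun w Dw hw h0 => (hP w Dw hw h0).trans (by gcongr; exact le_abs_self P)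
    refine ⟨W, hW.trans ((hu n).mono fun z hz => ?_), hW'⟩
    simp only [hz]
  · refine ⟨2 * K + (b 1 - b (-1)) * (volume (Ω : Set (Space N))).toReal, fun n => ?_⟩
    rw [ae_restrict_iff' measurableSet_Ioo]
    filter_upwards [(hS n).lintegral_slice_le (hK n), ae_slice (ae_cylMeasure.mp (hu n))]
      with t h1 h2 ht
    refine le_trans (le_of_eq ?_) ((setLIntegral_le_lintegral (Ω : Set (Space N)) _).trans (h1 ht))
    refine setLIntegral_congr_fun_ae Ω.isOpen.measurableSet (h2.mono fun x hx hxΩ => ?_)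
    rw [hx ⟨hxΩ, ht⟩]
  · refine ⟨α⁻¹ * K, fun n => ?_⟩
    refine le_trans (le_of_eq ?_) ((setLIntegral_le_lintegral (cyl Ω T : Set (Space N × ℝ)) _).trans
      ((hS n).lintegral_weighted_le (hK n) hα))
    refine lintegral_congr_ae ?_
    filter_upwards [hu n, hDu n] with z h1 h2
    rw [h1, h2]
  -- Nonnegativity passes to the whole space because the representatives vanish off the cylinder.
  · have hpos' : (∀ n, ∀ᵐ z, 0 ≤ u n z) ∨ ConditionB N (fun s => -b (-s)) a₁ := by
      refine hpos.imp_left fun h0 n => ?_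
      filter_upwards [ae_cylMeasure.mp (h0 n), ae_cylMeasure.mp (hu n)] with z h1 h2
      by_cases hz : z ∈ (cyl Ω T : Set (Space N × ℝ))
      · rw [h2 hz]
        exact h1 hz
      · rw [(hS n).zero_off z hz]
    obtain ⟨C, hC0, hC⟩ := exists_abs_level_le hN hb hS hK hpos'
    have hgrad : ∀ n, ∀ l : ℝ, 0 < l → volume {z | l < ‖Du n z‖} ≤ ENNReal.ofReal
        ((C * 2 ^ (((N : ℝ) + 2 * a₁) / N) + 4 * K) / l ^ (((N : ℝ) + 2 * a₁) / (N + a₁))) :=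
      fun n l hl => (hS n).grad_level_le (hK n) hN hb.growth.1 hC0 (hC n) hl
    have hK0 : 0 ≤ K := (hS 0).K_nonneg (hK 0)
    refine ⟨?_, ⟨C * 2 ^ (((N : ℝ) + 2 * a₁) / N) + 4 * K, fun n k hk => ?_⟩, ⟨C, fun n k hk => ?_⟩, ?_⟩
    · obtain ⟨σ, σ', hσ', h1, h2, h3, D, hD⟩ := timeDerivBounded_of_sol hN hS hK hb.growth.1
        (by positivity) hgrad
      refine ⟨σ, σ', hσ', h1, h2, h3, D, fun n => ?_⟩
      obtain ⟨f, Λ, hf, hΛ, hφ⟩ := hD n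
      refine ⟨f, Λ, hf, hΛ, fun φ => ?_⟩
      rw [← hφ φ, distTimeDeriv, distTimeDeriv, neg_inj]
      refine integral_congr_ae ((hu n).mono fun z hz => ?_)
      simp only [hz]
    · refine le_trans (measure_mono_ae ?_)
        ((Measure.restrict_apply_le _ _).trans (hgrad n k hk))
      filter_upwards [hDu n] with z hz hzk
      have h1 : k < |‖Dv n z‖| := hzk
      rwa [abs_norm, ← hz] at h1
    · refine le_trans (measure_mono_ae ?_) ((Measure.restrict_apply_le _ _).trans (hC n k hk))
      filter_upwards [hu n] with z hz hzk
      have h1 : k < |v n z| := hzk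
      rwa [← hz] at h1
    · have hN0 : (0 : ℝ) < N := by exact_mod_cast hN
      have ha := hb.growth.1
      obtain ⟨s, w, hs, hw, hlim⟩ := exists_subseq_tendsto hS hK (by positivity) hC
      obtain ⟨p, C', hp, hC'⟩ := exists_lintegral_abs_b_rpow_le hN hb hS hK hpos'
      have : IsFiniteMeasure (cylMeasure Ω T) := ⟨by simpa [cylMeasure] using (hS 0).fin⟩
      have hlim' : ∀ᵐ z ∂(cylMeasure Ω T), Tendsto (fun j => u (s j) z) atTop (𝓝 (w z)) :=
        ae_restrict_of_ae hlim
      obtain ⟨h1, h2⟩ := tendsto_one_of_bounded (μ := cylMeasure Ω T)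
        (f := fun j z => b (u (s j) z)) (g := fun z => b (w z))
        (fun j => (hb_cont.measurable.comp (hS (s j)).meas).aestronglyMeasurable) hp
        (fun j => (setLIntegral_le_lintegral _ _).trans (hC' (s j)))
        (hlim'.mono fun z hz => (hb_cont.tendsto _).comp hz)
      refine ⟨w, s, hw, hs, ?_, h1, h2.congr fun j => eLpNorm_congr_ae ?_⟩
      · filter_upwards [hlim', ae_all_iff.mpr hu] with z h3 h4
        exact h3.congr fun j => h4 (s j)
      · filter_upwards [hu (s j)] with z hz
        rw [hz]
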